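/- **Setting.** For a prime power $q$ and $n\ge 0$ let $V=\mathbb F_q^n$, and let $R_n(q)$ be the convolution algebra of $GL(V)$-invariant complex functions on (complete flags in $V$) $\times$ (complete flags in $V$) $\times V$, with product $$(\alpha*\beta)(F,F',v)=\sum_{H,\,u\in V}\alpha(F,H,u)\,\beta(H,F',v-u).$$ For $w\in S_n$ and $\beta\subset\{1,\dots,n\}$ let $T_{w,\beta}$ be the characteristic function of the orbit of the triples $(F,F',v)$ for which there is a basis $b_1,\dots,b_n$ of $V$ with $F_i=\langle b_1,\dots,b_i\rangle$, $F'_j=\langle b_{w(1)},\dots,b_{w(j)}\rangle$, $v=\sum_{i\in\beta}b_i$. The structure constants in the basis of orbits are polynomials in $q$. So there is a $\mathbb C[\mathbf q,\mathbf q^{-1}]$-algebra $R_n$ specializing to $R_n(q)$ at $\mathbf q\mapsto q$; let $\mathcal R_n=\mathbb C(\mathbf q)\otimes_{\mathbb C[\mathbf q,\mathbf q^{-1}]}R_n$ be the generic mirabolic Hecke algebra. Sending $T_{w,\beta}$ to $T_{w,\beta}$, with $w$ extended by $w(n+1)=n+1$, defines the standard inclusion $\mathcal R_n\to\mathcal R_{n+1}$.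 With $T_i=T_{s_i,\emptyset}$ for $i\ge 1$, $T_0=T_{1,\{1\}}$ and $e=\mathbf q^{-1}(T_0+1)$, put $$L_n=\mathbf q^{1-n}\,T_{n-1}\cdots T_1\,e\,T_1\cdots T_{n-1}\in\mathcal R_n .$$ For a finitely generated left $\mathcal R_n$-module $M$, $n\ge 1$, the generalized eigenspaces of $L_n$ are $\mathcal R_{n-1}$-modules. Let $i\text{-}\mathrm{Res}\,M$ be the generalized eigenspace for the eigenvalue $\mathbf q^i$ if $i\in\mathbb Z$, and for the eigenvalue $0$ if $i=\infty$; let $i\text{-}\mathrm{Ind}$ be the left adjoint of $i\text{-}\mathrm{Res}$. Let $G_0(\mathcal R_n)$ be the Grothendieck group of finitely generated left $\mathcal R_n$-modules and $$\mathcal G(\mathcal R)=\bigoplus_{n\ge 0}\mathbb C\otimes_{\mathbb Z}G_0(\mathcal R_n).$$ The functors $i\text{-}\mathrm{Res}$ and $i\text{-}\mathrm{Ind}$, for all $n$ together, induce linear operators $e_i$ and $f_i$ on $\mathcal G(\mathcal R)$ for $i\in\mathbb Z\cup\{\infty\}$, where $e_i$ is zero on the summand $n=0$. For $k\ge 0$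 put $\mathcal F_k=\ker(e_\infty^{k+1})/\ker(e_\infty^{k})$. Let $\mathfrak{gl}_\infty$ be the Lie algebra of complex $\mathbb Z\times\mathbb Z$ matrices with finitely many non-zero entries, with matrix units $E_{ij}$. Its charge zero Fock space is the space spanned by the semi-infinite wedges $v_{s_0}\wedge v_{s_1}\wedge\cdots$, where $s_0>s_1>\cdots$ are the elements of a set $S\subset\mathbb Z$ such that $S\setminus\mathbb Z_{\le 0}$ and $\mathbb Z_{\le 0}\setminus S$ are finite of the same cardinality; $E_{ij}$ acts on it by replacing $v_j$ by $v_i$. **Proposition.** The operators $e_i,f_i$, $i\in\mathbb Z\cup\{\infty\}$, are well defined, and the following hold. 1. For all $i\in\mathbb Z$ and $k\ge 0$, the operators $e_i$ and $f_i$ preserve $\ker(e_\infty^k)$; hence they act on each layer: $e_i(\mathcal F_k)\subset\mathcal F_k$ and $f_i(\mathcal F_k)\subset\mathcal F_k$. 2. For all $k\ge 0$, $f_\infty$ maps $\ker(e_\infty^{k})$ to $\ker(e_\infty^{k+1})$ and induces an isomorphism $\mathcal F_k\to\mathcal F_{k+1}$, whose inverse is the map $\mathcal F_{k+1}\to\mathcal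 F_k$ induced by $e_\infty$. 3. There is a representation of $\mathfrak{gl}_\infty$ on $\mathcal G(\mathcal R)$ in which $E_{i,i+1}$ acts as $e_i$ and $E_{i+1,i}$ acts as $f_i$ for all $i\in\mathbb Z$, which preserves all $\ker(e_\infty^k)$, and for which, for every $k\ge 0$, the induced representation on $\mathcal F_k$ is isomorphic to the charge zero Fock space. 4. With this action, $\mathcal G(\mathcal R)$ is isomorphic, as a representation of $\mathfrak{gl}_\infty$, to the direct sum of countably infinitely many copies of the charge zero Fock space. -/

import Mathlib

open scoped TensorProduct LaurentPolynomial DirectSum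

set_option maxSynthPendingDepth 3

attribute [local instance] LieRing.ofAssociativeRing

namespace Mirabolic

noncomputable section

/-! ## The generic mirabolic Hecke algebra -/

/-- Index set of the finite fields: `(p, k)` stands for the field with `p ^ (k + 1)` elements. -/
abbrev PrimePower : Type := Nat.Primes × ℕ

instance (x : PrimePower) : Fact (x.1 : ℕ).Prime := ⟨x.1.2⟩

/-- The finite field with `p ^ (k + 1)` elements. -/
abbrev Fq (x : PrimePower) : Type := GaloisField (x.1 : ℕ) (x.2 + 1)

/-- The number of elements of `Fq x`, as a complex number. -/
def PrimePower.card (x : PrimePower) : ℂ := ((x.1 : ℕ) : ℂ) ^ (x.2 + 1)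

theorem PrimePower.card_ne_zero (x : PrimePower) : x.card ≠ 0 :=
  pow_ne_zero _ (Nat.cast_ne_zero.mpr x.1.2.ne_zero)

/-- The vector space `V = F_q ^ n`. -/
abbrev Vq (n : ℕ) (x : PrimePower) : Type := Fin n → Fq x

/-- The set of complete flags in `V = F_q ^ n` (maximal chains of subspaces). -/
abbrev FlagVar (n : ℕ) (x : PrimePower) : Type := Flag (Submodule (Fq x) (Vq n x))

instance (n : ℕ) (x : PrimePower) : Finite (FlagVar n x) :=
  Finite.of_injective (fun F : FlagVar n x => (F : Set (Submodule (Fq x) (Vq n x))))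
    SetLike.coe_injective

instance (n : ℕ) (x : PrimePower) : Fintype (FlagVar n x) := Fintype.ofFinite _

instance (n : ℕ) (x : PrimePower) : DecidableEq (FlagVar n x) := Classical.decEq _

instance (n : ℕ) (x : PrimePower) : Fintype (Vq n x) := Fintype.ofFinite _

/-- The convolution algebra of all complex functions on `Flags × Flags × V`. A function `α` is
stored as the matrix whose `(F, F')` entry is the element `∑_v α (F, F', v) [v]` of the group
algebra `ℂ[V]`, so that the product is
`(α * β) (F, F', v) = ∑_{H, u} α (F, H, u) β (H, F', v - u)`. -/
abbrev Conv (n : ℕ) (x : PrimePower) : Type :=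
  Matrix (FlagVar n x) (FlagVar n x) (AddMonoidAlgebra ℂ (Vq n x))

/-- Families of elements of the convolution algebras, one for every finite field. -/
def ConvFamily (n : ℕ) : Type := ∀ x : PrimePower, Conv n x

instance (n : ℕ) : Ring (ConvFamily n) := inferInstanceAs (Ring (∀ x : PrimePower, Conv n x))

/-- Specialization `ℂ[q, q⁻¹] → ℂ` of the indeterminate at the order of the finite field. -/
def specialize (x : PrimePower) : ℂ[T;T⁻¹] →+* ℂ :=
  LaurentPolynomial.eval₂ (RingHom.id ℂ) (Units.mk0 x.card x.card_ne_zero)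

/-- A Laurent polynomial acts on a family by its value at the order of each finite field. -/
instance (n : ℕ) : Algebra ℂ[T;T⁻¹] (ConvFamily n) :=
  RingHom.toAlgebra' (RingHom.pi fun x => (algebraMap ℂ (Conv n x)).comp (specialize x))
    (fun c f => funext fun x => Algebra.commutes (specialize x c) (f x))

/-- The `GL(V)`-orbit of triples `(F, F', v)` with label `(w, β)`: there is a basis `b` of `V` with
`F_i = ⟨b_1, …, b_i⟩`, `F'_j = ⟨b_{w(1)}, …, b_{w(j)}⟩` and `v = ∑_{i ∈ β} b_i`. -/
def InOrbit {n : ℕ} {x : PrimePower} (w : Equiv.Perm (Fin n)) (β : Finset (Fin n))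
    (F F' : FlagVar n x) (v : Vq n x) : Prop :=
  ∃ b : Module.Basis (Fin n) (Fq x) (Vq n x),
    F = b.toFlag ∧ F' = (b.reindex w.symm).toFlag ∧ v = ∑ i ∈ β, b i

open Classical in
/-- The characteristic function of the orbit `(w, β)`, over every finite field at once. Every orbit
has a label `(w, β)`; labels are not unique here, which is harmless. -/
def orbitFamily {n : ℕ} (w : Equiv.Perm (Fin n)) (β : Finset (Fin n)) : ConvFamily n :=
  fun _ F F' => ∑ v, if InOrbit w β F F' v then AddMonoidAlgebra.single v 1 else 0

/-- The mirabolic Hecke algebra over `ℂ[q, q⁻¹]`: since the structure constants of the convolution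
algebras in the bases of orbits are given by polynomials in `q`, it is the
`ℂ[q, q⁻¹]`-algebra of families spanned by the characteristic functions of the orbits. -/
def IntegralMirabolic (n : ℕ) : Subalgebra ℂ[T;T⁻¹] (ConvFamily n) :=
  Algebra.adjoin ℂ[T;T⁻¹] {f | ∃ w β, f = orbitFamily w β}

/-- The field `ℂ(q)`. -/
abbrev Kq : Type := FractionRing ℂ[T;T⁻¹]

/-- The indeterminate `q` of `ℂ(q)`. -/
def qq : Kq := algebraMap ℂ[T;T⁻¹] Kq (LaurentPolynomial.T 1)

/-- The generic mirabolic Hecke algebra `R_n`, an algebra over `ℂ(q)`. -/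
abbrev R (n : ℕ) : Type := Kq ⊗[ℂ[T;T⁻¹]] (IntegralMirabolic n)

/-- The basis element `T_{w, β}` of `R_n`. -/
def Tw {n : ℕ} (w : Equiv.Perm (Fin n)) (β : Finset (Fin n)) : R n :=
  1 ⊗ₜ[ℂ[T;T⁻¹]] ⟨orbitFamily w β, Algebra.subset_adjoin ⟨w, β, rfl⟩⟩

/-- The generator `T_{j+1} = T_{s_{j+1}, ∅}` of `R_{n+1}`, for `0 ≤ j < n`. -/
def Tgen {n : ℕ} (j : Fin n) : R (n + 1) := Tw (Equiv.swap j.castSucc j.succ) ∅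

/-- The generator `e = q⁻¹ (T_0 + 1)` of `R_{n+1}`, where `T_0 = T_{1, {1}}`. -/
def eGen (n : ℕ) : R (n + 1) := qq⁻¹ • (Tw 1 {0} + 1)

/-- The Jucys–Murphy element `L_{n+1} = q^{-n} T_n ⋯ T_1 e T_1 ⋯ T_n` of `R_{n+1}`. -/
def jucysMurphy (n : ℕ) : R (n + 1) :=
  (qq⁻¹) ^ n • ((List.ofFn (Tgen (n := n))).reverse.prod * eGen n * (List.ofFn (Tgen (n := n))).prod)

/-- `ι` is the standard inclusion `R_n → R_{n+1}`: it sends `T_{w, β}` to `T_{w, β}`, where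
`w ∈ S_n` is extended to `S_{n+1}` by fixing the last letter. The elements `T_{w, β}` generate
`R_n`, so there is at most one such `ι`. -/
def IsStdInclusion (n : ℕ) (ι : R n →ₐ[Kq] R (n + 1)) : Prop :=
  ∀ (w : Equiv.Perm (Fin n)) (β : Finset (Fin n)),
    ι (Tw w β) = Tw (w.viaEmbedding Fin.castSuccEmb) (β.map Fin.castSuccEmb)

/-! ## Refined restriction and induction -/

/-- The generalized eigenspace of `a ∈ A` for the eigenvalue `c` in an `A`-module `M`. -/
def genEigenspace {A : Type} [Ring A] [Algebra Kq A] (a : A) (c : Kq)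
    (M : Type) [AddCommGroup M] [Module A M] : Set M :=
  {m | ∃ k : ℕ, (a - algebraMap Kq A c) ^ k • m = 0}

/-- The eigenvalue attached to the index `i ∈ ℤ ∪ {∞}`: `q ^ i` for `i ∈ ℤ`, and `0` for `∞ = ⊤`. -/
def eigenvalue : WithTop ℤ → Kq
  | (i : ℤ) => qq ^ i
  | ⊤ => 0

/-- `M(q ^ i)` (or `M(0)` for `i = ∞`): the generalized eigenspace of the last Jucys–Murphy element
in an `R_{n+1}`-module. -/
def eigenPart {n : ℕ} (i : WithTop ℤ) (M : FGModuleCat.{0} (R (n + 1))) : Set M :=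
  genEigenspace (jucysMurphy n) (eigenvalue i) M

/-- The `R_n`-module `N` is the refined restriction `i-Res M` of the `R_{n+1}`-module `M`: it is
identified, compatibly with the action of `R_n` through `ι`, with the generalized eigenspace
`eigenPart i M`. This determines `N` up to a unique isomorphism. -/
def IsRefinedRes {n : ℕ} (ι : R n →ₐ[Kq] R (n + 1)) (i : WithTop ℤ)
    (M : FGModuleCat.{0} (R (n + 1))) (N : FGModuleCat.{0} (R n)) : Prop :=
  ∃ j : N →ₛₗ[(ι : R n →+* R (n + 1))] M, Function.Injective j ∧ Set.range j = eigenPart i M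

/-- The `R_{n+1}`-module `P` is the refined induction `i-Ind N` of the `R_n`-module `N`, that is, the
value at `N` of the left adjoint of `i-Res`: there is a universal `R_n`-linear map `η` from `N` to
`i-Res P`. Here an `R_n`-linear map `N → i-Res M` is an `ι`-semilinear map `N → M` with values in
`eigenPart i M`. This determines `P` up to a unique isomorphism. -/
def IsRefinedInd {n : ℕ} (ι : R n →ₐ[Kq] R (n + 1)) (i : WithTop ℤ)
    (N : FGModuleCat.{0} (R n)) (P : FGModuleCat.{0} (R (n + 1))) : Prop :=
  ∃ η : N →ₛₗ[(ι : R n →+* R (n + 1))] P, (∀ y, η y ∈ eigenPart i P) ∧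
    ∀ (M : FGModuleCat.{0} (R (n + 1))) (g : N →ₛₗ[(ι : R n →+* R (n + 1))] M),
      (∀ y, g y ∈ eigenPart i M) → ∃! h : P →ₗ[R (n + 1)] M, ∀ y, h (η y) = g y

/-! ## Grothendieck groups -/

/-- The relations `[M] = [M'] + [M'']` for all short exact sequences `0 → M' → M → M'' → 0`. -/
def exactRelations (A : Type) [Ring A] : Set (FreeAbelianGroup (FGModuleCat.{0} A)) :=
  {r | ∃ (M' M M'' : FGModuleCat.{0} A) (f : M' →ₗ[A] M) (g : M →ₗ[A] M''),
    Function.Injective f ∧ Function.Exact f g ∧ Function.Surjective g ∧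
      r = FreeAbelianGroup.of M - FreeAbelianGroup.of M' - FreeAbelianGroup.of M''}

/-- The Grothendieck group `G_0(A)` of the category of finitely generated left `A`-modules. -/
abbrev G0 (A : Type) [Ring A] : Type 1 :=
  FreeAbelianGroup (FGModuleCat.{0} A) ⧸ AddSubgroup.closure (exactRelations A)

/-- The class `[M]` in `G_0(A)`. -/
def G0.mk {A : Type} [Ring A] (M : FGModuleCat.{0} A) : G0 A :=
  QuotientAddGroup.mk (FreeAbelianGroup.of M)

/-- The complex vector space `G(R) = ⨁_n ℂ ⊗ G_0(R_n)`. -/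
abbrev GR : Type 1 := ⨁ n : ℕ, ℂ ⊗[ℤ] G0 (R n)

/-- The class `[M]` in `G(R)` of a finitely generated `R_n`-module `M`. -/
def cls {n : ℕ} (M : FGModuleCat.{0} (R n)) : GR :=
  DirectSum.lof ℂ ℕ (fun n => ℂ ⊗[ℤ] G0 (R n)) n ((1 : ℂ) ⊗ₜ[ℤ] G0.mk M)

/-- `e` is the operator on `G(R)` induced by the functors `i-Res : R_{n+1}-Mod → R_n-Mod` for all
`n`. On `G(R_0)` it is zero. The classes `[M]` span `G(R)`, so there is at most one such `e`. -/
def IsResOperator (ι : ∀ n, R n →ₐ[Kq] R (n + 1)) (i : WithTop ℤ) (e : Module.End ℂ GR) : Prop :=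
  (∀ M : FGModuleCat.{0} (R 0), e (cls M) = 0) ∧
  ∀ (n : ℕ) (M : FGModuleCat.{0} (R (n + 1))), ∃ N : FGModuleCat.{0} (R n),
    IsRefinedRes (ι n) i M N ∧ e (cls M) = cls N

/-- `f` is the operator on `G(R)` induced by the functors `i-Ind : R_n-Mod → R_{n+1}-Mod` for all
`n`. There is at most one such `f`. -/
def IsIndOperator (ι : ∀ n, R n →ₐ[Kq] R (n + 1)) (i : WithTop ℤ) (f : Module.End ℂ GR) : Prop :=
  ∀ (n : ℕ) (N : FGModuleCat.{0} (R n)), ∃ P : FGModuleCat.{0} (R (n + 1)),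
    IsRefinedInd (ι n) i N P ∧ f (cls N) = cls P

/-! ## Layers of the kernel filtration -/

section Layers

variable {W : Type*} [AddCommGroup W] [Module ℂ W]

/-- The layer `ker e^{k+1} / ker e^k`. -/
abbrev Layer (e : Module.End ℂ W) (k : ℕ) : Type _ :=
  (LinearMap.ker (e ^ (k + 1))) ⧸
    (LinearMap.ker (e ^ k)).submoduleOf (LinearMap.ker (e ^ (k + 1)))

/-- The map from the layer `k` to the layer `l` induced by an operator `φ` that maps `ker e^{k+1}`
to `ker e^{l+1}` and `ker e^k` to `ker e^l`. -/
def layerMap (e : Module.End ℂ W) (φ : Module.End ℂ W) (k l : ℕ)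
    (h₁ : LinearMap.ker (e ^ (k + 1)) ≤ (LinearMap.ker (e ^ (l + 1))).comap φ)
    (h₀ : LinearMap.ker (e ^ k) ≤ (LinearMap.ker (e ^ l)).comap φ) :
    Layer e k →ₗ[ℂ] Layer e l :=
  Submodule.mapQ _ _ (φ.restrict h₁) (fun x hx => h₀ (x := (x : W)) hx)

end Layers

/-! ## The Lie algebra `gl_∞` -/

/-- The Lie algebra `gl_∞` of complex matrices indexed by `ℤ × ℤ` with finitely many non-zero
entries, acting on `⨁_{i ∈ ℤ} ℂ v_i`. -/
def glInf : LieSubalgebra ℂ (Module.End ℂ (ℤ →₀ ℂ)) where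
  carrier := {A | {p : ℤ × ℤ | A (Finsupp.single p.2 1) p.1 ≠ 0}.Finite}
  zero_mem' := by simp
  add_mem' := by
    intro A B hA hB
    refine (hA.union hB).subset fun p hp => ?_
    by_contra h
    simp only [Set.mem_union, Set.mem_ofPred_eq, not_or, not_not] at h
    simp [h.1, h.2] at hp
  smul_mem' := by
    intro c A hA
    refine hA.subset fun p hp h => hp ?_
    simp [h]
  lie_mem' := by
    have key : ∀ A B : Module.End ℂ (ℤ →₀ ℂ),
        {p : ℤ × ℤ | A (Finsupp.single p.2 1) p.1 ≠ 0}.Finite →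
        {p : ℤ × ℤ | B (Finsupp.single p.2 1) p.1 ≠ 0}.Finite →
        {p : ℤ × ℤ | (A * B) (Finsupp.single p.2 1) p.1 ≠ 0}.Finite := by
      intro A B hA hB
      refine ((hA.image Prod.fst).prod (hB.image Prod.snd)).subset fun p hp => ?_
      have hexp : (A * B) (Finsupp.single p.2 1) p.1 =
          (B (Finsupp.single p.2 1)).sum fun j c => c * A (Finsupp.single j 1) p.1 := by
        rw [Module.End.mul_apply]
        conv_lhs => rw [← Finsupp.sum_single (B (Finsupp.single p.2 1))]
        rw [map_finsuppSum, Finsupp.sum_apply]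
        refine Finsupp.sum_congr fun j _ => ?_
        rw [← Finsupp.smul_single_one, map_smul, Finsupp.smul_apply, smul_eq_mul]
      rw [Set.mem_ofPred_eq, hexp] at hp
      obtain ⟨j, hj, hne⟩ := Finset.exists_ne_zero_of_sum_ne_zero hp
      refine ⟨⟨(p.1, j), right_ne_zero_of_mul hne, rfl⟩, ⟨(j, p.2), ?_, rfl⟩⟩
      exact left_ne_zero_of_mul hne
    intro A B hA hB
    refine ((key A B hA hB).union (key B A hB hA)).subset fun p hp => ?_
    by_contra h
    simp only [Set.mem_union, Set.mem_ofPred_eq, not_or, not_not] at h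
    apply hp
    have e : (⁅A, B⁆ : Module.End ℂ (ℤ →₀ ℂ)) = A * B - B * A := rfl
    rw [e, LinearMap.sub_apply, Finsupp.sub_apply, h.1, h.2, sub_zero]

/-- The matrix unit `E_{ij} ∈ gl_∞`: it maps `v_j` to `v_i` and the other `v_k` to `0`. -/
def matE (i j : ℤ) : glInf :=
  ⟨(Finsupp.lsingle i).comp (Finsupp.lapply j), by
    refine (Set.finite_singleton (i, j)).subset fun p hp => ?_
    by_contra h
    apply hp
    rcases eq_or_ne p.2 j with h2 | h2
    · have h1 : i ≠ p.1 := fun h1 => h (Prod.ext h1.symm h2)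
      simp [Finsupp.single_apply, h1]
    · simp [h2]⟩

/-- The coordinates of an element of `gl_∞` in the basis of matrix units. -/
def entries : glInf →ₗ[ℂ] (ℤ × ℤ →₀ ℂ) where
  toFun A := Finsupp.ofSupportFinite (fun p => A.1 (Finsupp.single p.2 1) p.1) A.2
  map_add' _ _ := Finsupp.ext fun _ => rfl
  map_smul' _ _ := Finsupp.ext fun _ => rfl

theorem entries_apply (A : glInf) (p : ℤ × ℤ) :
    entries A p = A.1 (Finsupp.single p.2 1) p.1 := rfl

theorem entries_injective : Function.Injective entries := by
  intro A B h
  refine Subtype.ext (Finsupp.lhom_ext' fun j => LinearMap.ext_ring (Finsupp.ext fun i => ?_))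
  exact DFunLike.congr_fun h (i, j)

theorem entries_matE (i j : ℤ) : entries (matE i j) = Finsupp.single (i, j) 1 := by
  classical
  ext p
  rw [entries_apply]
  simp only [matE, LinearMap.comp_apply, Finsupp.lapply_apply, Finsupp.lsingle_apply,
    Finsupp.single_apply, Prod.ext_iff]
  by_cases h1 : i = p.1 <;> by_cases h2 : j = p.2 <;> simp [h1, h2, eq_comm]

theorem eq_sum_matE (A : glInf) : A = (entries A).sum fun p c => c • matE p.1 p.2 := by
  apply entries_injective
  rw [map_finsuppSum]
  simp [entries_matE]

theorem glInf_induction {P : glInf → Prop} (h0 : P 0) (hadd : ∀ A B, P A → P B → P (A + B))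
    (hsmul : ∀ (c : ℂ) A, P A → P (c • A)) (hE : ∀ i j, P (matE i j)) (A : glInf) : P A := by
  rw [eq_sum_matE A]
  exact Finset.sum_induction _ P hadd h0 fun p _ => hsmul _ _ (hE _ _)

theorem lie_matE (i j k l : ℤ) : ⁅matE i j, matE k l⁆ =
    (if j = k then matE i l else 0) - (if l = i then matE k j else 0) := by
  apply Subtype.ext
  refine Finsupp.lhom_ext' fun m => LinearMap.ext_ring (Finsupp.ext fun n => ?_)
  by_cases h1 : j = k <;> by_cases h2 : l = i <;>
    simp [matE, Ring.lie_def, Finsupp.single_apply, h1, h2, eq_comm]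

/-! ## The Fock space of semi-infinite wedges -/

/-- A subset `S` of `ℤ` that differs from `{0, -1, -2, …}` by finitely many elements. It stands for
the semi-infinite wedge `v_{s_0} ∧ v_{s_1} ∧ ⋯`, where `s_0 > s_1 > ⋯` are the elements of `S`. -/
abbrev Maya : Type := {S : Set ℤ // (S \ Set.Iic 0).Finite ∧ (Set.Iic 0 \ S).Finite}

namespace Maya

/-- Adjoin an element. -/
def insert (i : ℤ) (S : Maya) : Maya :=
  ⟨Insert.insert i S.1, (S.2.1.insert i).subset fun x hx => by
      rcases hx with ⟨rfl | hx, h⟩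
      · exact Or.inl rfl
      · exact Or.inr ⟨hx, h⟩,
    S.2.2.subset fun x hx => ⟨hx.1, fun h => hx.2 (Or.inr h)⟩⟩

/-- Remove an element. -/
def erase (i : ℤ) (S : Maya) : Maya :=
  ⟨S.1 \ {i}, S.2.1.subset fun x hx => ⟨hx.1.1, hx.2⟩,
    (S.2.2.insert i).subset fun x hx => by
      by_cases h : x = i
      · exact Or.inl h
      · exact Or.inr ⟨hx.1, fun hS => hx.2 ⟨hS, h⟩⟩⟩

/-- The sign `(-1) ^ #{s ∈ S | s > i}`. -/
def sign (i : ℤ) (S : Maya) : ℂ := (-1) ^ {s | s ∈ S.1 ∧ i < s}.ncard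

/-- The charge `#(S \ {0, -1, …}) - #({0, -1, …} \ S)`. -/
def charge (S : Maya) : ℤ := (S.1 \ Set.Iic 0).ncard - (Set.Iic 0 \ S.1).ncard

theorem finite_gt (i : ℤ) (S : Maya) : {s | s ∈ S.1 ∧ i < s}.Finite := by
  refine (S.2.1.union (Set.finite_Icc i 0)).subset fun s hs => ?_
  by_cases h : s ≤ 0
  · exact Or.inr ⟨hs.2.le, h⟩
  · exact Or.inl ⟨hs.1, h⟩

theorem sign_insert (i j : ℤ) (S : Maya) (hj : j ∉ S.1) :
    sign i (insert j S) = if i < j then -sign i S else sign i S := by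
  unfold sign
  split_ifs with h
  · have : {s | s ∈ (insert j S).1 ∧ i < s} = Insert.insert j {s | s ∈ S.1 ∧ i < s} := by
      ext s
      simp only [insert, Set.mem_insert_iff, Set.mem_ofPred_eq]
      constructor
      · rintro ⟨rfl | hs, h'⟩
        · exact Or.inl rfl
        · exact Or.inr ⟨hs, h'⟩
      · rintro (rfl | ⟨hs, h'⟩)
        · exact ⟨Or.inl rfl, h⟩
        · exact ⟨Or.inr hs, h'⟩
    rw [this, Set.ncard_insert_of_notMem (fun hs => hj hs.1) (finite_gt i S), pow_succ]
    ring
  · have : {s | s ∈ (insert j S).1 ∧ i < s} = {s | s ∈ S.1 ∧ i < s} := by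
      ext s
      simp only [insert, Set.mem_insert_iff, Set.mem_ofPred_eq]
      constructor
      · rintro ⟨rfl | hs, h'⟩
        · exact absurd h' h
        · exact ⟨hs, h'⟩
      · rintro ⟨hs, h'⟩
        exact ⟨Or.inr hs, h'⟩
    rw [this]

theorem insert_erase {j : ℤ} {S : Maya} (hj : j ∈ S.1) : insert j (erase j S) = S :=
  Subtype.ext (by simp [insert, erase, Set.insert_eq_of_mem hj])

theorem erase_insert {j : ℤ} {S : Maya} (hj : j ∉ S.1) : erase j (insert j S) = S :=
  Subtype.ext (by simp [insert, erase, hj])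

theorem insert_comm (i j : ℤ) (S : Maya) : insert i (insert j S) = insert j (insert i S) :=
  Subtype.ext (Set.insert_comm i j S.1)

theorem mem_insert {i j : ℤ} {S : Maya} : i ∈ (insert j S).1 ↔ i = j ∨ i ∈ S.1 := Iff.rfl

theorem mem_erase {i j : ℤ} {S : Maya} : i ∈ (erase j S).1 ↔ i ∈ S.1 ∧ i ≠ j := Iff.rfl

theorem erase_comm (i j : ℤ) (S : Maya) : erase i (erase j S) = erase j (erase i S) :=
  Subtype.ext (by ext x; simp only [erase, Set.mem_sdiff]; tauto)

theorem erase_insert_comm {i j : ℤ} (h : i ≠ j) (S : Maya) :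
    erase i (insert j S) = insert j (erase i S) := by
  apply Subtype.ext
  ext x
  rw [mem_erase, mem_insert, mem_insert, mem_erase]
  constructor
  · rintro ⟨rfl | hx, h'⟩
    · exact Or.inl rfl
    · exact Or.inr ⟨hx, h'⟩
  · rintro (rfl | ⟨hx, h'⟩)
    · exact ⟨Or.inl rfl, h.symm⟩
    · exact ⟨Or.inr hx, h'⟩

theorem sign_erase (i j : ℤ) (S : Maya) (hj : j ∈ S.1) :
    sign i (erase j S) = if i < j then -sign i S else sign i S := by
  have h := sign_insert i j (erase j S) (fun h => h.2 rfl)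
  rw [insert_erase hj] at h
  rw [h]
  split_ifs <;> simp

theorem sign_mul_self (i : ℤ) (S : Maya) : sign i S * sign i S = 1 := by
  unfold sign
  rw [← mul_pow]
  simp

theorem charge_insert {i : ℤ} {S : Maya} (hi : i ∉ S.1) : charge (insert i S) = charge S + 1 := by
  unfold charge
  by_cases h : i ≤ 0
  · have h1 : (insert i S).1 \ Set.Iic 0 = S.1 \ Set.Iic 0 :=
      Set.insert_sdiff_of_mem _ h
    have h2 : Set.Iic 0 \ S.1 = Insert.insert i (Set.Iic 0 \ (insert i S).1) := by
      ext x
      simp only [insert, Set.mem_sdiff, Set.mem_Iic, Set.mem_insert_iff]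
      by_cases hx : x = i
      · subst hx; simp [h, hi]
      · simp [hx]
    rw [h1, h2, Set.ncard_insert_of_notMem (fun hx => hx.2 (Or.inl rfl)) (insert i S).2.2]
    push_cast
    ring
  · have h1 : (insert i S).1 \ Set.Iic 0 = Insert.insert i (S.1 \ Set.Iic 0) :=
      Set.insert_sdiff_of_notMem _ h
    have h2 : Set.Iic 0 \ (insert i S).1 = Set.Iic 0 \ S.1 := by
      ext x
      simp only [insert, Set.mem_sdiff, Set.mem_Iic, Set.mem_insert_iff]
      constructor
      · rintro ⟨hx, hx'⟩
        exact ⟨hx, fun hS => hx' (Or.inr hS)⟩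
      · rintro ⟨hx, hx'⟩
        refine ⟨hx, ?_⟩
        rintro (rfl | hS)
        · exact h hx
        · exact hx' hS
    rw [h1, h2, Set.ncard_insert_of_notMem (fun hx => hi hx.1) S.2.1]
    push_cast
    ring

end Maya

/-- The Fock space of all charges: formal combinations of semi-infinite wedges. -/
abbrev FullFock : Type := Maya →₀ ℂ

open Classical in
/-- The exterior multiplication `v_i ∧ -`. -/
def wedge (i : ℤ) : Module.End ℂ FullFock :=
  Finsupp.linearCombination ℂ fun S =>
    if i ∈ S.1 then 0 else Finsupp.single (S.insert i) (S.sign i)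

open Classical in
/-- The contraction with the `i`-th coordinate function. -/
def contract (i : ℤ) : Module.End ℂ FullFock :=
  Finsupp.linearCombination ℂ fun S =>
    if i ∈ S.1 then Finsupp.single (S.erase i) (S.sign i) else 0

theorem wedge_single_of_mem {i : ℤ} {S : Maya} (h : i ∈ S.1) (c : ℂ) :
    wedge i (Finsupp.single S c) = 0 := by
  simp [wedge, h]

theorem wedge_single_of_notMem {i : ℤ} {S : Maya} (h : i ∉ S.1) (c : ℂ) :
    wedge i (Finsupp.single S c) = Finsupp.single (S.insert i) (c * S.sign i) := by
  simp [wedge, h]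

theorem contract_single_of_mem {i : ℤ} {S : Maya} (h : i ∈ S.1) (c : ℂ) :
    contract i (Finsupp.single S c) = Finsupp.single (S.erase i) (c * S.sign i) := by
  simp [contract, h]

theorem contract_single_of_notMem {i : ℤ} {S : Maya} (h : i ∉ S.1) (c : ℂ) :
    contract i (Finsupp.single S c) = 0 := by
  simp [contract, h]

theorem wedge_wedge (i j : ℤ) : wedge i * wedge j = -(wedge j * wedge i) := by
  refine Finsupp.lhom_ext' fun S => LinearMap.ext_ring ?_
  simp only [LinearMap.comp_apply, Finsupp.lsingle_apply, Module.End.mul_apply,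
    LinearMap.neg_apply]
  by_cases hi : i ∈ S.1
  · rw [wedge_single_of_mem hi, map_zero, neg_zero]
    by_cases hj : j ∈ S.1
    · rw [wedge_single_of_mem hj, map_zero]
    · rw [wedge_single_of_notMem hj, wedge_single_of_mem (Or.inr hi)]
  · by_cases hj : j ∈ S.1
    · rw [wedge_single_of_mem hj, map_zero, wedge_single_of_notMem hi,
        wedge_single_of_mem (Or.inr hj), neg_zero]
    · rw [wedge_single_of_notMem hi, wedge_single_of_notMem hj]
      rcases eq_or_ne i j with rfl | hij
      · rw [wedge_single_of_mem (Or.inl rfl), neg_zero]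
      · rw [wedge_single_of_notMem (fun h => (Maya.mem_insert.1 h).elim hij hi),
          wedge_single_of_notMem (fun h => (Maya.mem_insert.1 h).elim hij.symm hj), Maya.insert_comm,
          ← Finsupp.single_neg, Maya.sign_insert _ _ _ hi, Maya.sign_insert _ _ _ hj]
        congr 1
        rcases lt_or_gt_of_ne hij with h | h <;> simp [h, not_lt_of_gt h] <;> ring

theorem contract_contract (i j : ℤ) : contract i * contract j = -(contract j * contract i) := by
  refine Finsupp.lhom_ext' fun S => LinearMap.ext_ring ?_
  simp only [LinearMap.comp_apply, Finsupp.lsingle_apply, Module.End.mul_apply,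
    LinearMap.neg_apply]
  by_cases hi : i ∈ S.1
  · by_cases hj : j ∈ S.1
    · rw [contract_single_of_mem hi, contract_single_of_mem hj]
      rcases eq_or_ne i j with rfl | hij
      · rw [contract_single_of_notMem (fun h => (Maya.mem_erase.1 h).2 rfl), neg_zero]
      · rw [contract_single_of_mem (Maya.mem_erase.2 ⟨hi, hij⟩),
          contract_single_of_mem (Maya.mem_erase.2 ⟨hj, hij.symm⟩), Maya.erase_comm,
          ← Finsupp.single_neg, Maya.sign_erase _ _ _ hi, Maya.sign_erase _ _ _ hj]
        congr 1
        rcases lt_or_gt_of_ne hij with h | h <;> simp [h, not_lt_of_gt h] <;> ring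
    · rw [contract_single_of_notMem hj, map_zero, contract_single_of_mem hi,
        contract_single_of_notMem (fun h => hj (Maya.mem_erase.1 h).1), neg_zero]
  · rw [contract_single_of_notMem hi, map_zero, neg_zero]
    by_cases hj : j ∈ S.1
    · rw [contract_single_of_mem hj, contract_single_of_notMem (fun h => hi (Maya.mem_erase.1 h).1)]
    · rw [contract_single_of_notMem hj, map_zero]

theorem contract_wedge (i j : ℤ) :
    contract i * wedge j = (if i = j then 1 else 0) - wedge j * contract i := by
  refine Finsupp.lhom_ext' fun S => LinearMap.ext_ring ?_
  simp only [LinearMap.comp_apply, Finsupp.lsingle_apply, Module.End.mul_apply,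
    LinearMap.sub_apply]
  rcases eq_or_ne i j with rfl | hij
  · rw [if_pos rfl, Module.End.one_apply]
    by_cases hi : i ∈ S.1
    · rw [wedge_single_of_mem hi, map_zero, contract_single_of_mem hi,
        wedge_single_of_notMem (fun h => (Maya.mem_erase.1 h).2 rfl), Maya.insert_erase hi,
        Maya.sign_erase _ _ _ hi, if_neg (lt_irrefl i), one_mul, Maya.sign_mul_self, sub_self]
    · rw [wedge_single_of_notMem hi, contract_single_of_notMem hi, map_zero, sub_zero,
        contract_single_of_mem (Or.inl rfl), Maya.erase_insert hi,
        Maya.sign_insert _ _ _ hi, if_neg (lt_irrefl i), one_mul, Maya.sign_mul_self]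
  · rw [if_neg hij, LinearMap.zero_apply, zero_sub]
    by_cases hi : i ∈ S.1
    · by_cases hj : j ∈ S.1
      · rw [wedge_single_of_mem hj, map_zero, contract_single_of_mem hi,
          wedge_single_of_mem (Maya.mem_erase.2 ⟨hj, hij.symm⟩), neg_zero]
      · rw [wedge_single_of_notMem hj, contract_single_of_mem (Or.inr hi),
          contract_single_of_mem hi, wedge_single_of_notMem (fun h => hj (Maya.mem_erase.1 h).1),
          Maya.erase_insert_comm hij, ← Finsupp.single_neg, Maya.sign_insert _ _ _ hj,
          Maya.sign_erase _ _ _ hi]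
        congr 1
        rcases lt_or_gt_of_ne hij with h | h <;> simp [h, not_lt_of_gt h] <;> ring
    · rw [contract_single_of_notMem hi, map_zero, neg_zero]
      by_cases hj : j ∈ S.1
      · rw [wedge_single_of_mem hj, map_zero]
      · rw [wedge_single_of_notMem hj, contract_single_of_notMem (fun h => (Maya.mem_insert.1 h).elim hij hi)]

/-- The action of `gl_∞` on the full Fock space: `E_{ij}` acts by replacing `v_j` by `v_i`, that
is, by `(v_i ∧ -) ∘ (contraction with the j-th coordinate)`. -/
def fullRepLinear : glInf →ₗ[ℂ] Module.End ℂ FullFock :=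
  (Finsupp.linearCombination ℂ fun p : ℤ × ℤ => wedge p.1 * contract p.2).comp entries

theorem fullRepLinear_matE (i j : ℤ) : fullRepLinear (matE i j) = wedge i * contract j := by
  simp [fullRepLinear, entries_matE]

theorem fullRepLinear_lie (A B : glInf) : fullRepLinear ⁅A, B⁆ =
    fullRepLinear A * fullRepLinear B - fullRepLinear B * fullRepLinear A := by
  induction A using glInf_induction with
  | h0 => simp
  | hadd A A' h h' => rw [add_lie, map_add, map_add, h, h']; noncomm_ring
  | hsmul c A h =>
    rw [smul_lie, map_smul, map_smul, h, smul_sub, smul_mul_assoc, mul_smul_comm]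
  | hE i j =>
    induction B using glInf_induction with
    | h0 => simp
    | hadd B B' h h' => rw [lie_add, map_add, map_add, h, h']; noncomm_ring
    | hsmul c B h =>
      rw [lie_smul, map_smul, map_smul, h, smul_sub, smul_mul_assoc, mul_smul_comm]
    | hE k l =>
      have key : ∀ a b c d : ℤ, wedge a * contract b * (wedge c * contract d) =
          (if b = c then wedge a * contract d else 0) -
            wedge a * wedge c * (contract b * contract d) := by
        intro a b c d
        have : wedge a * contract b * (wedge c * contract d) =
            wedge a * (contract b * wedge c) * contract d := by simp only [mul_assoc]
        rw [this, contract_wedge]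
        split_ifs <;> simp [mul_sub, sub_mul, mul_assoc]
      rw [lie_matE, map_sub, fullRepLinear_matE, fullRepLinear_matE, key, key,
        wedge_wedge k i, contract_contract l j]
      rw [apply_ite fullRepLinear, apply_ite fullRepLinear, fullRepLinear_matE,
        fullRepLinear_matE, map_zero, neg_mul_neg]
      abel

/-- The charge zero Fock space: the span of the semi-infinite wedges of charge zero. -/
def fockSubmodule : Submodule ℂ FullFock := Finsupp.supported ℂ ℂ {S : Maya | S.charge = 0}

/-- The charge zero Fock space as a vector space. -/
def Fock : Type := fockSubmodule

instance : AddCommGroup Fock := inferInstanceAs (AddCommGroup fockSubmodule)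

instance : Module ℂ Fock := inferInstanceAs (Module ℂ fockSubmodule)

theorem fullRep_mem (A : glInf) (x : FullFock) (hx : x ∈ fockSubmodule) :
    fullRepLinear A x ∈ fockSubmodule := by
  induction A using glInf_induction with
  | h0 => simp
  | hadd A A' h h' => rw [map_add]; exact fockSubmodule.add_mem h h'
  | hsmul c A h => rw [map_smul]; exact Submodule.smul_mem _ c h
  | hE i j =>
    rw [fullRepLinear_matE]
    suffices h : fockSubmodule ≤ Submodule.comap (wedge i * contract j) fockSubmodule from h hx
    rw [fockSubmodule, Finsupp.supported_eq_span_single, Submodule.span_le]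
    rintro _ ⟨S, hS, rfl⟩
    rw [← Finsupp.supported_eq_span_single]
    change wedge i (contract j (Finsupp.single S 1)) ∈ fockSubmodule
    by_cases hj : j ∈ S.1
    · rw [contract_single_of_mem hj]
      by_cases hi : i ∈ (S.erase j).1
      · rw [wedge_single_of_mem hi]
        exact zero_mem _
      · rw [wedge_single_of_notMem hi]
        refine Finsupp.single_mem_supported _ _ ?_
        have h1 := Maya.charge_insert hi
        have h2 := Maya.charge_insert (i := j) (S := S.erase j) (fun h => (Maya.mem_erase.1 h).2 rfl)
        rw [Maya.insert_erase hj] at h2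
        have h3 : S.charge = 0 := hS
        change Maya.charge _ = 0
        omega
    · rw [contract_single_of_notMem hj, map_zero]
      exact zero_mem _

/-- The representation of `gl_∞` on the charge zero Fock space. -/
def fockRep : glInf →ₗ⁅ℂ⁆ Module.End ℂ Fock where
  toFun A := (fullRepLinear A).restrict (fullRep_mem A)
  map_add' A B := LinearMap.ext fun x => Subtype.ext
    (LinearMap.congr_fun (map_add fullRepLinear A B) x.1)
  map_smul' c A := LinearMap.ext fun x => Subtype.ext
    (LinearMap.congr_fun (map_smul fullRepLinear c A) x.1)
  map_lie' := by
    intro A B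
    exact LinearMap.ext fun x => Subtype.ext (LinearMap.congr_fun (fullRepLinear_lie A B) x.1)

end

end Mirabolic

open Mirabolic

/-! The generic algebra of rank n is split semisimple, and all assertions can be read off an
explicit matrix model. A path is a sequence of n steps that starts at the vacuum diagram; each step
moves one particle from a place i to the free place i+1, or is the idle step ⊤. The model `Blk n`
consists of the matrices indexed by paths that are block diagonal with respect to the end points.
Its simple modules are labelled by the diagrams S of charge zero and size at most n, that is, by
pairs (k, S) where k = n - size S is the number of idle steps.

The core is the isomorphism `rEquiv` of `Blk n` with the generic algebra. It is compatible with the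
inclusions, and it turns the last Jucys–Murphy element into the diagonal matrix with entry q^i at
the paths that end with the step i, and 0 at those that end with ⊤ (`jucysMurphy_eq`). Hence i-Res
selects the paths with last step i, and i-Ind appends the step i. For a finite step, rank and size
change together, so k is kept and S changes as under E_{i,i+1} or E_{i+1,i}. The step ⊤ keeps S and
shifts k. In coordinates given by multiplicities of simple modules, the sum of the Grothendieck
groups becomes a direct sum of copies of the Fock space indexed by k (`fockEquiv`): the operators
with i in ℤ act diagonally by matrix units, and the operators with index ∞ are the two shifts
(`lowerOp_character`, `raiseOp_character`). The kernel of the k-th power of the left shift is the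
sum of the first k copies, which gives the statements on layers.

The isomorphism is obtained from generators, relations and a dimension count. Over a finite field,
T_j is the adjacency matrix of complete flags that differ in exactly one given dimension, and the
average over the k-dimensional member of a flag gives an idempotent e_k. These elements satisfy
`Rel` (`convRel`), and they generate the orbit functions (`orbit_genPair`). Seminormal matrices give
a second family of elements with the same relations (`rel_blk`), and they generate all of `Blk n`
(`adjoin_genSet`).

`Blk n` is in fact presented by `Rel` (`exists_lift`). In rank n+1, with t the last T and e the last
idempotent, the generated algebra is spanned by the image B of the smaller algebra, by BtB and by eB
(`adjoin_le_span3`). Sliding factors through t shows that this span is not larger than `Blk (n + 1)`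
(`pairCount_growth_le`). So `Blk n` maps onto the generic algebra.

This map is injective because the dimensions agree. Raising and lowering of diagrams satisfy [D, U]
= 1 on the relevant vectors, as in a differential poset, so the number of pairs of paths with equal
end points is the sum of C(n,k)^2 k!, the number of partial permutations (`pairCount_eq`). Equally
many orbit functions are linearly independent (`pairCount_le_finrank`). -/

namespace Mirabolic

noncomputable section

/-! ## Complete flags -/

section Flags

open Module Submodule

variable {n : ℕ} {k V : Type*} [Field k] [AddCommGroup V] [Module k V]

/-- The `i`-dimensional member of a complete flag (the whole space if `i` is too large). -/
def sub (F : Flag (Submodule k V)) (i : ℕ) : Submodule k V :=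
  sSup {U | U ∈ F ∧ finrank k U ≤ i}

/-- The span of the basis vectors indexed by `A`. -/
abbrev bspan (b : Basis (Fin n) k V) (A : Set (Fin n)) : Submodule k V := span k (b '' A)

theorem mem_bspan {b : Basis (Fin n) k V} {A : Set (Fin n)} {v : V} :
    v ∈ bspan b A ↔ ∀ i, b.repr v i ≠ 0 → i ∈ A := by
  rw [bspan, Basis.mem_span_image]
  simp [Set.subset_def]

theorem bspan_inf (b : Basis (Fin n) k V) (A B : Set (Fin n)) :
    bspan b A ⊓ bspan b B = bspan b (A ∩ B) := by
  ext v
  simp only [mem_inf, mem_bspan, Set.mem_inter_iff]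
  grind

theorem finrank_bspan (b : Basis (Fin n) k V) (A : Set (Fin n)) :
    finrank k (bspan b A) = A.ncard := by
  classical
  have h := finrank_span_eq_card (R := k) (b := fun a : A => b a)
    (b.linearIndependent.comp _ Subtype.val_injective)
  rw [bspan, Set.image_eq_range, h, ← Nat.card_eq_fintype_card, Nat.card_coe_set_eq]

theorem ncard_val_lt (i : ℕ) : {a : Fin n | a.val < i}.ncard = min i n := by
  rw [← Set.ncard_image_of_injective _ Fin.val_injective]
  have : Fin.val '' {a : Fin n | a.val < i} = ((Finset.range (min i n) : Finset ℕ) : Set ℕ) := by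
    ext x
    simp only [Set.mem_image, Finset.coe_range, Set.mem_Iio, lt_min_iff]
    constructor
    · rintro ⟨a, h, rfl⟩; exact ⟨h, a.2⟩
    · rintro ⟨h1, h2⟩; exact ⟨⟨x, h2⟩, h1, rfl⟩
  rw [this, Set.ncard_coe_finset, Finset.card_range]

theorem flag_eq_bspan (b : Basis (Fin n) k V) (i : Fin (n + 1)) :
    b.flag i = bspan b {a | a.val < i.val} := rfl

theorem sub_toFlag (b : Basis (Fin n) k V) (i : ℕ) :
    sub b.toFlag i = bspan b {a | a.val < i} := by
  have hle : ∀ U, U ∈ b.toFlag → finrank k U ≤ i → U ≤ bspan b {a | a.val < i} := by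
    intro U hU hi
    obtain ⟨j, rfl⟩ := b.mem_toFlag.1 hU
    rw [flag_eq_bspan] at hi ⊢
    rw [finrank_bspan, ncard_val_lt] at hi
    refine span_mono (Set.image_mono fun a ha => ?_)
    have := j.2
    simp only [Set.mem_ofPred_eq] at ha ⊢
    omega
  apply le_antisymm
  · exact sSup_le fun U hU => hle U hU.1 hU.2
  · refine le_sSup ⟨b.mem_toFlag.2 ⟨⟨min i n, by omega⟩, ?_⟩, ?_⟩
    · rw [flag_eq_bspan]
      congr 2
      ext a
      have := a.2
      simp only [Set.mem_ofPred_eq]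
      omega
    · rw [finrank_bspan, ncard_val_lt]; omega

/-- A flag is only given as a maximal chain, so it has to be shown that no dimension is skipped.
Above a member U take a member W of least dimension. Adding to U a line of W gives a subspace
comparable with every member, hence a member by maximality, and so W cannot be more than one
dimension larger. -/
theorem exists_mem_flag_finrank [FiniteDimensional k V] (F : Flag (Submodule k V)) (i : ℕ)
    (hi : i ≤ finrank k V) : ∃ U ∈ F, finrank k U = i := by
  induction i with
  | zero => exact ⟨⊥, F.bot_mem, finrank_bot k V⟩
  | succ i ih =>
    obtain ⟨U, hU, hUi⟩ := ih (by omega)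
    have hne : ∃ d, ∃ W ∈ F, U < W ∧ finrank k W = d := by
      refine ⟨_, ⊤, F.top_mem, lt_top_iff_ne_top.2 ?_, rfl⟩
      rintro rfl
      rw [finrank_top] at hUi
      omega
    classical
    obtain ⟨W, hW, hUW, hd⟩ := Nat.find_spec hne
    have hmin : ∀ X ∈ F, U < X → finrank k W ≤ finrank k X := fun X hX hUX => by
      rw [hd]; exact Nat.find_min' hne ⟨X, hX, hUX, rfl⟩
    refine ⟨W, hW, le_antisymm ?_ (by have := finrank_lt_finrank_of_lt hUW; omega)⟩
    obtain ⟨v, hvW, hvU⟩ := SetLike.exists_of_lt hUW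
    by_contra hcon
    have hZW : U ⊔ span k {v} ≤ W := sup_le hUW.le ((span_singleton_le_iff_mem v W).2 hvW)
    have hZU : U < U ⊔ span k {v} := left_lt_sup.2 fun h => hvU (h (mem_span_singleton_self v))
    have hZr : finrank k ↥(U ⊔ span k {v}) ≤ i + 1 := by
      have h1 := finrank_add_le_finrank_add_finrank U (span k {v})
      have h2 : finrank k (span k {v}) ≤ 1 := finrank_span_le_card (R := k) {v}
      omega
    have hZF : U ⊔ span k {v} ∈ F := by
      rw [Flag.mem_iff_forall_le_or_ge]
      intro X hX
      rcases F.le_or_le hX hU with h | h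
      · exact Or.inr (h.trans hZU.le)
      · rcases h.eq_or_lt with rfl | h
        · exact Or.inr hZU.le
        · refine Or.inl ?_
          have h3 := hmin X hX h
          rcases F.le_or_le hX hW with h4 | h4
          · rw [eq_of_le_of_finrank_le h4 h3]; exact hZW
          · exact hZW.trans h4
    have := hmin _ hZF hZU
    omega

/-- Choose one vector in each difference of consecutive members. Dimensions force the chosen vectors
to span; beyond index n the chain is constant, which is why the dimension is `min i n`. -/
theorem exists_basis_of_chain [FiniteDimensional k V] (hV : finrank k V = n)
    (c : ℕ → Submodule k V) (hm : Monotone c) (hc : ∀ i, finrank k (c i) = min i n) :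
    ∃ b : Basis (Fin n) k V, ∀ i, c i = bspan b {a | a.val < i} := by
  have hlt : ∀ i : Fin n, c i.val < c (i.val + 1) := fun i => by
    refine lt_of_le_of_ne (hm (Nat.le_succ _)) fun h => ?_
    have h1 := hc i.val
    have h2 := hc (i.val + 1)
    rw [← h] at h2
    have := i.2
    omega
  choose v hv1 hv2 using fun i => SetLike.exists_of_lt (hlt i)
  have key : ∀ i, i ≤ n → c i = span k (v '' {a | a.val < i}) := by
    intro i
    induction i with
    | zero =>
      intro _
      have : finrank k (c 0) = 0 := by rw [hc]; simp
      rw [finrank_eq_zero.1 this]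
      simp
    | succ i ih =>
      intro hi
      have h0 := ih (by omega)
      have hset : {a : Fin n | a.val < i + 1} = insert ⟨i, hi⟩ {a : Fin n | a.val < i} := by
        ext a
        simp only [Set.mem_ofPred_eq, Set.mem_insert_iff, Fin.ext_iff]
        omega
      rw [hset, Set.image_insert_eq, span_insert, ← h0]
      symm
      apply eq_of_le_of_finrank_le
      · exact sup_le ((span_singleton_le_iff_mem _ _).2 (hv1 ⟨i, hi⟩)) (hm (Nat.le_succ _))
      · have h1 : c i < span k {v ⟨i, hi⟩} ⊔ c i :=
          right_lt_sup.2 fun h => hv2 ⟨i, hi⟩ (h (mem_span_singleton_self _))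
        have h2 := finrank_lt_finrank_of_lt h1
        rw [hc] at h2 ⊢
        omega
  have htop : ⊤ ≤ span k (Set.range v) := by
    have h1 := key n le_rfl
    have h2 : {a : Fin n | a.val < n} = Set.univ := by ext a; simp
    rw [h2, Set.image_univ] at h1
    rw [← h1]
    refine (eq_top_of_finrank_eq ?_).ge
    rw [hc, hV]; simp
  let b := basisOfTopLeSpanOfCardEqFinrank v htop (by simp [hV])
  have hb : (b : Fin n → V) = v := coe_basisOfTopLeSpanOfCardEqFinrank _ _ _
  refine ⟨b, fun i => ?_⟩
  rw [bspan, hb]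
  rcases le_total i n with h | h
  · exact key i h
  · have h2 : {a : Fin n | a.val < i} = Set.univ := by ext a; have := a.2; simp; omega
    rw [h2, Set.image_univ, top_le_iff.1 htop]
    apply eq_top_of_finrank_eq
    rw [hc, hV]; omega

theorem sub_eq_of_mem [FiniteDimensional k V] (F : Flag (Submodule k V)) {U : Submodule k V}
    (hU : U ∈ F) : sub F (finrank k U) = U := by
  refine le_antisymm (sSup_le fun W hW => ?_) (le_sSup ⟨hU, le_rfl⟩)
  rcases F.le_or_le hW.1 hU with h | h
  · exact h
  · rw [eq_of_le_of_finrank_le h hW.2]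

theorem sub_mono (F : Flag (Submodule k V)) : Monotone (sub F) := fun _ _ h =>
  sSup_le_sSup fun _ hU => ⟨hU.1, hU.2.trans h⟩

variable [FiniteDimensional k V] (hV : finrank k V = n)
include hV

theorem sub_of_le (F : Flag (Submodule k V)) {i : ℕ} (hi : n ≤ i) : sub F i = ⊤ :=
  top_le_iff.1 (le_sSup ⟨F.top_mem, by rw [finrank_top, hV]; exact hi⟩)

theorem finrank_sub (F : Flag (Submodule k V)) (i : ℕ) : finrank k (sub F i) = min i n := by
  rcases le_total i n with h | h
  · obtain ⟨U, hU, hd⟩ := exists_mem_flag_finrank F i (hV ▸ h)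
    have := sub_eq_of_mem F hU
    rw [hd] at this
    rw [this, hd]; omega
  · rw [sub_of_le hV F h, finrank_top, hV]; omega

theorem sub_mem_flag (F : Flag (Submodule k V)) (i : ℕ) : sub F i ∈ F := by
  rcases le_total i n with h | h
  · obtain ⟨U, hU, hd⟩ := exists_mem_flag_finrank F i (hV ▸ h)
    have := sub_eq_of_mem F hU
    rw [hd] at this
    rw [this]; exact hU
  · rw [sub_of_le hV F h]; exact F.top_mem

omit hV in
theorem flag_ext {F G : Flag (Submodule k V)} (h : ∀ i, sub F i = sub G i) : F = G := by
  have aux : ∀ F G : Flag (Submodule k V), (∀ i, sub F i = sub G i) → ∀ U, U ∈ F → U ∈ G := by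
    intro F G h U hU
    rw [← sub_eq_of_mem F hU, h]
    exact sub_mem_flag rfl G _
  exact Flag.ext (Set.ext fun U => ⟨aux F G h U, aux G F (fun i => (h i).symm) U⟩)

theorem exists_flag_of_chain (c : ℕ → Submodule k V) (hm : Monotone c)
    (hc : ∀ i, finrank k (c i) = min i n) : ∃ F : Flag (Submodule k V), sub F = c := by
  obtain ⟨b, hb⟩ := exists_basis_of_chain hV c hm hc
  exact ⟨b.toFlag, funext fun i => by rw [sub_toFlag, hb]⟩

theorem exists_basis_toFlag (F : Flag (Submodule k V)) : ∃ b : Basis (Fin n) k V, F = b.toFlag := by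
  obtain ⟨b, hb⟩ := exists_basis_of_chain hV (sub F) (sub_mono F) (finrank_sub hV F)
  exact ⟨b, flag_ext fun i => by rw [sub_toFlag, hb]⟩

end Flags

/-! ## Bases adapted to a pair of flags -/

section Adapted

open Module Submodule

variable {n : ℕ} {k V : Type*} [Field k] [AddCommGroup V] [Module k V]

theorem bspan_sup (b : Basis (Fin n) k V) (A B : Set (Fin n)) :
    bspan b A ⊔ bspan b B = bspan b (A ∪ B) := by
  rw [bspan, bspan, bspan, Set.image_union, span_union]

theorem bspan_reindex (b : Basis (Fin n) k V) (s : Equiv.Perm (Fin n)) (A : Set (Fin n)) :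
    bspan (b.reindex s) A = bspan b (s ⁻¹' A) := by
  rw [bspan, bspan, ← Equiv.image_symm_eq_preimage, ← Set.image_comp]
  congr 2
  ext i
  simp

/-- The basis `b` is adapted to the pair of flags `(F, F')`, which are in relative position `w`. -/
def Adapted (b : Basis (Fin n) k V) (w : Equiv.Perm (Fin n)) (F F' : Flag (Submodule k V)) :
    Prop :=
  F = b.toFlag ∧ F' = (b.reindex w.symm).toFlag

/-- The order on the indices of an adapted basis given by the positions in both flags. -/
def wle (w : Equiv.Perm (Fin n)) (i j : Fin n) : Prop := i ≤ j ∧ w.symm i ≤ w.symm j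

theorem wle_refl (w : Equiv.Perm (Fin n)) (i : Fin n) : wle w i i := ⟨le_rfl, le_rfl⟩

theorem wle_trans {w : Equiv.Perm (Fin n)} {i j l : Fin n} (h : wle w i j) (h' : wle w j l) :
    wle w i l := ⟨h.1.trans h'.1, h.2.trans h'.2⟩

/-- Sets of indices that are closed downwards. -/
def IsDown (w : Equiv.Perm (Fin n)) (D : Set (Fin n)) : Prop := ∀ i j, wle w i j → j ∈ D → i ∈ D

theorem Adapted.sub_left {b : Basis (Fin n) k V} {w : Equiv.Perm (Fin n)}
    {F F' : Flag (Submodule k V)} (h : Adapted b w F F') (m : ℕ) :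
    sub F m = bspan b {a | a.val < m} := by
  rw [h.1, sub_toFlag]

theorem Adapted.sub_right {b : Basis (Fin n) k V} {w : Equiv.Perm (Fin n)}
    {F F' : Flag (Submodule k V)} (h : Adapted b w F F') (m : ℕ) :
    sub F' m = bspan b {a | (w.symm a).val < m} := by
  rw [h.2, sub_toFlag, bspan_reindex]
  rfl

theorem adapted_of_sub [FiniteDimensional k V] {b : Basis (Fin n) k V} {w : Equiv.Perm (Fin n)}
    {F F' : Flag (Submodule k V)} (h : ∀ m, sub F m = bspan b {a | a.val < m})
    (h' : ∀ m, sub F' m = bspan b {a | (w.symm a).val < m}) : Adapted b w F F' := by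
  constructor
  · exact flag_ext fun m => by rw [h, sub_toFlag]
  · exact flag_ext fun m => by rw [h', sub_toFlag, bspan_reindex]; rfl

/-- A unitriangular change of an adapted basis is adapted. -/
theorem Adapted.tri [FiniteDimensional k V] {b : Basis (Fin n) k V} {w : Equiv.Perm (Fin n)}
    {F F' : Flag (Submodule k V)} (h : Adapted b w F F') (c : Fin n → V)
    (hc : ∀ i j, b.repr (c i) j ≠ 0 → wle w j i) (hd : ∀ i, b.repr (c i) i ≠ 0) :
    ∃ b' : Basis (Fin n) k V, (∀ i, b' i = c i) ∧ Adapted b' w F F' := by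
  have hV : finrank k V = n := by simpa using finrank_eq_card_basis b
  have hmem : ∀ i, c i ∈ bspan b {j | wle w j i} := fun i => mem_bspan.2 fun j hj => hc i j hj
  -- Inversion of the triangular change of basis, by recursion along the first of the two orders.
  have hinv : ∀ N, ∀ i : Fin n, i.val < N → b i ∈ span k (c '' {j | wle w j i}) := by
    intro N
    induction N with
    | zero => intro i hi; omega
    | succ N ih =>
      intro i hi
      have h1 : b i = (b.repr (c i) i)⁻¹ •
          (c i - ∑ j ∈ Finset.univ.erase i, b.repr (c i) j • b j) := by
        have h2 := b.sum_repr (c i)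
        rw [← Finset.add_sum_erase _ _ (Finset.mem_univ i)] at h2
        nth_rewrite 2 [← h2]
        rw [add_sub_cancel_right, smul_smul, inv_mul_cancel₀ (hd i), one_smul]
      rw [h1]
      refine smul_mem _ _ (sub_mem (subset_span ⟨i, wle_refl w i, rfl⟩)
        (sum_mem fun j hj => ?_))
      by_cases h0 : b.repr (c i) j = 0
      · rw [h0, zero_smul]; exact zero_mem _
      · have hji := hc i j h0
        have hlt : j.val < i.val := lt_of_le_of_ne hji.1 (fun h => Finset.ne_of_mem_erase hj (Fin.ext h))
        refine smul_mem _ _ (span_mono (Set.image_mono ?_) (ih j (by omega)))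
        exact fun l hl => wle_trans hl hji
  -- The members of both flags are spanned by downward closed sets of basis vectors, so it suffices
  -- that such spans do not change.
  have hspan : ∀ D, IsDown w D → span k (c '' D) = bspan b D := by
    intro D hD
    apply le_antisymm
    · rw [span_le]
      rintro _ ⟨i, hi, rfl⟩
      exact span_mono (Set.image_mono fun j hj => hD j i hj hi) (hmem i)
    · rw [bspan, span_le]
      rintro _ ⟨i, hi, rfl⟩
      exact span_mono (Set.image_mono fun j hj => hD j i hj hi) (hinv _ i (Nat.lt_succ_self _))
  have htop : ⊤ ≤ span k (Set.range c) := by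
    have h1 := hspan Set.univ fun _ _ _ _ => trivial
    rw [Set.image_univ, bspan, Set.image_univ, b.span_eq] at h1
    exact h1.ge
  obtain ⟨B, hB⟩ : ∃ B : Basis (Fin n) k V, ⇑B = c :=
    ⟨_, coe_basisOfTopLeSpanOfCardEqFinrank c htop (by simp [hV])⟩
  subst hB
  refine ⟨B, fun i => rfl, adapted_of_sub (fun m => ?_) fun m => ?_⟩
  · rw [h.sub_left]
    refine (hspan {a | a.val < m} fun i j hij hj => ?_).symm
    exact lt_of_le_of_lt (Fin.val_le_of_le hij.1) hj
  · rw [h.sub_right]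
    refine (hspan {a | (w.symm a).val < m} fun i j hij hj => ?_).symm
    exact lt_of_le_of_lt (Fin.val_le_of_le hij.2) hj

/-- Uniqueness in the Bruhat decomposition. Membership of b'_i in the flag members where it first
appears bounds its support in both orders. The coefficient at i cannot vanish, since otherwise b'_i
would already lie in the previous member of F. -/
theorem Adapted.unique {b b' : Basis (Fin n) k V} {w w' : Equiv.Perm (Fin n)}
    {F F' : Flag (Submodule k V)} (h : Adapted b w F F') (h' : Adapted b' w' F F') :
    w = w' ∧ ∀ i j, b.repr (b' i) j ≠ 0 → wle w j i := by
  have h1 : ∀ i j, b.repr (b' i) j ≠ 0 → j ≤ i ∧ w.symm j ≤ w'.symm i := by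
    intro i j hj
    have h2 : b' i ∈ sub F (i.val + 1) := by
      rw [h'.sub_left]
      exact subset_span ⟨i, Nat.lt_succ_self _, rfl⟩
    have h3 : b' i ∈ sub F' ((w'.symm i).val + 1) := by
      rw [h'.sub_right]
      exact subset_span ⟨i, Nat.lt_succ_self _, rfl⟩
    rw [h.sub_left, mem_bspan] at h2
    rw [h.sub_right, mem_bspan] at h3
    exact ⟨Nat.lt_succ_iff.1 (h2 j hj), Nat.lt_succ_iff.1 (h3 j hj)⟩
  have h4 : ∀ i, b.repr (b' i) i ≠ 0 := by
    intro i hi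
    have h5 : b' i ∈ sub F i.val := by
      rw [h.sub_left, mem_bspan]
      intro j hj
      refine lt_of_le_of_ne (h1 i j hj).1 fun hji => ?_
      exact hj (hji ▸ hi)
    rw [h'.sub_left, mem_bspan] at h5
    exact absurd (h5 i (by simp)) (lt_irrefl i.val)
  have h6 : ∀ i, w.symm i ≤ w'.symm i := fun i => (h1 i i (h4 i)).2
  -- One inverse permutation is pointwise below the other, and the sums of their values agree, so
  -- they are equal.
  have h7 : w = w' := by
    have h8 : ∑ i, (w.symm i).val = ∑ i, (w'.symm i).val := by
      rw [Equiv.sum_comp w.symm (fun i : Fin n => i.val), Equiv.sum_comp w'.symm (fun i : Fin n => i.val)]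
    have h9 := (Finset.sum_eq_sum_iff_of_le (fun i _ => Fin.val_le_of_le (h6 i))).1 h8
    have : w.symm = w'.symm := Equiv.ext fun i => Fin.ext (h9 i (Finset.mem_univ i))
    rw [← w.symm_symm, this, w'.symm_symm]
  refine ⟨h7, fun i j hj => ?_⟩
  have := h1 i j hj
  rw [← h7] at this
  exact this

open Classical in
/-- The downward closure of a finite set of indices. -/
def down (w : Equiv.Perm (Fin n)) (A : Finset (Fin n)) : Finset (Fin n) :=
  Finset.univ.filter fun i => ∃ j ∈ A, wle w i j

theorem mem_down {w : Equiv.Perm (Fin n)} {A : Finset (Fin n)} {i : Fin n} :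
    i ∈ down w A ↔ ∃ j ∈ A, wle w i j := by
  simp [down]

theorem isDown_down (w : Equiv.Perm (Fin n)) (A : Finset (Fin n)) :
    IsDown w (down w A : Set (Fin n)) := by
  intro i j hij hj
  rw [Finset.mem_coe, mem_down] at hj ⊢
  obtain ⟨l, hl, hjl⟩ := hj
  exact ⟨l, hl, wle_trans hij hjl⟩

theorem down_subset_iff {w : Equiv.Perm (Fin n)} {A D : Finset (Fin n)}
    (hD : IsDown w (D : Set (Fin n))) : down w A ⊆ D ↔ A ⊆ D := by
  constructor
  · exact fun h i hi => h (mem_down.2 ⟨i, hi, wle_refl w i⟩)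
  · intro h i hi
    obtain ⟨j, hj, hij⟩ := mem_down.1 hi
    exact hD i j hij (h hj)

theorem exists_max_above (w : Equiv.Perm (Fin n)) (D : Finset (Fin n)) (i : Fin n) (hi : i ∈ D) :
    ∃ m ∈ D, wle w i m ∧ ∀ j ∈ D, wle w m j → j = m := by
  classical
  obtain ⟨m, hm, hmax⟩ := Finset.exists_max_image (D.filter fun j => wle w i j) id
    ⟨i, Finset.mem_filter.2 ⟨hi, wle_refl w i⟩⟩
  rw [Finset.mem_filter] at hm
  refine ⟨m, hm.1, hm.2, fun j hj hmj => ?_⟩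
  exact le_antisymm (hmax j (Finset.mem_filter.2 ⟨hj, wle_trans hm.2 hmj⟩)) hmj.1

/-- The change between two adapted bases is triangular for `wle`, so a support can only spread
downwards. The downward closure is therefore an invariant of the two flags and the vector. -/
theorem Adapted.down_support {b b' : Basis (Fin n) k V} {w : Equiv.Perm (Fin n)}
    {F F' : Flag (Submodule k V)} (h : Adapted b w F F') (h' : Adapted b' w F F') (v : V) :
    down w (b.repr v).support = down w (b'.repr v).support := by
  have key : ∀ b b' : Basis (Fin n) k V, Adapted b w F F' → Adapted b' w F F' →
      down w (b.repr v).support ⊆ down w (b'.repr v).support := by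
    intro b b' h h'
    rw [down_subset_iff (isDown_down _ _)]
    intro j hj
    rw [Finsupp.mem_support_iff] at hj
    have h1 : b.repr v j = ∑ i, b'.repr v i * b.repr (b' i) j := by
      conv_lhs => rw [← b'.sum_repr v]
      simp [Finsupp.finsetSum_apply, -Basis.sum_repr]
    rw [h1] at hj
    obtain ⟨i, -, hi⟩ := Finset.exists_ne_zero_of_sum_ne_zero hj
    exact mem_down.2 ⟨i, Finsupp.mem_support_iff.2 (left_ne_zero_of_mul hi),
      (h.unique h').2 i j (right_ne_zero_of_mul hi)⟩
  exact (key b b' h h').antisymm (key b' b h' h)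

/-- The orbit of a vector under the stabilizer of a pair of flags is determined by the downward
closure of its support in an adapted basis. -/
theorem Adapted.exists_sum_eq [FiniteDimensional k V] {b : Basis (Fin n) k V}
    {w : Equiv.Perm (Fin n)} {F F' : Flag (Submodule k V)} (h : Adapted b w F F') (v : V)
    (β : Finset (Fin n)) (hβ : down w (b.repr v).support = down w β) :
    ∃ b' : Basis (Fin n) k V, Adapted b' w F F' ∧ v = ∑ i ∈ β, b' i := by
  classical
  set I := down w β with hI
  -- The maximal elements of I lie in every set whose downward closure is I, in particular in β and
  -- in the support of v. Each other element of I is assigned by `a` to a maximal element above it.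
  let M : Finset (Fin n) := I.filter fun m => ∀ j ∈ I, wle w m j → j = m
  have hM : ∀ A : Finset (Fin n), down w A = I → ∀ m ∈ M, m ∈ A := by
    intro A hA m hm
    rw [Finset.mem_filter, ← hA] at hm
    obtain ⟨j, hj, hmj⟩ := mem_down.1 hm.1
    rw [← hm.2 j (mem_down.2 ⟨j, hj, wle_refl w j⟩) hmj]
    exact hj
  have ha : ∀ i, ∃ m, i ∈ I → m ∈ M ∧ wle w i m := by
    intro i
    by_cases hi : i ∈ I
    · obtain ⟨m, h1, h2, h3⟩ := exists_max_above w I i hi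
      exact ⟨m, fun _ => ⟨Finset.mem_filter.2 ⟨h1, h3⟩, h2⟩⟩
    · exact ⟨i, fun h => absurd h hi⟩
  choose a ha using ha
  let x : Fin n → k := fun i => b.repr v i
  let d : Fin n → k := fun i => x i - if i ∈ β then 1 else 0
  -- A maximal basis vector is scaled by its coefficient in v and absorbs, for the indices assigned
  -- to it, the difference between v and the sum over β. Then the new vectors indexed by β add up to
  -- v.
  let c : Fin n → V := fun i =>
    if i ∈ M then x i • b i + ∑ j ∈ (I \ M).filter (fun j => a j = i), d j • b j else b i
  have hrepr : ∀ i l, b.repr (c i) l = if i ∈ M then (x i * if i = l then 1 else 0) +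
      (if l ∈ I \ M ∧ a l = i then d l else 0) else if i = l then 1 else 0 := by
    intro i l
    by_cases hi : i ∈ M
    · simp only [c, if_pos hi, map_add, map_smul, map_sum, Finsupp.add_apply, Finsupp.smul_apply,
        Basis.repr_self, Finsupp.single_apply, smul_eq_mul, Finsupp.finsetSum_apply]
      congr 1
      simp
    · simp [c, hi, Finsupp.single_apply]
  have hsub : ∀ i, i ∈ M → x i ≠ 0 := fun i hi => Finsupp.mem_support_iff.1 (hM _ hβ i hi)
  obtain ⟨b', hb', had⟩ := h.tri c (by
    intro i l hl
    rw [hrepr] at hl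
    by_cases hil : i = l
    · rw [hil]; exact wle_refl w l
    · by_cases hi : i ∈ M
      · rw [if_pos hi, if_neg hil, mul_zero, zero_add] at hl
        have h1 : l ∈ I \ M ∧ a l = i := by by_contra h; rw [if_neg h] at hl; exact hl rfl
        have h2 := (ha l (Finset.mem_sdiff.1 h1.1).1).2
        rw [h1.2] at h2
        exact h2
      · rw [if_neg hi, if_neg hil] at hl
        exact absurd rfl hl) (by
    intro i
    rw [hrepr]
    by_cases hi : i ∈ M
    · have : ¬ (i ∈ I \ M ∧ a i = i) := fun h => (Finset.mem_sdiff.1 h.1).2 hi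
      rw [if_pos hi, if_pos rfl, if_neg this, mul_one, add_zero]
      exact hsub i hi
    · simp [hi])
  refine ⟨b', had, ?_⟩
  apply b.repr.injective
  ext l
  have hβM : M ⊆ β := fun m hm => hM β rfl m hm
  have hβI : β ⊆ I := fun i hi => mem_down.2 ⟨i, hi, wle_refl w i⟩
  have hxI : ∀ l, l ∉ I → x l = 0 := by
    intro l hl
    by_contra h0
    exact hl (hβ ▸ mem_down.2 ⟨l, Finsupp.mem_support_iff.2 h0, wle_refl w l⟩)
  have e1 : b.repr (∑ i ∈ β, b' i) l = ∑ i ∈ β, b.repr (c i) l := by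
    simp [hb', Finsupp.finsetSum_apply]
  rw [e1, ← Finset.sum_sdiff hβM]
  have e2 : ∑ i ∈ β \ M, b.repr (c i) l = if l ∈ β \ M then 1 else 0 := by
    rw [← Finset.sum_ite_eq' (β \ M) l (fun _ => (1 : k))]
    refine Finset.sum_congr rfl fun i hi => ?_
    rw [hrepr, if_neg (Finset.mem_sdiff.1 hi).2]
  have e3 : ∑ i ∈ M, b.repr (c i) l = (if l ∈ M then x l else 0) +
      if l ∈ I \ M then d l else 0 := by
    have : ∀ i ∈ M, b.repr (c i) l = (if i = l then x l else 0) +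
        (if a l = i then (if l ∈ I \ M then d l else 0) else 0) := by
      intro i hi
      rw [hrepr, if_pos hi]
      grind
    rw [Finset.sum_congr rfl this, Finset.sum_add_distrib, Finset.sum_ite_eq', Finset.sum_ite_eq]
    congr 1
    by_cases hl : l ∈ I \ M
    · rw [if_pos (ha l (Finset.mem_sdiff.1 hl).1).1]
    · simp [hl]
  rw [e2, e3]
  change x l = _
  simp only [Finset.mem_sdiff, d]
  by_cases h1 : l ∈ M
  · simp [h1]
  · by_cases h2 : l ∈ I
    · by_cases h3 : l ∈ β <;> simp [h1, h2, h3]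
    · have h3 : l ∉ β := fun h => h2 (hβI h)
      simp [h1, h2, h3, hxI l h2]

end Adapted

/-! ## Simple reflections and adjacent flags -/

section Adjacent

open Module Submodule

variable {n : ℕ} {k V : Type*} [Field k] [AddCommGroup V] [Module k V]

/-- The simple transposition exchanging the letters `j` and `j + 1`. -/
def sref (j : ℕ) (hj : j + 1 < n) : Equiv.Perm (Fin n) :=
  Equiv.swap ⟨j, Nat.lt_of_succ_lt hj⟩ ⟨j + 1, hj⟩

theorem sref_left (j : ℕ) (hj : j + 1 < n) :
    sref j hj ⟨j, Nat.lt_of_succ_lt hj⟩ = ⟨j + 1, hj⟩ := Equiv.swap_apply_left _ _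

theorem sref_right (j : ℕ) (hj : j + 1 < n) :
    sref j hj ⟨j + 1, hj⟩ = ⟨j, Nat.lt_of_succ_lt hj⟩ := Equiv.swap_apply_right _ _

theorem sref_of_ne (j : ℕ) (hj : j + 1 < n) {a : Fin n} (h1 : a.val ≠ j) (h2 : a.val ≠ j + 1) :
    sref j hj a = a :=
  Equiv.swap_apply_of_ne_of_ne (fun h => h1 (by rw [h])) (fun h => h2 (by rw [h]))

theorem sref_symm (j : ℕ) (hj : j + 1 < n) : (sref j hj).symm = sref j hj := Equiv.symm_swap _ _

theorem sref_mul_self (j : ℕ) (hj : j + 1 < n) : sref j hj * sref j hj = 1 := Equiv.swap_mul_self _ _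

theorem sref_apply_apply (j : ℕ) (hj : j + 1 < n) (a : Fin n) : sref j hj (sref j hj a) = a :=
  Equiv.swap_apply_self _ _ _

theorem sref_val_lt (j : ℕ) (hj : j + 1 < n) {m : ℕ} (hm : m ≠ j + 1) (a : Fin n) :
    (sref j hj a).val < m ↔ a.val < m := by
  by_cases h1 : a.val = j
  · obtain rfl : a = ⟨j, Nat.lt_of_succ_lt hj⟩ := Fin.ext h1
    rw [sref_left]; simp only; omega
  · by_cases h2 : a.val = j + 1
    · obtain rfl : a = ⟨j + 1, hj⟩ := Fin.ext h2
      rw [sref_right]; simp only; omega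
    · rw [sref_of_ne j hj h1 h2]

/-- Two flags that agree except possibly in dimension `j + 1`. -/
def Fadj (j : ℕ) (F H : Flag (Submodule k V)) : Prop := ∀ i, i ≠ j + 1 → sub F i = sub H i

theorem Fadj.symm {j : ℕ} {F H : Flag (Submodule k V)} (h : Fadj j F H) : Fadj j H F :=
  fun i hi => (h i hi).symm

theorem Fadj.trans {j : ℕ} {F G H : Flag (Submodule k V)} (h : Fadj j F G) (h' : Fadj j G H) :
    Fadj j F H := fun i hi => (h i hi).trans (h' i hi)

theorem Fadj.refl (j : ℕ) (F : Flag (Submodule k V)) : Fadj j F F := fun _ _ => rfl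

theorem Fadj.eq [FiniteDimensional k V] {j : ℕ} {F H : Flag (Submodule k V)} (h : Fadj j F H)
    (h' : sub F (j + 1) = sub H (j + 1)) : F = H := by
  refine flag_ext fun i => ?_
  by_cases hi : i = j + 1
  · rw [hi, h']
  · exact h i hi

theorem Adapted.swap {b : Basis (Fin n) k V} {w : Equiv.Perm (Fin n)}
    {F F' : Flag (Submodule k V)} (h : Adapted b w F F') (j : ℕ) (hj : j + 1 < n) :
    Adapted (b.reindex (sref j hj)) (sref j hj * w) (b.reindex (sref j hj)).toFlag F' ∧
      Fadj j F (b.reindex (sref j hj)).toFlag ∧ F ≠ (b.reindex (sref j hj)).toFlag := by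
  have hs : ∀ m, sub (b.reindex (sref j hj)).toFlag m = bspan b {a | (sref j hj a).val < m} := by
    intro m
    rw [sub_toFlag, bspan_reindex]
    rfl
  refine ⟨⟨rfl, ?_⟩, fun m hm => ?_, fun hF => ?_⟩
  · rw [h.2]
    congr 1
    ext1 i
    simp [sref_symm, sref_apply_apply]
  · rw [h.sub_left, hs]
    simp only [sref_val_lt j hj hm]
  · have h1 := hs (j + 1)
    rw [← hF, h.sub_left] at h1
    have h2 : b ⟨j, Nat.lt_of_succ_lt hj⟩ ∈ bspan b {a | a.val < j + 1} :=
      subset_span ⟨_, Nat.lt_succ_self j, rfl⟩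
    rw [h1, mem_bspan] at h2
    have h3 := h2 ⟨j, Nat.lt_of_succ_lt hj⟩ (by simp)
    simp [sref_left] at h3

/-- The right side does not involve H beyond its position: among the flags adjacent to F in
dimension j+1, at most one is in the position w with respect to F'. This gives uniqueness in
`famT_mul_famX`. -/
theorem Adapted.sub_eq_of_adj {b : Basis (Fin n) k V} {w : Equiv.Perm (Fin n)}
    {F H F' : Flag (Submodule k V)} (h : Adapted b w H F') {j : ℕ} (hj : j + 1 < n)
    (hw : w.symm ⟨j, Nat.lt_of_succ_lt hj⟩ < w.symm ⟨j + 1, hj⟩) (hF : Fadj j F H) :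
    sub H (j + 1) = sub F j ⊔
      (sub F (j + 2) ⊓ sub F' ((w.symm ⟨j, Nat.lt_of_succ_lt hj⟩).val + 1)) := by
  rw [hF j (by omega), hF (j + 2) (by omega), h.sub_left, h.sub_left, h.sub_left, h.sub_right,
    bspan_inf, bspan_sup]
  refine congrArg (bspan b) (Set.ext fun a => ?_)
  change a.val < j + 1 ↔ a.val < j ∨ (a.val < j + 2 ∧ (w.symm a).val < _ + 1)
  by_cases h1 : a.val = j
  · obtain rfl : a = ⟨j, Nat.lt_of_succ_lt hj⟩ := Fin.ext h1
    simp only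
    omega
  · by_cases h2 : a.val = j + 1
    · obtain rfl : a = ⟨j + 1, hj⟩ := Fin.ext h2
      have := Fin.lt_def.1 hw
      simp only
      omega
    · omega

/-- Since F differs from H, its member of dimension j+1 contains a combination of b_{j+1} and b_j
with non-zero coefficient at b_{j+1}. Replacing b_{j+1} by it is a triangular change because j
precedes j+1 in both orders; exchanging the two vectors then adapts the basis to F. The condition on
I says that the span indexed by I survives the replacement. -/
theorem Adapted.of_adj [FiniteDimensional k V] {b : Basis (Fin n) k V} {w : Equiv.Perm (Fin n)}
    {F H F' : Flag (Submodule k V)} (h : Adapted b w H F') {j : ℕ} (hj : j + 1 < n)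
    (hw : w.symm ⟨j, Nat.lt_of_succ_lt hj⟩ < w.symm ⟨j + 1, hj⟩) (hF : Fadj j F H) (hne : F ≠ H)
    (I : Set (Fin n)) (hI : (⟨j + 1, hj⟩ : Fin n) ∈ I → (⟨j, Nat.lt_of_succ_lt hj⟩ : Fin n) ∈ I) :
    ∃ b' : Basis (Fin n) k V, Adapted b' (sref j hj * w) F F' ∧
      bspan b' (sref j hj ⁻¹' I) = bspan b I := by
  have hV : finrank k V = n := by simpa using finrank_eq_card_basis b
  set l : Fin n := ⟨j, Nat.lt_of_succ_lt hj⟩ with hl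
  set r : Fin n := ⟨j + 1, hj⟩ with hr
  have hlr : l ≠ r := by simp [hl, hr]
  have hnle : ¬ sub F (j + 1) ≤ sub H (j + 1) := fun hle => hne (hF.eq
    (eq_of_le_of_finrank_eq hle (by rw [finrank_sub hV, finrank_sub hV])))
  obtain ⟨u, huF, huH⟩ := SetLike.not_le_iff_exists.1 hnle
  have hu2 : u ∈ bspan b {a | a.val < j + 2} := by
    rw [← h.sub_left, ← hF (j + 2) (by omega)]
    exact sub_mono F (Nat.le_succ _) huF
  rw [h.sub_left] at huH
  have hur : b.repr u r ≠ 0 := by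
    intro h0
    refine huH (mem_bspan.2 fun i hi => ?_)
    have h1 : i.val < j + 2 := mem_bspan.1 hu2 i hi
    refine lt_of_le_of_ne (Nat.lt_succ_iff.1 h1) fun h2 => ?_
    obtain rfl : i = r := Fin.ext h2
    exact hi h0
  let u' : V := b.repr u r • b r + b.repr u l • b l
  have hu'r : ∀ i, b.repr u' i = (if i = r then b.repr u r else 0) +
      if i = l then b.repr u l else 0 := by
    intro i
    simp [u', Finsupp.single_apply, eq_comm]
  -- The discarded part of u lies in the j-dimensional member, which F and H share.
  have hu'F : u' ∈ sub F (j + 1) := by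
    have h1 : u - u' ∈ sub F j := by
      rw [hF j (by omega), h.sub_left, mem_bspan]
      intro i hi
      rw [map_sub, Finsupp.sub_apply, hu'r] at hi
      by_contra h2
      have h2' : j ≤ i.val := not_lt.1 h2
      have h3 : b.repr u i ≠ 0 → i.val < j + 2 := fun h => mem_bspan.1 hu2 i h
      by_cases h4 : i = r
      · subst h4; simp [hlr.symm] at hi
      · by_cases h5 : i = l
        · subst h5; simp [hlr] at hi
        · have h6 : i.val ≠ j := fun h => h5 (Fin.ext h)
          have h7 : i.val ≠ j + 1 := fun h => h4 (Fin.ext h)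
          have h8 : b.repr u i = 0 := by by_contra h; have := h3 h; omega
          simp [h4, h5, h8] at hi
    have h2 := Submodule.sub_mem _ huF (sub_mono F (Nat.le_succ j) h1)
    rwa [sub_sub_cancel] at h2
  obtain ⟨B, hB, hBad⟩ := h.tri (Function.update (⇑b) r u') (by
    intro i a ha
    by_cases hi : i = r
    · subst hi
      rw [Function.update_self, hu'r] at ha
      by_cases h1 : a = r
      · rw [h1]; exact wle_refl w r
      · by_cases h2 : a = l
        · rw [h2]
          exact ⟨Fin.le_def.2 (Nat.le_succ j), hw.le⟩
        · simp [h1, h2] at ha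
    · rw [Function.update_of_ne hi, Basis.repr_self, Finsupp.single_apply] at ha
      by_cases h1 : i = a
      · rw [h1]; exact wle_refl w a
      · simp [h1] at ha) (by
    intro i
    by_cases hi : i = r
    · subst hi
      rw [Function.update_self, hu'r]
      simpa [hlr.symm] using hur
    · rw [Function.update_of_ne hi]; simp)
  have hs := hBad.swap j hj
  have hpre : ∀ A : Set (Fin n), bspan (B.reindex (sref j hj)) (sref j hj ⁻¹' A) = bspan B A := by
    intro A
    rw [bspan_reindex, ← Set.preimage_comp]
    congr 2
    ext a
    simp [sref_apply_apply]
  refine ⟨B.reindex (sref j hj), ?_, ?_⟩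
  · apply adapted_of_sub _ (hs.1.sub_right)
    intro m
    by_cases hm : m = j + 1
    · subst hm
      symm
      apply eq_of_le_of_finrank_eq
      · rw [bspan, span_le]
        rintro _ ⟨a, ha, rfl⟩
        have ha' : a.val < j + 1 := ha
        by_cases h1 : a = l
        · subst h1
          rw [Basis.reindex_apply, sref_symm, sref_left, hB, ← hr, Function.update_self]
          exact hu'F
        · have h2 : a.val ≠ j := fun h => h1 (Fin.ext h)
          rw [Basis.reindex_apply, sref_symm, sref_of_ne j hj h2 (by omega), hB,
            Function.update_of_ne (by intro h; rw [h] at ha'; simp [hr] at ha')]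
          refine sub_mono F (Nat.le_succ j) ?_
          rw [hF j (by omega), h.sub_left]
          exact subset_span ⟨a, (show a.val < j by omega), rfl⟩
      · rw [finrank_bspan, ncard_val_lt, finrank_sub hV]
    · rw [hF m hm, ← hs.1.sub_left, hs.2.1 m hm]
  · rw [hpre]
    apply eq_of_le_of_finrank_eq
    · rw [bspan, span_le]
      rintro _ ⟨a, ha, rfl⟩
      by_cases h1 : a = r
      · subst h1
        rw [hB, Function.update_self]
        exact add_mem (smul_mem _ _ (subset_span ⟨_, ha, rfl⟩))
          (smul_mem _ _ (subset_span ⟨_, hI ha, rfl⟩))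
      · rw [hB, Function.update_of_ne h1]
        exact subset_span ⟨_, ha, rfl⟩
    · rw [finrank_bspan, finrank_bspan]

end Adjacent

/-! ## Averages over subspaces and counting adjacent flags -/

section Average

open Module Submodule

variable {V : Type} [Fintype V]

open Classical in
/-- The sum of the elements of the group algebra that satisfy a predicate. -/
def chi (P : V → Prop) : AddMonoidAlgebra ℂ V :=
  ∑ v, if P v then AddMonoidAlgebra.single v 1 else 0

open Classical in
theorem coeff_chi (P : V → Prop) (v : V) : (chi P).coeff v = if P v then 1 else 0 := by
  rw [chi, AddMonoidAlgebra.coeff_sum, Finsupp.finsetSum_apply, Finset.sum_eq_single v]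
  · split_ifs <;> simp
  · intro u _ hu
    split_ifs <;> simp [hu]
  · simp

theorem chi_congr {P Q : V → Prop} (h : ∀ v, P v ↔ Q v) : chi P = chi Q := by
  rw [show P = Q from funext fun v => propext (h v)]

theorem chi_false : chi (fun _ : V => False) = 0 := by simp [chi]

theorem chi_zero [AddCommGroup V] : chi (fun v : V => v = 0) = 1 := by
  classical
  ext v
  rw [coeff_chi, AddMonoidAlgebra.one_def, AddMonoidAlgebra.coeff_single, Finsupp.single_apply]
  simp [eq_comm]

variable {k : Type} [Field k] [AddCommGroup V] [Module k V]

/-- The average of the elements of a subspace in the group algebra. -/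
def avg (U : Submodule k V) : AddMonoidAlgebra ℂ V := (Nat.card U : ℂ)⁻¹ • chi (· ∈ U)

theorem card_sub_ne_zero (U : Submodule k V) : (Nat.card U : ℂ) ≠ 0 :=
  Nat.cast_ne_zero.2 Nat.card_pos.ne'

open Classical in
theorem coeff_avg (U : Submodule k V) (v : V) :
    (avg U).coeff v = if v ∈ U then (Nat.card U : ℂ)⁻¹ else 0 := by
  rw [avg, AddMonoidAlgebra.coeff_smul, Finsupp.smul_apply, coeff_chi]
  split_ifs <;> simp

theorem avg_bot : avg (⊥ : Submodule k V) = 1 := by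
  rw [avg, show (chi (· ∈ (⊥ : Submodule k V)) : AddMonoidAlgebra ℂ V) = 1 from
    (chi_congr fun v => mem_bot k).trans chi_zero]
  simp

theorem single_mul_avg {U : Submodule k V} {u : V} (hu : u ∈ U) :
    AddMonoidAlgebra.single u (1 : ℂ) * avg U = avg U := by
  classical
  rw [avg, mul_smul_comm]
  congr 1
  rw [chi, Finset.mul_sum]
  refine Fintype.sum_equiv (Equiv.addLeft u) _ _ fun v => ?_
  have : v ∈ U ↔ u + v ∈ U := (U.add_mem_iff_right hu).symm
  by_cases h : v ∈ U
  · rw [if_pos h, AddMonoidAlgebra.single_mul_single, Equiv.coe_addLeft, if_pos (this.1 h), one_mul]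
  · rw [if_neg h, Equiv.coe_addLeft, if_neg (fun h' => h (this.2 h')), mul_zero]

theorem avg_mul_of_invariant {U : Submodule k V} {a : AddMonoidAlgebra ℂ V}
    (h : ∀ u ∈ U, AddMonoidAlgebra.single u (1 : ℂ) * a = a) : avg U * a = a := by
  classical
  have h1 : chi (· ∈ U) * a = (Nat.card U : ℂ) • a := by
    rw [chi, Finset.sum_mul]
    have : ∀ v ∈ Finset.univ, (if v ∈ U then AddMonoidAlgebra.single v (1 : ℂ) else 0) * a =
        if v ∈ U then a else 0 := by
      intro v _
      split_ifs with hv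
      · exact h v hv
      · exact zero_mul a
    rw [Finset.sum_congr rfl this, ← Finset.sum_filter, Finset.sum_const, ← Nat.cast_smul_eq_nsmul ℂ]
    congr 2
    rw [Nat.card_eq_fintype_card, Fintype.card_subtype]
  rw [avg, smul_mul_assoc, h1, smul_smul, inv_mul_cancel₀ (card_sub_ne_zero U), one_smul]

/-- The product is invariant under translation by U + W, so multiplying it by the average over U + W
changes nothing. That average in turn absorbs the averages over U and W. -/
theorem avg_mul_avg (U W : Submodule k V) : avg U * avg W = avg (U ⊔ W) := by
  have h1 : avg (U ⊔ W) * (avg U * avg W) = avg U * avg W := by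
    refine avg_mul_of_invariant fun x hx => ?_
    obtain ⟨u, hu, w, hw, rfl⟩ := mem_sup.1 hx
    rw [← one_mul (1 : ℂ), ← AddMonoidAlgebra.single_mul_single, mul_mul_mul_comm, single_mul_avg hu,
      single_mul_avg hw]
  have h2 : ∀ X : Submodule k V, X ≤ U ⊔ W → avg X * avg (U ⊔ W) = avg (U ⊔ W) :=
    fun X hX => avg_mul_of_invariant fun u hu => single_mul_avg (hX hu)
  rw [← h1, mul_comm, mul_assoc, h2 W le_sup_right, h2 U le_sup_left]

end Average

section Count

open Module Submodule

variable {n : ℕ} {k V : Type} [Field k] [AddCommGroup V] [Module k V]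
  [Fintype V] (hV : finrank k V = n)
include hV

theorem exists_adj (F : Flag (Submodule k V)) {j : ℕ} (hj : j + 1 < n) {U : Submodule k V}
    (h1 : sub F j ≤ U) (h2 : U ≤ sub F (j + 2)) (hU : finrank k U = j + 1) :
    ∃ H, Fadj j F H ∧ sub H (j + 1) = U := by
  obtain ⟨H, hH⟩ := exists_flag_of_chain hV (Function.update (sub F) (j + 1) U) (by
    intro a b hab
    by_cases ha : a = j + 1
    · by_cases hb : b = j + 1
      · rw [ha, hb]
      · rw [ha, Function.update_self, Function.update_of_ne hb]
        exact h2.trans (sub_mono F (by omega))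
    · rw [Function.update_of_ne ha]
      by_cases hb : b = j + 1
      · rw [hb, Function.update_self]
        exact (sub_mono F (by omega)).trans h1
      · rw [Function.update_of_ne hb]
        exact sub_mono F hab) (by
    intro i
    by_cases hi : i = j + 1
    · rw [hi, Function.update_self, hU]; omega
    · rw [Function.update_of_ne hi, finrank_sub hV])
  refine ⟨H, fun i hi => ?_, ?_⟩
  · rw [hH, Function.update_of_ne hi]
  · rw [hH, Function.update_self]

theorem card_sub (F : Flag (Submodule k V)) {i : ℕ} (hi : i ≤ n) :
    Nat.card (sub F i) = Nat.card k ^ i := by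
  rw [Module.natCard_eq_pow_finrank (K := k), finrank_sub hV, min_eq_left hi]

/-- The member of dimension j+1 of such a flag has to be the span of the j-dimensional member and v.
-/
theorem existsUnique_adj_mem (F : Flag (Submodule k V)) {j : ℕ} (hj : j + 1 < n) {v : V}
    (h1 : v ∉ sub F j) (h2 : v ∈ sub F (j + 2)) :
    ∃! H, Fadj j F H ∧ v ∈ sub H (j + 1) := by
  have hlt : sub F j < sub F j ⊔ span k {v} :=
    left_lt_sup.2 fun h => h1 (h (mem_span_singleton_self v))
  have hle : finrank k ↥(sub F j ⊔ span k {v}) ≤ j + 1 := by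
    have h3 := finrank_add_le_finrank_add_finrank (sub F j) (span k {v})
    have h4 : finrank k (span k {v}) ≤ 1 := finrank_span_le_card (R := k) {v}
    rw [finrank_sub hV] at h3
    omega
  have hr : finrank k ↥(sub F j ⊔ span k {v}) = j + 1 := by
    have h3 := finrank_lt_finrank_of_lt hlt
    rw [finrank_sub hV] at h3
    omega
  obtain ⟨H, hH, hU⟩ := exists_adj hV F hj le_sup_left
    (sup_le (sub_mono F (by omega)) ((span_singleton_le_iff_mem _ _).2 h2)) hr
  refine ⟨H, ⟨hH, ?_⟩, ?_⟩
  · rw [hU]; exact le_sup_right (a := sub F j) (mem_span_singleton_self v)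
  · rintro G ⟨hG, hv⟩
    refine (hG.symm.trans hH).eq ?_
    rw [hU]
    symm
    apply eq_of_le_of_finrank_eq
    · refine sup_le ?_ ((span_singleton_le_iff_mem _ _).2 hv)
      rw [hG j (by omega)]; exact sub_mono G (by omega)
    · rw [hr, finrank_sub hV]; omega

open Classical in
/-- There are `q + 1` flags that agree with a given one except in one dimension. -/
theorem card_adj [Finite k] [Fintype (Flag (Submodule k V))] (F : Flag (Submodule k V)) {j : ℕ}
    (hj : j + 1 < n) : (Finset.univ.filter fun H => Fadj j F H).card = Nat.card k + 1 := by
  set N := (Finset.univ.filter fun H => Fadj j F H).card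
  have hcard : ∀ U : Submodule k V, Nat.card U = (Finset.univ.filter fun v => v ∈ U).card := by
    intro U
    rw [Nat.card_eq_fintype_card, Fintype.card_subtype]
  have hd : ∀ U W : Submodule k V, U ≤ W →
      (Finset.univ.filter fun v => v ∈ W ∧ v ∉ U).card = Nat.card W - Nat.card U := by
    intro U W hUW
    rw [hcard, hcard, ← Finset.card_sdiff_of_subset]
    · congr 1
      ext v
      simp
    · intro v
      simp only [Finset.mem_filter, Finset.mem_univ, true_and]
      exact fun h => hUW h
  -- Double count of the pairs (H, v) with v in the (j+1)-dimensional member of H and outside the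
  -- j-dimensional member of F.
  have e1 : ∑ H ∈ Finset.univ.filter (fun H => Fadj j F H),
      (Finset.univ.filter fun v => v ∈ sub H (j + 1) ∧ v ∉ sub F j).card =
      N * (Nat.card k ^ (j + 1) - Nat.card k ^ j) := by
    rw [Finset.sum_const_nat (m := Nat.card k ^ (j + 1) - Nat.card k ^ j)]
    intro H hH
    rw [Finset.mem_filter] at hH
    rw [hd, card_sub hV _ (by omega), card_sub hV _ (by omega)]
    rw [hH.2 j (by omega)]; exact sub_mono H (by omega)
  have e2 : ∑ H ∈ Finset.univ.filter (fun H => Fadj j F H),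
      (Finset.univ.filter fun v => v ∈ sub H (j + 1) ∧ v ∉ sub F j).card =
      Nat.card k ^ (j + 2) - Nat.card k ^ j := by
    rw [← card_sub hV F (show j + 2 ≤ n by omega), ← card_sub hV F (show j ≤ n by omega),
      ← hd _ _ (sub_mono F (by omega))]
    simp only [Finset.card_filter]
    rw [Finset.sum_comm]
    refine Finset.sum_congr rfl fun v _ => ?_
    rw [← Finset.card_filter, Finset.filter_filter]
    split_ifs with h
    · obtain ⟨H, hH, hu⟩ := existsUnique_adj_mem hV F hj h.2 h.1
      rw [Finset.card_eq_one]
      refine ⟨H, Finset.ext fun G => ?_⟩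
      simp only [Finset.mem_filter, Finset.mem_univ, true_and, Finset.mem_singleton]
      constructor
      · rintro ⟨h3, h4⟩; exact hu G ⟨h3, h4.1⟩
      · rintro rfl; exact ⟨hH.1, hH.2, h.2⟩
    · rw [Finset.card_eq_zero]
      refine Finset.filter_eq_empty_iff.2 fun H _ hH => h ⟨?_, hH.2.2⟩
      rw [hH.1 (j + 2) (by omega)]
      exact sub_mono H (by omega) hH.2.1
  rw [e1] at e2
  have hq : 2 ≤ Nat.card k := by
    have := Finite.one_lt_card (α := k)
    omega
  generalize Nat.card k = q at *
  have h3 : N * (q ^ j * (q - 1)) = (q + 1) * (q ^ j * (q - 1)) := by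
    obtain ⟨p, rfl⟩ : ∃ p, q = p + 1 := ⟨q - 1, by omega⟩
    have e3 : (p + 1) ^ (j + 1) - (p + 1) ^ j = (p + 1) ^ j * p := by
      rw [pow_succ, Nat.mul_succ, Nat.add_sub_cancel]
    have e4 : (p + 1) ^ (j + 2) - (p + 1) ^ j = (p + 1 + 1) * ((p + 1) ^ j * p) := by
      apply Nat.sub_eq_of_eq_add
      ring
    rw [e3, e4] at e2
    simpa using e2
  exact Nat.eq_of_mul_eq_mul_right (Nat.mul_pos (pow_pos (by omega) _) (by omega)) h3

-- Compare coefficients at a vector: it lies in all q+1 of the adjacent members, in exactly one of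
-- them, or in none, according to whether it lies in the j-dimensional member of F, only in the
-- (j+2)-dimensional one, or in neither. This is the relation `TeT` in disguise.
open Classical in
theorem sum_avg_adj [Finite k] [Fintype (Flag (Submodule k V))] (F : Flag (Submodule k V)) {j : ℕ}
    (hj : j + 1 < n) : ∑ H ∈ Finset.univ.filter (fun H => Fadj j F H), avg (sub H (j + 1)) =
      (Nat.card k : ℂ) • avg (sub F (j + 2)) + avg (sub F j) := by
  have hq : (Nat.card k : ℂ) ≠ 0 := Nat.cast_ne_zero.2 Nat.card_pos.ne'
  ext v
  have e0 : ∀ H : Flag (Submodule k V), (avg (sub H (j + 1))).coeff v =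
      ((Nat.card k : ℂ) ^ (j + 1))⁻¹ * (if v ∈ sub H (j + 1) then 1 else 0) := by
    intro H
    rw [coeff_avg, card_sub hV _ (by omega)]
    push_cast
    split_ifs <;> simp
  rw [AddMonoidAlgebra.coeff_sum, Finsupp.finsetSum_apply]
  simp only [e0]
  rw [← Finset.mul_sum, Finset.sum_boole, Finset.filter_filter, AddMonoidAlgebra.coeff_add,
    Finsupp.add_apply, AddMonoidAlgebra.coeff_smul, Finsupp.smul_apply, coeff_avg, coeff_avg,
    card_sub hV _ (by omega), card_sub hV _ (by omega)]
  push_cast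
  by_cases h1 : v ∈ sub F j
  · have : (Finset.univ.filter fun H => Fadj j F H ∧ v ∈ sub H (j + 1)) =
        Finset.univ.filter fun H => Fadj j F H := by
      ext H
      simp only [Finset.mem_filter, Finset.mem_univ, true_and, and_iff_left_iff_imp]
      intro hH
      rw [hH j (by omega)] at h1
      exact sub_mono H (by omega) h1
    rw [this, card_adj hV F hj, if_pos h1, if_pos (sub_mono F (by omega) h1)]
    push_cast
    rw [smul_eq_mul]
    field_simp
    ring
  · rw [if_neg h1]
    by_cases h2 : v ∈ sub F (j + 2)
    · obtain ⟨H, hH, hu⟩ := existsUnique_adj_mem hV F hj h1 h2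
      have : (Finset.univ.filter fun H => Fadj j F H ∧ v ∈ sub H (j + 1)) = {H} := by
        ext G
        simp only [Finset.mem_filter, Finset.mem_univ, true_and, Finset.mem_singleton]
        exact ⟨fun h => hu G h, fun h => h ▸ hH⟩
      rw [this, if_pos h2, Finset.card_singleton, smul_eq_mul]
      push_cast
      field_simp
      ring
    · have : (Finset.univ.filter fun H => Fadj j F H ∧ v ∈ sub H (j + 1)) = ∅ := by
        refine Finset.filter_eq_empty_iff.2 fun H _ hH => h2 ?_
        rw [hH.1 (j + 2) (by omega)]
        exact sub_mono H (by omega) hH.2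
      rw [this, if_neg h2]
      simp

end Count

/-! ## The defining relations -/

/-- The defining relations of the mirabolic Hecke algebra of rank `n`: the generators `T j`,
`j + 1 < n`, satisfy the relations of the Hecke algebra, and `e k`, `k ≤ n`, is a decreasing chain
of idempotents. -/
structure Rel {K W : Type*} [CommRing K] [Ring W] [Algebra K W] (q : K) (n : ℕ) (T e : ℕ → W) :
    Prop where
  e_zero : e 0 = 1
  e_mul : ∀ i j, i ≤ j → j ≤ n → e i * e j = e j ∧ e j * e i = e j
  T_e : ∀ j k, j + 1 < n → k ≤ n → k ≠ j + 1 → T j * e k = e k * T j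
  T_sq : ∀ j, j + 1 < n → T j * T j = (q - 1) • T j + q • 1
  T_comm : ∀ i j, i + 1 < j → j + 1 < n → T i * T j = T j * T i
  braid : ∀ j, j + 2 < n → T j * T (j + 1) * T j = T (j + 1) * T j * T (j + 1)
  eTe : ∀ j, j + 1 < n → e (j + 1) * T j * e (j + 1) = e (j + 2) * T j
  TeT : ∀ j, j + 1 < n →
    (T j + 1) * e (j + 1) * (T j + 1) = (T j + 1) * (q • e (j + 2) + e j)

/-! ### The relations in the convolution algebra over a finite field -/

section Conv

open Module Submodule

variable {n : ℕ} {x : PrimePower}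

theorem finrank_Vq : finrank (Fq x) (Vq n x) = n := by simp

theorem card_Fq : (Nat.card (Fq x) : ℂ) = x.card := by
  rw [GaloisField.card _ _ (Nat.succ_ne_zero _), PrimePower.card]
  push_cast
  rfl

variable (n x)

open Classical in
/-- The characteristic function of the pairs of flags that agree except in dimension `j + 1`. -/
def convE (j : ℕ) : Conv n x := Matrix.of fun F H => if Fadj j F H then 1 else 0

/-- The operator `T_{j+1}` over a finite field. -/
def convT (j : ℕ) : Conv n x := convE n x j - 1

/-- The operator averaging over the `k`-dimensional member of a flag. -/
def convAvg (k : ℕ) : Conv n x := Matrix.diagonal fun F => avg (sub F k)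

variable {n x}

open Classical in
theorem convE_apply (j : ℕ) (F H : FlagVar n x) :
    convE n x j F H = if Fadj j F H then 1 else 0 := rfl

open Classical in
theorem convE_mul_apply (j : ℕ) (M : Conv n x) (F F' : FlagVar n x) :
    (convE n x j * M) F F' = ∑ H ∈ Finset.univ.filter (fun H => Fadj j F H), M H F' := by
  rw [Matrix.mul_apply, Finset.sum_filter]
  refine Finset.sum_congr rfl fun H _ => ?_
  rw [convE_apply]
  split_ifs <;> simp

open Classical in
theorem mul_convE_apply (j : ℕ) (M : Conv n x) (F F' : FlagVar n x) :
    (M * convE n x j) F F' = ∑ H ∈ Finset.univ.filter (fun H => Fadj j F' H), M F H := by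
  rw [Matrix.mul_apply, Finset.sum_filter]
  refine Finset.sum_congr rfl fun H _ => ?_
  rw [convE_apply]
  by_cases h : Fadj j H F'
  · rw [if_pos h, if_pos h.symm, mul_one]
  · rw [if_neg h, if_neg (fun h' => h h'.symm), mul_zero]

theorem convE_sq {j : ℕ} (hj : j + 1 < n) :
    convE n x j * convE n x j = (x.card + 1) • convE n x j := by
  classical
  ext1 F F'
  rw [convE_mul_apply, Matrix.smul_apply, convE_apply]
  by_cases h : Fadj j F F'
  · rw [if_pos h, Finset.sum_congr rfl (g := fun _ => 1), Finset.sum_const, card_adj finrank_Vq F hj,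
      ← Nat.cast_smul_eq_nsmul ℂ]
    · push_cast
      rw [card_Fq]
    · intro H hH
      rw [Finset.mem_filter] at hH
      rw [convE_apply, if_pos (hH.2.symm.trans h)]
  · rw [if_neg h, smul_zero]
    refine Finset.sum_eq_zero fun H hH => ?_
    rw [Finset.mem_filter] at hH
    rw [convE_apply, if_neg (fun h' => h (hH.2.trans h'))]

-- The flag in the middle of a gallery of type (i, j) is unique if it exists: its member of
-- dimension i+1 comes from F', all the others from F. So the product has only entries 0 and 1.
open Classical in
theorem convE_mul_convE_apply {i j : ℕ} (hij : i ≠ j) (F F' : FlagVar n x) :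
    (convE n x i * convE n x j) F F' = if ∃ H, Fadj i F H ∧ Fadj j H F' then 1 else 0 := by
  rw [convE_mul_apply]
  simp only [convE_apply]
  rw [← Finset.sum_filter, Finset.filter_filter]
  split_ifs with h
  · obtain ⟨H, hH⟩ := h
    have : (Finset.univ.filter fun H => Fadj i F H ∧ Fadj j H F') = {H} := by
      ext G
      simp only [Finset.mem_filter, Finset.mem_univ, true_and, Finset.mem_singleton]
      refine ⟨fun hG => (hG.1.symm.trans hH.1).eq ?_, fun h => h ▸ hH⟩
      rw [hG.2 (i + 1) (by omega), hH.2 (i + 1) (by omega)]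
    rw [this, Finset.sum_singleton]
  · rw [Finset.filter_eq_empty_iff.2 fun H _ hH => h ⟨H, hH⟩, Finset.sum_empty]

theorem convE_comm {i j : ℕ} (hij : i + 1 < j) (hj : j + 1 < n) :
    convE n x i * convE n x j = convE n x j * convE n x i := by
  classical
  ext1 F F'
  rw [convE_mul_convE_apply (by omega), convE_mul_convE_apply (by omega)]
  refine if_congr ⟨?_, ?_⟩ rfl rfl
  · rintro ⟨H, h1, h2⟩
    obtain ⟨G, hG, hU⟩ := exists_adj finrank_Vq F hj (U := sub F' (j + 1))
      (by rw [h1 j (by omega), h2 j (by omega)]; exact sub_mono F' (by omega))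
      (by rw [h1 (j + 2) (by omega), h2 (j + 2) (by omega)]; exact sub_mono F' (by omega))
      (by rw [finrank_sub finrank_Vq]; omega)
    refine ⟨G, hG, fun m hm => ?_⟩
    by_cases hm' : m = j + 1
    · rw [hm', hU]
    · rw [← hG m hm', h1 m hm, h2 m hm']
  · rintro ⟨H, h1, h2⟩
    obtain ⟨G, hG, hU⟩ := exists_adj finrank_Vq F (show i + 1 < n by omega) (U := sub F' (i + 1))
      (by rw [h1 i (by omega), h2 i (by omega)]; exact sub_mono F' (by omega))
      (by rw [h1 (i + 2) (by omega), h2 (i + 2) (by omega)]; exact sub_mono F' (by omega))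
      (by rw [finrank_sub finrank_Vq]; omega)
    refine ⟨G, hG, fun m hm => ?_⟩
    by_cases hm' : m = i + 1
    · rw [hm', hU]
    · rw [← hG m hm', h1 m hm, h2 m hm']

open Classical in
/-- The number of galleries of type `(i, j, i)` is computed from the position of the flags. -/
theorem convE_mul_convE_mul_convE_apply {i j : ℕ} (hij : i ≠ j) (F F' : FlagVar n x) :
    (convE n x i * convE n x j * convE n x i) F F' =
      ((Finset.univ.filter fun H : FlagVar n x =>
        Fadj i F' H ∧ ∃ G, Fadj i F G ∧ Fadj j G H).card : ℂ) • 1 := by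
  rw [mul_convE_apply]
  simp only [convE_mul_convE_apply hij]
  rw [← Finset.sum_filter, Finset.filter_filter, Finset.sum_const, Nat.cast_smul_eq_nsmul]

open Classical in
/-- The characteristic function of the pairs of flags that agree except in dimensions
`j + 1` and `j + 2`. -/
def convJ (n : ℕ) (x : PrimePower) (j : ℕ) : Conv n x := Matrix.of fun F F' =>
  if ∀ m, m ≠ j + 1 → m ≠ j + 2 → sub F m = sub F' m then 1 else 0

/-- Between flags that agree outside two neighbouring dimensions there are q+1 galleries of type (i,
j, i) if they are adjacent in dimension i+1. Otherwise there is exactly one, because the member of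
dimension i+1 in the middle is forced to be the subspace U in `hex`. With l the smaller of i and j,
both sides of the braid relation acquire the same term `convJ`. -/
theorem convE_triple {i j l : ℕ} (hi : i + 1 < n) (hij : i ≠ j)
    (hl : (i = l ∧ j = l + 1) ∨ (i = l + 1 ∧ j = l))
    (hex : ∀ F F' : FlagVar n x, (∀ m, m ≠ l + 1 → m ≠ l + 2 → sub F m = sub F' m) →
      ¬ Fadj i F F' → ∃ U : Submodule (Fq x) (Vq n x), finrank (Fq x) U = i + 1 ∧
        sub F i ≤ U ∧ U ≤ sub F (i + 2) ∧ sub F' i ≤ U ∧ U ≤ sub F' (i + 2) ∧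
        ∀ G H : FlagVar n x, Fadj i F G → Fadj j G H → Fadj i F' H → sub H (i + 1) = U) :
    convE n x i * convE n x j * convE n x i = convJ n x l + x.card • convE n x i := by
  classical
  ext1 F F'
  rw [convE_mul_convE_mul_convE_apply hij, Matrix.add_apply, Matrix.smul_apply, convE_apply]
  change _ = (if _ then _ else _) + _
  by_cases hF : ∀ m, m ≠ l + 1 → m ≠ l + 2 → sub F m = sub F' m
  · rw [if_pos hF]
    by_cases h : Fadj i F F'
    · rw [if_pos h]
      have : (Finset.univ.filter fun H : FlagVar n x =>
          Fadj i F' H ∧ ∃ G, Fadj i F G ∧ Fadj j G H) =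
          Finset.univ.filter fun H => Fadj i F' H := by
        ext H
        simp only [Finset.mem_filter, Finset.mem_univ, true_and, and_iff_left_iff_imp]
        exact fun hH => ⟨H, h.trans hH, Fadj.refl j H⟩
      rw [this, card_adj finrank_Vq F' hi]
      push_cast
      rw [card_Fq, add_smul, one_smul, add_comm]
    · rw [if_neg h, smul_zero, add_zero]
      obtain ⟨U, hU, h1, h2, h3, h4, h5⟩ := hex F F' hF h
      obtain ⟨H, hH, hHU⟩ := exists_adj finrank_Vq F' hi h3 h4 hU
      obtain ⟨G, hG, hGU⟩ := exists_adj finrank_Vq F hi h1 h2 hU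
      have hGH : Fadj j G H := by
        intro m hm
        by_cases hm' : m = i + 1
        · rw [hm', hGU, hHU]
        · rw [← hG m hm', ← hH m hm', hF m (by omega) (by omega)]
      have : (Finset.univ.filter fun H : FlagVar n x =>
          Fadj i F' H ∧ ∃ G, Fadj i F G ∧ Fadj j G H) = {H} := by
        ext H'
        simp only [Finset.mem_filter, Finset.mem_univ, true_and, Finset.mem_singleton]
        constructor
        · rintro ⟨h6, G', h7, h8⟩
          exact (h6.symm.trans hH).eq (by rw [h5 G' H' h7 h8 h6, hHU])
        · rintro rfl
          exact ⟨hH, G, hG, hGH⟩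
      rw [this]
      simp
  · have h : ¬ Fadj i F F' := fun h => hF fun m h1 h2 => h m (by omega)
    rw [if_neg hF, if_neg h, Finset.filter_eq_empty_iff.2]
    · simp
    · rintro H - ⟨h1, G, h2, h3⟩
      refine hF fun m h4 h5 => ?_
      rw [h2 m (by omega), h3 m (by omega), h1 m (by omega)]

theorem finrank_sup_of_ne {k V : Type*} [Field k] [AddCommGroup V] [Module k V]
    [FiniteDimensional k V] {U U' L : Submodule k V} {d : ℕ} (hU : finrank k U = d + 1)
    (hU' : finrank k U' = d + 1) (hL : finrank k L = d) (h : L ≤ U) (h' : L ≤ U') (hne : U ≠ U') :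
    finrank k ↥(U ⊔ U') = d + 2 := by
  have h1 := Submodule.finrank_sup_add_finrank_inf_eq U U'
  have h2 : finrank k ↥(U ⊓ U') < finrank k U :=
    finrank_lt_finrank_of_lt (inf_lt_left.2 fun hle =>
      hne (eq_of_le_of_finrank_eq hle (by rw [hU, hU'])))
  have h3 := finrank_mono (le_inf h h')
  omega

theorem finrank_inf_of_ne {k V : Type*} [Field k] [AddCommGroup V] [Module k V]
    [FiniteDimensional k V] {U U' M : Submodule k V} {d : ℕ} (hU : finrank k U = d + 1)
    (hU' : finrank k U' = d + 1) (hM : finrank k M = d + 2) (h : U ≤ M) (h' : U' ≤ M)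
    (hne : U ≠ U') : finrank k ↥(U ⊓ U') = d := by
  have h1 := Submodule.finrank_sup_add_finrank_inf_eq U U'
  have h2 : finrank k U < finrank k ↥(U ⊔ U') :=
    finrank_lt_finrank_of_lt (left_lt_sup.2 fun hle =>
      hne (eq_of_le_of_finrank_eq hle (by rw [hU, hU'])).symm)
  have h3 := finrank_mono (sup_le h h')
  omega

/-- The forced subspace in the middle is the intersection of the (j+2)-dimensional members for
galleries of type (j, j+1, j), and the sum of the (j+1)-dimensional members for type (j+1, j, j+1).
-/
theorem convE_braid {j : ℕ} (hj : j + 2 < n) :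
    convE n x j * convE n x (j + 1) * convE n x j - x.card • convE n x j =
      convE n x (j + 1) * convE n x j * convE n x (j + 1) - x.card • convE n x (j + 1) := by
  have hne : ∀ F F' : FlagVar n x, ∀ i a, ¬ Fadj i F F' →
      (∀ m, m ≠ i + 1 → m ≠ a → sub F m = sub F' m) → sub F a ≠ sub F' a := by
    intro F F' i a h h' ha
    refine h fun m hm => ?_
    by_cases hma : m = a
    · rw [hma, ha]
    · exact h' m hm hma
  rw [convE_triple (l := j) (by omega) (by omega) (Or.inl ⟨rfl, rfl⟩),
    convE_triple (l := j) (by omega) (by omega) (Or.inr ⟨rfl, rfl⟩)]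
  · abel
  · intro F F' hF h
    have h0 := hne F F' (j + 1) (j + 1) h (fun m h1 h2 => hF m h2 h1)
    have e1 : sub F j = sub F' j := hF _ (by omega) (by omega)
    have e3 : sub F (j + 1 + 2) = sub F' (j + 1 + 2) := hF _ (by omega) (by omega)
    have h5 : finrank (Fq x) ↥(sub F (j + 1) ⊔ sub F' (j + 1)) = j + 1 + 1 :=
      finrank_sup_of_ne (d := j) (L := sub F j) (by rw [finrank_sub finrank_Vq]; omega)
        (by rw [finrank_sub finrank_Vq]; omega) (by rw [finrank_sub finrank_Vq]; omega)
        (sub_mono F (by omega)) (e1 ▸ sub_mono F' (by omega)) h0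
    refine ⟨sub F (j + 1) ⊔ sub F' (j + 1), h5, le_sup_left,
      sup_le (sub_mono F (by omega)) (e3 ▸ sub_mono F' (by omega)), le_sup_right,
      sup_le (e3 ▸ sub_mono F (by omega)) (sub_mono F' (by omega)), ?_⟩
    intro G H hG hGH hH
    symm
    apply eq_of_le_of_finrank_eq
    · refine sup_le ?_ ?_
      · rw [hG _ (by omega), ← hGH (j + 1 + 1) (by omega)]; exact sub_mono G (by omega)
      · rw [hH _ (by omega)]; exact sub_mono H (by omega)
    · rw [h5, finrank_sub finrank_Vq]; omega
  · intro F F' hF h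
    have h0 := hne F F' j (j + 2) h (fun m h1 h2 => hF m h1 h2)
    have e1 : sub F (j + 3) = sub F' (j + 3) := hF _ (by omega) (by omega)
    have e3 : sub F j = sub F' j := hF _ (by omega) (by omega)
    have h5 : finrank (Fq x) ↥(sub F (j + 2) ⊓ sub F' (j + 2)) = j + 1 :=
      finrank_inf_of_ne (d := j + 1) (M := sub F (j + 3)) (by rw [finrank_sub finrank_Vq]; omega)
        (by rw [finrank_sub finrank_Vq]; omega) (by rw [finrank_sub finrank_Vq]; omega)
        (sub_mono F (by omega)) (e1 ▸ sub_mono F' (by omega)) h0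
    refine ⟨sub F (j + 2) ⊓ sub F' (j + 2), h5,
      le_inf (sub_mono F (by omega)) (e3 ▸ sub_mono F' (by omega)), inf_le_left,
      le_inf (e3 ▸ sub_mono F (by omega)) (sub_mono F' (by omega)), inf_le_right, ?_⟩
    intro G H hG hGH hH
    apply eq_of_le_of_finrank_eq
    · refine le_inf ?_ ?_
      · rw [hG _ (by omega), ← hGH (j + 1) (by omega)]; exact sub_mono G (by omega)
      · rw [hH _ (by omega)]; exact sub_mono H (by omega)
    · rw [h5, finrank_sub finrank_Vq]; omega

theorem convAvg_mul_convE {j k : ℕ} (hk : k ≠ j + 1) :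
    convE n x j * convAvg n x k = convAvg n x k * convE n x j := by
  classical
  ext1 F F'
  rw [convAvg, Matrix.mul_diagonal, Matrix.diagonal_mul, convE_apply]
  split_ifs with h
  · rw [h k hk, one_mul, mul_one]
  · simp

theorem convRel (n : ℕ) (x : PrimePower) : Rel x.card n (convT n x) (convAvg n x) where
  e_zero := by
    rw [convAvg, ← Matrix.diagonal_one]
    congr 1
    ext1 F
    have : sub F 0 = ⊥ := finrank_eq_zero.1 (by rw [finrank_sub finrank_Vq]; simp)
    rw [this, avg_bot]
  e_mul i j hij hj := by
    simp only [convAvg, Matrix.diagonal_mul_diagonal, avg_mul_avg]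
    constructor
    · congr 1; ext1 F; rw [sup_eq_right.2 (sub_mono F hij)]
    · congr 1; ext1 F; rw [sup_eq_left.2 (sub_mono F hij)]
  T_e j k hj hk hjk := by
    rw [convT, sub_mul, mul_sub, convAvg_mul_convE hjk, one_mul, mul_one]
  T_sq j hj := by
    have h : convT n x j * convT n x j = convE n x j * convE n x j - (2 : ℂ) • convE n x j + 1 := by
      rw [convT, ofNat_smul_eq_nsmul]; noncomm_ring
    rw [h, convE_sq hj, convT]
    module
  T_comm i j hij hj := by
    have h := convE_comm (x := x) hij hj
    simp only [convT]
    rw [sub_mul, mul_sub, mul_sub, sub_mul, h]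
    noncomm_ring
  braid j hj := by
    have h := convE_braid (x := x) hj
    -- With T = E - 1 and E² = (q+1)E, the braid relation for T becomes the relation for E with the
    -- correction term -qE.
    have key : ∀ a b : Conv n x, a * a = (x.card + 1) • a → b * b = (x.card + 1) • b →
        a * b * a - x.card • a = b * a * b - x.card • b →
        (a - 1) * (b - 1) * (a - 1) = (b - 1) * (a - 1) * (b - 1) := by
      intro a b ha hb hab
      have e : ∀ a b : Conv n x, (a - 1) * (b - 1) * (a - 1) =
          a * b * a - a * b - b * a + b - a * a + 2 • a - 1 := by
        intro a b; noncomm_ring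
      rw [e, e, ha, hb]
      have h2 : a * b * a = b * a * b - x.card • b + x.card • a := by rw [← hab]; abel
      rw [h2]
      module
    exact key _ _ (convE_sq (by omega)) (convE_sq hj) h
  -- T has zero diagonal, and two different adjacent flags have (j+1)-dimensional members whose sum
  -- is the common (j+2)-dimensional member; so the product of the two averages is the average over
  -- the latter.
  eTe j hj := by
    ext1 F F'
    rw [convAvg, Matrix.mul_diagonal, Matrix.diagonal_mul, convAvg, Matrix.diagonal_mul, convT,
      Matrix.sub_apply, convE_apply]
    by_cases h : F = F'
    · rw [← h, if_pos (Fadj.refl j F), Matrix.one_apply_eq]; simp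
    · rw [Matrix.one_apply_ne h, sub_zero]
      split_ifs with h'
      · have hr : ∀ F : FlagVar n x, finrank (Fq x) (sub F (j + 1)) = j + 1 :=
          fun F => by rw [finrank_sub finrank_Vq]; omega
        have h2 : sub F (j + 1) < sub F (j + 1) ⊔ sub F' (j + 1) := left_lt_sup.2 fun hle =>
          h (h'.eq (eq_of_le_of_finrank_eq hle (by rw [hr, hr])).symm)
        have h3 := finrank_lt_finrank_of_lt h2
        rw [hr] at h3
        have h4 : sub F (j + 1) ⊔ sub F' (j + 1) = sub F (j + 2) := by
          apply eq_of_le_of_finrank_le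
          · refine sup_le (sub_mono F (by omega)) ?_
            rw [h' (j + 2) (by omega)]; exact sub_mono F' (by omega)
          · rw [finrank_sub finrank_Vq]; omega
        rw [mul_one, mul_one, avg_mul_avg, h4]
      · simp
  -- The entry at an adjacent pair is the sum of averages over the adjacent flags, computed in
  -- `sum_avg_adj`.
  TeT j hj := by
    classical
    rw [convT, sub_add_cancel]
    ext1 F F'
    rw [mul_convE_apply, Matrix.mul_add, Matrix.mul_smul, Matrix.add_apply, Matrix.smul_apply]
    simp only [convAvg, Matrix.mul_diagonal, convE_apply]
    by_cases h : Fadj j F F'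
    · rw [if_pos h, one_mul, one_mul, ← card_Fq, ← sum_avg_adj finrank_Vq F' hj]
      refine Finset.sum_congr rfl fun H hH => ?_
      rw [Finset.mem_filter] at hH
      rw [if_pos (h.trans hH.2), one_mul]
    · rw [if_neg h, zero_mul, zero_mul, smul_zero, add_zero]
      refine Finset.sum_eq_zero fun H hH => ?_
      rw [Finset.mem_filter] at hH
      rw [if_neg (fun h' => h (h'.trans hH.2.symm)), zero_mul]

end Conv

/-! ## Generation by the simple reflections and the averaging idempotents -/

section Families

open Module Submodule

variable {n : ℕ}

theorem specialize_T (x : PrimePower) (i : ℤ) :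
    specialize x (LaurentPolynomial.T i) = x.card ^ i := by
  rw [specialize, LaurentPolynomial.eval₂_T]
  simp

theorem family_smul_apply (c : ℂ[T;T⁻¹]) (f : ConvFamily n) (x : PrimePower) :
    (c • f) x = specialize x c • f x := by
  rw [Algebra.smul_def, Algebra.smul_def]
  rfl

theorem family_mul_apply (f g : ConvFamily n) (x : PrimePower) : (f * g) x = f x * g x := rfl

variable (n) in
/-- The family of the operators `T_{j+1}`. -/
def famT (j : ℕ) : ConvFamily n := fun x => convT n x j

variable (n) in
/-- The family of the averaging operators. -/
def famE (k : ℕ) : ConvFamily n := fun x => convAvg n x k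

theorem famRel (n : ℕ) :
    Rel (LaurentPolynomial.T 1 : ℂ[T;T⁻¹]) n (famT n) (famE n) where
  e_zero := funext fun x => (convRel n x).e_zero
  e_mul i j hij hj := ⟨funext fun x => ((convRel n x).e_mul i j hij hj).1,
    funext fun x => ((convRel n x).e_mul i j hij hj).2⟩
  T_e j k hj hk hjk := funext fun x => (convRel n x).T_e j k hj hk hjk
  T_sq j hj := funext fun x => by
    have h := (convRel n x).T_sq j hj
    have e : ((((LaurentPolynomial.T 1 : ℂ[T;T⁻¹]) - 1) • famT n j : ConvFamily n) x) =
        (x.card - 1) • convT n x j := by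
      rw [family_smul_apply, map_sub, specialize_T, map_one, zpow_one]; rfl
    have e2 : ((LaurentPolynomial.T 1 : ℂ[T;T⁻¹]) • (1 : ConvFamily n)) x =
        x.card • (1 : Conv n x) := by
      rw [family_smul_apply, specialize_T, zpow_one]; rfl
    rw [← e, ← e2] at h
    exact h
  T_comm i j hij hj := funext fun x => (convRel n x).T_comm i j hij hj
  braid j hj := funext fun x => (convRel n x).braid j hj
  eTe j hj := funext fun x => (convRel n x).eTe j hj
  TeT j hj := funext fun x => by
    have h := (convRel n x).TeT j hj
    have e2 : ((LaurentPolynomial.T 1 : ℂ[T;T⁻¹]) • famE n (j + 2)) x =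
        x.card • convAvg n x (j + 2) := by
      rw [family_smul_apply, specialize_T, zpow_one]; rfl
    rw [← e2] at h
    exact h

/-- The characteristic functions of the triples `(F, F', v)` for which `v` is in the span of the
vectors indexed by `I` in a basis adapted to the flags `(F, F')` in position `w`. -/
def famX (w : Equiv.Perm (Fin n)) (I : Set (Fin n)) : ConvFamily n := fun x F F' =>
  chi fun v => ∃ b : Basis (Fin n) (Fq x) (Vq n x), Adapted b w F F' ∧ v ∈ bspan b I

/-- Only the downward closure of β is an invariant of the orbit. In this form any adapted basis
serves, not just one in which v is a sum of basis vectors. -/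
theorem inOrbit_iff {x : PrimePower} {w : Equiv.Perm (Fin n)} {β : Finset (Fin n)}
    {F F' : FlagVar n x} {v : Vq n x} : InOrbit w β F F' v ↔
      ∃ b : Basis (Fin n) (Fq x) (Vq n x), Adapted b w F F' ∧
        down w (b.repr v).support = down w β := by
  constructor
  · rintro ⟨b, h1, h2, rfl⟩
    refine ⟨b, ⟨h1, h2⟩, ?_⟩
    congr 1
    ext i
    simp [Finsupp.finsetSum_apply, Finsupp.single_apply]
  · rintro ⟨b, h1, h2⟩
    obtain ⟨b', h3, h4⟩ := h1.exists_sum_eq v β h2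
    exact ⟨b', h3.1, h3.2, h4⟩

theorem orbitFamily_apply (w : Equiv.Perm (Fin n)) (β : Finset (Fin n)) (x : PrimePower)
    (F F' : FlagVar n x) : orbitFamily w β x F F' = chi (InOrbit w β F F') := rfl

theorem family_ext {f g : ConvFamily n} (h : ∀ x F F', f x F F' = g x F F') : f = g :=
  funext fun x => Matrix.ext fun F F' => h x F F'

theorem chi_and_const {V : Type} [Fintype V] (p : Prop) [Decidable p] (P : V → Prop) :
    chi (fun v => p ∧ P v) = if p then chi P else 0 := by
  split_ifs with h
  · exact chi_congr fun v => ⟨fun h' => h'.2, fun h' => ⟨h, h'⟩⟩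
  · rw [← chi_false]; exact chi_congr fun v => ⟨fun h' => h h'.1, False.elim⟩

open Classical in
theorem famX_empty_apply (w : Equiv.Perm (Fin n)) (x : PrimePower) (F F' : FlagVar n x) :
    famX w ∅ x F F' = if ∃ b : Basis (Fin n) (Fq x) (Vq n x), Adapted b w F F' then 1 else 0 := by
  rw [← chi_zero (V := Vq n x), ← chi_and_const]
  refine chi_congr fun v => ?_
  simp only [bspan, Set.image_empty, span_empty, mem_bot]
  exact ⟨fun ⟨b, h1, h2⟩ => ⟨⟨b, h1⟩, h2⟩, fun ⟨⟨b, h1⟩, h2⟩ => ⟨b, h1, h2⟩⟩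

theorem orbitFamily_empty (w : Equiv.Perm (Fin n)) : orbitFamily w ∅ = famX w ∅ := by
  refine family_ext fun x F F' => chi_congr fun v => ?_
  simp only [InOrbit, bspan, Set.image_empty, span_empty, mem_bot, Finset.sum_empty]
  exact ⟨fun ⟨b, h1, h2, h3⟩ => ⟨b, ⟨h1, h2⟩, h3⟩, fun ⟨b, ⟨h1, h2⟩, h3⟩ => ⟨b, h1, h2, h3⟩⟩

theorem adapted_one_self {x : PrimePower} (F : FlagVar n x) :
    ∃ b : Basis (Fin n) (Fq x) (Vq n x), Adapted b 1 F F := by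
  obtain ⟨b, hb⟩ := exists_basis_toFlag finrank_Vq F
  refine ⟨b, hb, ?_⟩
  rw [hb]
  congr 1
  ext1 i
  simp

theorem famX_one_empty : famX (n := n) 1 ∅ = 1 := by
  classical
  refine family_ext fun x F F' => ?_
  change _ = (1 : Conv n x) F F'
  rw [famX_empty_apply, Matrix.one_apply]
  refine if_congr ⟨?_, ?_⟩ rfl rfl
  · rintro ⟨b, h1, h2⟩
    rw [h1, h2]
    congr 1
    ext1 i
    simp
  · rintro rfl
    exact adapted_one_self F

open Classical in
theorem famT_mul_apply (j : ℕ) (f : ConvFamily n) (x : PrimePower) (F F' : FlagVar n x) :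
    (famT n j * f) x F F' =
      ∑ H ∈ Finset.univ.filter (fun H => Fadj j F H ∧ F ≠ H), f x H F' := by
  rw [family_mul_apply]
  change ((convE n x j - 1) * f x) F F' = _
  rw [sub_mul, one_mul, Matrix.sub_apply, convE_mul_apply,
    ← Finset.add_sum_erase (Finset.univ.filter fun H => Fadj j F H) _
      (Finset.mem_filter.2 ⟨Finset.mem_univ F, Fadj.refl j F⟩), add_sub_cancel_left]
  refine Finset.sum_congr (Finset.ext fun H => ?_) fun _ _ => rfl
  simp only [Finset.mem_erase, Finset.mem_filter, Finset.mem_univ, true_and]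
  tauto

/-- Multiplication by a simple reflection that increases the length. -/
theorem famT_mul_famX (w : Equiv.Perm (Fin n)) {j : ℕ} (hj : j + 1 < n)
    (hw : w.symm ⟨j + 1, hj⟩ < w.symm ⟨j, Nat.lt_of_succ_lt hj⟩) (I : Set (Fin n))
    (hI : (⟨j, Nat.lt_of_succ_lt hj⟩ : Fin n) ∈ I → (⟨j + 1, hj⟩ : Fin n) ∈ I) :
    famT n j * famX (sref j hj * w) (sref j hj ⁻¹' I) = famX w I := by
  classical
  have hsymm : ∀ a, (sref j hj * w).symm a = w.symm (sref j hj a) := fun a => by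
    rw [Equiv.Perm.mul_def, Equiv.symm_trans_apply, sref_symm]
  have hw' : (sref j hj * w).symm ⟨j, Nat.lt_of_succ_lt hj⟩ < (sref j hj * w).symm ⟨j + 1, hj⟩ := by
    rw [hsymm, hsymm, sref_left, sref_right]; exact hw
  have hmm : sref j hj * (sref j hj * w) = w := by rw [← mul_assoc, sref_mul_self, one_mul]
  refine family_ext fun x F F' => ?_
  rw [famT_mul_apply]
  ext v
  rw [AddMonoidAlgebra.coeff_sum, Finsupp.finsetSum_apply]
  simp only [famX, coeff_chi]
  rw [Finset.sum_boole, Finset.filter_filter]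
  split_ifs with h
  · obtain ⟨b, hb, hv⟩ := h
    obtain ⟨h1, h2, h3⟩ := hb.swap j hj
    -- For a triple in the longer position the intermediate flag is unique, by
    -- `Adapted.sub_eq_of_adj`, and it is found by exchanging two basis vectors. Hence the
    -- coefficient of the product is 1.
    have : (Finset.univ.filter fun H : FlagVar n x => (Fadj j F H ∧ F ≠ H) ∧
        ∃ b : Basis (Fin n) (Fq x) (Vq n x), Adapted b (sref j hj * w) H F' ∧
          v ∈ bspan b (sref j hj ⁻¹' I)) = {(b.reindex (sref j hj)).toFlag} := by
      ext H
      simp only [Finset.mem_filter, Finset.mem_univ, true_and, Finset.mem_singleton]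
      constructor
      · rintro ⟨⟨h4, -⟩, b', h5, -⟩
        refine (h4.symm.trans h2).eq ?_
        rw [h5.sub_eq_of_adj hj hw' h4, h1.sub_eq_of_adj hj hw' h2]
      · rintro rfl
        refine ⟨⟨h2, h3⟩, _, h1, ?_⟩
        rw [bspan_reindex, ← Set.preimage_comp]
        convert hv
        ext a
        simp [sref_apply_apply]
    rw [this]
    simp
  · rw [Finset.filter_eq_empty_iff.2]
    · simp
    · rintro H - ⟨⟨h1, h2⟩, b, h3, h4⟩
      obtain ⟨b', h5, h6⟩ := h3.of_adj hj hw' h1 h2 (sref j hj ⁻¹' I)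
        (by simpa [sref_left, sref_right] using hI)
      rw [hmm] at h5
      refine h ⟨b', h5, ?_⟩
      rw [← h6, ← Set.preimage_comp] at h4
      convert h4
      ext a
      simp [sref_apply_apply]

theorem famT_eq {j : ℕ} (hj : j + 1 < n) : famT n j = orbitFamily (sref j hj) ∅ := by
  rw [orbitFamily_empty, ← famT_mul_famX (sref j hj) hj, sref_mul_self, Set.preimage_empty,
    famX_one_empty, mul_one]
  · rw [sref_symm, sref_left, sref_right]; exact Fin.lt_def.2 (Nat.lt_succ_self j)
  · exact fun h => h.elim

/-- The span of the first k vectors of an adapted basis is the k-dimensional member of F, whatever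
the basis, so the conditions on the flags and on the vector separate. The power of q is the number
of vectors that the average divides by. -/
theorem famX_initial (w : Equiv.Perm (Fin n)) {k : ℕ} (hk : k ≤ n) :
    famX w {a | a.val < k} = (LaurentPolynomial.T k : ℂ[T;T⁻¹]) • (famE n k * famX w ∅) := by
  classical
  refine family_ext fun x F F' => ?_
  rw [family_smul_apply, family_mul_apply, Matrix.smul_apply]
  change _ = _ • (convAvg n x k * _) F F'
  rw [convAvg, Matrix.diagonal_mul, famX_empty_apply, specialize_T, zpow_natCast]
  have e : x.card ^ k • avg (sub F k) = chi (· ∈ sub F k) := by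
    rw [avg, card_sub finrank_Vq F hk, smul_smul]
    push_cast
    rw [card_Fq, mul_inv_cancel₀ (pow_ne_zero _ x.card_ne_zero), one_smul]
  rw [← smul_mul_assoc, e, mul_ite, mul_one, mul_zero, ← chi_and_const]
  refine chi_congr fun v => ⟨?_, ?_⟩
  · rintro ⟨b, h1, h2⟩
    refine ⟨⟨b, h1⟩, ?_⟩
    rw [h1.sub_left]; exact h2
  · rintro ⟨⟨b, h1⟩, h2⟩
    refine ⟨b, h1, ?_⟩
    rw [h1.sub_left] at h2; exact h2

theorem down_eq_self {w : Equiv.Perm (Fin n)} {I : Finset (Fin n)}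
    (h : IsDown w (I : Set (Fin n))) : down w I = I :=
  ((down_subset_iff h).2 subset_rfl).antisymm fun i hi => mem_down.2 ⟨i, hi, wle_refl w i⟩

theorem orbitFamily_down (w : Equiv.Perm (Fin n)) (β : Finset (Fin n)) :
    orbitFamily w (down w β) = orbitFamily w β := by
  refine family_ext fun x F F' => chi_congr fun v => ?_
  rw [inOrbit_iff, inOrbit_iff, down_eq_self (isDown_down w β)]

-- A vector lies in the span indexed by a downward closed I exactly if the downward closure of its
-- support is contained in I. The relation is unitriangular for inclusion, which allows orbit
-- functions to be recovered from the functions `famX`.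
open Classical in
theorem famX_eq_sum (w : Equiv.Perm (Fin n)) (I : Finset (Fin n))
    (hI : IsDown w (I : Set (Fin n))) :
    famX w I = ∑ J ∈ I.powerset.filter (fun J : Finset (Fin n) => IsDown w (J : Set (Fin n))),
      orbitFamily w J := by
  refine family_ext fun x F F' => ?_
  have e : ∀ s : Finset (Finset (Fin n)), (∑ J ∈ s, orbitFamily w J) x F F' =
      ∑ J ∈ s, orbitFamily w J x F F' := by
    intro s
    induction s using Finset.induction_on with
    | empty => simp; rfl
    | insert a s ha ih => rw [Finset.sum_insert ha, Finset.sum_insert ha, ← ih]; rfl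
  rw [e]
  ext v
  rw [AddMonoidAlgebra.coeff_sum, Finsupp.finsetSum_apply]
  simp only [orbitFamily_apply, famX, coeff_chi]
  rw [Finset.sum_boole, Finset.filter_filter]
  split_ifs with h
  · obtain ⟨b, hb, hv⟩ := h
    have : (I.powerset.filter fun J : Finset (Fin n) => IsDown w (J : Set (Fin n)) ∧ InOrbit w J F F' v) =
        {down w (b.repr v).support} := by
      ext J
      simp only [Finset.mem_filter, Finset.mem_powerset, Finset.mem_singleton]
      constructor
      · rintro ⟨-, h1, h2⟩
        obtain ⟨b', h3, h4⟩ := inOrbit_iff.1 h2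
        rw [hb.down_support h3, h4, down_eq_self h1]
      · rintro rfl
        refine ⟨(down_subset_iff hI).2 fun i hi => ?_, isDown_down _ _, inOrbit_iff.2 ⟨b, hb, ?_⟩⟩
        · exact mem_bspan.1 hv i (Finsupp.mem_support_iff.1 hi)
        · rw [down_eq_self (isDown_down _ _)]
    rw [this]
    simp
  · rw [Finset.filter_eq_empty_iff.2]
    · simp
    · rintro J hJ ⟨h1, h2⟩
      obtain ⟨b, h3, h4⟩ := inOrbit_iff.1 h2
      refine h ⟨b, h3, mem_bspan.2 fun i hi => ?_⟩
      apply Finset.mem_powerset.1 hJ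
      rw [← down_eq_self h1, ← h4]
      exact mem_down.2 ⟨i, Finsupp.mem_support_iff.2 hi, wle_refl w i⟩

theorem famX_mem (w : Equiv.Perm (Fin n)) (I : Finset (Fin n)) (hI : IsDown w (I : Set (Fin n))) :
    famX w I ∈ IntegralMirabolic n := by
  rw [famX_eq_sum w I hI]
  exact _root_.sum_mem fun J _ => Algebra.subset_adjoin ⟨w, J, rfl⟩

theorem famE_eq {k : ℕ} (hk : k ≤ n) :
    famE n k = (LaurentPolynomial.T (-k) : ℂ[T;T⁻¹]) • famX (n := n) 1 {a | a.val < k} := by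
  rw [famX_initial 1 hk, famX_one_empty, mul_one, smul_smul, ← LaurentPolynomial.T_add]
  simp

theorem famE_mem {k : ℕ} (hk : k ≤ n) : famE n k ∈ IntegralMirabolic n := by
  classical
  rw [famE_eq hk]
  refine Subalgebra.smul_mem _ ?_ _
  have : ({a | a.val < k} : Set (Fin n)) =
      ((Finset.univ.filter fun a : Fin n => a.val < k : Finset (Fin n)) : Set (Fin n)) := by
    ext; simp
  rw [this]
  refine famX_mem 1 _ fun i j hij hj => ?_
  rw [Finset.mem_coe, Finset.mem_filter] at hj ⊢
  exact ⟨Finset.mem_univ i, lt_of_le_of_lt (Fin.le_def.1 hij.1) hj.2⟩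

theorem famT_mem {j : ℕ} (hj : j + 1 < n) : famT n j ∈ IntegralMirabolic n := by
  rw [famT_eq hj]
  exact Algebra.subset_adjoin ⟨_, _, rfl⟩

end Families

/-! ### Generation of the orbit functions in two consecutive ranks at once -/

section Generation

variable {n : ℕ}

/-- The extension of a permutation by a fixed last letter. -/
abbrev extp (w : Equiv.Perm (Fin n)) : Equiv.Perm (Fin (n + 1)) :=
  w.viaEmbedding Fin.castSuccEmb

theorem extp_castSucc (w : Equiv.Perm (Fin n)) (a : Fin n) :
    extp w a.castSucc = (w a).castSucc := w.viaEmbedding_apply Fin.castSuccEmb a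

theorem extp_last (w : Equiv.Perm (Fin n)) : extp w (Fin.last n) = Fin.last n :=
  w.viaEmbedding_apply_of_notMem Fin.castSuccEmb _ (by
    rintro ⟨a, ha⟩; exact (Fin.castSucc_lt_last a).ne ha)

theorem extp_eq {w : Equiv.Perm (Fin n)} {u : Equiv.Perm (Fin (n + 1))}
    (h : ∀ a : Fin n, u a.castSucc = (w a).castSucc) (h' : u (Fin.last n) = Fin.last n) :
    extp w = u := by
  ext1 a
  induction a using Fin.lastCases with
  | last => rw [extp_last, h']
  | cast a => rw [extp_castSucc, h]

theorem extp_one : extp (1 : Equiv.Perm (Fin n)) = 1 := extp_eq (fun _ => rfl) rfl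

theorem extp_symm_castSucc (w : Equiv.Perm (Fin n)) (a : Fin n) :
    (extp w).symm a.castSucc = (w.symm a).castSucc := by
  rw [Equiv.symm_apply_eq, extp_castSucc, Equiv.apply_symm_apply]

theorem extp_sref_mul (w : Equiv.Perm (Fin n)) {j : ℕ} (hj : j + 1 < n) :
    extp (sref j hj * w) = sref j (Nat.lt_succ_of_lt hj) * extp w := by
  have h : ∀ a : Fin n, sref j (Nat.lt_succ_of_lt hj) a.castSucc = (sref j hj a).castSucc := by
    intro a
    by_cases h1 : a.val = j
    · obtain rfl : a = ⟨j, Nat.lt_of_succ_lt hj⟩ := Fin.ext h1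
      rw [sref_left]; exact sref_left j _
    · by_cases h2 : a.val = j + 1
      · obtain rfl : a = ⟨j + 1, hj⟩ := Fin.ext h2
        rw [sref_right]; exact sref_right j _
      · rw [sref_of_ne j hj h1 h2]
        exact sref_of_ne j _ (a := a.castSucc) h1 h2
  refine extp_eq (fun a => ?_) ?_
  · rw [Equiv.Perm.mul_apply, extp_castSucc, h, Equiv.Perm.mul_apply]
  · rw [Equiv.Perm.mul_apply, extp_last, sref_of_ne]
    · simp only [Fin.val_last]; omega
    · simp only [Fin.val_last]; omega

theorem image_preimage_sref {j : ℕ} (hj : j + 1 < n) (I : Set (Fin n)) :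
    Fin.castSucc '' (sref j hj ⁻¹' I) =
      sref j (Nat.lt_succ_of_lt hj) ⁻¹' (Fin.castSucc '' I) := by
  have h := extp_sref_mul 1 hj
  rw [mul_one, extp_one, mul_one] at h
  ext a
  rw [Set.mem_preimage, ← h]
  induction a using Fin.lastCases with
  | last =>
    rw [extp_last]
    simp [Fin.castSucc_ne_last]
  | cast a =>
    rw [extp_castSucc]
    simp

theorem isDown_extp {w : Equiv.Perm (Fin n)} {I : Set (Fin n)} :
    IsDown (extp w) (Fin.castSucc '' I) ↔ IsDown w I := by
  constructor
  · intro h i j hij hj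
    have := h i.castSucc j.castSucc ⟨hij.1, by
      rw [extp_symm_castSucc, extp_symm_castSucc]; exact hij.2⟩ ⟨j, hj, rfl⟩
    simpa using this
  · rintro h i _ hij ⟨j, hj, rfl⟩
    induction i using Fin.lastCases with
    | last => exact absurd hij.1 (not_le.2 (Fin.castSucc_lt_last j))
    | cast i =>
      refine ⟨i, h i j ⟨hij.1, ?_⟩ hj, rfl⟩
      have := hij.2
      rwa [extp_symm_castSucc, extp_symm_castSucc] at this

variable (n) in
/-- The subalgebra generated by the pairs of corresponding generators in ranks `n` and `n + 1`. -/
def genPair : Subalgebra ℂ[T;T⁻¹] (ConvFamily n × ConvFamily (n + 1)) :=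
  Algebra.adjoin ℂ[T;T⁻¹] ({p | ∃ j, j + 1 < n ∧ p = (famT n j, famT (n + 1) j)} ∪
    {p | ∃ k, k ≤ n ∧ p = (famE n k, famE (n + 1) k)})

theorem famT_genPair {j : ℕ} (hj : j + 1 < n) : (famT n j, famT (n + 1) j) ∈ genPair n :=
  Algebra.subset_adjoin (Or.inl ⟨j, hj, rfl⟩)

theorem famE_genPair {k : ℕ} (hk : k ≤ n) : (famE n k, famE (n + 1) k) ∈ genPair n :=
  Algebra.subset_adjoin (Or.inr ⟨k, hk, rfl⟩)

/-- A weighted count of the inversions of a permutation. -/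
def invWeight (w : Equiv.Perm (Fin n)) : ℕ := ∑ i : Fin n, (n - i.val) * (w.symm i).val

/-- The weights at j and j+1 differ by one, so putting two values in the right order lowers the sum
by their difference. -/
theorem invWeight_lt (w : Equiv.Perm (Fin n)) {j : ℕ} (hj : j + 1 < n)
    (hw : w.symm ⟨j + 1, hj⟩ < w.symm ⟨j, Nat.lt_of_succ_lt hj⟩) :
    invWeight (sref j hj * w) < invWeight w := by
  have hsymm : ∀ a, (sref j hj * w).symm a = w.symm (sref j hj a) := fun a => by
    rw [Equiv.Perm.mul_def, Equiv.symm_trans_apply, sref_symm]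
  set l : Fin n := ⟨j, Nat.lt_of_succ_lt hj⟩ with hl
  set r : Fin n := ⟨j + 1, hj⟩ with hr
  have hlr : r ∈ (Finset.univ : Finset (Fin n)).erase l :=
    Finset.mem_erase.2 ⟨by simp [hl, hr], Finset.mem_univ r⟩
  unfold invWeight
  rw [← Finset.add_sum_erase _ _ (Finset.mem_univ l), ← Finset.add_sum_erase _ _ hlr,
    ← Finset.add_sum_erase _ (fun i : Fin n => (n - i.val) * (w.symm i).val) (Finset.mem_univ l),
    ← Finset.add_sum_erase _ (fun i : Fin n => (n - i.val) * (w.symm i).val) hlr]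
  have e : ∀ i ∈ ((Finset.univ : Finset (Fin n)).erase l).erase r,
      (n - i.val) * ((sref j hj * w).symm i).val = (n - i.val) * (w.symm i).val := by
    intro i hi
    rw [Finset.mem_erase, Finset.mem_erase] at hi
    rw [hsymm, sref_of_ne j hj (fun h => hi.2.1 (Fin.ext h)) (fun h => hi.1 (Fin.ext h))]
  rw [Finset.sum_congr rfl e, hsymm, hsymm, hl, sref_left, hr, sref_right, ← hl, ← hr, ← add_assoc,
    ← add_assoc]
  refine Nat.add_lt_add_right ?_ _
  have hlt := Fin.lt_def.1 hw
  have h1 : l.val = j := rfl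
  have h2 : r.val = j + 1 := rfl
  rw [h1, h2]
  obtain ⟨d, hd⟩ : ∃ d, n - j = d + 1 := ⟨n - j - 1, by omega⟩
  have h3 : n - (j + 1) = d := by omega
  rw [hd, h3, Nat.succ_mul, Nat.succ_mul]
  omega

theorem eq_one_of_no_descent (w : Equiv.Perm (Fin n)) (h : ∀ (j : ℕ) (hj : j + 1 < n),
    w.symm ⟨j, Nat.lt_of_succ_lt hj⟩ < w.symm ⟨j + 1, hj⟩) : w = 1 := by
  cases n with
  | zero => exact Subsingleton.elim _ _
  | succ n =>
    have h1 : StrictMono w.symm := Fin.strictMono_iff_lt_succ.2 fun i => h i.val (by omega)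
    have h2 := (StrictMono.range_inj h1 strictMono_id).1 (by simp)
    have h3 : w.symm = Equiv.refl _ := Equiv.ext fun i => congrFun h2 i
    rw [← w.symm_symm, h3]
    rfl

theorem exists_initial (I : Set (Fin n))
    (h : ∀ (j : ℕ) (hj : j + 1 < n), (⟨j + 1, hj⟩ : Fin n) ∈ I →
      (⟨j, Nat.lt_of_succ_lt hj⟩ : Fin n) ∈ I) :
    ∃ k, k ≤ n ∧ I = {a | a.val < k} := by
  classical
  have hex : ∃ k, ∀ a ∈ I, a.val < k := ⟨n, fun a _ => a.2⟩
  have hk := Nat.find_spec hex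
  have hkn : Nat.find hex ≤ n := Nat.find_min' hex fun a _ => a.2
  refine ⟨Nat.find hex, hkn, Set.ext fun a => ⟨hk a, fun ha => ?_⟩⟩
  have ha' : a.val < Nat.find hex := ha
  have hdown : ∀ d (b : Fin n), b ∈ I → ∀ a : Fin n, a.val + d = b.val → a ∈ I := by
    intro d
    induction d with
    | zero => intro b hb a hab; rwa [show a = b from Fin.ext hab]
    | succ d ih =>
      intro b hb a hab
      have hlt : a.val + 1 < n := by have := b.2; omega
      exact h a.val hlt (ih b hb ⟨a.val + 1, hlt⟩ (by simp only; omega))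
  have hmin := Nat.find_min hex (show Nat.find hex - 1 < Nat.find hex by omega)
  push Not at hmin
  obtain ⟨b, hb, hb'⟩ := hmin
  exact hdown (b.val - a.val) b hb a (by omega)

/-- If I is an initial segment, `famX_initial` splits off an averaging operator and leaves the empty
set, for which descents lead down to the identity permutation. If I contains j+1 but not j, downward
closure forces a descent of w at j, and `famT_mul_famX` splits off a simple reflection. Treating
ranks n and n+1 together records that the standard inclusion respects the expressions in the
generators. -/
theorem famX_genPair (N : ℕ) : ∀ w : Equiv.Perm (Fin n), invWeight w < N → ∀ I : Set (Fin n),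
    IsDown w I → (famX w I, famX (extp w) (Fin.castSucc '' I)) ∈ genPair n := by
  induction N with
  | zero => intro w hw; omega
  | succ N ih =>
    have hstep : ∀ (w : Equiv.Perm (Fin n)), invWeight w < N + 1 → ∀ (j : ℕ) (hj : j + 1 < n),
        w.symm ⟨j + 1, hj⟩ < w.symm ⟨j, Nat.lt_of_succ_lt hj⟩ → ∀ (I : Set (Fin n)),
        IsDown w I → ((⟨j, Nat.lt_of_succ_lt hj⟩ : Fin n) ∈ I → (⟨j + 1, hj⟩ : Fin n) ∈ I) →
        (famX w I, famX (extp w) (Fin.castSucc '' I)) ∈ genPair n := by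
      intro w hwN j hj hw I hI hlr
      have hsymm : ∀ a, (sref j hj * w).symm a = w.symm (sref j hj a) := fun a => by
        rw [Equiv.Perm.mul_def, Equiv.symm_trans_apply, sref_symm]
      have h1 := famT_mul_famX w hj hw I hlr
      have h2 := famT_mul_famX (extp w) (Nat.lt_succ_of_lt hj) (by
          have e1 := extp_symm_castSucc w ⟨j + 1, hj⟩
          have e2 := extp_symm_castSucc w ⟨j, Nat.lt_of_succ_lt hj⟩
          rw [Fin.castSucc_mk] at e1 e2
          rw [e1, e2]
          exact hw) (Fin.castSucc '' I) (by
          rintro ⟨a, ha, ha'⟩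
          refine ⟨_, hlr ?_, rfl⟩
          rwa [show a = ⟨j, Nat.lt_of_succ_lt hj⟩ from
            Fin.ext (show a.val = j from congrArg (fun b : Fin (n + 1) => b.val) ha')] at ha)
      rw [← extp_sref_mul w hj, ← image_preimage_sref hj] at h2
      rw [← h1, ← h2, ← Prod.mk_mul_mk]
      -- It remains to see that the reflected set is downward closed for the shorter permutation.
      refine mul_mem (famT_genPair hj) (ih _ (by have := invWeight_lt w hj hw; omega) _ ?_)
      intro a b hab hb
      by_cases hbl : b.val = j
      · obtain rfl : b = ⟨j, Nat.lt_of_succ_lt hj⟩ := Fin.ext hbl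
        rw [Set.mem_preimage, sref_left] at hb
        have h3 := hab.1
        have h4 := hab.2
        rw [hsymm, hsymm, sref_left] at h4
        by_cases hal : a.val = j
        · obtain rfl : a = ⟨j, Nat.lt_of_succ_lt hj⟩ := Fin.ext hal
          rwa [Set.mem_preimage, sref_left]
        · have h5 : a.val < j := lt_of_le_of_ne (Fin.le_def.1 h3) hal
          rw [sref_of_ne j hj hal (by omega)] at h4
          rw [Set.mem_preimage, sref_of_ne j hj hal (by omega)]
          exact hI _ _ ⟨Fin.le_def.2 (by simp only; omega), h4⟩ hb
      · by_cases hbr : b.val = j + 1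
        · obtain rfl : b = ⟨j + 1, hj⟩ := Fin.ext hbr
          rw [Set.mem_preimage, sref_right] at hb
          have h3 := Fin.le_def.1 hab.1
          have h4 := hab.2
          rw [hsymm, hsymm, sref_right] at h4
          by_cases hal : a.val = j
          · obtain rfl : a = ⟨j, Nat.lt_of_succ_lt hj⟩ := Fin.ext hal
            rw [Set.mem_preimage, sref_left]; exact hlr hb
          · by_cases har : a.val = j + 1
            · obtain rfl : a = ⟨j + 1, hj⟩ := Fin.ext har
              rwa [Set.mem_preimage, sref_right]
            · rw [sref_of_ne j hj hal har] at h4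
              rw [Set.mem_preimage, sref_of_ne j hj hal har]
              simp only at h3
              exact hI _ _ ⟨Fin.le_def.2 (by simp only; omega), h4⟩ hb
        · rw [Set.mem_preimage, sref_of_ne j hj hbl hbr] at hb
          have h3 := Fin.le_def.1 hab.1
          have h4 := hab.2
          rw [hsymm, hsymm, sref_of_ne j hj hbl hbr] at h4
          rw [Set.mem_preimage]
          refine hI _ _ ⟨Fin.le_def.2 ?_, h4⟩ hb
          have h5 := sref_val_lt j hj (m := b.val + 1) (by omega) a
          omega
    have hempty : ∀ w : Equiv.Perm (Fin n), invWeight w < N + 1 →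
        (famX w ∅, famX (extp w) ∅) ∈ genPair n := by
      intro w hw
      by_cases h : ∃ (j : ℕ) (hj : j + 1 < n),
          w.symm ⟨j + 1, hj⟩ < w.symm ⟨j, Nat.lt_of_succ_lt hj⟩
      · obtain ⟨j, hj, h⟩ := h
        have := hstep w hw j hj h ∅ (fun _ _ _ h => h) (fun h => h.elim)
        rwa [Set.image_empty] at this
      · rw [eq_one_of_no_descent w fun j hj => ?_, extp_one, famX_one_empty, famX_one_empty]
        · exact one_mem _
        · push Not at h
          refine lt_of_le_of_ne (h j hj) fun h' => ?_
          have := w.symm.injective h'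
          simp at this
    intro w hw I hI
    by_cases h : ∀ (j : ℕ) (hj : j + 1 < n), (⟨j + 1, hj⟩ : Fin n) ∈ I →
      (⟨j, Nat.lt_of_succ_lt hj⟩ : Fin n) ∈ I
    · obtain ⟨k, hk, rfl⟩ := exists_initial I h
      have himg : Fin.castSucc '' {a : Fin n | a.val < k} = {a : Fin (n + 1) | a.val < k} := by
        ext a
        constructor
        · rintro ⟨b, hb, rfl⟩; exact hb
        · intro ha
          have ha' : a.val < k := ha
          exact ⟨⟨a.val, by omega⟩, ha', rfl⟩
      rw [himg, famX_initial w hk, famX_initial (extp w) (Nat.le_succ_of_le hk), ← Prod.smul_mk,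
        ← Prod.mk_mul_mk]
      exact Subalgebra.smul_mem _ (mul_mem (famE_genPair hk) (hempty w hw)) _
    · push Not at h
      obtain ⟨j, hj, hr, hl⟩ := h
      refine hstep w hw j hj ?_ I hI fun h => absurd h hl
      by_contra hle
      exact hl (hI _ _ ⟨Fin.le_def.2 (Nat.le_succ j), not_lt.1 hle⟩ hr)

/-- Inverts the unitriangular relation `famX_eq_sum` by recursion on a downward closed set. The
downward closed subsets in rank n+1 that occur are exactly the images of those in rank n, so the
recursions in both ranks run in parallel. -/
theorem orbit_genPair (w : Equiv.Perm (Fin n)) (β : Finset (Fin n)) :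
    (orbitFamily w β, orbitFamily (extp w) (β.map Fin.castSuccEmb)) ∈ genPair n := by
  classical
  have hmap : ∀ I : Finset (Fin n), ((I.map Fin.castSuccEmb : Finset (Fin (n + 1))) :
      Set (Fin (n + 1))) = Fin.castSucc '' (I : Set (Fin n)) := fun I => by
    rw [Finset.coe_map]; rfl
  have key : ∀ I : Finset (Fin n), IsDown w (I : Set (Fin n)) →
      (orbitFamily w I, orbitFamily (extp w) (I.map Fin.castSuccEmb)) ∈ genPair n := by
    intro I
    induction I using Finset.strongInduction with
    | H I ih =>
      intro hI
      have h0 := famX_genPair _ w (Nat.lt_succ_self _) I hI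
      have hI' : IsDown (extp w) ((I.map Fin.castSuccEmb : Finset (Fin (n + 1))) :
          Set (Fin (n + 1))) := by rw [hmap]; exact isDown_extp.2 hI
      rw [← hmap, famX_eq_sum w I hI, famX_eq_sum _ _ hI'] at h0
      have hmem : I ∈ I.powerset.filter (fun J : Finset (Fin n) => IsDown w (J : Set (Fin n))) :=
        Finset.mem_filter.2 ⟨Finset.mem_powerset_self I, hI⟩
      have hre : ((I.map Fin.castSuccEmb).powerset.filter
          (fun J : Finset (Fin (n + 1)) => IsDown (extp w) (J : Set (Fin (n + 1))))) =
          (I.powerset.filter (fun J : Finset (Fin n) => IsDown w (J : Set (Fin n)))).map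
            ⟨Finset.map Fin.castSuccEmb, Finset.map_injective _⟩ := by
        ext J
        simp only [Finset.mem_filter, Finset.mem_powerset, Finset.mem_map,
          Function.Embedding.coeFn_mk]
        constructor
        · rintro ⟨h1, h2⟩
          obtain ⟨J', hJ', rfl⟩ := Finset.subset_map_iff.1 h1
          rw [hmap, isDown_extp] at h2
          exact ⟨J', ⟨hJ', h2⟩, rfl⟩
        · rintro ⟨J', ⟨h1, h2⟩, rfl⟩
          refine ⟨Finset.map_subset_map.2 h1, ?_⟩
          rw [hmap, isDown_extp]
          exact h2
      rw [hre, Finset.sum_map, Function.Embedding.coeFn_mk, ← Finset.add_sum_erase _ _ hmem,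
        ← Finset.add_sum_erase _
          (fun J : Finset (Fin n) => orbitFamily (extp w) (J.map Fin.castSuccEmb)) hmem,
        ← Prod.mk_add_mk] at h0
      have h1 : (∑ J ∈ (I.powerset.filter
            (fun J : Finset (Fin n) => IsDown w (J : Set (Fin n)))).erase I, orbitFamily w J,
          ∑ J ∈ (I.powerset.filter
            (fun J : Finset (Fin n) => IsDown w (J : Set (Fin n)))).erase I,
            orbitFamily (extp w) (J.map Fin.castSuccEmb)) ∈ genPair n := by
        have hs : ∀ s : Finset (Finset (Fin n)), (∑ J ∈ s, orbitFamily w J,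
            ∑ J ∈ s, orbitFamily (extp w) (J.map Fin.castSuccEmb)) =
            ∑ J ∈ s, (orbitFamily w J, orbitFamily (extp w) (J.map Fin.castSuccEmb)) :=
          fun s => Prod.ext
            (by rw [Prod.fst_sum]) (by rw [Prod.snd_sum])
        rw [hs]
        refine sum_mem fun J hJ => ?_
        rw [Finset.mem_erase, Finset.mem_filter, Finset.mem_powerset] at hJ
        exact ih J (lt_of_le_of_ne hJ.2.1 hJ.1) hJ.2.2
      have h2 := sub_mem h0 h1
      rwa [add_sub_cancel_right] at h2
  -- An arbitrary β may be replaced by its downward closure, since both label the same orbit.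
  have h := key (down w β) (isDown_down w β)
  have hd : (down w β).map Fin.castSuccEmb = down (extp w) (β.map Fin.castSuccEmb) := by
    ext a
    rw [mem_down, Finset.mem_map]
    constructor
    · rintro ⟨i, hi, rfl⟩
      obtain ⟨j, hj, hij⟩ := mem_down.1 hi
      refine ⟨j.castSucc, Finset.mem_map_of_mem _ hj, hij.1, ?_⟩
      change (extp w).symm i.castSucc ≤ _
      rw [extp_symm_castSucc, extp_symm_castSucc]
      exact hij.2
    · rintro ⟨b, hb, hab⟩
      obtain ⟨j, hj, rfl⟩ := Finset.mem_map.1 hb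
      have hab1 : a ≤ j.castSucc := hab.1
      have hab2 : (extp w).symm a ≤ (extp w).symm j.castSucc := hab.2
      induction a using Fin.lastCases with
      | last => exact absurd hab1 (not_le.2 (Fin.castSucc_lt_last j))
      | cast i =>
        rw [extp_symm_castSucc, extp_symm_castSucc] at hab2
        exact ⟨i, mem_down.2 ⟨j, hj, hab1, hab2⟩, rfl⟩
  rwa [hd, orbitFamily_down, orbitFamily_down] at h

end Generation

/-! ## Moves on Maya diagrams -/

section Moves

/-- The vacuum. -/
def vac : Maya := ⟨Set.Iic 0, by simp, by simp⟩

/-- The particle at `i` can be moved one place up; the step `⊤` is always possible. -/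
def CanMove : WithTop ℤ → Maya → Prop
  | (i : ℤ), S => i ∈ S.1 ∧ i + 1 ∉ S.1
  | ⊤, _ => True

/-- Move the particle at `i` one place up; the step `⊤` does nothing. -/
def move : WithTop ℤ → Maya → Maya
  | (i : ℤ), S => (S.erase i).insert (i + 1)
  | ⊤, S => S

/-- Move the particle at `i + 1` one place down. -/
def unmove (i : ℤ) (S : Maya) : Maya := (S.erase (i + 1)).insert i

/-- Two steps that are independent of each other. -/
def Nadj : WithTop ℤ → WithTop ℤ → Prop
  | (i : ℤ), (j : ℤ) => i + 2 ≤ j ∨ j + 2 ≤ i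
  | (_ : ℤ), ⊤ => True
  | ⊤, (_ : ℤ) => True
  | ⊤, ⊤ => False

theorem canMove_coe {i : ℤ} {S : Maya} : CanMove i S ↔ i ∈ S.1 ∧ i + 1 ∉ S.1 := Iff.rfl

theorem canMove_top {S : Maya} : CanMove ⊤ S := trivial

theorem move_top (S : Maya) : move ⊤ S = S := rfl

theorem mem_move {i x : ℤ} {S : Maya} : x ∈ (move i S).1 ↔ x = i + 1 ∨ (x ∈ S.1 ∧ x ≠ i) := Iff.rfl

theorem mem_unmove {i x : ℤ} {S : Maya} :
    x ∈ (unmove i S).1 ↔ x = i ∨ (x ∈ S.1 ∧ x ≠ i + 1) := Iff.rfl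

theorem maya_ext {S S' : Maya} (h : ∀ x, x ∈ S.1 ↔ x ∈ S'.1) : S = S' :=
  Subtype.ext (Set.ext h)

theorem Nadj.ne {i j : WithTop ℤ} (h : Nadj i j) : i ≠ j := by
  rintro rfl
  induction i using WithTop.recTopCoe <;> simp only [Nadj] at h
  omega

theorem unmove_move {i : ℤ} {S : Maya} (h : CanMove i S) : unmove i (move i S) = S := by
  refine maya_ext fun x => ?_
  rw [canMove_coe] at h
  rw [mem_unmove, mem_move]
  grind

theorem move_unmove {i : ℤ} {S : Maya} (h : i + 1 ∈ S.1) (h' : i ∉ S.1) :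
    move i (unmove i S) = S := by
  refine maya_ext fun x => ?_
  rw [mem_move, mem_unmove]
  grind

theorem canMove_unmove {i : ℤ} {S : Maya} (h : i + 1 ∈ S.1) (h' : i ∉ S.1) :
    CanMove i (unmove i S) := by
  rw [canMove_coe, mem_unmove, mem_unmove]
  grind

theorem mem_move_of_canMove {i : ℤ} {S : Maya} (h : CanMove i S) :
    i + 1 ∈ (move i S).1 ∧ i ∉ (move i S).1 := by
  rw [canMove_coe] at h
  rw [mem_move, mem_move]
  grind

theorem move_injective {i : WithTop ℤ} {S S' : Maya} (h : CanMove i S) (h' : CanMove i S')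
    (e : move i S = move i S') : S = S' := by
  induction i using WithTop.recTopCoe with
  | top => exact e
  | coe i => rw [← unmove_move h, e, unmove_move h']

theorem Nadj.swap {i j : WithTop ℤ} {S : Maya} (h : Nadj i j) (hi : CanMove i S)
    (hj : CanMove j (move i S)) :
    CanMove j S ∧ CanMove i (move j S) ∧ move i (move j S) = move j (move i S) := by
  induction i using WithTop.recTopCoe with
  | top => exact ⟨hj, trivial, rfl⟩
  | coe i =>
    induction j using WithTop.recTopCoe with
    | top => exact ⟨trivial, hi, rfl⟩
    | coe j =>
      simp only [Nadj] at h
      rw [canMove_coe] at hi hj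
      rw [mem_move, mem_move] at hj
      refine ⟨?_, ?_, maya_ext fun x => ?_⟩
      · rw [canMove_coe]; grind
      · rw [canMove_coe, mem_move, mem_move]; grind
      · rw [mem_move, mem_move, mem_move, mem_move]; grind

/-- Two independent steps commute. -/
theorem Nadj.swap' {i j : WithTop ℤ} {S : Maya} (h : Nadj i j) (hi : CanMove i S)
    (hj : CanMove j S) :
    CanMove j (move i S) := by
  induction i using WithTop.recTopCoe with
  | top => exact hj
  | coe i =>
    induction j using WithTop.recTopCoe with
    | top => exact trivial
    | coe j =>
      simp only [Nadj] at h
      rw [canMove_coe] at hi hj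
      rw [canMove_coe, mem_move, mem_move]; grind

/-- The excess of a diagram at a place, weighted by the place. -/
def weightAt (S : Maya) (s : ℤ) : ℤ := by
  classical exact ((if s ∈ S.1 then 1 else 0) - (if s ≤ 0 then 1 else 0)) * s

theorem weightAt_support (S : Maya) : (Function.support (weightAt S)).Finite := by
  classical
  refine (S.2.1.union S.2.2).subset fun s hs => ?_
  rw [Function.mem_support, weightAt] at hs
  by_cases h1 : s ∈ S.1 <;> by_cases h2 : s ≤ 0
  · simp [h1, h2] at hs
  · exact Or.inl ⟨h1, h2⟩
  · exact Or.inr ⟨h2, h1⟩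
  · simp [h1, h2] at hs

/-- The number of unit moves that lead from the vacuum to a diagram of charge zero. -/
def size (S : Maya) : ℤ := ∑ᶠ s, weightAt S s

theorem size_nonneg (S : Maya) : 0 ≤ size S := by
  classical
  refine finsum_nonneg fun s => ?_
  rw [weightAt]
  split_ifs <;> simp <;> omega

theorem size_vac : size vac = 0 := by
  classical
  refine finsum_eq_zero_of_forall_eq_zero fun s => ?_
  rw [weightAt]
  have : s ∈ vac.1 ↔ s ≤ 0 := Iff.rfl
  simp [this]

theorem size_move {i : ℤ} {S : Maya} (h : CanMove i S) : size (move i S) = size S + 1 := by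
  classical
  have h1 : weightAt (move i S) = fun s => weightAt S s +
      ((Pi.single (i + 1) (i + 1) : ℤ → ℤ) s - (Pi.single i i : ℤ → ℤ) s) := by
    funext s
    rw [canMove_coe] at h
    rw [weightAt, weightAt, mem_move, Pi.single_apply, Pi.single_apply]
    by_cases h1 : s = i
    · subst h1
      have h3 : ¬ (s = s + 1 ∨ s ∈ S.1 ∧ s ≠ s) := by omega
      rw [if_neg h3, if_pos h.1, if_neg (show ¬ s = s + 1 by omega), if_pos rfl]
      ring
    · by_cases h2 : s = i + 1
      · subst h2
        rw [if_pos (Or.inl rfl), if_neg h.2, if_pos rfl, if_neg (show ¬ i + 1 = i by omega)]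
        ring
      · simp [h1, h2]
  have hs : ∀ a b : ℤ, (Function.support (Pi.single a b : ℤ → ℤ)).Finite := fun a b =>
    (Set.finite_singleton a).subset Pi.support_single_subset
  have hs' : ∀ a b : ℤ, ∑ᶠ s, (Pi.single a b : ℤ → ℤ) s = b := fun a b => by
    rw [finsum_eq_single _ a fun x hx => Pi.single_eq_of_ne hx _, Pi.single_eq_same]
  rw [size, h1, finsum_add_distrib (weightAt_support S) (((hs _ _).union (hs _ _)).subset
    (Function.support_sub _ _)), finsum_sub_distrib (hs _ _) (hs _ _), hs', hs', size]
  ring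

theorem charge_vac : vac.charge = 0 := by
  simp [Maya.charge, vac]

theorem charge_move {i : WithTop ℤ} {S : Maya} (h : CanMove i S) :
    (move i S).charge = S.charge := by
  induction i using WithTop.recTopCoe with
  | top => rfl
  | coe i =>
    rw [canMove_coe] at h
    have h1 := Maya.charge_insert (i := i + 1) (S := S.erase i) fun hx => h.2 hx.1
    have h2 := Maya.charge_insert (i := i) (S := S.erase i) fun hx => hx.2 rfl
    rw [Maya.insert_erase h.1] at h2
    exact h1.trans h2.symm

/-- If no particle can be moved down, the diagram is closed downwards, and a downward closed diagram
of charge zero is the vacuum. -/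
theorem exists_unmove {S : Maya} (h : S.charge = 0) (hv : S ≠ vac) :
    ∃ i : ℤ, i + 1 ∈ S.1 ∧ i ∉ S.1 := by
  by_contra! hcon
  have hd : ∀ (k : ℕ) (s : ℤ), s ∈ S.1 → s - k ∈ S.1 := by
    intro k s hs
    induction k with
    | zero => simpa using hs
    | succ k ih => exact hcon _ (by rwa [show s - ↑(k + 1) + 1 = s - k by push_cast; ring])
  have hd' : ∀ s t : ℤ, s ∈ S.1 → t ≤ s → t ∈ S.1 := fun s t hs hts => by
    have := hd (s - t).toNat s hs
    rwa [show s - ((s - t).toNat : ℤ) = t by omega] at this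
  unfold Maya.charge at h
  by_cases hp : ∃ s ∈ S.1, 0 < s
  · obtain ⟨s, hs, hs0⟩ := hp
    have h1 : Set.Iic 0 \ S.1 = ∅ := by
      ext x
      simp only [Set.mem_sdiff, Set.mem_Iic, Set.mem_empty_iff_false, iff_false, not_and, not_not]
      exact fun hx => hd' s x hs (by omega)
    rw [h1, Set.ncard_empty, Nat.cast_zero, sub_zero, Nat.cast_eq_zero,
      Set.ncard_eq_zero S.2.1] at h
    exact (Set.eq_empty_iff_forall_notMem.1 h s) ⟨hs, not_le.2 hs0⟩
  · push Not at hp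
    have h1 : S.1 \ Set.Iic 0 = ∅ := Set.sdiff_eq_empty.2 hp
    rw [h1, Set.ncard_empty, Nat.cast_zero, zero_sub, neg_eq_zero, Nat.cast_eq_zero,
      Set.ncard_eq_zero S.2.2, Set.sdiff_eq_empty] at h
    exact hv (Subtype.ext (Set.Subset.antisymm hp h))

theorem eq_vac_of_size {S : Maya} (h : S.charge = 0) (hs : size S = 0) : S = vac := by
  by_contra hv
  obtain ⟨i, h1, h2⟩ := exists_unmove h hv
  have h3 := size_move (canMove_unmove h1 h2)
  rw [move_unmove h1 h2, hs] at h3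
  have := size_nonneg (unmove i S)
  omega

theorem size_move_le (i : WithTop ℤ) {S : Maya} (h : CanMove i S) :
    size S ≤ size (move i S) ∧ size (move i S) ≤ size S + 1 := by
  induction i using WithTop.recTopCoe with
  | top => rw [move_top]; omega
  | coe i => rw [size_move h]; omega

/-- Two consecutive steps are determined, up to order, by the diagrams that they connect. -/
theorem move_move_eq {i j i' j' : WithTop ℤ} {S : Maya} (hi : CanMove i S)
    (hj : CanMove j (move i S)) (hi' : CanMove i' S) (hj' : CanMove j' (move i' S))
    (h : move j (move i S) = move j' (move i' S)) :
    (i' = i ∧ j' = j) ∨ (i' = j ∧ j' = i ∧ Nadj i j) := by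
  have key : ∀ a b : ℤ, CanMove a S → CanMove b S → move a S = move b S → a = b := by
    intro a b ha hb hab
    rw [canMove_coe] at ha hb
    have h1 : a ∈ (move a S).1 ↔ a ∈ (move b S).1 := by rw [hab]
    rw [mem_move, mem_move] at h1
    grind
  have hsz := congrArg size h
  induction i using WithTop.recTopCoe with
  | top =>
    induction j using WithTop.recTopCoe with
    | top =>
      induction i' using WithTop.recTopCoe with
      | top =>
        induction j' using WithTop.recTopCoe with
        | top => exact Or.inl ⟨rfl, rfl⟩
        | coe j' => rw [size_move hj', move_top, move_top] at hsz; omega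
      | coe i' =>
        have := (size_move_le j' hj').1
        rw [size_move hi'] at this
        rw [move_top, move_top] at hsz
        omega
    | coe j =>
      rw [move_top] at h hj hsz
      rw [size_move hj] at hsz
      induction i' using WithTop.recTopCoe with
      | top =>
        induction j' using WithTop.recTopCoe with
        | top => rw [move_top, move_top] at hsz; omega
        | coe j' => rw [key j j' hj hj' h]; exact Or.inl ⟨rfl, rfl⟩
      | coe i' =>
        induction j' using WithTop.recTopCoe with
        | top => rw [key j i' hj hi' h]; exact Or.inr ⟨rfl, rfl, trivial⟩
        | coe j' => rw [size_move hj', size_move hi'] at hsz; omega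
  | coe i =>
    induction j using WithTop.recTopCoe with
    | top =>
      rw [move_top] at h
      rw [move_top, size_move hi] at hsz
      induction i' using WithTop.recTopCoe with
      | top =>
        induction j' using WithTop.recTopCoe with
        | top => rw [move_top, move_top] at hsz; omega
        | coe j' => rw [key i j' hi hj' h]; exact Or.inr ⟨rfl, rfl, trivial⟩
      | coe i' =>
        induction j' using WithTop.recTopCoe with
        | top => rw [key i i' hi hi' h]; exact Or.inl ⟨rfl, rfl⟩
        | coe j' => rw [size_move hj', size_move hi'] at hsz; omega
    | coe j =>
      rw [size_move hj, size_move hi] at hsz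
      induction i' using WithTop.recTopCoe with
      | top =>
        have := (size_move_le j' hj').2
        rw [move_top] at this hsz
        omega
      | coe i' =>
        induction j' using WithTop.recTopCoe with
        | top => rw [move_top, size_move hi'] at hsz; omega
        | coe j' =>
          have H : ∀ x, x ∈ (move j (move i S)).1 ↔ x ∈ (move j' (move i' S)).1 := fun x => by rw [h]
          simp only [mem_move] at H
          rw [canMove_coe] at hi hi' hj hj'
          rw [mem_move, mem_move] at hj hj'
          -- The two diagrams need to be compared only at the places touched by the four steps.
          have h1 := H i
          have h2 := H j
          have h3 := H i'
          have h4 := H j'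
          have h5 := H (i + 1)
          have h6 := H (j + 1)
          have h7 := H (i' + 1)
          have h8 := H (j' + 1)
          clear H key hsz h
          simp only [WithTop.coe_inj, Nadj]
          grind

/-- Two different steps that lead to the same diagram start from a common diagram. -/
theorem exists_common {i j : WithTop ℤ} {S S' : Maya} (hi : CanMove i S) (hj : CanMove j S')
    (h : move i S = move j S') (hij : i ≠ j) :
    ∃ κ, CanMove j κ ∧ move j κ = S ∧ CanMove i κ ∧ move i κ = S' ∧ Nadj i j := by
  induction i using WithTop.recTopCoe with
  | top =>
    induction j using WithTop.recTopCoe with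
    | top => exact absurd rfl hij
    | coe j => exact ⟨S', hj, h.symm, trivial, rfl, trivial⟩
  | coe i =>
    induction j using WithTop.recTopCoe with
    | top => exact ⟨S, trivial, rfl, hi, h, trivial⟩
    | coe j =>
      have hij' : i ≠ j := fun e => hij (by rw [e])
      have H : ∀ x, x ∈ (move i S).1 ↔ x ∈ (move j S').1 := fun x => by rw [h]
      simp only [mem_move] at H
      rw [canMove_coe] at hi hj
      have h1 := H i
      have h2 := H j
      have h3 := H (i + 1)
      have h4 := H (j + 1)
      have h5 : j + 1 ∈ S.1 ∧ j ∉ S.1 := by grind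
      have h6 : CanMove i (unmove j S) := by rw [canMove_coe, mem_unmove, mem_unmove]; grind
      refine ⟨unmove j S, canMove_unmove h5.1 h5.2, move_unmove h5.1 h5.2, h6, ?_, ?_⟩
      · refine maya_ext fun x => ?_
        have := H x
        rw [mem_move, mem_unmove]
        grind
      · simp only [Nadj]; grind

theorem finite_canMove (S : Maya) : {i | CanMove i S}.Finite := by
  refine ((((S.2.1.union (S.2.2.image fun x => x - 1)).union (Set.finite_singleton 0)).image
    (fun i : ℤ => (i : WithTop ℤ))).union (Set.finite_singleton ⊤)).subset fun i hi => ?_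
  induction i using WithTop.recTopCoe with
  | top => exact Or.inr rfl
  | coe i =>
    have hi' : i ∈ S.1 ∧ i + 1 ∉ S.1 := hi
    refine Or.inl ⟨i, ?_, rfl⟩
    by_cases h : 0 < i
    · exact Or.inl (Or.inl ⟨hi'.1, not_le.2 h⟩)
    · by_cases h0 : i = 0
      · exact Or.inr h0
      · exact Or.inl (Or.inr ⟨i + 1, ⟨Set.mem_Iic.2 (by omega), hi'.2⟩, by simp⟩)

end Moves

/-! ## Paths -/

section Paths

/-- Sequences of steps that start at the vacuum, together with the diagrams where they end. -/
def pathAux : ℕ → Σ T : Type, T → Maya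
  | 0 => ⟨Unit, fun _ => vac⟩
  | n + 1 => ⟨{x : (pathAux n).1 × WithTop ℤ // CanMove x.2 ((pathAux n).2 x.1)},
      fun x => move x.1.2 ((pathAux n).2 x.1.1)⟩

/-- Sequences of `n` steps that start at the vacuum. -/
def Path (n : ℕ) : Type := (pathAux n).1

variable {n : ℕ}

/-- The diagram where a path ends. -/
def tip (p : Path n) : Maya := (pathAux n).2 p

/-- Add a step. -/
def snoc (p : Path n) (i : WithTop ℤ) (h : CanMove i (tip p)) : Path (n + 1) := ⟨(p, i), h⟩

/-- Remove the last step. -/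
def init (p : Path (n + 1)) : Path n := Prod.fst (Subtype.val p)

/-- The last step. -/
def last (p : Path (n + 1)) : WithTop ℤ := Prod.snd (Subtype.val p)

theorem canMove_last (p : Path (n + 1)) : CanMove (last p) (tip (init p)) := Subtype.property p

theorem tip_eq (p : Path (n + 1)) : tip p = move (last p) (tip (init p)) := rfl

@[simp] theorem init_snoc (p : Path n) (i : WithTop ℤ) (h : CanMove i (tip p)) :
    init (snoc p i h) = p := rfl

@[simp] theorem last_snoc (p : Path n) (i : WithTop ℤ) (h : CanMove i (tip p)) :
    last (snoc p i h) = i := rfl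

@[simp] theorem tip_snoc (p : Path n) (i : WithTop ℤ) (h : CanMove i (tip p)) :
    tip (snoc p i h) = move i (tip p) := rfl

theorem path_ext {p q : Path (n + 1)} (h : init p = init q) (h' : last p = last q) : p = q :=
  Subtype.ext (Prod.ext h h')

instance : Unique (Path 0) := inferInstanceAs (Unique Unit)

instance instFinitePath : (n : ℕ) → Finite (Path n)
  | 0 => inferInstance
  | n + 1 => by
    have := instFinitePath n
    have : ∀ p : Path n, Finite {i | CanMove i (tip p)} := fun p => finite_canMove (tip p)
    exact Finite.of_injective
      (fun x : Path (n + 1) => (⟨init x, ⟨last x, canMove_last x⟩⟩ :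
        Σ p : Path n, {i | CanMove i (tip p)}))
      fun x y h => by
        have h1 : init x = init y := congrArg Sigma.fst h
        have h2 : last x = last y := by
          have := congrArg (fun z : Σ p : Path n, {i | CanMove i (tip p)} => z.2.1) h
          exact this
        exact path_ext h1 h2

instance : Fintype (Path n) := Fintype.ofFinite _

instance : DecidableEq (Path n) := Classical.decEq _

theorem charge_tip : ∀ {n : ℕ} (p : Path n), (tip p).charge = 0
  | 0, _ => charge_vac
  | _ + 1, p => by rw [tip_eq, charge_move (canMove_last p), charge_tip]

theorem size_tip_le : ∀ {n : ℕ} (p : Path n), size (tip p) ≤ n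
  | 0, _ => size_vac.le
  | n + 1, p => by
    have h1 := size_tip_le (init p)
    have h2 := (size_move_le (last p) (canMove_last p)).2
    rw [tip_eq]
    push_cast
    omega

/-- Surplus length is filled with idle steps. Together with `charge_tip` and `size_tip_le` this
identifies the end points of paths of length n as the diagrams of charge zero and size at most n. -/
theorem exists_path {S : Maya} (h : S.charge = 0) (hs : size S ≤ n) : ∃ p : Path n, tip p = S := by
  induction n generalizing S with
  | zero =>
    have := size_nonneg S
    exact ⟨default, (eq_vac_of_size h (by push_cast at hs; omega)).symm⟩
  | succ n ih =>
    by_cases hn : size S ≤ n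
    · obtain ⟨p, rfl⟩ := ih h hn
      exact ⟨snoc p ⊤ trivial, rfl⟩
    · obtain ⟨i, h1, h2⟩ := exists_unmove h (by
        rintro rfl
        rw [size_vac] at hn
        omega)
      have h3 := canMove_unmove h1 h2
      have h4 := size_move h3
      rw [move_unmove h1 h2] at h4
      obtain ⟨p, hp⟩ := ih (S := unmove i S) (by rw [← charge_move h3, move_unmove h1 h2, h])
        (by push_cast at hs; omega)
      exact ⟨snoc p i (hp ▸ h3), by rw [tip_snoc, hp, move_unmove h1 h2]⟩

theorem last_eq_of_tip {p q : Path (n + 1)} (h : tip (init p) = tip (init q))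
    (ht : tip p = tip q) : last p = last q := by
  -- A second idle step is appended on both sides to make `move_move_eq` applicable.
  have h1 := move_move_eq (i := last p) (j := ⊤) (i' := last q) (j' := ⊤) (canMove_last p) trivial
    (by rw [h]; exact canMove_last q) trivial (by
      rw [move_top, move_top, ← tip_eq, h, ← tip_eq, ht])
  rcases h1 with h1 | ⟨h1, h2, _⟩
  · exact h1.1.symm
  · exact h2.symm.trans h1.symm

theorem path_eq_of_tip {p q : Path (n + 1)} (h : init p = init q) (ht : tip p = tip q) : p = q :=
  path_ext h (last_eq_of_tip (by rw [h]) ht)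

end Paths

/-! ## Counting pairs of paths -/

section Counting

open Finset

theorem sign_succ {i : ℤ} {S : Maya} (h : i + 1 ∉ S.1) : S.sign (i + 1) = S.sign i := by
  unfold Maya.sign
  have : {s | s ∈ S.1 ∧ i + 1 < s} = {s | s ∈ S.1 ∧ i < s} := by
    ext s
    constructor
    · rintro ⟨h1, h2⟩
      exact ⟨h1, by omega⟩
    · rintro ⟨h1, h2⟩
      refine ⟨h1, lt_of_le_of_ne (by omega) ?_⟩
      rintro rfl
      exact h h1
  rw [this]

theorem sign_erase_self (i : ℤ) (S : Maya) : (S.erase i).sign i = S.sign i := by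
  by_cases h : i ∈ S.1
  · rw [Maya.sign_erase _ _ _ h, if_neg (lt_irrefl _)]
  · congr 1
    exact maya_ext fun x => ⟨fun hx => hx.1, fun hx => ⟨hx, fun e => h (e ▸ hx)⟩⟩

-- The signs of wedge and contraction cancel: after the particle at i has been removed, no particle
-- lies strictly between i and the free place i+1.
open Classical in
theorem raise_single (i : ℤ) (S : Maya) (c : ℂ) :
    fullRepLinear (matE (i + 1) i) (Finsupp.single S c) =
      if CanMove i S then Finsupp.single (move i S) c else 0 := by
  rw [fullRepLinear_matE, Module.End.mul_apply, canMove_coe]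
  by_cases h : i ∈ S.1
  · rw [contract_single_of_mem h]
    by_cases h' : i + 1 ∈ S.1
    · rw [wedge_single_of_mem, if_neg (fun hh => hh.2 h')]
      exact ⟨h', by simp⟩
    · rw [wedge_single_of_notMem (fun hh => h' (Maya.mem_erase.1 hh).1), if_pos ⟨h, h'⟩,
        Maya.sign_erase _ _ _ h, if_neg (by omega), sign_succ h', mul_assoc, Maya.sign_mul_self,
        mul_one]
      rfl
  · rw [contract_single_of_notMem h, map_zero, if_neg (fun hh => h hh.1)]

open Classical in
theorem lower_single (i : ℤ) (S : Maya) (c : ℂ) :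
    fullRepLinear (matE i (i + 1)) (Finsupp.single S c) =
      if i + 1 ∈ S.1 ∧ i ∉ S.1 then Finsupp.single (unmove i S) c else 0 := by
  rw [fullRepLinear_matE, Module.End.mul_apply]
  by_cases h : i + 1 ∈ S.1
  · rw [contract_single_of_mem h]
    by_cases h' : i ∈ S.1
    · rw [wedge_single_of_mem, if_neg (fun hh => hh.2 h')]
      exact ⟨h', by simp⟩
    · rw [wedge_single_of_notMem (fun hh => h' (Maya.mem_erase.1 hh).1), if_pos ⟨h, h'⟩,
        ← sign_succ (i := i) (S := S.erase (i + 1)) (fun hh => hh.2 rfl), sign_erase_self,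
        mul_assoc, Maya.sign_mul_self, mul_one]
      rfl
  · rw [contract_single_of_notMem h, map_zero, if_neg (fun hh => h hh.1)]

open Classical in
theorem diag_single (i : ℤ) (S : Maya) (c : ℂ) :
    fullRepLinear (matE i i) (Finsupp.single S c) = if i ∈ S.1 then Finsupp.single S c else 0 := by
  rw [fullRepLinear_matE, Module.End.mul_apply]
  by_cases h : i ∈ S.1
  · rw [contract_single_of_mem h, wedge_single_of_notMem (fun hh => (Maya.mem_erase.1 hh).2 rfl), sign_erase_self,
      mul_assoc, Maya.sign_mul_self, mul_one, Maya.insert_erase h, if_pos h]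
  · rw [contract_single_of_notMem h, map_zero, if_neg h]

open Classical in
theorem lower_apply (i : ℤ) (y : FullFock) (S : Maya) :
    fullRepLinear (matE i (i + 1)) y S = if CanMove i S then y (move i S) else 0 := by
  induction y using Finsupp.induction_linear with
  | zero => simp
  | add y z hy hz => rw [map_add, Finsupp.add_apply, hy, hz]; split_ifs <;> simp
  | single T c =>
    rw [lower_single]
    by_cases h : CanMove i S
    · rw [if_pos h]
      by_cases h' : T = move i S
      · subst h'
        rw [if_pos (mem_move_of_canMove h), unmove_move h, Finsupp.single_eq_same,
          Finsupp.single_eq_same]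
      · rw [Finsupp.single_eq_of_ne' h']
        split_ifs with h2
        · rw [Finsupp.single_eq_of_ne']
          rintro rfl
          exact h' (move_unmove h2.1 h2.2).symm
        · rfl
    · rw [if_neg h]
      split_ifs with h2
      · rw [Finsupp.single_eq_of_ne']
        rintro rfl
        exact h (canMove_unmove h2.1 h2.2)
      · rfl

/-- The sum of the elementary raising matrices in a window. -/
def raiseMat (N : ℕ) : glInf := ∑ k ∈ range (2 * N), matE ((k : ℤ) - N + 1) (k - N)

/-- The sum of the elementary lowering matrices in a window. -/
def lowerMat (N : ℕ) : glInf := ∑ k ∈ range (2 * N), matE ((k : ℤ) - N) (k - N + 1)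

/-- The commutators of opposite matrix units telescope. On a diagram that agrees with the vacuum
outside the window, the first remaining unit acts by 1 and the second by 0, so D and U behave as in
the Heisenberg algebra; working in a window keeps the sums finite. -/
theorem lie_lowerMat_raiseMat (N : ℕ) :
    ⁅lowerMat N, raiseMat N⁆ = matE (-N) (-N) - matE N N := by
  have h1 : ∀ k l : ℕ, ⁅matE ((k : ℤ) - N) (k - N + 1), matE ((l : ℤ) - N + 1) (l - N)⁆ =
      if k = l then matE ((k : ℤ) - N) (k - N) - matE (((k + 1 : ℕ) : ℤ) - N) ((k + 1 : ℕ) - N)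
      else 0 := by
    intro k l
    rw [lie_matE]
    by_cases h : k = l
    · subst h
      rw [if_pos rfl, if_pos rfl, if_pos rfl]
      push_cast
      rw [show (k : ℤ) + 1 - N = k - N + 1 by ring]
    · rw [if_neg (by omega), if_neg (by omega), if_neg h, sub_zero]
  rw [lowerMat, raiseMat, sum_lie]
  simp only [lie_sum, h1, sum_ite_eq]
  have h2 : ∀ k ∈ range (2 * N), (if k ∈ range (2 * N) then
      matE ((k : ℤ) - N) (k - N) - matE (((k + 1 : ℕ) : ℤ) - N) ((k + 1 : ℕ) - N) else 0) =
      matE ((k : ℤ) - N) (k - N) - matE (((k + 1 : ℕ) : ℤ) - N) ((k + 1 : ℕ) - N) :=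
    fun k hk => if_pos hk
  rw [sum_congr rfl h2, sum_range_sub' (fun k : ℕ => matE ((k : ℤ) - N) (k - N))]
  push_cast
  rw [zero_sub, show (2 : ℤ) * N - N = N by ring]

/-- A diagram that differs from the vacuum only in a window. -/
def Bounded (n : ℕ) (S : Maya) : Prop := (∀ s ∈ S.1, s ≤ n) ∧ ∀ s : ℤ, s ≤ -n → s ∈ S.1

theorem Bounded.move {n : ℕ} {S : Maya} (h : Bounded n S) (i : WithTop ℤ) (hi : CanMove i S) :
    Bounded (n + 1) (move i S) := by
  induction i using WithTop.recTopCoe with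
  | top =>
    refine ⟨fun s hs => (h.1 s hs).trans (by push_cast; omega), fun s hs => h.2 s ?_⟩
    push_cast at hs
    omega
  | coe i =>
    rw [canMove_coe] at hi
    have h1 := h.1 i hi.1
    have h2 : ¬ i + 1 ≤ -n := fun hh => hi.2 (h.2 _ hh)
    refine ⟨fun s hs => ?_, fun s hs => ?_⟩
    · rw [mem_move] at hs
      have := h.1 s
      push_cast
      grind
    · rw [mem_move]
      push_cast at hs
      have := h.2 s
      grind

theorem bounded_tip : ∀ {n : ℕ} (p : Path n), Bounded n (tip p)
  | 0, p => ⟨fun s (hs : s ≤ 0) => by simpa using hs,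
      fun s hs => show s ≤ 0 by simpa using hs⟩
  | n + 1, p => by rw [tip_eq]; exact (bounded_tip (init p)).move _ (canMove_last p)

/-- The possible steps from a diagram. -/
def steps (S : Maya) : Finset (WithTop ℤ) := (finite_canMove S).toFinset

theorem mem_steps {S : Maya} {i : WithTop ℤ} : i ∈ steps S ↔ CanMove i S :=
  Set.Finite.mem_toFinset _

theorem sum_path_succ {M : Type*} [AddCommMonoid M] {n : ℕ} (F : Path n → WithTop ℤ → M) :
    ∑ x : Path (n + 1), F (init x) (last x) = ∑ p : Path n, ∑ i ∈ steps (tip p), F p i := by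
  rw [sum_sigma']
  refine sum_bij' (fun x _ => ⟨init x, last x⟩)
    (fun y hy => snoc y.1 y.2 (mem_steps.1 (mem_sigma.1 hy).2))
    (fun x _ => mem_sigma.2 ⟨mem_univ _, mem_steps.2 (canMove_last x)⟩) (fun _ _ => mem_univ _)
    (fun x _ => rfl) (fun y _ => rfl) (fun x _ => rfl)

theorem finite_step_window {n N : ℕ} (hN : n < N) {S : Maya} (hS : Bounded n S) {i : ℤ}
    (hi : CanMove i S) : ∃ k ∈ range (2 * N), i = (k : ℤ) - N := by
  rw [canMove_coe] at hi
  have h1 := hS.1 i hi.1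
  have h2 : ¬ i + 1 ≤ -n := fun hh => hi.2 (hS.2 _ hh)
  exact ⟨(i + N).toNat, mem_range.2 (by omega), by omega⟩

open Classical in
theorem sum_steps {M : Type*} [AddCommMonoid M] {n N : ℕ} (hN : n < N) {S : Maya}
    (hS : Bounded n S) (F : WithTop ℤ → M) :
    ∑ i ∈ steps S, F i = F ⊤ +
      ∑ k ∈ range (2 * N), if CanMove (((k : ℤ) - N : ℤ) : WithTop ℤ) S
        then F (((k : ℤ) - N : ℤ) : WithTop ℤ) else 0 := by
  have h : steps S = insert ⊤ (((range (2 * N)).filter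
      (fun k : ℕ => CanMove (((k : ℤ) - N : ℤ) : WithTop ℤ) S)).image
      (fun k : ℕ => (((k : ℤ) - N : ℤ) : WithTop ℤ))) := by
    ext i
    rw [mem_steps, mem_insert, mem_image]
    induction i using WithTop.recTopCoe with
    | top => simp [canMove_top]
    | coe i =>
      constructor
      · intro hi
        obtain ⟨k, hk, rfl⟩ := finite_step_window hN hS hi
        exact Or.inr ⟨k, mem_filter.2 ⟨hk, hi⟩, rfl⟩
      · rintro (h | ⟨k, hk, h⟩)
        · exact absurd h (WithTop.coe_ne_top)
        · rw [← h]; exact (mem_filter.1 hk).2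
  rw [h, sum_insert, sum_image, sum_filter]
  · intro a _ b _ hab
    have := WithTop.coe_inj.1 hab
    omega
  · simp

/-- The sum of the end points of all paths. -/
def pathVec (n : ℕ) : FullFock := ∑ p : Path n, Finsupp.single (tip p) 1

theorem pathVec_succ {n N : ℕ} (hN : n < N) :
    pathVec (n + 1) = pathVec n + fullRepLinear (raiseMat N) (pathVec n) := by
  classical
  have h := sum_path_succ (n := n) fun p i => (Finsupp.single (move i (tip p)) 1 : FullFock)
  rw [pathVec, pathVec, map_sum, ← sum_add_distrib]
  refine h.trans (sum_congr rfl fun p _ => ?_)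
  rw [sum_steps hN (bounded_tip p), move_top, raiseMat, map_sum, LinearMap.sum_apply]
  congr 1
  refine sum_congr rfl fun k _ => ?_
  rw [raise_single]

theorem commutator_pathVec {n N : ℕ} (hN : n < N) :
    fullRepLinear (lowerMat N) (fullRepLinear (raiseMat N) (pathVec n)) =
      fullRepLinear (raiseMat N) (fullRepLinear (lowerMat N) (pathVec n)) + pathVec n := by
  classical
  have h := LinearMap.congr_fun (fullRepLinear_lie (lowerMat N) (raiseMat N)) (pathVec n)
  have h2 : fullRepLinear ⁅lowerMat N, raiseMat N⁆ (pathVec n) = pathVec n := by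
    rw [lie_lowerMat_raiseMat, map_sub, LinearMap.sub_apply, pathVec, map_sum, map_sum,
      ← sum_sub_distrib]
    refine sum_congr rfl fun p _ => ?_
    have hb := bounded_tip p
    rw [diag_single, diag_single, if_pos (hb.2 _ (by omega)), if_neg, sub_zero]
    intro hh
    have := hb.1 _ hh
    omega
  rw [h2] at h
  rw [LinearMap.sub_apply, Module.End.mul_apply, Module.End.mul_apply] at h
  exact sub_eq_iff_eq_add'.1 h.symm

theorem lower_pathVec_zero (N : ℕ) : fullRepLinear (lowerMat N) (pathVec 0) = 0 := by
  classical
  rw [pathVec, Fintype.sum_unique, lowerMat, map_sum, LinearMap.sum_apply]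
  refine sum_eq_zero fun k _ => ?_
  rw [lower_single, if_neg]
  rintro ⟨h1, h2⟩
  have h1' : (k : ℤ) - N + 1 ≤ 0 := h1
  exact h2 (show (k : ℤ) - N ≤ 0 by omega)

/-- The vector of all paths is (1 + U)^n applied to the vacuum, where 1 is the idle step. Since [D,
U] = 1 there and D kills the vacuum, D differentiates this power. -/
theorem lower_pathVec_succ {n N : ℕ} (hN : n < N) :
    fullRepLinear (lowerMat N) (pathVec (n + 1)) = ((n : ℂ) + 1) • pathVec n := by
  induction n with
  | zero =>
    rw [pathVec_succ hN, map_add, commutator_pathVec hN, lower_pathVec_zero, map_zero]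
    simp
  | succ n ih =>
    have h := ih (by omega)
    rw [pathVec_succ hN, map_add, commutator_pathVec hN, h, map_smul]
    have h3 := pathVec_succ (n := n) (N := N) (by omega)
    rw [h3]
    push_cast
    module

open Classical in
/-- The number of pairs of paths of given lengths with the same end point. -/
def pairCount (m n : ℕ) : ℕ := ∑ p : Path m, ∑ q : Path n, if tip p = tip q then 1 else 0

theorem pathVec_apply_cast (m n : ℕ) :
    ((pairCount m n : ℕ) : ℂ) = ∑ p : Path m, pathVec n (tip p) := by
  classical
  rw [pairCount]
  push_cast
  refine sum_congr rfl fun p _ => ?_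
  rw [pathVec, Finsupp.finsetSum_apply]
  refine sum_congr rfl fun q _ => ?_
  rw [Finsupp.single_apply]
  simp [eq_comm]

/-- Remove the last step of the first path. If it is idle, pairs of lengths m and n+1 remain; the
sum over the other steps is the operator D applied to the vector of the second paths, and
`lower_pathVec_succ` evaluates it. -/
theorem pairCount_succ (m n : ℕ) :
    pairCount (m + 1) (n + 1) = pairCount m (n + 1) + (n + 1) * pairCount m n := by
  classical
  have h : ((pairCount (m + 1) (n + 1) : ℕ) : ℂ) =
      ((pairCount m (n + 1) + (n + 1) * pairCount m n : ℕ) : ℂ) := by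
    push_cast
    rw [pathVec_apply_cast, pathVec_apply_cast, pathVec_apply_cast, mul_sum, ← sum_add_distrib]
    refine (sum_path_succ (n := m) fun p i => pathVec (n + 1) (move i (tip p))).trans ?_
    refine sum_congr rfl fun p _ => ?_
    rw [sum_steps (N := max m n + 1) (by omega) (bounded_tip p), move_top]
    congr 1
    have h1 := lower_pathVec_succ (n := n) (N := max m n + 1) (by omega)
    have h2 := DFunLike.congr_fun h1 (tip p)
    rw [Finsupp.smul_apply, smul_eq_mul] at h2
    rw [← h2, lowerMat, map_sum, LinearMap.sum_apply, Finsupp.finsetSum_apply]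
    exact sum_congr rfl fun k _ => (lower_apply _ _ _).symm
  exact_mod_cast h

theorem last_eq_top_of_tip {n : ℕ} {p : Path (n + 1)} (h : tip p = vac) :
    last p = ⊤ ∧ tip (init p) = vac := by
  have h1 := canMove_last p
  rw [tip_eq] at h
  generalize last p = i at h h1
  induction i using WithTop.recTopCoe with
  | top => exact ⟨rfl, h⟩
  | coe i =>
    have h2 := size_move h1
    rw [h, size_vac] at h2
    have := size_nonneg (tip (init p))
    omega

theorem path_vac_unique : ∀ {n : ℕ} {p q : Path n}, tip p = vac → tip q = vac → p = q
  | 0, _, _, _, _ => Subsingleton.elim _ _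
  | n + 1, p, q, hp, hq => by
    have h1 := last_eq_top_of_tip hp
    have h2 := last_eq_top_of_tip hq
    exact path_ext (path_vac_unique h1.2 h2.2) (h1.1.trans h2.1.symm)

theorem pairCount_zero_left (n : ℕ) : pairCount 0 n = 1 := by
  classical
  obtain ⟨q, hq⟩ := exists_path (n := n) charge_vac (by rw [size_vac]; positivity)
  rw [pairCount, Fintype.sum_unique, sum_eq_single q]
  · rw [if_pos]; exact hq.symm
  · intro q' _ hne
    rw [if_neg]
    intro h
    exact hne (path_vac_unique h.symm hq)
  · simp

theorem pairCount_comm (m n : ℕ) : pairCount m n = pairCount n m := by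
  rw [pairCount, pairCount, sum_comm]
  simp only [eq_comm]

/-- The number of partial bijections between sets with m and n elements satisfies the same
recurrence and initial values. -/
theorem pairCount_eq (m n : ℕ) :
    pairCount m n = ∑ k ∈ range (m + 1), m.choose k * n.choose k * k.factorial := by
  induction m generalizing n with
  | zero => rw [pairCount_zero_left]; simp
  | succ m ih =>
    cases n with
    | zero =>
      rw [pairCount_comm, pairCount_zero_left, sum_range_succ', sum_eq_zero]
      · simp
      · intro k _; simp
    | succ n =>
      rw [pairCount_succ, ih, ih, sum_range_succ' _ (m + 1)]
      have h1 : ∀ k, (m + 1).choose (k + 1) * (n + 1).choose (k + 1) * (k + 1).factorial =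
          m.choose (k + 1) * (n + 1).choose (k + 1) * (k + 1).factorial +
            (n + 1) * (m.choose k * n.choose k * k.factorial) := by
        intro k
        have h2 := Nat.add_one_mul_choose_eq n k
        rw [Nat.choose_succ_succ m k, Nat.factorial_succ]
        have : m.choose k * (n + 1).choose (k + 1) * ((k + 1) * k.factorial) =
          m.choose k * k.factorial * ((n + 1).choose (k + 1) * (k + 1)) := by ring
        rw [add_mul, add_mul, this, ← h2]
        ring
      rw [sum_congr rfl fun k _ => h1 k, sum_add_distrib, ← mul_sum,
        sum_range_succ' (fun k => m.choose k * (n + 1).choose k * k.factorial) m,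
        sum_range_succ (fun k => m.choose (k + 1) * (n + 1).choose (k + 1) * (k + 1).factorial) m]
      simp only [Nat.choose_succ_self, Nat.choose_zero_right, zero_mul, add_zero]
      ring

end Counting

/-! ### The dimension bound for one step in the rank -/

section Growth

open Finset

instance {n : ℕ} : Inhabited (Path n) :=
  ⟨(exists_path (n := n) charge_vac (by rw [size_vac]; positivity)).choose⟩

open Classical in
/-- A chosen path to a diagram. -/
def rep (n : ℕ) (S : Maya) : Path n := if h : ∃ p : Path n, tip p = S then h.choose else default

theorem tip_rep {n : ℕ} {S : Maya} (h : ∃ p : Path n, tip p = S) : tip (rep n S) = S := by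
  rw [rep, dif_pos h]
  exact h.choose_spec

@[simp] theorem tip_rep_tip {n : ℕ} (p : Path n) : tip (rep n (tip p)) = tip p := tip_rep ⟨p, rfl⟩

/-- Pairs of paths with the same end point. -/
abbrev IdxP (n : ℕ) : Type := {z : Path n × Path n // tip z.1 = tip z.2}

/-- Pairs of paths with the same end point of the largest possible size. -/
abbrev IdxH (n : ℕ) : Type := {z : Path n × Path n // tip z.1 = tip z.2 ∧ size (tip z.1) = n}

/-- Pairs of paths, connected through a common chosen path with one step less. -/
abbrev IdxQ (m : ℕ) : Type :=
  {z : (Path (m + 1) × Path (m + 1)) × (Path (m + 1) × Path (m + 1)) //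
    tip z.1.1 = tip z.2.1 ∧ tip z.1.2 = tip z.2.2 ∧ init z.2.1 = init z.2.2 ∧
      init z.2.1 = rep m (tip (init z.2.1))}

instance (n : ℕ) : Fintype (IdxP n) := Fintype.ofFinite _
instance (n : ℕ) : Fintype (IdxH n) := Fintype.ofFinite _
instance (n : ℕ) : Fintype (IdxQ n) := Fintype.ofFinite _

theorem card_subtype_eq_sum {α : Type*} [Fintype α] (P : α → Prop) [DecidablePred P]
    [Fintype {a // P a}] :
    Fintype.card {a // P a} = ∑ a, if P a then 1 else 0 := by
  rw [Fintype.card_subtype, card_filter]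

theorem card_IdxP (n : ℕ) : Fintype.card (IdxP n) = pairCount n n := by
  classical
  rw [card_subtype_eq_sum, Fintype.sum_prod_type, pairCount]

theorem pairCount_growth (m n : ℕ) : pairCount (m + 1) (n + 1) =
    ∑ p : Path m, ∑ q : Path n, ∑ i ∈ steps (tip p), ∑ j ∈ steps (tip q),
      open Classical in if move i (tip p) = move j (tip q) then 1 else 0 := by
  classical
  have h1 : ∀ p : Path m, ∀ i, ∑ y : Path (n + 1), (if move i (tip p) = tip y then 1 else 0) =
      ∑ q : Path n, ∑ j ∈ steps (tip q), if move i (tip p) = move j (tip q) then 1 else 0 :=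
    fun p i => sum_path_succ fun q j => if move i (tip p) = move j (tip q) then 1 else 0
  rw [pairCount]
  refine (sum_path_succ fun p i =>
    ∑ y : Path (n + 1), if move i (tip p) = tip y then 1 else 0).trans ?_
  refine sum_congr rfl fun p _ => ?_
  rw [sum_congr rfl fun i _ => h1 p i, sum_comm]

-- Upward moves outnumber downward moves by one: the indicator function of the diagram drops from 1
-- to 0 across the window, and each move contributes a jump.
open Classical in
theorem card_add_eq {n N : ℕ} (hN : n < N) {S : Maya} (hS : Bounded n S) :
    ((range (2 * N)).filter fun k : ℕ => (k : ℤ) - N ∈ S.1 ∧ (k : ℤ) - N + 1 ∉ S.1).card =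
    ((range (2 * N)).filter fun k : ℕ => (k : ℤ) - N + 1 ∈ S.1 ∧ (k : ℤ) - N ∉ S.1).card + 1 := by
  have h1 := sum_range_sub' (fun k : ℕ => if (k : ℤ) - N ∈ S.1 then (1 : ℤ) else 0) (2 * N)
  have h2 : ((2 * N : ℕ) : ℤ) - N ∉ S.1 := fun h => by
    have := hS.1 _ h
    push_cast at this
    omega
  rw [if_neg h2, if_pos (hS.2 _ (by push_cast; omega)), sub_zero] at h1
  have h3 : ∀ k : ℕ, (if (k : ℤ) - N ∈ S.1 then (1 : ℤ) else 0) -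
      (if ((k + 1 : ℕ) : ℤ) - N ∈ S.1 then (1 : ℤ) else 0) =
      (if (k : ℤ) - N ∈ S.1 ∧ (k : ℤ) - N + 1 ∉ S.1 then 1 else 0) -
      (if (k : ℤ) - N + 1 ∈ S.1 ∧ (k : ℤ) - N ∉ S.1 then 1 else 0) := by
    intro k
    rw [show ((k + 1 : ℕ) : ℤ) - N = (k : ℤ) - N + 1 by push_cast; ring]
    by_cases ha : (k : ℤ) - N ∈ S.1 <;> by_cases hb : (k : ℤ) - N + 1 ∈ S.1 <;> simp [ha, hb]
  rw [sum_congr rfl fun k _ => h3 k, sum_sub_distrib, sum_boole, sum_boole] at h1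
  have h4 : ∀ a b : ℕ, (a : ℤ) - b = 1 → a = b + 1 := by intros; omega
  exact h4 _ _ h1

open Classical in
/-- The pairs counted by `IdxQ` for given outer paths. -/
def midPairs {m : ℕ} (p q : Path (m + 1)) : Finset (Path (m + 1) × Path (m + 1)) :=
  univ.filter fun z => tip p = tip z.1 ∧ tip q = tip z.2 ∧ init z.1 = init z.2 ∧
      init z.1 = rep m (tip (init z.1))

theorem mem_midPairs {m : ℕ} {p q : Path (m + 1)} {z : Path (m + 1) × Path (m + 1)} :
    z ∈ midPairs p q ↔ tip p = tip z.1 ∧ tip q = tip z.2 ∧ init z.1 = init z.2 ∧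
      init z.1 = rep m (tip (init z.1)) := by
  simp [midPairs]

/-- The last step and the end point determine the diagram before the step; the common beginning is
the chosen representative of that diagram. -/
theorem midPairs_eq_of_last {m : ℕ} {p q : Path (m + 1)} {z z' : Path (m + 1) × Path (m + 1)}
    (hz : z ∈ midPairs p q) (hz' : z' ∈ midPairs p q) (h : last z.1 = last z'.1) : z = z' := by
  rw [mem_midPairs] at hz hz'
  have h1 : tip (init z.1) = tip (init z'.1) := by
    refine move_injective (canMove_last z.1) (by rw [h]; exact canMove_last _) ?_
    rw [← tip_eq, h, ← tip_eq, ← hz.1, ← hz'.1]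
  have h2 : init z.1 = init z'.1 := by rw [hz.2.2.2, h1, ← hz'.2.2.2]
  refine Prod.ext (path_ext h2 h) (path_eq_of_tip ?_ ?_)
  · rw [← hz.2.2.1, h2, hz'.2.2.1]
  · rw [← hz.2.1, hz'.2.1]

theorem nadj_of_canMove {i j : WithTop ℤ} {S : Maya} (hi : CanMove i S) (hj : CanMove j S)
    (h : i ≠ j) : Nadj i j := by
  induction i using WithTop.recTopCoe <;> induction j using WithTop.recTopCoe
  · exact absurd rfl h
  · trivial
  · trivial
  · rename_i i j
    rw [canMove_coe] at hi hj
    have : i ≠ j := fun e => h (by rw [e])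
    simp only [Nadj]
    grind

-- Two steps out of a common diagram to different diagrams are independent, so the square can be
-- completed. This sends a pair with a common predecessor injectively to a common successor.
open Classical in
theorem card_midPairs_le_of_ne {m : ℕ} {p q : Path (m + 1)} (h : tip p ≠ tip q) :
    (midPairs p q).card ≤ ((steps (tip p) ×ˢ steps (tip q)).filter
      fun y => move y.1 (tip p) = move y.2 (tip q)).card := by
  refine card_le_card_of_injOn (fun z => (last z.2, last z.1)) (fun z hz => ?_)
    fun z hz z' hz' hzz => midPairs_eq_of_last hz hz' (Prod.mk.inj hzz).2
  have hz' := mem_midPairs.1 hz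
  have hi := canMove_last z.1
  have hj := canMove_last z.2
  rw [← hz'.2.2.1] at hj
  have h1 : tip p = move (last z.1) (tip (init z.1)) := hz'.1
  have h2 : tip q = move (last z.2) (tip (init z.1)) := by rw [hz'.2.2.1]; exact hz'.2.1
  have hN := nadj_of_canMove hi hj fun e => h (by rw [h1, h2, e])
  have hs := hN.swap hi (hN.swap' hi hj)
  simp only [coe_filter, mem_product, mem_steps, Set.mem_ofPred_eq]
  rw [h1, h2]
  exact ⟨⟨hN.swap' hi hj, hs.2.1⟩, hs.2.2.symm⟩

-- Pairs with a common predecessor number at most the downward moves, plus one for the idle step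
-- unless the size is maximal. Common successors number at least the upward moves plus one, and by
-- `card_add_eq` this exceeds the downward moves by two. So the summands 1 and the indicator of
-- maximal size fit in.
open Classical in
theorem card_midPairs_le_of_eq {m : ℕ} {p q : Path (m + 1)} (h : tip p = tip q) :
    (midPairs p q).card + (1 + if size (tip p) = (m + 1 : ℕ) then 1 else 0) ≤
      ((steps (tip p) ×ˢ steps (tip q)).filter
        fun y => move y.1 (tip p) = move y.2 (tip q)).card := by
  have hb := bounded_tip p
  set N := m + 2
  have hN : m + 1 < N := by omega
  have h1 := card_add_eq hN hb
  set A := (range (2 * N)).filter fun k : ℕ => (k : ℤ) - N ∈ (tip p).1 ∧ (k : ℤ) - N + 1 ∉ (tip p).1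
  set B := (range (2 * N)).filter fun k : ℕ => (k : ℤ) - N + 1 ∈ (tip p).1 ∧ (k : ℤ) - N ∉ (tip p).1
    with hB
  have h2 : A.card + 1 ≤ ((steps (tip p) ×ˢ steps (tip q)).filter
      fun y => move y.1 (tip p) = move y.2 (tip q)).card := by
    have h3 : A.card + 1 = (steps (tip p)).card := by
      rw [card_eq_sum_ones (steps (tip p)), sum_steps hN hb, card_filter, add_comm]
      exact congrArg _ (sum_congr rfl fun k _ => if_congr Iff.rfl rfl rfl)
    rw [h3]
    refine card_le_card_of_injOn (fun i => (i, i)) (fun i hi => ?_)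
      fun i _ j _ hij => congrArg Prod.fst hij
    simp only [coe_filter, mem_product, Set.mem_ofPred_eq]
    rw [← h]
    exact ⟨⟨hi, hi⟩, rfl⟩
  have h4 : (midPairs p q).card ≤ B.card + if size (tip p) = (m + 1 : ℕ) then 0 else 1 := by
    have h5 : (midPairs p q).card ≤ (B.image (fun k : ℕ => (((k : ℤ) - N : ℤ) : WithTop ℤ)) ∪
        if size (tip p) = (m + 1 : ℕ) then ∅ else {⊤}).card := by
      refine card_le_card_of_injOn (fun z => last z.1) (fun z hz => ?_)
        fun z hz z' hz' hzz => midPairs_eq_of_last hz hz' hzz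
      have hz' := mem_midPairs.1 hz
      have hi := canMove_last z.1
      have h6 : tip p = move (last z.1) (tip (init z.1)) := hz'.1
      simp only [coe_union, Set.mem_union, mem_coe]
      generalize last z.1 = i at hi h6
      induction i using WithTop.recTopCoe with
      | top =>
        right
        rw [if_neg, mem_singleton]
        rw [h6, move_top]
        have := size_tip_le (init z.1)
        push_cast
        omega
      | coe i =>
        left
        have h7 := mem_move_of_canMove hi
        rw [← h6] at h7
        have h8 := hb.1 _ h7.1
        have h9 : ¬ i ≤ -((m + 1 : ℕ) : ℤ) := fun hh => h7.2 (hb.2 _ hh)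
        have h10 : ((i + N).toNat : ℤ) - N = i := by omega
        refine mem_image.2 ⟨(i + N).toNat, ?_, by rw [h10]⟩
        rw [hB, mem_filter, h10]
        exact ⟨mem_range.2 (by omega), h7⟩
    refine h5.trans ((card_union_le _ _).trans (add_le_add card_image_le ?_))
    split_ifs <;> simp
  split_ifs at h4 ⊢ <;> omega

/-- The three terms on the left index the spanning set in `finrank_span3_succ`. Grouping the pairs
on the right by the paths without their last steps reduces the claim to fixed p and q. -/
theorem pairCount_growth_le (m : ℕ) :
    Fintype.card (IdxP (m + 1)) + Fintype.card (IdxQ m) + Fintype.card (IdxH (m + 1)) ≤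
      Fintype.card (IdxP (m + 2)) := by
  classical
  rw [card_IdxP (m + 2), pairCount_growth, card_subtype_eq_sum, card_subtype_eq_sum,
    card_subtype_eq_sum, Fintype.sum_prod_type, Fintype.sum_prod_type, Fintype.sum_prod_type,
    Fintype.sum_prod_type, ← sum_add_distrib, ← sum_add_distrib]
  refine sum_le_sum fun p _ => ?_
  rw [← sum_add_distrib, ← sum_add_distrib]
  refine sum_le_sum fun q _ => ?_
  have h1 : (∑ z : Path (m + 1) × Path (m + 1), if tip p = tip z.1 ∧ tip q = tip z.2 ∧
      init z.1 = init z.2 ∧ init z.1 = rep m (tip (init z.1)) then 1 else 0) =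
      (midPairs p q).card := by
    rw [midPairs, card_filter]
  have h2 : (∑ i ∈ steps (tip p), ∑ j ∈ steps (tip q),
      if move i (tip p) = move j (tip q) then 1 else 0) =
      ((steps (tip p) ×ˢ steps (tip q)).filter
        fun y => move y.1 (tip p) = move y.2 (tip q)).card := by
    rw [card_filter, sum_product]
  rw [h2]
  dsimp only
  rw [h1]
  by_cases h : tip p = tip q
  · have := card_midPairs_le_of_eq h
    simp only [h, true_and, if_true] at this ⊢
    omega
  · have := card_midPairs_le_of_ne h
    simp only [h, false_and, if_false]
    omega

theorem pairCount_growth_le_zero :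
    Fintype.card (IdxP 0) + Fintype.card (IdxH 0) ≤ Fintype.card (IdxP 1) := by
  have h1 : Fintype.card (IdxH 0) ≤ 1 :=
    Fintype.card_le_one_iff_subsingleton.2 (inferInstanceAs (Subsingleton {z : Path 0 × Path 0 // _}))
  rw [card_IdxP, card_IdxP, pairCount_eq, pairCount_eq]
  simp [Finset.sum_range_succ]
  omega

end Growth

/-! ## The seminormal matrices -/

section Eigenvalues

theorem qq_zpow (i : ℤ) : qq ^ i = algebraMap ℂ[T;T⁻¹] Kq (LaurentPolynomial.T i) := by
  have h0 : qq ≠ 0 := by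
    rw [qq, Ne, FaithfulSMul.algebraMap_eq_zero_iff]
    exact LaurentPolynomial.isUnit_T (R := ℂ) 1 |>.ne_zero
  have hn : ∀ n : ℕ, qq ^ n = algebraMap ℂ[T;T⁻¹] Kq (LaurentPolynomial.T n) := fun n => by
    rw [qq, ← map_pow, LaurentPolynomial.T_pow, mul_one]
  rcases Int.eq_nat_or_neg i with ⟨n, rfl | rfl⟩
  · rw [zpow_natCast, hn]
  · rw [zpow_neg, zpow_natCast, inv_eq_iff_eq_inv, ← one_div]
    rw [eq_div_iff, hn, ← map_mul, ← LaurentPolynomial.T_add]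
    · simp
    · rw [Ne, FaithfulSMul.algebraMap_eq_zero_iff]
      exact LaurentPolynomial.isUnit_T (R := ℂ) _ |>.ne_zero

theorem qq_zpow_injective : Function.Injective fun i : ℤ => qq ^ i := by
  intro i j h
  simp only [qq_zpow] at h
  have h1 := IsFractionRing.injective ℂ[T;T⁻¹] Kq h
  by_contra hne
  have h2 := congrArg (fun f : ℂ[T;T⁻¹] => f.coeff i) h1
  simp only [LaurentPolynomial.T, AddMonoidAlgebra.coeff_single, Finsupp.single_eq_same] at h2
  rw [Finsupp.single_eq_of_ne hne] at h2
  exact one_ne_zero h2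

theorem qq_ne_zero : qq ≠ 0 := by
  intro h
  have := qq_zpow_injective (show (fun i : ℤ => qq ^ i) 1 = (fun i : ℤ => qq ^ i) 2 by simp [h])
  omega

@[simp] theorem eigenvalue_coe (i : ℤ) : eigenvalue i = qq ^ i := rfl

@[simp] theorem eigenvalue_top : eigenvalue ⊤ = 0 := rfl

theorem eigenvalue_injective : Function.Injective eigenvalue := by
  intro i j h
  induction i using WithTop.recTopCoe <;> induction j using WithTop.recTopCoe
  · rfl
  · exact absurd h.symm (zpow_ne_zero _ qq_ne_zero)
  · exact absurd h (zpow_ne_zero _ qq_ne_zero)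
  · exact congrArg _ (qq_zpow_injective h)

/-- The coefficient of the seminormal matrices. -/
def semi (i j : WithTop ℤ) : Kq :=
  (qq * eigenvalue j - eigenvalue i) / (eigenvalue j - eigenvalue i)

/-- The denominator vanishes and the value is the default 0. It is the right value: the only step
that can be repeated at once is ⊤, and two idle steps span an eigenline of T for the eigenvalue -1.
-/
theorem semi_self (i : WithTop ℤ) : semi i i = 0 := by simp [semi]

theorem semi_add_semi {i j : WithTop ℤ} (h : i ≠ j) : semi i j + semi j i = qq + 1 := by
  have h1 : eigenvalue j - eigenvalue i ≠ 0 := sub_ne_zero.2 fun e => h (eigenvalue_injective e).symm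
  have h2 : eigenvalue i - eigenvalue j ≠ 0 := sub_ne_zero.2 fun e => h (eigenvalue_injective e)
  rw [semi, semi, div_add_div _ _ h1 h2, div_eq_iff (mul_ne_zero h1 h2)]
  ring

/-- Neighbouring finite steps cannot be interchanged. There the coefficient degenerates to 0, or to
q+1 in the other order (`semi_asc`), so T acts on the single path by -1 or by q. -/
theorem semi_desc (i : ℤ) : semi (i + 1 : ℤ) i = 0 := by
  rw [semi, eigenvalue_coe, eigenvalue_coe, zpow_add_one₀ qq_ne_zero, mul_comm, sub_self, zero_div]

theorem semi_asc (i : ℤ) : semi i (i + 1 : ℤ) = qq + 1 := by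
  have h := semi_add_semi (i := (i : WithTop ℤ)) (j := ((i + 1 : ℤ) : WithTop ℤ)) (by
    rw [Ne, WithTop.coe_inj]; omega)
  rwa [semi_desc, add_zero] at h

theorem semi_top (i : ℤ) : semi i ⊤ = 1 := by
  rw [semi, eigenvalue_top, eigenvalue_coe, mul_zero]
  exact div_self (by simpa using zpow_ne_zero i qq_ne_zero)

theorem semi_ne_zero {i j : WithTop ℤ} (h : Nadj i j) : semi i j ≠ 0 := by
  have hne := h.ne
  have h1 : eigenvalue j - eigenvalue i ≠ 0 :=
    sub_ne_zero.2 fun e => hne (eigenvalue_injective e).symm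
  refine div_ne_zero (fun h0 => ?_) h1
  rw [sub_eq_zero] at h0
  induction j using WithTop.recTopCoe with
  | top =>
    rw [eigenvalue_top, mul_zero] at h0
    exact hne (eigenvalue_injective (h0.symm.trans eigenvalue_top.symm))
  | coe j =>
    rw [eigenvalue_coe, mul_comm, ← zpow_add_one₀ qq_ne_zero, ← eigenvalue_coe] at h0
    have h2 := eigenvalue_injective h0
    subst h2
    simp only [Nadj] at h
    omega

/-- Two steps that cannot be interchanged. -/
def Adj (i j : WithTop ℤ) : Prop := ∃ a b : ℤ, i = a ∧ j = b ∧ (a = b + 1 ∨ b = a + 1)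

theorem adj_or (i j : WithTop ℤ) : i = j ∨ Adj i j ∨ Nadj i j := by
  induction i using WithTop.recTopCoe with
  | top =>
    induction j using WithTop.recTopCoe with
    | top => exact Or.inl rfl
    | coe j => exact Or.inr (Or.inr trivial)
  | coe i =>
    induction j using WithTop.recTopCoe with
    | top => exact Or.inr (Or.inr trivial)
    | coe j =>
      rcases eq_or_ne i j with rfl | h
      · exact Or.inl rfl
      · by_cases h' : i = j + 1 ∨ j = i + 1
        · exact Or.inr (Or.inl ⟨i, j, rfl, rfl, h'⟩)
        · refine Or.inr (Or.inr ?_)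
          simp only [Nadj]
          omega

theorem Adj.semi {i j : WithTop ℤ} (h : Adj i j) :
    (semi i j = 0 ∧ semi j i = qq + 1) ∨ (semi i j = qq + 1 ∧ semi j i = 0) := by
  obtain ⟨a, b, rfl, rfl, rfl | rfl⟩ := h
  · exact Or.inl ⟨semi_desc b, semi_asc b⟩
  · exact Or.inr ⟨semi_asc a, semi_desc a⟩

/-- The identity behind the braid relation. -/
theorem braid_semi {i j k : WithTop ℤ} (hij : i = j → i = ⊤) (hjk : j = k → j = ⊤)
    (hik : i = k → i = ⊤) (g1 g2 g3 g4 g5 g6 : Kq) :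
    semi i j * (semi j k * (semi i j * (g1 + g2) + semi i k * (g3 + g5)) +
      semi i k * (semi j i * (g2 + g1) + semi j k * (g4 + g6))) - qq * (semi i j * (g1 + g2)) =
    semi j k * (semi i j * (semi j k * (g1 + g3) + semi i k * (g2 + g4)) +
      semi i k * (semi k j * (g3 + g1) + semi i j * (g5 + g6))) - qq * (semi j k * (g1 + g3)) := by
  have hi := eigenvalue_injective
  have key0 : ∀ {l : WithTop ℤ}, l ≠ ⊤ → eigenvalue l ≠ 0 := fun h e =>
    h (hi (e.trans eigenvalue_top.symm))
  -- Coinciding steps are idle steps with eigenvalue 0 and need separate treatment, because the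
  -- fraction defining `semi` degenerates. For distinct steps the claim is a rational identity in
  -- three eigenvalues.
  by_cases h1 : i = j
  · obtain rfl := h1
    rw [hij rfl, semi_self]
    by_cases h2 : k = ⊤
    · rw [h2, semi_self]; ring
    · have := key0 h2
      rw [semi, semi, eigenvalue_top]
      field_simp
      ring
  by_cases h2 : j = k
  · obtain rfl := h2
    rw [hjk rfl, semi_self]
    have := key0 (show i ≠ ⊤ by rw [← hjk rfl]; exact h1)
    rw [semi, semi, eigenvalue_top]
    field_simp
    ring
  by_cases h3 : i = k
  · obtain rfl := h3
    rw [hik rfl, semi_self]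
    have := key0 (show j ≠ ⊤ by rw [← hik rfl]; exact Ne.symm h1)
    rw [semi, semi, eigenvalue_top]
    field_simp
    ring
  · have e1 := sub_ne_zero.2 fun e => h1 (hi e)
    have e2 := sub_ne_zero.2 fun e => h2 (hi e)
    have e3 := sub_ne_zero.2 fun e => h3 (hi e)
    have e1' := sub_ne_zero.2 fun e => h1 (hi e).symm
    have e2' := sub_ne_zero.2 fun e => h2 (hi e).symm
    have e3' := sub_ne_zero.2 fun e => h3 (hi e).symm
    simp only [semi]
    generalize eigenvalue i = x at *
    generalize eigenvalue j = y at *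
    generalize eigenvalue k = z at *
    rw [← neg_sub y x, ← neg_sub z y]
    field_simp
    ring

end Eigenvalues

/-! ### Block matrices indexed by paths, and the seminormal matrix of the last generator -/

section Blocks

open Finset

variable {n m : ℕ}

variable (n) in
/-- The algebra of the matrices that are indexed by paths and are block diagonal with respect to the
end points. -/
def Blk : Subalgebra Kq (Matrix (Path n) (Path n) Kq) where
  carrier := {M | ∀ p q, tip p ≠ tip q → M p q = 0}
  mul_mem' := by
    intro M N hM hN p q h
    rw [Matrix.mul_apply]
    refine sum_eq_zero fun r _ => ?_
    by_cases hr : tip p = tip r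
    · rw [hN r q fun e => h (hr.trans e), mul_zero]
    · rw [hM p r hr, zero_mul]
  add_mem' := by
    intro M N hM hN p q h
    rw [Matrix.add_apply, hM p q h, hN p q h, add_zero]
  algebraMap_mem' := by
    intro c p q h
    rw [Matrix.algebraMap_matrix_apply, if_neg fun e => h (by rw [e])]

theorem Blk.ext' {a b : Blk n} (h : ∀ p q, a.1 p q = b.1 p q) : a = b :=
  Subtype.ext (Matrix.ext h)

theorem Blk.zero_of_ne (a : Blk n) {p q : Path n} (h : tip p ≠ tip q) : a.1 p q = 0 := a.2 p q h

theorem Blk.mul_apply (a b : Blk n) (p q : Path n) :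
    (a * b).1 p q = ∑ r, a.1 p r * b.1 r q := Matrix.mul_apply

theorem Blk.one_apply (p q : Path n) : (1 : Blk n).1 p q = if p = q then 1 else 0 :=
  Matrix.one_apply

/-- Diagonal matrices. -/
def dg (f : Path n → Kq) : Blk n := ⟨Matrix.diagonal f, fun p q h =>
  Matrix.diagonal_apply_ne _ fun e => h (by rw [e])⟩

theorem dg_mul_apply (f : Path n → Kq) (a : Blk n) (p q : Path n) :
    (dg f * a).1 p q = f p * a.1 p q := Matrix.diagonal_mul _ _ _ _

theorem mul_dg_apply (f : Path n → Kq) (a : Blk n) (p q : Path n) :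
    (a * dg f).1 p q = a.1 p q * f q := Matrix.mul_diagonal _ _ _ _

theorem dg_apply (f : Path n → Kq) (p q : Path n) : (dg f).1 p q = if p = q then f p else 0 :=
  Matrix.diagonal_apply _ _ _

theorem dg_mul_dg (f g : Path n → Kq) : dg f * dg g = dg fun p => f p * g p :=
  Subtype.ext (Matrix.diagonal_mul_diagonal _ _)

theorem dg_one : dg (fun _ : Path n => 1) = 1 := Subtype.ext Matrix.diagonal_one

open Classical in
theorem sum_last_eq {M : Type*} [AddCommMonoid M] (i : WithTop ℤ) (F : Path (n + 1) → M) :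
    ∑ y : Path (n + 1), (if last y = i then F y else 0) =
      ∑ p : Path n, if h : CanMove i (tip p) then F (snoc p i h) else 0 := by
  have h1 := sum_path_succ (n := n) fun p j => if j = i then
    (if h : CanMove i (tip p) then F (snoc p i h) else 0) else 0
  refine Eq.trans (sum_congr rfl fun y _ => ?_) (h1.trans (sum_congr rfl fun p _ => ?_))
  · by_cases h : last y = i
    · subst h
      rw [if_pos rfl, if_pos rfl, dif_pos (canMove_last y)]
      rfl
    · rw [if_neg h, if_neg h]
  · rw [sum_ite_eq']
    by_cases h : CanMove i (tip p)
    · rw [if_pos (mem_steps.2 h)]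
    · rw [if_neg (fun h' => h (mem_steps.1 h')), dif_neg h]

open Classical in
/-- The inclusion of the algebra of rank `n` in the algebra of rank `n + 1`. -/
def incl (n : ℕ) : Blk n →ₐ[Kq] Blk (n + 1) :=
  AlgHom.ofLinearMap
    { toFun := fun a => ⟨Matrix.of fun x y => if last x = last y then a.1 (init x) (init y) else 0,
        fun x y h => by
          rw [Matrix.of_apply]
          split_ifs with h1
          · refine a.2 _ _ fun h2 => h ?_
            rw [tip_eq, tip_eq, h1, h2]
          · rfl⟩
      map_add' := fun a b => Blk.ext' fun x y => by
        change (if _ then a.1 _ _ + b.1 _ _ else (0 : Kq)) = (if _ then _ else 0) + if _ then _ else 0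
        split_ifs <;> simp
      map_smul' := fun c a => Blk.ext' fun x y => by
        change (if _ then c * a.1 _ _ else (0 : Kq)) = c * if _ then _ else 0
        split_ifs <;> simp }
    (Blk.ext' fun x y => by
      change (if last x = last y then (1 : Blk n).1 (init x) (init y) else 0) = _
      rw [Blk.one_apply, Blk.one_apply]
      by_cases h : x = y
      · simp [h]
      · rw [if_neg h]
        split_ifs with h1 h2
        · exact absurd (path_ext h2 h1) h
        · rfl
        · rfl)
    (fun a b => Blk.ext' fun x z => by
      rw [Blk.mul_apply]
      change (if last x = last z then (a * b).1 (init x) (init z) else 0) =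
        ∑ y, (if last x = last y then a.1 (init x) (init y) else 0) *
          (if last y = last z then b.1 (init y) (init z) else 0)
      by_cases h : last x = last z
      · rw [if_pos h, Blk.mul_apply]
        have h1 : ∀ y : Path (n + 1), (if last x = last y then a.1 (init x) (init y) else 0) *
          (if last y = last z then b.1 (init y) (init z) else 0) =
          if last y = last x then a.1 (init x) (init y) * b.1 (init y) (init z) else 0 := by
          intro y
          by_cases hy : last y = last x
          · rw [if_pos hy.symm, if_pos (hy.trans h), if_pos hy]
          · rw [if_neg fun e => hy e.symm, if_neg hy, zero_mul]
        rw [sum_congr rfl fun y _ => h1 y, sum_last_eq]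
        refine sum_congr rfl fun p _ => ?_
        split_ifs with hp
        · rfl
        · rw [Blk.zero_of_ne a, zero_mul]
          exact fun e => hp (e ▸ canMove_last x)
      · rw [if_neg h]
        refine (sum_eq_zero fun y _ => ?_).symm
        by_cases hy : last x = last y
        · rw [if_neg fun e => h (hy.trans e), mul_zero]
        · rw [if_neg hy, zero_mul])

open Classical in
theorem incl_apply (a : Blk n) (x y : Path (n + 1)) :
    (incl n a).1 x y = if last x = last y then a.1 (init x) (init y) else 0 := rfl

theorem incl_dg (f : Path n → Kq) : incl n (dg f) = dg fun x => f (init x) := by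
  classical
  refine Blk.ext' fun x y => ?_
  rw [incl_apply, dg_apply, dg_apply]
  by_cases h : x = y
  · simp [h]
  · rw [if_neg h]
    split_ifs with h1 h2
    · exact absurd (path_ext h2 h1) h
    · rfl
    · rfl

/-- The next to last step. -/
abbrev last2 (x : Path (m + 2)) : WithTop ℤ := last (init x)

open Classical in
/-- The seminormal matrix of `T + 1` for the last generator `T`. -/
def topE (m : ℕ) : Blk (m + 2) :=
  ⟨Matrix.of fun x y => if init (init x) = init (init y) ∧ tip x = tip y
    then semi (last2 y) (last y) else 0, fun x y h => by
      rw [Matrix.of_apply, if_neg fun h' => h h'.2]⟩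

open Classical in
theorem topE_apply (x y : Path (m + 2)) : (topE m).1 x y =
    if init (init x) = init (init y) ∧ tip x = tip y then semi (last2 y) (last y) else 0 := rfl

open Classical in
/-- The value of a function at a path, extended by zero to sequences of steps that are not
possible. -/
def ext2 (f : Path (m + 2) → Kq) (κ : Path m) (i j : WithTop ℤ) : Kq :=
  if h : CanMove i (tip κ) then
    if h' : CanMove j (move i (tip κ)) then f (snoc (snoc κ i h) j h') else 0 else 0

theorem ext2_self (f : Path (m + 2) → Kq) (y : Path (m + 2)) :
    ext2 f (init (init y)) (last2 y) (last y) = f y := by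
  rw [ext2, dif_pos (canMove_last (init y))]
  exact dif_pos (canMove_last y)

/-- The classes that define the seminormal matrices. -/
theorem related_iff {x y : Path (m + 2)} :
    (init (init x) = init (init y) ∧ tip x = tip y) ↔
      x = y ∨ ∃ (h : CanMove (last y) (tip (init (init y))))
        (h' : CanMove (last2 y) (move (last y) (tip (init (init y))))),
        Nadj (last2 y) (last y) ∧ x = snoc (snoc (init (init y)) (last y) h) (last2 y) h' := by
  constructor
  · rintro ⟨h1, h2⟩
    have hx := canMove_last x
    have hx' := canMove_last (init x)
    rw [tip_eq (init x), h1] at hx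
    rw [h1] at hx'
    have h3 : move (last y) (move (last2 y) (tip (init (init y)))) =
        move (last x) (move (last2 x) (tip (init (init y)))) := by
      rw [← h1, ← tip_eq, ← tip_eq, h1, ← tip_eq, ← tip_eq, h2]
    rcases move_move_eq (canMove_last (init y)) (canMove_last y) hx' hx h3 with h | h
    · exact Or.inl (path_ext (path_ext h1 h.1) h.2)
    · refine Or.inr ⟨h.1 ▸ hx', ?_, h.2.2, ?_⟩
      · have := hx
        rwa [h.2.1, h.1] at this
      · exact path_ext (path_ext h1 h.1) h.2.1
  · rintro (rfl | ⟨h, h', hN, rfl⟩)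
    · exact ⟨rfl, rfl⟩
    · refine ⟨rfl, ?_⟩
      exact (hN.swap (canMove_last (init y)) (canMove_last y)).2.2

/-- Each entry of the matrix depends on its column only, and the rows that meet a column are the
path and the one with its last two steps interchanged. The extension by zero covers steps that
cannot be interchanged; equal steps cause no double count since the coefficient is then 0. -/
theorem vecMul_topE (f : Path (m + 2) → Kq) (y : Path (m + 2)) :
    Matrix.vecMul f (topE m).1 y = semi (last2 y) (last y) *
      (ext2 f (init (init y)) (last2 y) (last y) + ext2 f (init (init y)) (last y) (last2 y)) := by
  classical
  rw [Matrix.vecMul, dotProduct]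
  simp only [topE_apply]
  by_cases hs : last2 y = last y
  · simp [hs, semi_self]
  rw [ext2_self]
  have h1 : ∀ x, f x * (if init (init x) = init (init y) ∧ tip x = tip y
      then semi (last2 y) (last y) else 0) = semi (last2 y) (last y) *
      if init (init x) = init (init y) ∧ tip x = tip y then f x else 0 := by
    intro x; split_ifs <;> ring
  rw [sum_congr rfl fun x _ => h1 x, ← mul_sum, ← sum_filter]
  congr 1
  by_cases hN : Nadj (last2 y) (last y)
  · have hsw := hN.swap (canMove_last (init y)) (canMove_last y)
    have h2 : (univ.filter fun x => init (init x) = init (init y) ∧ tip x = tip y) =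
        {y, snoc (snoc (init (init y)) (last y) hsw.1) (last2 y) hsw.2.1} := by
      ext x
      simp only [mem_filter, mem_univ, true_and, mem_insert, mem_singleton]
      rw [related_iff]
      constructor
      · rintro (h | ⟨_, _, _, h⟩)
        · exact Or.inl h
        · exact Or.inr h
      · rintro (h | h)
        · exact Or.inl h
        · exact Or.inr ⟨hsw.1, hsw.2.1, hN, h⟩
    rw [h2, sum_pair, ext2, dif_pos hsw.1, dif_pos hsw.2.1]
    intro e
    exact hs (congrArg (fun z : Path (m + 2) => last z) e).symm
  · have h2 : (univ.filter fun x => init (init x) = init (init y) ∧ tip x = tip y) = {y} := by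
      ext x
      simp only [mem_filter, mem_univ, true_and, mem_singleton]
      rw [related_iff]
      constructor
      · rintro (h | ⟨_, _, h, _⟩)
        · exact h
        · exact absurd h hN
      · exact Or.inl
    rw [h2, sum_singleton, ext2]
    split_ifs with h3 h4
    · exact absurd (nadj_of_canMove (canMove_last (init y)) h3 hs) hN
    · rw [add_zero]
    · rw [add_zero]

end Blocks

/-! ### The braid relation of the seminormal matrices -/

section Braid

open Finset

variable {n m : ℕ}

open Classical in
theorem vecMul_incl (f : Path (n + 1) → Kq) (a : Blk n) (y : Path (n + 1)) :
    Matrix.vecMul f (incl n a).1 y = Matrix.vecMul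
      (fun p : Path n => if h : CanMove (last y) (tip p) then f (snoc p (last y) h) else 0) a.1
        (init y) := by
  simp only [Matrix.vecMul, dotProduct]
  have h1 : ∀ x : Path (n + 1), f x * (incl n a).1 x y =
      if last x = last y then f x * a.1 (init x) (init y) else 0 := by
    intro x
    rw [incl_apply]
    split_ifs <;> simp
  rw [sum_congr rfl fun x _ => h1 x, sum_last_eq (last y) fun x => f x * a.1 (init x) (init y)]
  refine sum_congr rfl fun p _ => ?_
  split_ifs <;> simp

/-- Three possible consecutive steps. -/
def Can3 (S : Maya) (i j k : WithTop ℤ) : Prop :=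
  CanMove i S ∧ CanMove j (move i S) ∧ CanMove k (move j (move i S))

theorem can3_self (y : Path (m + 3)) :
    Can3 (tip (init (init (init y)))) (last (init (init y))) (last (init y)) (last y) :=
  ⟨canMove_last (init (init y)), canMove_last (init y), canMove_last y⟩

theorem eq_top_of_canMove {i : WithTop ℤ} {S : Maya} (h : CanMove i S) (h' : CanMove i (move i S)) :
    i = ⊤ := by
  induction i using WithTop.recTopCoe with
  | top => rfl
  | coe i =>
    rw [canMove_coe, mem_move, mem_move] at h'
    exact absurd (Or.inl rfl) h'.2

theorem Adj.not_canMove {i j : WithTop ℤ} {S : Maya} (h : Adj i j) (hi : CanMove i S)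
    (hj : CanMove j S) : False := by
  obtain ⟨a, b, rfl, rfl, h⟩ := h
  rw [canMove_coe] at hi hj
  grind

theorem Can3.ne13 {S : Maya} {i j k : WithTop ℤ} (h : Can3 S i j k) (e : i = k) : i = ⊤ := by
  subst e
  obtain ⟨h1, h2, h3⟩ := h
  induction i using WithTop.recTopCoe with
  | top => rfl
  | coe i =>
    induction j using WithTop.recTopCoe with
    | top => exact eq_top_of_canMove h1 h3
    | coe j =>
      rw [canMove_coe] at h1 h2 h3
      simp only [mem_move] at h2 h3
      grind

/-- Neighbouring steps have a forced relative order, whatever the third step is: the rearrangements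
excluded are precisely those that reverse i and j. `Can3.adj23` and `Can3.adj13` treat the other two
positions of the neighbouring pair. -/
theorem Can3.adj12 {S : Maya} {i j k : WithTop ℤ} (h : Can3 S i j k) (hA : Adj i j) :
    ¬ Can3 S j i k ∧ ¬ Can3 S j k i ∧ ¬ Can3 S k j i := by
  obtain ⟨a, b, rfl, rfl, hab⟩ := hA
  refine ⟨fun h' => Adj.not_canMove ⟨a, b, rfl, rfl, hab⟩ h.1 h'.1,
    fun h' => Adj.not_canMove ⟨a, b, rfl, rfl, hab⟩ h.1 h'.1, fun h' => ?_⟩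
  induction k using WithTop.recTopCoe with
  | top => exact Adj.not_canMove ⟨a, b, rfl, rfl, hab⟩ h.1 h'.2.1
  | coe k =>
    obtain ⟨h1, h2, h3⟩ := h
    obtain ⟨h4, h5, h6⟩ := h'
    rw [canMove_coe] at h1 h2 h3 h4 h5 h6
    simp only [mem_move] at h2 h3 h5 h6
    grind

theorem Can3.adj23 {S : Maya} {i j k : WithTop ℤ} (h : Can3 S i j k) (hA : Adj j k) :
    ¬ Can3 S i k j ∧ ¬ Can3 S k i j ∧ ¬ Can3 S k j i := by
  refine ⟨fun h' => Adj.not_canMove hA h.2.1 h'.2.1, fun h' => ?_, fun h' => ?_⟩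
  · obtain ⟨a, b, rfl, rfl, hab⟩ := hA
    obtain ⟨h1, h2, h3⟩ := h
    obtain ⟨h4, h5, h6⟩ := h'
    induction i using WithTop.recTopCoe with
    | top =>
      rw [move_top] at h2
      exact Adj.not_canMove ⟨a, b, rfl, rfl, hab⟩ h2 h4
    | coe i =>
      rw [canMove_coe] at h1 h2 h3 h4 h5 h6
      simp only [mem_move] at h2 h3 h5 h6
      grind
  · obtain ⟨a, b, rfl, rfl, hab⟩ := hA
    obtain ⟨h1, h2, h3⟩ := h
    obtain ⟨h4, h5, h6⟩ := h'
    induction i using WithTop.recTopCoe with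
    | top => exact Adj.not_canMove ⟨a, b, rfl, rfl, hab⟩ h2 h4
    | coe i =>
      rw [canMove_coe] at h1 h2 h3 h4 h5 h6
      simp only [mem_move] at h2 h3 h5 h6
      grind

theorem Can3.adj13 {S : Maya} {i j k : WithTop ℤ} (h : Can3 S i j k) (hA : Adj i k) :
    ¬ Can3 S j k i ∧ ¬ Can3 S k i j ∧ ¬ Can3 S k j i := by
  refine ⟨fun h' => ?_, fun h' => Adj.not_canMove hA h.1 h'.1,
    fun h' => Adj.not_canMove hA h.1 h'.1⟩
  obtain ⟨a, b, rfl, rfl, hab⟩ := hA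
  obtain ⟨h1, h2, h3⟩ := h
  obtain ⟨h4, h5, h6⟩ := h'
  induction j using WithTop.recTopCoe with
  | top => exact Adj.not_canMove ⟨a, b, rfl, rfl, hab⟩ h1 h5
  | coe j =>
    rw [canMove_coe] at h1 h2 h3 h4 h5 h6
    simp only [mem_move] at h2 h3 h5 h6
    grind

theorem Can3.swap12 {S : Maya} {i j k : WithTop ℤ} (h : Can3 S i j k) (hA : ¬ Adj i j) :
    Can3 S j i k := by
  rcases adj_or i j with rfl | h' | h'
  · exact h
  · exact absurd h' hA
  · obtain ⟨h1, h2, h3⟩ := h'.swap h.1 h.2.1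
    exact ⟨h1, h2, h3 ▸ h.2.2⟩

theorem Can3.swap23 {S : Maya} {i j k : WithTop ℤ} (h : Can3 S i j k) (hA : ¬ Adj j k) :
    Can3 S i k j := by
  rcases adj_or j k with rfl | h' | h'
  · exact h
  · exact absurd h' hA
  · obtain ⟨h1, h2, _⟩ := h'.swap h.2.1 h.2.2
    exact ⟨h.1, h1, h2⟩

open Classical in
/-- The action of the first of two adjacent generators on functions of three steps. -/
def stepOp1 (S : Maya) (g : WithTop ℤ → WithTop ℤ → WithTop ℤ → Kq) (i j k : WithTop ℤ) : Kq :=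
  if Can3 S i j k then semi i j * (g i j k + g j i k) else 0

open Classical in
/-- The action of the second of two adjacent generators on functions of three steps. -/
def stepOp2 (S : Maya) (g : WithTop ℤ → WithTop ℤ → WithTop ℤ → Kq) (i j k : WithTop ℤ) : Kq :=
  if Can3 S i j k then semi j k * (g i j k + g i k j) else 0

/-- The expansion holds without regard to which rearrangements of the steps are possible: for an
impossible one either the values of g vanish, or a product of `semi i j` and `semi j i` for
neighbouring steps does. This makes one scalar identity cover all cases. -/
theorem stepOp1_121 {S : Maya} {g : WithTop ℤ → WithTop ℤ → WithTop ℤ → Kq}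
    (hg : ∀ i j k, ¬ Can3 S i j k → g i j k = 0) {i j k : WithTop ℤ} (h : Can3 S i j k) :
    stepOp1 S (stepOp2 S (stepOp1 S g)) i j k =
      semi i j * (semi j k * (semi i j * (g i j k + g j i k) + semi i k * (g i k j + g k i j)) +
        semi i k * (semi j i * (g j i k + g i j k) + semi j k * (g j k i + g k j i))) := by
  rw [stepOp1, if_pos h, stepOp2, if_pos h, stepOp1, if_pos h]
  have e1 : semi j k * stepOp1 S g i k j = semi j k * (semi i k * (g i k j + g k i j)) := by
    by_cases hA : Adj j k
    · have := h.adj23 hA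
      rw [stepOp1, if_neg this.1, hg _ _ _ this.1, hg _ _ _ this.2.1]
      ring
    · rw [stepOp1, if_pos (h.swap23 hA)]
  have e2 : semi i j * stepOp2 S (stepOp1 S g) j i k = semi i j * (semi i k *
      (semi j i * (g j i k + g i j k) + semi j k * (g j k i + g k j i))) := by
    by_cases hA : Adj i j
    · have := h.adj12 hA
      rw [stepOp2, if_neg this.1, hg _ _ _ this.1, hg _ _ _ this.2.1, hg _ _ _ this.2.2]
      rcases hA.semi with h0 | h0 <;> rw [h0.1, h0.2] <;> ring
    · have h2 := h.swap12 hA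
      rw [stepOp2, if_pos h2, stepOp1, if_pos h2]
      by_cases hA' : Adj i k
      · have := h.adj13 hA'
        rw [stepOp1, if_neg this.1, hg _ _ _ this.1, hg _ _ _ this.2.2]
        ring
      · rw [stepOp1, if_pos (h2.swap23 hA')]
  linear_combination semi i j * e1 + e2

theorem stepOp2_212 {S : Maya} {g : WithTop ℤ → WithTop ℤ → WithTop ℤ → Kq}
    (hg : ∀ i j k, ¬ Can3 S i j k → g i j k = 0) {i j k : WithTop ℤ} (h : Can3 S i j k) :
    stepOp2 S (stepOp1 S (stepOp2 S g)) i j k =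
      semi j k * (semi i j * (semi j k * (g i j k + g i k j) + semi i k * (g j i k + g j k i)) +
        semi i k * (semi k j * (g i k j + g i j k) + semi i j * (g k i j + g k j i))) := by
  rw [stepOp2, if_pos h, stepOp1, if_pos h, stepOp2, if_pos h]
  have e1 : semi i j * stepOp2 S g j i k = semi i j * (semi i k * (g j i k + g j k i)) := by
    by_cases hA : Adj i j
    · have := h.adj12 hA
      rw [stepOp2, if_neg this.1, hg _ _ _ this.1, hg _ _ _ this.2.1]
      ring
    · rw [stepOp2, if_pos (h.swap12 hA)]
  have e2 : semi j k * stepOp1 S (stepOp2 S g) i k j = semi j k * (semi i k *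
      (semi k j * (g i k j + g i j k) + semi i j * (g k i j + g k j i))) := by
    by_cases hA : Adj j k
    · have := h.adj23 hA
      rw [stepOp1, if_neg this.1, hg _ _ _ this.1, hg _ _ _ this.2.1, hg _ _ _ this.2.2]
      rcases hA.semi with h0 | h0 <;> rw [h0.1, h0.2] <;> ring
    · have h2 := h.swap23 hA
      rw [stepOp1, if_pos h2, stepOp2, if_pos h2]
      by_cases hA' : Adj i k
      · have := h.adj13 hA'
        rw [stepOp2, if_neg this.2.1, hg _ _ _ this.2.1, hg _ _ _ this.2.2]
        ring
      · rw [stepOp2, if_pos (h2.swap12 hA')]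
  linear_combination semi j k * e1 + e2

open Classical in
/-- The value of a function at a path, extended by zero to sequences of steps that are not
possible. -/
def ext3 (f : Path (m + 3) → Kq) (κ : Path m) (i j k : WithTop ℤ) : Kq :=
  if h : Can3 (tip κ) i j k then f (snoc (snoc (snoc κ i h.1) j h.2.1) k h.2.2) else 0

theorem ext3_self (f : Path (m + 3) → Kq) (y : Path (m + 3)) :
    ext3 f (init (init (init y))) (last (init (init y))) (last (init y)) (last y) = f y := by
  rw [ext3, dif_pos (can3_self y)]
  rfl

theorem ext3_eq_ext2 (f : Path (m + 3) → Kq) (κ : Path m) (i j k : WithTop ℤ) :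
    ext3 f κ i j k = ext2 (fun p => open Classical in
      if h : CanMove k (tip p) then f (snoc p k h) else 0) κ i j := by
  rw [ext3, ext2]
  by_cases h1 : CanMove i (tip κ)
  · by_cases h2 : CanMove j (move i (tip κ))
    · rw [dif_pos h1, dif_pos h2]
      by_cases h3 : CanMove k (move j (move i (tip κ)))
      · rw [dif_pos ⟨h1, h2, h3⟩]
        split_ifs with h4
        · rfl
        · exact absurd h3 h4
      · rw [dif_neg fun h => h3 h.2.2]
        split_ifs with h4
        · exact absurd h4 h3
        · rfl
    · rw [dif_neg fun h => h2 h.2.1, dif_pos h1, dif_neg h2]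
  · rw [dif_neg fun h => h1 h.1, dif_neg h1]

theorem ext3_eq_ext2' (f : Path (m + 3) → Kq) (κ : Path m) (i j k : WithTop ℤ)
    (hi : CanMove i (tip κ)) :
    ext3 f κ i j k = ext2 f (snoc κ i hi) j k := by
  rw [ext3, ext2]
  by_cases h2 : CanMove j (tip (snoc κ i hi))
  · rw [dif_pos h2]
    by_cases h3 : CanMove k (move j (tip (snoc κ i hi)))
    · rw [dif_pos ⟨hi, h2, h3⟩, dif_pos h3]
    · rw [dif_neg fun h => h3 h.2.2, dif_neg h3]
  · rw [dif_neg fun h => h2 h.2.1, dif_neg h2]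

theorem ext3_vecMul_incl_topE (f : Path (m + 3) → Kq) (κ : Path m) :
    ext3 (Matrix.vecMul f (incl (m + 2) (topE m)).1) κ = stepOp1 (tip κ) (ext3 f κ) := by
  funext i j k
  rw [stepOp1]
  split_ifs with h
  · rw [ext3, dif_pos h, vecMul_incl, vecMul_topE, ext3_eq_ext2, ext3_eq_ext2]
    rfl
  · rw [ext3, dif_neg h]

theorem ext3_vecMul_topE (f : Path (m + 3) → Kq) (κ : Path m) :
    ext3 (Matrix.vecMul f (topE (m + 1)).1) κ = stepOp2 (tip κ) (ext3 f κ) := by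
  funext i j k
  rw [stepOp2]
  split_ifs with h
  · rw [ext3, dif_pos h, vecMul_topE, ext3_eq_ext2' _ _ _ _ _ h.1, ext3_eq_ext2' _ _ _ _ _ h.1]
    rfl
  · rw [ext3, dif_neg h]

theorem blk_ext_vecMul {a b : Blk n} (h : ∀ (f : Path n → Kq) y,
    Matrix.vecMul f a.1 y = Matrix.vecMul f b.1 y) : a = b :=
  Blk.ext' fun x y => by
    have := h (Pi.single x 1) y
    rwa [Matrix.single_one_vecMul, Matrix.single_one_vecMul] at this

/-- Both matrices fix everything but the last three steps, so on functions with a fixed beginning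
they become `stepOp1` and `stepOp2`. Their expansions reduce the relation to `braid_semi`. -/
theorem topE_braid (m : ℕ) :
    incl (m + 2) (topE m) * topE (m + 1) * incl (m + 2) (topE m) - qq • incl (m + 2) (topE m) =
      topE (m + 1) * incl (m + 2) (topE m) * topE (m + 1) - qq • topE (m + 1) := by
  refine blk_ext_vecMul fun f y => ?_
  set κ := init (init (init y))
  have e1 : Matrix.vecMul f (incl (m + 2) (topE m) * topE (m + 1) * incl (m + 2) (topE m)).1 y =
      stepOp1 (tip κ) (stepOp2 (tip κ) (stepOp1 (tip κ) (ext3 f κ))) (last (init (init y)))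
        (last (init y)) (last y) := by
    rw [← ext3_vecMul_incl_topE, ← ext3_vecMul_topE, ← ext3_vecMul_incl_topE, ext3_self,
      Matrix.vecMul_vecMul, Matrix.vecMul_vecMul, ← Matrix.mul_assoc]
    rfl
  have e2 : Matrix.vecMul f (topE (m + 1) * incl (m + 2) (topE m) * topE (m + 1)).1 y =
      stepOp2 (tip κ) (stepOp1 (tip κ) (stepOp2 (tip κ) (ext3 f κ))) (last (init (init y)))
        (last (init y)) (last y) := by
    rw [← ext3_vecMul_topE, ← ext3_vecMul_incl_topE, ← ext3_vecMul_topE, ext3_self,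
      Matrix.vecMul_vecMul, Matrix.vecMul_vecMul, ← Matrix.mul_assoc]
    rfl
  have e3 : Matrix.vecMul f (incl (m + 2) (topE m)).1 y =
      stepOp1 (tip κ) (ext3 f κ) (last (init (init y))) (last (init y)) (last y) := by
    rw [← ext3_vecMul_incl_topE, ext3_self]
  have e4 : Matrix.vecMul f (topE (m + 1)).1 y =
      stepOp2 (tip κ) (ext3 f κ) (last (init (init y))) (last (init y)) (last y) := by
    rw [← ext3_vecMul_topE, ext3_self]
  have hsub : ∀ a b : Blk (m + 3), Matrix.vecMul f (a - qq • b).1 y =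
      Matrix.vecMul f a.1 y - qq * Matrix.vecMul f b.1 y := by
    intro a b
    change Matrix.vecMul f (a.1 - qq • b.1) y = _
    rw [Matrix.vecMul_sub, Matrix.vecMul_smul]
    rfl
  have hV := can3_self y
  have hg : ∀ i j k, ¬ Can3 (tip κ) i j k → ext3 f κ i j k = 0 := fun i j k h => dif_neg h
  rw [hsub, hsub, e1, e2, e3, e4, stepOp1_121 hg hV, stepOp2_212 hg hV, stepOp1, if_pos hV,
    stepOp2, if_pos hV]
  -- In three possible consecutive steps, only the idle step can occur twice.
  refine braid_semi (fun h => ?_) (fun h => ?_) hV.ne13 _ _ _ _ _ _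
  · refine eq_top_of_canMove hV.1 ?_
    have := hV.2.1
    rwa [← h] at this
  · refine eq_top_of_canMove hV.2.1 ?_
    have := hV.2.2
    rwa [← h] at this

end Braid

/-! ### The defining relations for the seminormal matrices, and the Jucys–Murphy elements -/

section SeminormalRelations

open Finset

variable {n m : ℕ}

theorem related_cases {x y : Path (m + 2)}
    (h : init (init x) = init (init y) ∧ tip x = tip y) : x = y ∨ (x ≠ y ∧
      init (init x) = init (init y) ∧ last (init x) = last y ∧ last x = last (init y) ∧
      Nadj (last2 y) (last y)) := by
  rcases related_iff.1 h with rfl | ⟨_, _, hN, rfl⟩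
  · exact Or.inl rfl
  · exact Or.inr ⟨fun e => hN.ne (congrArg (fun z : Path (m + 2) => last z) e), rfl, rfl, rfl, hN⟩

theorem vecMul_mul (f : Path n → Kq) (a b : Blk n) :
    Matrix.vecMul f (a * b).1 = Matrix.vecMul (Matrix.vecMul f a.1) b.1 :=
  (Matrix.vecMul_vecMul f a.1 b.1).symm

theorem vecMul_dg (f g : Path n → Kq) (y : Path n) :
    Matrix.vecMul f (dg g).1 y = f y * g y := Matrix.vecMul_diagonal _ _ _

theorem vecMul_add' (f : Path n → Kq) (a b : Blk n) :
    Matrix.vecMul f (a + b).1 = Matrix.vecMul f a.1 + Matrix.vecMul f b.1 :=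
  Matrix.vecMul_add _ _ _

theorem vecMul_smul' (f : Path n → Kq) (c : Kq) (a : Blk n) :
    Matrix.vecMul f (c • a).1 = c • Matrix.vecMul f a.1 :=
  Matrix.vecMul_smul _ _ _

/-- Two possible consecutive steps. -/
def Can2 (S : Maya) (i j : WithTop ℤ) : Prop := CanMove i S ∧ CanMove j (move i S)

theorem can2_self (y : Path (m + 2)) : Can2 (tip (init (init y))) (last2 y) (last y) :=
  ⟨canMove_last (init y), canMove_last y⟩

theorem ext2_of_can {f : Path (m + 2) → Kq} {κ : Path m} {i j : WithTop ℤ}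
    (h : Can2 (tip κ) i j) : ext2 f κ i j = f (snoc (snoc κ i h.1) j h.2) := by
  rw [ext2, dif_pos h.1, dif_pos h.2]

theorem ext2_of_not {f : Path (m + 2) → Kq} {κ : Path m} {i j : WithTop ℤ}
    (h : ¬ Can2 (tip κ) i j) : ext2 f κ i j = 0 := by
  rw [ext2]
  split_ifs with h1 h2
  · exact absurd ⟨h1, h2⟩ h
  · rfl
  · rfl

open Classical in
theorem ext2_vecMul_topE (f : Path (m + 2) → Kq) (κ : Path m) (i j : WithTop ℤ) :
    ext2 (Matrix.vecMul f (topE m).1) κ i j =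
      if Can2 (tip κ) i j then semi i j * (ext2 f κ i j + ext2 f κ j i) else 0 := by
  split_ifs with h
  · rw [ext2_of_can h, vecMul_topE]
    rfl
  · exact ext2_of_not h

theorem ext2_vecMul_incl_incl (f : Path (m + 2) → Kq) (a : Blk m) (κ : Path m)
    (i j : WithTop ℤ) : ext2 (Matrix.vecMul f (incl (m + 1) (incl m a)).1) κ i j =
      ∑ κ', ext2 f κ' i j * a.1 κ' κ := by
  by_cases h : Can2 (tip κ) i j
  · rw [ext2_of_can h, vecMul_incl, vecMul_incl, Matrix.vecMul, dotProduct]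
    rfl
  · rw [ext2_of_not h]
    refine (sum_eq_zero fun κ' _ => ?_).symm
    by_cases ht : tip κ' = tip κ
    · rw [ext2_of_not (by rwa [ht]), zero_mul]
    · rw [Blk.zero_of_ne a ht, mul_zero]

/-- One matrix rearranges the last two steps with coefficients that depend on these steps only; the
other changes the beginning without changing its end point. -/
theorem topE_comm_incl_incl (m : ℕ) (a : Blk m) :
    topE m * incl (m + 1) (incl m a) = incl (m + 1) (incl m a) * topE m := by
  refine blk_ext_vecMul fun f y => ?_
  rw [vecMul_mul, vecMul_mul, vecMul_topE, ext2_vecMul_incl_incl, ext2_vecMul_incl_incl,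
    ← ext2_self (Matrix.vecMul _ _) y, ext2_vecMul_incl_incl, ← sum_add_distrib, mul_sum]
  refine sum_congr rfl fun κ' _ => ?_
  by_cases ht : tip κ' = tip (init (init y))
  · rw [ext2_vecMul_topE, if_pos (by rw [ht]; exact can2_self y)]
    ring
  · rw [Blk.zero_of_ne a ht]
    ring

theorem not_can2_of_adj {S : Maya} {i j : WithTop ℤ} (h : Can2 S i j) (hA : Adj i j) :
    ¬ Can2 S j i := fun h' => hA.not_canMove h.1 h'.1

theorem can2_of_nadj {S : Maya} {i j : WithTop ℤ} (h : Can2 S i j) (hN : Nadj i j) :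
    Can2 S j i := by
  have := hN.swap h.1 h.2
  exact ⟨this.1, this.2.1⟩

/-- The indicator of the finite steps. -/
def finStep (i : WithTop ℤ) : Kq := open Classical in if i = ⊤ then 0 else 1

@[simp] theorem finStep_top : finStep ⊤ = 0 := if_pos rfl

@[simp] theorem finStep_coe (i : ℤ) : finStep i = 1 := if_neg WithTop.coe_ne_top

theorem Can2.eq_top {S : Maya} {i : WithTop ℤ} (h : Can2 S i i) : i = ⊤ :=
  eq_top_of_canMove h.1 h.2

-- Interchangeable steps have coefficients with sum q+1. Neighbouring steps have no partner, but
-- there the coefficient is itself 0 or q+1, and for equal steps both sides vanish.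
open Classical in
theorem semi_sum {S : Maya} {i j : WithTop ℤ} (h : Can2 S i j) :
    semi i j * (semi i j + if Can2 S j i then semi j i else 0) = semi i j * (qq + 1) := by
  rcases adj_or i j with rfl | hA | hN
  · simp [semi_self]
  · rw [if_neg (not_can2_of_adj h hA)]
    rcases hA.semi with h0 | h0 <;> rw [h0.1] <;> ring
  · rw [if_pos (can2_of_nadj h hN), semi_add_semi hN.ne]

-- The form of `semi_sum` with a test of the next-to-last step inserted. It is new only when an idle
-- step is involved, and then it rests on `semi_top`.
open Classical in
theorem semi_sum_finStep {S : Maya} {i j : WithTop ℤ} (h : Can2 S i j) :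
    semi i j * (semi i j * finStep i + (if Can2 S j i then semi j i else 0) * finStep j) =
      semi i j * (qq * (finStep i * finStep j) + 1) := by
  have h0 := semi_sum h
  induction i using WithTop.recTopCoe with
  | top =>
    induction j using WithTop.recTopCoe with
    | top => simp [semi_self]
    | coe j =>
      rw [if_pos (can2_of_nadj h trivial), semi_top]
      simp
  | coe i =>
    induction j using WithTop.recTopCoe with
    | top => simp [semi_top]
    | coe j =>
      simp only [finStep_coe, mul_one]
      exact h0

theorem topE_sq (m : ℕ) : topE m * topE m = (qq + 1) • topE m := by
  classical
  refine blk_ext_vecMul fun f y => ?_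
  have h := can2_self y
  rw [vecMul_mul, vecMul_smul', Pi.smul_apply, smul_eq_mul, vecMul_topE, vecMul_topE,
    ext2_vecMul_topE, ext2_vecMul_topE, if_pos h]
  have h0 := semi_sum h
  split_ifs at h0 ⊢ with h1
  · linear_combination (ext2 f (init (init y)) (last2 y) (last y) +
      ext2 f (init (init y)) (last y) (last2 y)) * h0
  · linear_combination (ext2 f (init (init y)) (last2 y) (last y) +
      ext2 f (init (init y)) (last y) (last2 y)) * h0

variable (n) in
/-- The idempotent of the paths without the step `⊤`. -/
def full : Blk n := dg fun p => if size (tip p) = n then 1 else 0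

theorem full_comm (a : Blk n) : a * full n = full n * a := by
  refine Blk.ext' fun p q => ?_
  rw [full, mul_dg_apply, dg_mul_apply]
  by_cases h : tip p = tip q
  · rw [h, mul_comm]
  · rw [Blk.zero_of_ne a h]
    ring

theorem full_sq : full n * full n = full n := by
  rw [full, dg_mul_dg]
  congr 1
  funext p
  split_ifs <;> simp

theorem full_zero : full 0 = 1 := by
  rw [full, ← dg_one]
  congr 1
  funext p
  rw [if_pos]
  have h1 := size_tip_le p
  have h2 := size_nonneg (tip p)
  omega

theorem full_indicator (i : WithTop ℤ) {S : Maya} (h : CanMove i S) (hs : size S ≤ n) :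
    (if size (move i S) = (n + 1 : ℕ) then (1 : Kq) else 0) =
      (if size S = n then 1 else 0) * finStep i := by
  induction i using WithTop.recTopCoe with
  | top =>
    rw [move_top, if_neg, finStep_top, mul_zero]
    push_cast
    omega
  | coe i =>
    rw [size_move h, finStep_coe, mul_one]
    push_cast
    exact if_congr (by omega) rfl rfl

theorem full_succ_apply (x : Path (n + 1)) :
    (if size (tip x) = (n + 1 : ℕ) then (1 : Kq) else 0) =
      (if size (tip (init x)) = n then 1 else 0) * finStep (last x) :=
  full_indicator (last x) (canMove_last x) (size_tip_le _)

theorem incl_full_mul_full : incl n (full n) * full (n + 1) = full (n + 1) := by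
  rw [full, incl_dg, full, dg_mul_dg]
  congr 1
  funext x
  rw [full_succ_apply]
  split_ifs <;> simp

/-- The matrix in the middle tests the beginning, which is fixed by the outer factors, and the
next-to-last step; what remains is `semi_sum_finStep`. -/
theorem topE_full_topE (m : ℕ) : topE m * incl (m + 1) (full (m + 1)) * topE m =
    topE m * (qq • full (m + 2) + incl (m + 1) (incl m (full m))) := by
  classical
  refine blk_ext_vecMul fun f y => ?_
  set κ := init (init y)
  set i := last2 y
  set j := last y
  have h : Can2 (tip κ) i j := can2_self y
  set s : Kq := if size (tip κ) = m then 1 else 0 with hs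
  have hr : Matrix.vecMul f (topE m * (qq • full (m + 2) + incl (m + 1) (incl m (full m)))).1 y =
      semi i j * (ext2 f κ i j + ext2 f κ j i) * (qq * (s * finStep i * finStep j) + s) := by
    rw [vecMul_mul, vecMul_add', Pi.add_apply, vecMul_smul', Pi.smul_apply, full, full, incl_dg,
      incl_dg, vecMul_dg, vecMul_dg, vecMul_topE, full_succ_apply, full_succ_apply, smul_eq_mul]
    ring
  have hd : ∀ (g : Path (m + 2) → Kq) (a b : WithTop ℤ),
      ext2 (Matrix.vecMul g (incl (m + 1) (full (m + 1))).1) κ a b =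
        ext2 g κ a b * (s * finStep a) := by
    intro g a b
    by_cases hab : Can2 (tip κ) a b
    · rw [ext2_of_can hab, ext2_of_can hab, full, incl_dg, vecMul_dg]
      exact congrArg _ (full_indicator a hab.1 (size_tip_le κ))
    · rw [ext2_of_not hab, ext2_of_not hab, zero_mul]
  rw [hr, vecMul_mul, vecMul_mul, vecMul_topE, hd, hd, ext2_vecMul_topE, ext2_vecMul_topE,
    if_pos h]
  have h0 := semi_sum_finStep h
  split_ifs at h0 ⊢ with h1
  · linear_combination (ext2 f κ i j + ext2 f κ j i) * s * h0
  · linear_combination (ext2 f κ i j + ext2 f κ j i) * s * h0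

/-- If the steps before the last are finite for both paths and the two paths are related by an
interchange, their last steps are finite too. On the diagonal, a finite step followed by an idle one
has coefficient 1 by `semi_top`, so T has entry 0 there. -/
theorem full_topE_full (m : ℕ) :
    incl (m + 1) (full (m + 1)) * (topE m - 1) * incl (m + 1) (full (m + 1)) =
      full (m + 2) * (topE m - 1) := by
  classical
  refine Blk.ext' fun x y => ?_
  have hF : incl (m + 1) (full (m + 1)) =
      dg fun x : Path (m + 2) => if size (tip (init x)) = (m + 1 : ℕ) then (1 : Kq) else 0 := incl_dg _
  rw [hF, mul_dg_apply, dg_mul_apply, full, dg_mul_apply]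
  have hE : (topE m - 1).1 x y = (topE m).1 x y - (1 : Blk (m + 2)).1 x y := rfl
  have hl : last2 y = last (init y) := rfl
  rw [hE, topE_apply, Blk.one_apply, hl]
  simp only [full_succ_apply]
  by_cases hr : init (init x) = init (init y) ∧ tip x = tip y
  · rw [if_pos hr]
    rcases related_cases hr with rfl | ⟨hne, h1, h2, h3, hN⟩
    · rw [if_pos rfl]
      have hx := can2_self x
      change Can2 _ (last (init x)) (last x) at hx
      generalize last (init x) = i at *
      generalize last x = j at *
      induction j using WithTop.recTopCoe with
      | coe j =>
        induction i using WithTop.recTopCoe <;> split_ifs <;> simp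
      | top =>
        induction i using WithTop.recTopCoe <;> simp [semi_top]
    · rw [if_neg hne, h1, h2, h3]
      change Nadj (last (init y)) (last y) at hN
      generalize last (init y) = i at *
      generalize last y = j at *
      induction j using WithTop.recTopCoe with
      | coe j =>
        induction i using WithTop.recTopCoe <;> split_ifs <;> simp
      | top =>
        induction i using WithTop.recTopCoe <;> simp
  · have hne : x ≠ y := fun e => hr (by rw [e]; exact ⟨rfl, rfl⟩)
    rw [if_neg hr, if_neg hne]
    ring

/-- The seminormal matrices of the generators `T`. -/
def genT : (n : ℕ) → ℕ → Blk n
  | 0, _ => 0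
  | 1, _ => 0
  | m + 2, j => if j = m then topE m - 1 else incl (m + 1) (genT (m + 1) j)

/-- The seminormal matrices of the generators `e`. -/
def genE : (n : ℕ) → ℕ → Blk n
  | 0, _ => 1
  | n + 1, k => if k = n + 1 then full (n + 1) else incl n (genE n k)

theorem genT_top (m : ℕ) : genT (m + 2) m = topE m - 1 := if_pos rfl

theorem genT_succ {j : ℕ} (hj : j + 1 < n) : genT (n + 1) j = incl n (genT n j) := by
  match n, hj with
  | m + 1, hj => exact if_neg (by omega)

theorem genE_self : ∀ n, genE n n = full n
  | 0 => full_zero.symm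
  | _ + 1 => if_pos rfl

theorem genE_succ {k : ℕ} (hk : k ≤ n) : genE (n + 1) k = incl n (genE n k) := if_neg (by omega)

/-- Relations among the generators of smaller rank are transported by `incl`; only those that
involve the last T or the last idempotent are new, and they are the identities for `topE` and
`full`. -/
theorem rel_blk : ∀ n, Rel qq n (genT n) (genE n)
  | 0 =>
    { e_zero := rfl
      e_mul := fun i j hij hj => by
        obtain rfl : j = 0 := by omega
        obtain rfl : i = 0 := by omega
        exact ⟨one_mul 1, one_mul 1⟩
      T_e := fun j k hj => absurd hj (by omega)
      T_sq := fun j hj => absurd hj (by omega)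
      T_comm := fun i j _ hj => absurd hj (by omega)
      braid := fun j hj => absurd hj (by omega)
      eTe := fun j hj => absurd hj (by omega)
      TeT := fun j hj => absurd hj (by omega) }
  | n + 1 => by
    have ih := rel_blk n
    refine ⟨?_, ?_, ?_, ?_, ?_, ?_, ?_, ?_⟩
    · rw [genE_succ (Nat.zero_le n), ih.e_zero, map_one]
    · intro i j hij hj
      rcases Nat.lt_or_ge n j with h | h
      · obtain rfl : j = n + 1 := by omega
        rw [genE_self]
        have key : genE (n + 1) i * full (n + 1) = full (n + 1) := by
          rcases Nat.lt_or_ge n i with h' | h'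
          · obtain rfl : i = n + 1 := by omega
            rw [genE_self, full_sq]
          · rw [genE_succ h', ← incl_full_mul_full, ← mul_assoc, ← map_mul, ← genE_self,
              (ih.e_mul i n h' le_rfl).1]
        exact ⟨key, by rw [← full_comm, key]⟩
      · rw [genE_succ h, genE_succ (hij.trans h), ← map_mul, ← map_mul, (ih.e_mul i j hij h).1,
          (ih.e_mul i j hij h).2]
        exact ⟨rfl, rfl⟩
    · intro j k hj hk hkj
      rcases Nat.lt_or_ge n k with h | h
      · obtain rfl : k = n + 1 := by omega
        rw [genE_self, full_comm]
      · rcases Nat.lt_or_ge (j + 1) n with h' | h'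
        · rw [genT_succ h', genE_succ h, ← map_mul, ← map_mul, ih.T_e j k h' h hkj]
        · obtain rfl : n = j + 1 := by omega
          rw [genT_top, genE_succ h, genE_succ (by omega : k ≤ j), sub_mul, mul_sub, one_mul,
            mul_one, topE_comm_incl_incl]
    · intro j hj
      rcases Nat.lt_or_ge (j + 1) n with h' | h'
      · rw [genT_succ h', ← map_mul, ih.T_sq j h', map_add, map_smul, map_smul, map_one]
      · obtain rfl : n = j + 1 := by omega
        rw [genT_top, sub_mul, mul_sub, topE_sq]
        simp only [mul_one, one_mul, add_smul, sub_smul, one_smul, smul_sub]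
        abel
    · intro i j hij hj
      rcases Nat.lt_or_ge (j + 1) n with h' | h'
      · rw [genT_succ h', genT_succ (by omega), ← map_mul, ← map_mul, ih.T_comm i j hij h']
      · obtain rfl : n = j + 1 := by omega
        rw [genT_top, genT_succ (by omega), genT_succ hij, sub_mul, mul_sub, one_mul, mul_one,
          topE_comm_incl_incl]
    · intro j hj
      rcases Nat.lt_or_ge (j + 2) n with h' | h'
      · rw [genT_succ (by omega), genT_succ (by omega), ← map_mul, ← map_mul, ← map_mul, ← map_mul,
          ih.braid j h']
      · obtain rfl : n = j + 2 := by omega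
        rw [genT_top, genT_succ (by omega), genT_top, map_sub, map_one]
        have h1 := topE_braid j
        have h2 := topE_sq (j + 1)
        have h3 := congrArg (incl (j + 2)) (topE_sq j)
        rw [map_mul, map_smul] at h3
        generalize incl (j + 2) (topE j) = a at *
        generalize topE (j + 1) = b at *
        have h4 : ∀ x y : Blk (j + 3), (x - 1) * (y - 1) * (x - 1) =
            x * y * x - x * x - x * y - y * x + x + x + y - 1 := by intros; noncomm_ring
        rw [h4, h4, h2, h3]
        rw [sub_eq_sub_iff_add_eq_add] at h1
        have h5 : a * b * a = b * a * b + qq • a - qq • b := by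
          rw [eq_sub_iff_add_eq, h1]
        rw [h5]
        simp only [add_smul, one_smul]
        abel
    · intro j hj
      rcases Nat.lt_or_ge (j + 1) n with h' | h'
      · rw [genT_succ h', genE_succ (by omega), genE_succ (by omega), ← map_mul, ← map_mul,
          ← map_mul, ih.eTe j h']
      · obtain rfl : n = j + 1 := by omega
        rw [genT_top, genE_self, genE_succ le_rfl, genE_self, full_topE_full]
    · intro j hj
      rcases Nat.lt_or_ge (j + 1) n with h' | h'
      · have := congrArg (incl n) (ih.TeT j h')
        rw [map_mul, map_mul, map_mul, map_add, map_add, map_one, map_smul] at this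
        rw [genT_succ h', genE_succ (by omega), genE_succ (by omega), genE_succ (by omega), this]
      · obtain rfl : n = j + 1 := by omega
        rw [genT_top, genE_self, genE_succ le_rfl, genE_self, genE_succ (Nat.le_succ j),
          genE_succ le_rfl, genE_self, sub_add_cancel, topE_full_topE]

/-- The diagonal matrix of the eigenvalues of the last steps. -/
def lastDiag (n : ℕ) : Blk (n + 1) := dg fun x => eigenvalue (last x)

/-- This relation dictates the value of `semi`: it determines the diagonal entries where the last
two eigenvalues differ. Off the diagonal the two terms cancel because related paths have their last
two steps interchanged, and two idle steps contribute only zeros. -/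
theorem topE_lastDiag (m : ℕ) :
    topE m * incl (m + 1) (lastDiag m) - lastDiag (m + 1) * topE m =
      incl (m + 1) (lastDiag m) - qq • lastDiag (m + 1) := by
  classical
  refine Blk.ext' fun x y => ?_
  have h1 : (topE m * incl (m + 1) (lastDiag m) - lastDiag (m + 1) * topE m).1 x y =
      (topE m * incl (m + 1) (lastDiag m)).1 x y - (lastDiag (m + 1) * topE m).1 x y := rfl
  have h2 : (incl (m + 1) (lastDiag m) - qq • lastDiag (m + 1)).1 x y =
      (incl (m + 1) (lastDiag m)).1 x y - qq * (lastDiag (m + 1)).1 x y := rfl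
  rw [h1, h2, lastDiag, lastDiag, incl_dg, mul_dg_apply, dg_mul_apply, dg_apply, dg_apply,
    topE_apply]
  by_cases hr : init (init x) = init (init y) ∧ tip x = tip y
  · rw [if_pos hr]
    rcases related_cases hr with rfl | ⟨hne, _, _, h5, _⟩
    · rw [if_pos rfl, if_pos rfl]
      have hx := can2_self x
      change semi (last2 x) (last x) * eigenvalue (last2 x) - _ * semi (last2 x) (last x) =
        eigenvalue (last2 x) - _
      generalize last2 x = i at *
      generalize last x = j at *
      by_cases hij : i = j
      · subst hij
        rw [hx.eq_top]
        simp
      · have h3 : eigenvalue j - eigenvalue i ≠ 0 :=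
          sub_ne_zero.2 fun e => hij (eigenvalue_injective e).symm
        rw [semi]
        field_simp
        ring
    · rw [if_neg hne, if_neg hne, h5]
      ring
  · have hne : x ≠ y := fun e => hr (by rw [e]; exact ⟨rfl, rfl⟩)
    rw [if_neg hr, if_neg hne, if_neg hne]
    ring

/-- The commutation rule `topE_lastDiag` combined with the quadratic relation of T gives the
recursion of the Jucys–Murphy elements. -/
theorem genT_lastDiag (m : ℕ) :
    genT (m + 2) m * incl (m + 1) (lastDiag m) * genT (m + 2) m = qq • lastDiag (m + 1) := by
  have h1 := topE_lastDiag m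
  have h2 := (rel_blk (m + 2)).T_sq m (by omega)
  have h3 : genT (m + 2) m * incl (m + 1) (lastDiag m) =
      lastDiag (m + 1) * genT (m + 2) m - (qq - 1) • lastDiag (m + 1) := by
    rw [genT_top, sub_mul, mul_sub, mul_one, one_mul]
    rw [sub_eq_iff_eq_add] at h1
    rw [h1]
    simp only [sub_smul, one_smul]
    abel
  rw [h3, sub_mul, mul_assoc, h2]
  simp only [mul_add, mul_smul_comm, smul_mul_assoc, mul_one]
  abel

/-- From the vacuum only the particle at 0 can move. So the first step is 0, with eigenvalue 1, or
idle, with eigenvalue 0. -/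
theorem lastDiag_zero : lastDiag 0 = genE 1 1 := by
  rw [genE_self, lastDiag, full]
  congr 1
  funext x
  have hx := canMove_last x
  rw [full_succ_apply]
  have h0 : size (tip (init x)) = ((0 : ℕ) : ℤ) := by
    have h1 := size_tip_le (init x)
    have h2 := size_nonneg (tip (init x))
    omega
  rw [if_pos h0, one_mul]
  have hv : tip (init x) = vac := rfl
  rw [hv] at hx
  generalize last x = i at *
  induction i using WithTop.recTopCoe with
  | top => simp
  | coe i =>
    have h1 : i ≤ 0 := hx.1
    have h2 : ¬ i + 1 ≤ 0 := hx.2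
    obtain rfl : i = 0 := by omega
    rw [finStep_coe, eigenvalue_coe, zpow_zero]

end SeminormalRelations

/-! ### Matrix units, generation by the seminormal matrices, and a spanning set -/

section Generators

open Finset

variable {n m : ℕ}

open Classical in
/-- Matrix units; they are zero if the end points of the paths differ. -/
def mu (p q : Path n) : Blk n :=
  ⟨Matrix.of fun x y => if x = p ∧ y = q ∧ tip p = tip q then 1 else 0, fun x y h => by
    rw [Matrix.of_apply, if_neg]
    rintro ⟨rfl, rfl, h'⟩
    exact h h'⟩

open Classical in
theorem mu_apply (p q x y : Path n) :
    (mu p q).1 x y = if x = p ∧ y = q ∧ tip p = tip q then 1 else 0 := rfl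

theorem mu_of_ne {p q : Path n} (h : tip p ≠ tip q) : mu p q = 0 :=
  Blk.ext' fun x y => by rw [mu_apply, if_neg fun h' => h h'.2.2]; rfl

theorem mul_mu_apply (a : Blk n) {p q : Path n} (h : tip p = tip q) (x y : Path n) :
    (a * mu p q).1 x y = if y = q then a.1 x p else 0 := by
  classical
  rw [Blk.mul_apply, sum_eq_single p]
  · rw [mu_apply]
    by_cases hy : y = q
    · simp [hy, h]
    · simp [hy]
  · intro r _ hr
    rw [mu_apply, if_neg fun h' => hr h'.1, mul_zero]
  · simp

theorem mu_mul_apply (a : Blk n) {p q : Path n} (h : tip p = tip q) (x y : Path n) :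
    (mu p q * a).1 x y = if x = p then a.1 q y else 0 := by
  classical
  rw [Blk.mul_apply, sum_eq_single q]
  · rw [mu_apply]
    by_cases hy : x = p
    · simp [hy, h]
    · simp [hy]
  · intro r _ hr
    rw [mu_apply, if_neg fun h' => hr h'.2.1, zero_mul]
  · simp

theorem mu_mul_mu {p q r : Path n} (h : tip p = tip q) : mu p q * mu q r = mu p r := by
  classical
  refine Blk.ext' fun x y => ?_
  rw [mu_mul_apply _ h, mu_apply, mu_apply]
  by_cases hx : x = p
  · simp [hx, h]
  · simp [hx]

theorem mu_mul_mu_of_ne (p s : Path n) {q r : Path n} (h : q ≠ r) : mu p q * mu r s = 0 := by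
  classical
  by_cases ht : tip p = tip q
  · refine Blk.ext' fun x y => ?_
    rw [mu_mul_apply _ ht, mu_apply,
      if_neg (show ¬ (q = r ∧ y = s ∧ tip r = tip s) from fun h' => h h'.1), ite_self]
    rfl
  · rw [mu_of_ne ht, zero_mul]

theorem mu_mul_mul_mu (a : Blk n) {p q r s : Path n} (h : tip p = tip q) (h' : tip r = tip s)
    (ht : tip p = tip s) : mu p q * a * mu r s = a.1 q r • mu p s := by
  classical
  refine Blk.ext' fun x y => ?_
  rw [mul_mu_apply _ h', mu_mul_apply _ h]
  change _ = a.1 q r * (mu p s).1 x y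
  rw [mu_apply]
  by_cases hx : x = p <;> by_cases hy : y = s <;> simp [hx, hy, ht]

theorem blk_eq_sum (a : Blk n) : a = ∑ p, ∑ q, a.1 p q • mu p q := by
  classical
  refine Blk.ext' fun x y => ?_
  have h : ∀ s : Finset (Path n), ∀ f : Path n → Blk n, (∑ p ∈ s, f p).1 x y = ∑ p ∈ s, (f p).1 x y :=
    fun s f => by
      induction s using Finset.induction_on with
      | empty => rfl
      | insert a s ha ih =>
        rw [sum_insert ha, sum_insert ha, ← ih]
        rfl
  rw [h, sum_eq_single x, h, sum_eq_single y]
  · change _ = a.1 x y * (mu x y).1 x y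
    rw [mu_apply]
    by_cases ht : tip x = tip y
    · simp [ht]
    · simp [ht, Blk.zero_of_ne a ht]
  · intro q _ hq
    change a.1 x q * (mu x q).1 x y = 0
    rw [mu_apply, if_neg fun h' => hq h'.2.1.symm, mul_zero]
  · simp
  · intro p _ hp
    rw [h]
    refine sum_eq_zero fun q _ => ?_
    change a.1 p q * (mu p q).1 x y = 0
    rw [mu_apply, if_neg fun h' => hp h'.1.symm, mul_zero]
  · simp

theorem one_eq_sum_mu : (1 : Blk n) = ∑ p, mu p p := by
  classical
  conv_lhs => rw [blk_eq_sum 1]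
  refine sum_congr rfl fun p _ => ?_
  rw [sum_eq_single p]
  · rw [Blk.one_apply, if_pos rfl, one_smul]
  · intro q _ hq
    rw [Blk.one_apply, if_neg hq.symm, zero_smul]
  · simp

theorem blk_induction {P : Blk n → Prop} (h0 : P 0) (hadd : ∀ a b, P a → P b → P (a + b))
    (hsmul : ∀ (c : Kq) a, P a → P (c • a)) (hmu : ∀ p q, tip p = tip q → P (mu p q)) (a : Blk n) :
    P a := by
  rw [blk_eq_sum a]
  refine Finset.sum_induction _ P hadd h0 fun p _ => Finset.sum_induction _ P hadd h0 fun q _ => ?_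
  refine hsmul _ _ ?_
  by_cases h : tip p = tip q
  · exact hmu p q h
  · rw [mu_of_ne h]; exact h0

open Classical in
/-- The idempotent of the paths with a given last step. -/
def lastProj (n : ℕ) (i : WithTop ℤ) : Blk (n + 1) := dg fun x => if last x = i then 1 else 0

theorem lastProj_mul_incl_mu {p q : Path n} {i : WithTop ℤ} (hp : CanMove i (tip p))
    (hq : CanMove i (tip q)) (h : tip p = tip q) :
    lastProj n i * incl n (mu p q) = mu (snoc p i hp) (snoc q i hq) := by
  classical
  refine Blk.ext' fun x y => ?_
  rw [lastProj, dg_mul_apply, incl_apply, mu_apply, mu_apply]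
  have key : (last x = i ∧ last x = last y ∧ init x = p ∧ init y = q ∧ tip p = tip q) ↔
      (x = snoc p i hp ∧ y = snoc q i hq ∧ tip (snoc p i hp) = tip (snoc q i hq)) := by
    constructor
    · rintro ⟨h1, h2, h3, h4, h5⟩
      exact ⟨path_ext h3 h1, path_ext h4 (h2.symm.trans h1), by rw [tip_snoc, tip_snoc, h5]⟩
    · rintro ⟨rfl, rfl, _⟩
      exact ⟨rfl, rfl, rfl, rfl, h⟩
  rw [← if_congr key rfl rfl]
  simp only [ite_and]
  split_ifs <;> simp

/-- Lagrange interpolation: different last steps have different eigenvalues, so the spectral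
projections are polynomials in the Jucys–Murphy element. -/
theorem lastProj_mem {S : Subalgebra Kq (Blk (n + 1))} (h : lastDiag n ∈ S) (i : WithTop ℤ) :
    lastProj n i ∈ S := by
  classical
  have h1 : ∀ I : Finset (WithTop ℤ),
      dg (fun x : Path (n + 1) => ∏ j ∈ I, (eigenvalue (last x) - eigenvalue j)) ∈ S := by
    intro I
    induction I using Finset.induction_on with
    | empty => simp only [prod_empty, dg_one]; exact one_mem _
    | insert j I hj ih =>
      have : dg (fun x : Path (n + 1) => ∏ l ∈ insert j I, (eigenvalue (last x) - eigenvalue l)) =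
          (lastDiag n - eigenvalue j • 1) *
            dg (fun x : Path (n + 1) => ∏ l ∈ I, (eigenvalue (last x) - eigenvalue l)) := by
        have h2 : lastDiag n - eigenvalue j • 1 = dg fun x => eigenvalue (last x) - eigenvalue j := by
          rw [lastDiag, ← dg_one]
          refine Blk.ext' fun x y => ?_
          change (dg _).1 x y - eigenvalue j * (dg _).1 x y = _
          rw [dg_apply, dg_apply, dg_apply]
          split_ifs <;> ring
        rw [h2, dg_mul_dg]
        congr 1
        funext x
        rw [prod_insert hj]
      rw [this]
      exact mul_mem (sub_mem h (S.smul_mem (one_mem _) _)) ih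
  set I := (univ.image fun x : Path (n + 1) => last x).erase i
  have h2 : lastProj n i = (∏ j ∈ I, (eigenvalue i - eigenvalue j))⁻¹ •
      dg (fun x : Path (n + 1) => ∏ j ∈ I, (eigenvalue (last x) - eigenvalue j)) := by
    refine Blk.ext' fun x y => ?_
    change (dg _).1 x y = _ * (dg _).1 x y
    rw [dg_apply, dg_apply]
    by_cases hxy : x = y
    · rw [if_pos hxy, if_pos hxy]
      by_cases hi : last x = i
      · rw [if_pos hi, hi, inv_mul_cancel₀]
        refine prod_ne_zero_iff.2 fun j hj => sub_ne_zero.2 fun e => ?_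
        exact (mem_erase.1 hj).1 (eigenvalue_injective e).symm
      · have h0 : ∏ j ∈ I, (eigenvalue (last x) - eigenvalue j) = 0 :=
          prod_eq_zero (mem_erase.2 ⟨hi, mem_image_of_mem _ (mem_univ x)⟩)
            (sub_self (eigenvalue (last x)))
        rw [if_neg hi, h0, mul_zero]
    · rw [if_neg hxy, if_neg hxy, mul_zero]
  rw [h2]
  exact S.smul_mem (h1 I) _

/-- Two paths that continue to the same diagram by different steps have a common ancestor. -/
theorem exists_common_path {p q : Path n} {i j : WithTop ℤ} (hi : CanMove i (tip p))
    (hj : CanMove j (tip q)) (h : move i (tip p) = move j (tip q)) (hij : i ≠ j) :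
    ∃ (m : ℕ) (_ : n = m + 1) (r : Path m), CanMove j (tip r) ∧ move j (tip r) = tip p ∧
      CanMove i (tip r) ∧ move i (tip r) = tip q ∧ Nadj i j := by
  obtain ⟨κ, h1, h2, h3, h4, hN⟩ := exists_common hi hj h hij
  have hc : κ.charge = 0 := by rw [← charge_move h1, h2, charge_tip]
  have hs : size κ + 1 ≤ n := by
    induction j using WithTop.recTopCoe with
    | coe j =>
      rw [← size_move h1, h2]
      exact size_tip_le p
    | top =>
      induction i using WithTop.recTopCoe with
      | top => exact absurd rfl hij
      | coe i =>
        rw [← size_move h3, h4]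
        exact size_tip_le q
  have h0 := size_nonneg κ
  obtain ⟨m, rfl⟩ : ∃ m, n = m + 1 := ⟨n - 1, by omega⟩
  obtain ⟨r, rfl⟩ := exists_path (n := m) hc (by push_cast at hs; omega)
  exact ⟨m, rfl, r, h1, h2, h3, h4, hN⟩

theorem blk_zero_eq (a : Blk 0) : a = algebraMap Kq (Blk 0) (a.1 default default) := by
  refine Blk.ext' fun x y => ?_
  obtain rfl : x = default := Subsingleton.elim _ _
  obtain rfl : y = default := Subsingleton.elim _ _
  rw [Algebra.algebraMap_eq_smul_one]
  change _ = a.1 default default * (1 : Blk 0).1 default default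
  rw [Blk.one_apply, if_pos rfl, mul_one]

/-- The set of generators of an algebra with the relations of rank `n`. -/
def genSet {W : Type*} (n : ℕ) (T e : ℕ → W) : Set W :=
  {w | ∃ j, j + 1 < n ∧ w = T j} ∪ {w | ∃ k, k ≤ n ∧ w = e k}

/-- The generated algebra contains the smaller block algebra and the last Jucys–Murphy element,
hence the projections to a last step and all matrix units between paths with equal last step. Paths
with the same end point but different last steps are connected through a common ancestor by an
off-diagonal entry of the last T. -/
theorem adjoin_genSet : ∀ n, Algebra.adjoin Kq (genSet n (genT n) (genE n)) = ⊤
  | 0 => by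
    rw [eq_top_iff]
    rintro a -
    rw [blk_zero_eq a]
    exact Subalgebra.algebraMap_mem _ _
  | n + 1 => by
    set S := Algebra.adjoin Kq (genSet (n + 1) (genT (n + 1)) (genE (n + 1)))
    have hT : ∀ j, j + 1 < n + 1 → genT (n + 1) j ∈ S := fun j hj =>
      Algebra.subset_adjoin (Or.inl ⟨j, hj, rfl⟩)
    have hE : ∀ k, k ≤ n + 1 → genE (n + 1) k ∈ S := fun k hk =>
      Algebra.subset_adjoin (Or.inr ⟨k, hk, rfl⟩)
    have hI : ∀ a, incl n a ∈ S := by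
      intro a
      have ha : a ∈ Algebra.adjoin Kq (genSet n (genT n) (genE n)) := by
        rw [adjoin_genSet n]; trivial
      have h1 : (Algebra.adjoin Kq (genSet n (genT n) (genE n))).map (incl n) ≤ S := by
        rw [AlgHom.map_adjoin]
        refine Algebra.adjoin_le ?_
        rintro _ ⟨_, ⟨j, hj, rfl⟩ | ⟨k, hk, rfl⟩, rfl⟩
        · rw [← genT_succ hj]; exact hT j (by omega)
        · rw [← genE_succ hk]; exact hE k (by omega)
      exact h1 ⟨a, ha, rfl⟩
    have hX : lastDiag n ∈ S := by
      cases n with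
      | zero => rw [lastDiag_zero]; exact hE 1 le_rfl
      | succ m =>
        have h1 := genT_lastDiag m
        have h2 : lastDiag (m + 1) = qq⁻¹ •
            (genT (m + 2) m * incl (m + 1) (lastDiag m) * genT (m + 2) m) := by
          rw [h1, smul_smul, inv_mul_cancel₀ qq_ne_zero, one_smul]
        rw [h2]
        exact S.smul_mem (mul_mem (mul_mem (hT m (by omega)) (hI _)) (hT m (by omega))) _
    have hD : ∀ (p q : Path n) (i : WithTop ℤ) (hp : CanMove i (tip p)) (hq : CanMove i (tip q)),
        tip p = tip q → mu (snoc p i hp) (snoc q i hq) ∈ S := by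
      intro p q i hp hq h
      rw [← lastProj_mul_incl_mu hp hq h]
      exact mul_mem (lastProj_mem hX i) (hI _)
    rw [eq_top_iff]
    rintro a -
    induction a using blk_induction with
    | h0 => exact zero_mem _
    | hadd a b ha hb => exact add_mem ha hb
    | hsmul c a ha => exact S.smul_mem ha c
    | hmu x y hxy =>
      by_cases hl : last x = last y
      · have ht : tip (init x) = tip (init y) := by
          refine move_injective (canMove_last x) (by rw [hl]; exact canMove_last y) ?_
          rw [← tip_eq, hl, ← tip_eq, hxy]
        have hy : y = snoc (init y) (last x) (ht ▸ canMove_last x) := path_ext rfl hl.symm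
        rw [hy]
        exact hD (init x) (init y) (last x) (canMove_last x) _ ht
      · obtain ⟨m, rfl, r, h1, h2, h3, h4, hN⟩ :=
          exists_common_path (canMove_last x) (canMove_last y) hxy hl
        set p := snoc r (last y) h1
        set q := snoc r (last x) h3
        have hp : tip (init x) = tip p := h2.symm
        have hq : tip q = tip (init y) := h4
        set x' := snoc p (last x) (hp ▸ canMove_last x)
        set y' := snoc q (last y) (hq ▸ canMove_last y)
        have e1 : mu x x' ∈ S := hD (init x) p (last x) (canMove_last x) _ hp
        have e2 : mu y' y ∈ S := hD q (init y) (last y) _ (canMove_last y) hq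
        have hxx' : tip x = tip x' := by
          rw [tip_eq x, hp]; rfl
        have hyy' : tip y' = tip y := by
          rw [tip_eq y, ← hq]; rfl
        have e3 := mu_mul_mul_mu (genT (m + 2) m) hxx' hyy' hxy
        -- The auxiliary paths x' and y' differ by an interchange of independent steps, so this
        -- entry is non-zero and can be divided out.
        have e4 : (genT (m + 2) m).1 x' y' = semi (last x) (last y) := by
          have hne : x' ≠ y' := fun e => by
            have h5 : last x' = last y' := by rw [e]
            exact hl h5
          rw [genT_top]
          change (topE m).1 x' y' - (1 : Blk (m + 2)).1 x' y' = _
          rw [Blk.one_apply, if_neg hne, sub_zero, topE_apply, if_pos]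
          · rfl
          · exact ⟨rfl, by rw [← hxx', hxy, hyy']⟩
        rw [e4] at e3
        have e5 : mu x y = (semi (last x) (last y))⁻¹ • (mu x x' * genT (m + 2) m * mu y' y) := by
          rw [e3, smul_smul, inv_mul_cancel₀ (semi_ne_zero hN), one_smul]
        rw [e5]
        exact S.smul_mem (mul_mem (mul_mem e1 (hT m (by omega))) e2) _

theorem commute_of_gens {W : Type*} [Ring W] [Algebra Kq W] (ψ : Blk n →ₐ[Kq] W) (w : W)
    (hT : ∀ j, j + 1 < n → w * ψ (genT n j) = ψ (genT n j) * w)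
    (hE : ∀ k, k ≤ n → w * ψ (genE n k) = ψ (genE n k) * w) (a : Blk n) :
    w * ψ a = ψ a * w := by
  have ha : a ∈ Algebra.adjoin Kq (genSet n (genT n) (genE n)) := by
    rw [adjoin_genSet n]; trivial
  induction ha using Algebra.adjoin_induction with
  | mem x hx =>
    rcases hx with ⟨j, hj, rfl⟩ | ⟨k, hk, rfl⟩
    · exact hT j hj
    · exact hE k hk
  | algebraMap r => rw [AlgHom.commutes, Algebra.commutes]
  | add x y _ _ hx hy => rw [map_add, mul_add, add_mul, hx, hy]
  | mul x y _ _ hx hy => rw [map_mul, ← mul_assoc, hx, mul_assoc, hy, mul_assoc]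

/-- The span of the elements `a`, `a t b` and `e a`, where `a` and `b` are in the image of `ψ`. -/
def span3 {W : Type*} [Ring W] [Algebra Kq W] (ψ : Blk n →ₐ[Kq] W) (t e : W) : Submodule Kq W :=
  Submodule.span Kq ({w | ∃ a, w = ψ a} ∪ {w | ∃ a b, w = ψ a * t * ψ b} ∪ {w | ∃ a, w = e * ψ a})

/-- The last of the generators `T` in rank `n + 1`. -/
def topGen {W : Type*} [Zero W] (T : ℕ → W) : ℕ → W
  | 0 => 0
  | m + 1 => T m

section Span3

variable {W : Type*} [Ring W] [Algebra Kq W] {ψ : Blk n →ₐ[Kq] W} {t e : W}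

theorem map_mem_span3 (a : Blk n) : ψ a ∈ span3 ψ t e :=
  Submodule.subset_span (Or.inl (Or.inl ⟨a, rfl⟩))

theorem mid_mem_span3 (a b : Blk n) : ψ a * t * ψ b ∈ span3 ψ t e :=
  Submodule.subset_span (Or.inl (Or.inr ⟨a, b, rfl⟩))

theorem idem_mem_span3 (a : Blk n) : e * ψ a ∈ span3 ψ t e :=
  Submodule.subset_span (Or.inr ⟨a, rfl⟩)

theorem span3_induction {P : (w : W) → w ∈ span3 ψ t e → Prop}
    (h1 : ∀ a, P (ψ a) (map_mem_span3 a)) (h2 : ∀ a b, P (ψ a * t * ψ b) (mid_mem_span3 a b))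
    (h3 : ∀ a, P (e * ψ a) (idem_mem_span3 a))
    (hadd : ∀ a b ha hb, P a ha → P b hb → P (a + b) (add_mem ha hb))
    (hsmul : ∀ (c : Kq) a ha, P a ha → P (c • a) (Submodule.smul_mem _ c ha)) {w : W}
    (hw : w ∈ span3 ψ t e) : P w hw := by
  induction hw using Submodule.span_induction with
  | mem x hx =>
    rcases hx with (⟨a, rfl⟩ | ⟨a, b, rfl⟩) | ⟨a, rfl⟩
    · exact h1 a
    · exact h2 a b
    · exact h3 a
  | zero => simpa only [map_zero] using h1 0
  | add x y _ _ hx hy => exact hadd x y _ _ hx hy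
  | smul c x _ hx => exact hsmul c x _ hx

theorem span3_mul_map {w : W} (hw : w ∈ span3 ψ t e) (b : Blk n) : w * ψ b ∈ span3 ψ t e := by
  induction hw using span3_induction with
  | h1 a => rw [← map_mul]; exact map_mem_span3 _
  | h2 a c => rw [mul_assoc, ← map_mul]; exact mid_mem_span3 _ _
  | h3 a => rw [mul_assoc, ← map_mul]; exact idem_mem_span3 _
  | hadd x y _ _ hx hy => rw [add_mul]; exact add_mem hx hy
  | hsmul c x _ hx => rw [smul_mul_assoc]; exact Submodule.smul_mem _ c hx

end Span3

/-- The span contains 1 and is stable under left multiplication by the generators. The critical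
products are t ψ(a) t: decomposing a by the same statement one rank lower leaves t², t T t and t e
t, which the quadratic relation, the braid relation and `TeT` reduce. -/
theorem adjoin_le_span3 {W : Type*} [Ring W] [Algebra Kq W] {T e : ℕ → W} (hR : Rel qq (n + 1) T e)
    (ψ : Blk n →ₐ[Kq] W) (hT : ∀ j, j + 1 < n → ψ (genT n j) = T j)
    (hE : ∀ k, k ≤ n → ψ (genE n k) = e k)
    (hdec : ∀ m, n = m + 1 → ∀ a : Blk (m + 1),
      a ∈ span3 (incl m) (topGen (genT (m + 1)) m) (genE (m + 1) (m + 1)))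
    {w : W} (hw : w ∈ Algebra.adjoin Kq (genSet (n + 1) T e)) :
    w ∈ span3 ψ (topGen T n) (e (n + 1)) := by
  set t := topGen T n with ht
  set V := span3 ψ t (e (n + 1)) with hV
  have hcomm : ∀ a, e (n + 1) * ψ a = ψ a * e (n + 1) := commute_of_gens ψ _
    (fun j hj => by rw [hT j hj, hR.T_e j (n + 1) (by omega) le_rfl (by omega)])
    (fun k hk => by
      rw [hE k hk, (hR.e_mul k (n + 1) (by omega) le_rfl).1,
        (hR.e_mul k (n + 1) (by omega) le_rfl).2])
  -- The relation `eTe` turns products of e and t into elements of the middle type, so no separate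
  -- type for them is needed.
  have het : e (n + 1) * t = ψ (genE n n) * t * ψ (genE n n) := by
    cases n with
    | zero => rw [ht]; simp [topGen]
    | succ m =>
      rw [hE _ le_rfl, ht, topGen, hR.eTe m (by omega)]
  have hte : t * e (n + 1) = e (n + 1) * t := by
    cases n with
    | zero => rw [ht]; simp [topGen]
    | succ m => exact hR.T_e m (m + 2) (by omega) le_rfl (by omega)
  have htt : ∀ a, t * ψ a * t ∈ V := by
    intro a
    cases n with
    | zero => rw [ht]; simp only [topGen, mul_zero]; exact zero_mem _
    | succ m =>
      have htm : t = T m := rfl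
      have hc : ∀ b : Blk m, t * ψ (incl m b) = ψ (incl m b) * t :=
        commute_of_gens (ψ.comp (incl m)) t
          (fun j hj => by
            rw [AlgHom.comp_apply, ← genT_succ hj, hT j (by omega), htm,
              hR.T_comm j m (by omega) (by omega)])
          (fun k hk => by
            rw [AlgHom.comp_apply, ← genE_succ hk, hE k (by omega), htm,
              hR.T_e m k (by omega) (by omega) (by omega)])
      induction hdec m rfl a using span3_induction with
      | h1 b =>
        rw [hc, mul_assoc, htm, hR.T_sq m (by omega), mul_add, mul_smul_comm, mul_smul_comm, mul_one]
        refine add_mem (Submodule.smul_mem _ _ ?_) (Submodule.smul_mem _ _ (map_mem_span3 _))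
        have := mid_mem_span3 (ψ := ψ) (t := t) (e := e (m + 1 + 1)) (incl m b) 1
        rwa [map_one, mul_one] at this
      | h2 b c =>
        cases m with
        | zero =>
          simp only [topGen, mul_zero, zero_mul, map_zero]
          exact zero_mem _
        | succ l =>
          have h1 : ψ (topGen (genT (l + 1 + 1)) (l + 1)) = T l := hT l (by omega)
          rw [map_mul, map_mul, h1]
          -- The outer factors commute with t, so both copies of t come next to `T l`, and the braid
          -- relation leaves a single t.
          have h2 : t * (ψ (incl (l + 1) b) * T l * ψ (incl (l + 1) c)) * t =
              ψ (incl (l + 1) b) * (T l * t * T l) * ψ (incl (l + 1) c) := by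
            rw [htm, hR.braid l (by omega), ← htm]
            calc t * (ψ (incl (l + 1) b) * T l * ψ (incl (l + 1) c)) * t
                = (t * ψ (incl (l + 1) b)) * T l * (ψ (incl (l + 1) c) * t) := by
                  simp only [mul_assoc]
              _ = _ := by rw [hc, ← hc c]; simp only [mul_assoc]
          rw [h2, ← h1]
          have := mid_mem_span3 (ψ := ψ) (t := t) (e := e (l + 1 + 1 + 1))
            (incl (l + 1) b * topGen (genT (l + 1 + 1)) (l + 1))
            (topGen (genT (l + 1 + 1)) (l + 1) * incl (l + 1) c)
          rw [map_mul, map_mul] at this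
          simpa only [mul_assoc] using this
      | h3 b =>
        have h1 := hR.TeT m (by omega)
        -- The relation `TeT`, solved for its cubic term.
        have h2 : T m * e (m + 1) * T m = qq • (e (m + 2) * T m) + T m * e m + qq • e (m + 2) + e m -
            e (m + 1) * T m - T m * e (m + 1) - e (m + 1) := by
          have h3 : T m * e (m + 2) = e (m + 2) * T m := hte
          simp only [add_mul, mul_add, one_mul, mul_one, mul_smul_comm, smul_add] at h1
          rw [h3] at h1
          rw [eq_sub_iff_add_eq, eq_sub_iff_add_eq, eq_sub_iff_add_eq]
          rw [← sub_eq_zero] at h1 ⊢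
          rw [← h1]
          abel
        rw [map_mul, hE _ le_rfl, ← mul_assoc, mul_assoc (t * e (m + 1)), ← hc, ← mul_assoc, htm, h2]
        refine span3_mul_map ?_ (incl m b)
        have hVe : ∀ k ≤ m + 1, e k ∈ V := fun k hk => by
          rw [← hE k hk]; exact map_mem_span3 _
        have hVTe : ∀ k ≤ m + 1, T m * e k ∈ V := fun k hk => by
          have := mid_mem_span3 (ψ := ψ) (t := t) (e := e (m + 1 + 1)) 1 (genE (m + 1) k)
          rwa [map_one, one_mul, hE k hk] at this
        have hVeT : ∀ k ≤ m + 1, e k * T m ∈ V := fun k hk => by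
          have := mid_mem_span3 (ψ := ψ) (t := t) (e := e (m + 1 + 1)) (genE (m + 1) k) 1
          rwa [map_one, mul_one, hE k hk] at this
        have hVe2 : e (m + 2) ∈ V := by
          have := idem_mem_span3 (ψ := ψ) (t := t) (e := e (m + 1 + 1)) 1
          rwa [map_one, mul_one] at this
        have hVet : e (m + 2) * T m ∈ V := by
          change e (m + 1 + 1) * t ∈ V
          rw [het]
          exact mid_mem_span3 _ _
        exact sub_mem (sub_mem (sub_mem (add_mem (add_mem (add_mem (Submodule.smul_mem _ _ hVet)
          (hVTe m (by omega))) (Submodule.smul_mem _ _ hVe2)) (hVe m (by omega)))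
          (hVeT _ le_rfl)) (hVTe _ le_rfl)) (hVe _ le_rfl)
      | hadd x y _ _ hx hy => rw [map_add, mul_add, add_mul]; exact add_mem hx hy
      | hsmul c x _ hx =>
        rw [map_smul, mul_smul_comm, smul_mul_assoc]; exact Submodule.smul_mem _ c hx
  have key : ∀ v ∈ V, w * v ∈ V := by
    induction hw using Algebra.adjoin_induction with
    | algebraMap r =>
      intro v hv
      rw [← Algebra.smul_def]
      exact Submodule.smul_mem _ _ hv
    | add x y _ _ hx hy => intro v hv; rw [add_mul]; exact add_mem (hx v hv) (hy v hv)
    | mul x y _ _ hx hy => intro v hv; rw [mul_assoc]; exact hx _ (hy v hv)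
    | mem x hx =>
      have hψ : ∀ c v, v ∈ V → ψ c * v ∈ V := by
        intro c v hv
        induction hv using span3_induction with
        | h1 a => rw [← map_mul]; exact map_mem_span3 _
        | h2 a b => rw [← mul_assoc, ← mul_assoc, ← map_mul]; exact mid_mem_span3 _ _
        | h3 a => rw [← mul_assoc, ← hcomm, mul_assoc, ← map_mul]; exact idem_mem_span3 _
        | hadd x y _ _ hx hy => rw [mul_add]; exact add_mem hx hy
        | hsmul c x _ hx => rw [mul_smul_comm]; exact Submodule.smul_mem _ c hx
      have hete : ∀ b, e (n + 1) * t * ψ b ∈ V := fun b => by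
        rw [het, mul_assoc, ← map_mul]; exact mid_mem_span3 _ _
      have htop : ∀ v ∈ V, t * v ∈ V := by
        intro v hv
        induction hv using span3_induction with
        | h1 a =>
          have := mid_mem_span3 (ψ := ψ) (t := t) (e := e (n + 1)) 1 a
          rwa [map_one, one_mul] at this
        | h2 a b => rw [← mul_assoc, ← mul_assoc]; exact span3_mul_map (htt a) b
        | h3 a => rw [← mul_assoc, hte]; exact hete a
        | hadd x y _ _ hx hy => rw [mul_add]; exact add_mem hx hy
        | hsmul c x _ hx => rw [mul_smul_comm]; exact Submodule.smul_mem _ c hx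
      have hidem : ∀ v ∈ V, e (n + 1) * v ∈ V := by
        intro v hv
        induction hv using span3_induction with
        | h1 a => exact idem_mem_span3 a
        | h2 a b =>
          rw [← mul_assoc, ← mul_assoc, hcomm, mul_assoc, mul_assoc, ← mul_assoc (e (n + 1))]
          exact hψ _ _ (hete b)
        | h3 a =>
          rw [← mul_assoc, (hR.e_mul (n + 1) (n + 1) le_rfl le_rfl).1]
          exact idem_mem_span3 a
        | hadd x y _ _ hx hy => rw [mul_add]; exact add_mem hx hy
        | hsmul c x _ hx => rw [mul_smul_comm]; exact Submodule.smul_mem _ c hx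
      rcases hx with ⟨j, hj, rfl⟩ | ⟨k, hk, rfl⟩
      · rcases Nat.lt_or_ge (j + 1) n with h | h
        · rw [← hT j h]; exact hψ _
        · obtain rfl : n = j + 1 := by omega
          exact htop
      · rcases Nat.lt_or_ge n k with h | h
        · obtain rfl : k = n + 1 := by omega
          exact hidem
        · rw [← hE k h]; exact hψ _
  have h1 := key 1 (by rw [← map_one ψ]; exact map_mem_span3 _)
  rwa [mul_one] at h1

/-- Apply the spanning result to the block algebra itself, where the generators generate everything;
the decomposition it requires is the same statement one rank lower. -/
theorem mem_span3_incl : ∀ (n : ℕ) (a : Blk (n + 1)),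
    a ∈ span3 (incl n) (topGen (genT (n + 1)) n) (genE (n + 1) (n + 1))
  | n, a => by
    refine adjoin_le_span3 (rel_blk (n + 1)) (incl n) (fun j hj => (genT_succ hj).symm)
      (fun k hk => (genE_succ hk).symm) (fun m hm b => ?_) (by rw [adjoin_genSet]; trivial)
    subst hm
    exact mem_span3_incl m b

end Generators

/-! ### The presentation of the block algebras -/

section Presentation

open Finset

variable {n m : ℕ}

/-- The entries of a block matrix as coordinates. -/
def blkEquiv (n : ℕ) : Blk n ≃ₗ[Kq] (IdxP n → Kq) where
  toFun a z := a.1 z.1.1 z.1.2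
  map_add' _ _ := rfl
  map_smul' _ _ := rfl
  invFun f := ⟨Matrix.of fun x y => open Classical in if h : tip x = tip y then f ⟨(x, y), h⟩ else 0,
    fun x y h => by rw [Matrix.of_apply, dif_neg h]⟩
  left_inv a := by
    refine Blk.ext' fun x y => ?_
    change (dite _ _ _) = _
    split_ifs with h
    · rfl
    · exact (Blk.zero_of_ne a h).symm
  right_inv f := by
    funext z
    exact dif_pos z.2

instance : Module.Finite Kq (Blk n) := Module.Finite.equiv (blkEquiv n).symm

theorem finrank_blk (n : ℕ) : Module.finrank Kq (Blk n) = Fintype.card (IdxP n) := by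
  rw [(blkEquiv n).finrank_eq, Module.finrank_fintype_fun_eq_card]

theorem Rel.mono {K W : Type*} [CommRing K] [Ring W] [Algebra K W] {q : K} {n : ℕ} {T e : ℕ → W}
    (h : Rel q (n + 1) T e) : Rel q n T e where
  e_zero := h.e_zero
  e_mul i j hij hj := h.e_mul i j hij (by omega)
  T_e j k hj hk hkj := h.T_e j k (by omega) (by omega) hkj
  T_sq j hj := h.T_sq j (by omega)
  T_comm i j hij hj := h.T_comm i j hij (by omega)
  braid j hj := h.braid j (by omega)
  eTe j hj := h.eTe j (by omega)
  TeT j hj := h.TeT j (by omega)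

theorem Rel.prod {K W W' : Type*} [CommRing K] [Ring W] [Algebra K W] [Ring W'] [Algebra K W']
    {q : K} {n : ℕ} {T e : ℕ → W} {T' e' : ℕ → W'} (h : Rel q n T e) (h' : Rel q n T' e') :
    Rel q n (fun j => (T j, T' j)) (fun j => (e j, e' j)) where
  e_zero := Prod.ext h.e_zero h'.e_zero
  e_mul i j hij hj := ⟨Prod.ext (h.e_mul i j hij hj).1 (h'.e_mul i j hij hj).1,
    Prod.ext (h.e_mul i j hij hj).2 (h'.e_mul i j hij hj).2⟩
  T_e j k hj hk hkj := Prod.ext (h.T_e j k hj hk hkj) (h'.T_e j k hj hk hkj)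
  T_sq j hj := Prod.ext (h.T_sq j hj) (h'.T_sq j hj)
  T_comm i j hij hj := Prod.ext (h.T_comm i j hij hj) (h'.T_comm i j hij hj)
  braid j hj := Prod.ext (h.braid j hj) (h'.braid j hj)
  eTe j hj := Prod.ext (h.eTe j hj) (h'.eTe j hj)
  TeT j hj := Prod.ext (h.TeT j hj) (h'.TeT j hj)

/-- Splits off a factor from the algebra of two ranks below t, which can be slid through t. It moves
the beginning of x to any chosen path r with the same end point. -/
theorem mu_mul_incl_mu (p x : Path (m + 1)) {r : Path m} (hr : tip r = tip (init x)) :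
    mu p (snoc r (last x) (hr ▸ canMove_last x)) * incl m (mu r (init x)) = mu p x := by
  classical
  set x' := snoc r (last x) (hr ▸ canMove_last x)
  have hx : tip x' = tip x := by rw [tip_eq x, ← hr]; rfl
  by_cases h : tip p = tip x
  · refine Blk.ext' fun u v => ?_
    rw [mu_mul_apply _ (h.trans hx.symm), incl_apply, mu_apply, mu_apply]
    have key : (last x' = last v ∧ init x' = r ∧ init v = init x ∧ tip r = tip (init x)) ↔ v = x :=
      ⟨fun h' => path_ext h'.2.2.1 h'.1.symm, fun h' => by rw [h']; exact ⟨rfl, rfl, rfl, hr⟩⟩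
    have key' : (if last x' = last v then
        if init x' = r ∧ init v = init x ∧ tip r = tip (init x) then (1 : Kq) else 0 else 0) =
        if v = x then 1 else 0 := by
      rw [← if_congr key rfl rfl]
      simp only [ite_and]
    rw [key']
    by_cases hu : u = p <;> simp [hu, h]
  · rw [mu_of_ne h, mu_of_ne fun e => h (e.trans hx), zero_mul]

theorem incl_mu_mul_mu {x y q : Path (m + 1)} {r : Path m} (hr : tip r = tip (init x))
    (hy : init y = init x) :
    incl m (mu r (init x)) * mu y q = mu (snoc r (last y) (by rw [hr, ← hy]; exact canMove_last y)) q := by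
  classical
  set y' := snoc r (last y) (by rw [hr, ← hy]; exact canMove_last y)
  have hx : tip y' = tip y := by rw [tip_eq y, hy, ← hr]; rfl
  by_cases h : tip y = tip q
  · refine Blk.ext' fun u v => ?_
    rw [mul_mu_apply _ h, incl_apply, mu_apply, mu_apply]
    have key : (last u = last y ∧ init u = r ∧ init y = init x ∧ tip r = tip (init x)) ↔ u = y' :=
      ⟨fun h' => path_ext h'.2.1 h'.1, fun h' => by rw [h']; exact ⟨rfl, rfl, hy, hr⟩⟩
    have key' : (if last u = last y then
        if init u = r ∧ init y = init x ∧ tip r = tip (init x) then (1 : Kq) else 0 else 0) =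
        if u = y' then 1 else 0 := by
      rw [← if_congr key rfl rfl]
      simp only [ite_and]
    rw [key']
    by_cases hu : v = q <;> simp [hu, hx, h]
  · rw [mu_of_ne h, mu_of_ne fun e => h (hx.symm.trans e), mul_zero]

theorem incl_mu_mul_mu_of_ne {x y : Path (m + 1)} (q : Path (m + 1)) (r : Path m)
    (hy : init y ≠ init x) : incl m (mu r (init x)) * mu y q = 0 := by
  classical
  by_cases h : tip y = tip q
  · refine Blk.ext' fun u v => ?_
    rw [mul_mu_apply _ h, incl_apply, mu_apply,
      if_neg (show ¬ (init u = r ∧ init y = init x ∧ tip r = tip (init x)) from fun h' => hy h'.2.1),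
      ite_self, ite_self]
    rfl
  · rw [mu_of_ne h, mul_zero]

variable {W : Type} [Ring W] [Algebra Kq W] {ψ : Blk n →ₐ[Kq] W} {t e : W}

/-- It suffices to test matrix units. By `he`, the products with e vanish except for paths of
maximal size. -/
theorem span3_le {S : Submodule Kq W} (he : e * ψ (full n) = e)
    (hP : ∀ p q, tip p = tip q → ψ (mu p q) ∈ S)
    (hH : ∀ p q, tip p = tip q → size (tip p) = n → e * ψ (mu p q) ∈ S)
    (hQ : ∀ p x y q, tip p = tip x → tip y = tip q → ψ (mu p x) * t * ψ (mu y q) ∈ S) :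
    span3 ψ t e ≤ S := by
  refine Submodule.span_le.2 ?_
  rintro w ((⟨a, rfl⟩ | ⟨a, b, rfl⟩) | ⟨a, rfl⟩)
  · rw [SetLike.mem_coe]
    induction a using blk_induction with
    | h0 => rw [map_zero]; exact zero_mem _
    | hadd a b ha hb => rw [map_add]; exact add_mem ha hb
    | hsmul c a ha => rw [map_smul]; exact S.smul_mem _ ha
    | hmu p q h => exact hP p q h
  · rw [SetLike.mem_coe]
    induction a using blk_induction with
    | h0 => rw [map_zero, zero_mul, zero_mul]; exact zero_mem _
    | hadd a a' ha hb => rw [map_add, add_mul, add_mul]; exact add_mem ha hb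
    | hsmul c a ha => rw [map_smul, smul_mul_assoc, smul_mul_assoc]; exact S.smul_mem _ ha
    | hmu p x h =>
      induction b using blk_induction with
      | h0 => rw [map_zero, mul_zero]; exact zero_mem _
      | hadd a a' ha hb => rw [map_add, mul_add]; exact add_mem ha hb
      | hsmul c a ha => rw [map_smul, mul_smul_comm]; exact S.smul_mem _ ha
      | hmu y q h' => exact hQ p x y q h h'
  · rw [SetLike.mem_coe]
    induction a using blk_induction with
    | h0 => rw [map_zero, mul_zero]; exact zero_mem _
    | hadd a b ha hb => rw [map_add, mul_add]; exact add_mem ha hb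
    | hsmul c a ha => rw [map_smul, mul_smul_comm]; exact S.smul_mem _ ha
    | hmu p q h =>
      by_cases hs : size (tip p) = n
      · exact hH p q h hs
      · rw [← he, mul_assoc, ← map_mul]
        have : full n * mu p q = 0 := by
          refine Blk.ext' fun u v => ?_
          rw [full, dg_mul_apply, mu_apply]
          by_cases hu : u = p
          · rw [hu, if_neg hs, zero_mul]; rfl
          · rw [if_neg (show ¬ (u = p ∧ v = q ∧ tip p = tip q) from fun h' => hu h'.1), mul_zero]; rfl
        rw [this, map_zero, mul_zero]
        exact zero_mem _

theorem finrank_span3_zero {ψ : Blk 0 →ₐ[Kq] W} (he : e * ψ (full 0) = e) :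
    ∃ ι : Type, ∃ _ : Fintype ι, ∃ g : ι → W, span3 ψ 0 e ≤ Submodule.span Kq (Set.range g) ∧
      Fintype.card ι ≤ Fintype.card (IdxP 1) := by
  refine ⟨IdxP 0 ⊕ IdxH 0, inferInstance,
    Sum.elim (fun z => ψ (mu z.1.1 z.1.2)) (fun z => e * ψ (mu z.1.1 z.1.2)), ?_, ?_⟩
  · refine span3_le he (fun p q h => Submodule.subset_span ⟨Sum.inl ⟨(p, q), h⟩, rfl⟩)
      (fun p q h hs => Submodule.subset_span ⟨Sum.inr ⟨(p, q), h, by simpa using hs⟩, rfl⟩) ?_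
    intro p x y q _ _
    rw [mul_zero, zero_mul]
    exact zero_mem _
  · rw [Fintype.card_sum]
    exact pairCount_growth_le_zero

/-- In a product of matrix units around t, the part that concerns the beginnings slides through t.
So the product vanishes unless the two inner paths have the same beginning, and this beginning can
be normalized to a representative; what is left is indexed by `IdxQ`. -/
theorem finrank_span3_succ {ψ : Blk (m + 1) →ₐ[Kq] W} (he : e * ψ (full (m + 1)) = e)
    (hc : ∀ b : Blk m, t * ψ (incl m b) = ψ (incl m b) * t) :
    ∃ ι : Type, ∃ _ : Fintype ι, ∃ g : ι → W, span3 ψ t e ≤ Submodule.span Kq (Set.range g) ∧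
      Fintype.card ι ≤ Fintype.card (IdxP (m + 2)) := by
  refine ⟨IdxP (m + 1) ⊕ IdxQ m ⊕ IdxH (m + 1), inferInstance,
    Sum.elim (fun z => ψ (mu z.1.1 z.1.2)) (Sum.elim
      (fun z => ψ (mu z.1.1.1 z.1.2.1) * t * ψ (mu z.1.2.2 z.1.1.2))
      (fun z => e * ψ (mu z.1.1 z.1.2))), ?_, ?_⟩
  · refine span3_le he (fun p q h => Submodule.subset_span ⟨Sum.inl ⟨(p, q), h⟩, rfl⟩)
      (fun p q h hs => Submodule.subset_span ⟨Sum.inr (Sum.inr ⟨(p, q), h, by simpa using hs⟩), rfl⟩) ?_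
    intro p x y q hp hq
    have hr : tip (rep m (tip (init x))) = tip (init x) := tip_rep_tip _
    rw [← mu_mul_incl_mu p x hr, map_mul, mul_assoc (ψ _), ← hc, ← mul_assoc, mul_assoc, ← map_mul]
    by_cases hy : init y = init x
    · rw [incl_mu_mul_mu hr hy]
      refine Submodule.subset_span ⟨Sum.inr (Sum.inl ⟨((p, q),
        (snoc (rep m (tip (init x))) (last x) (by rw [hr]; exact canMove_last x),
          snoc (rep m (tip (init x))) (last y) (by rw [hr, ← hy]; exact canMove_last y))),
        ?_, ?_, rfl, ?_⟩), rfl⟩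
      · rw [hp, tip_eq x, tip_snoc, hr]
      · rw [← hq, tip_eq y, tip_snoc, hr, hy]
      · change rep m (tip (init x)) = rep m (tip (rep m (tip (init x))))
        rw [hr]
    · rw [incl_mu_mul_mu_of_ne q _ hy, map_zero, mul_zero]
      exact zero_mem _
  · rw [Fintype.card_sum, Fintype.card_sum, ← add_assoc]
    exact pairCount_growth_le m

theorem exists_lift_zero {T e : ℕ → W} (hR : Rel qq 0 T e) :
    ∃ ψ : Blk 0 →ₐ[Kq] W, (∀ j, j + 1 < 0 → ψ (genT 0 j) = T j) ∧
      ∀ k, k ≤ 0 → ψ (genE 0 k) = e k := by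
  refine ⟨AlgHom.ofLinearMap
    { toFun := fun a => algebraMap Kq W (a.1 default default)
      map_add' := fun a b => map_add (algebraMap Kq W) _ _
      map_smul' := fun c a => by
        change algebraMap Kq W (c * a.1 default default) = c • algebraMap Kq W (a.1 default default)
        rw [Algebra.smul_def, map_mul] } ?_ ?_, fun j hj => by omega, fun k hk => ?_⟩
  · change algebraMap Kq W ((1 : Blk 0).1 default default) = 1
    rw [Blk.one_apply, if_pos rfl, map_one]
  · intro a b
    change algebraMap Kq W ((a * b).1 default default) = _
    rw [Blk.mul_apply, Fintype.sum_unique, map_mul]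
    rfl
  · obtain rfl : k = 0 := by omega
    rw [hR.e_zero]
    change algebraMap Kq W ((1 : Blk 0).1 default default) = 1
    rw [Blk.one_apply, if_pos rfl, map_one]

/-- Consider the subalgebra S of the product of W with the block algebra generated by the pairs of
corresponding generators, the graph of the desired map. It satisfies the relations, so its dimension
is at most that of the block algebra, even if W is large. The projection to the block algebra is
surjective, hence bijective, and its inverse followed by the projection to W is the lift. -/
theorem exists_lift_succ {T e : ℕ → W} (hR : Rel qq (n + 1) T e)
    (ih : ∀ {W : Type} [Ring W] [Algebra Kq W] {T e : ℕ → W}, Rel qq n T e →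
      ∃ ψ : Blk n →ₐ[Kq] W, (∀ j, j + 1 < n → ψ (genT n j) = T j) ∧
        ∀ k, k ≤ n → ψ (genE n k) = e k) :
    ∃ ψ : Blk (n + 1) →ₐ[Kq] W, (∀ j, j + 1 < n + 1 → ψ (genT (n + 1) j) = T j) ∧
      ∀ k, k ≤ n + 1 → ψ (genE (n + 1) k) = e k := by
  have hR' := hR.prod (rel_blk (n + 1))
  set T' : ℕ → W × Blk (n + 1) := fun j => (T j, genT (n + 1) j)
  set e' : ℕ → W × Blk (n + 1) := fun j => (e j, genE (n + 1) j)
  obtain ⟨ψ, hT, hE⟩ := ih hR'.mono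
  set S := Algebra.adjoin Kq (genSet (n + 1) T' e')
  have hS : Subalgebra.toSubmodule S ≤ span3 ψ (topGen T' n) (e' (n + 1)) := fun w hw =>
    adjoin_le_span3 hR' ψ hT hE (fun m hm a => by subst hm; exact mem_span3_incl m a) hw
  have he : e' (n + 1) * ψ (full n) = e' (n + 1) := by
    rw [← genE_self, hE n le_rfl, (hR'.e_mul n (n + 1) (by omega) le_rfl).2]
  obtain ⟨ι, _, g, hg, hcard⟩ : ∃ ι : Type, ∃ _ : Fintype ι, ∃ g : ι → W × Blk (n + 1),
      span3 ψ (topGen T' n) (e' (n + 1)) ≤ Submodule.span Kq (Set.range g) ∧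
        Fintype.card ι ≤ Fintype.card (IdxP (n + 1)) := by
    cases n with
    | zero => exact finrank_span3_zero he
    | succ m =>
      refine finrank_span3_succ he (commute_of_gens (ψ.comp (incl m)) _
        (fun j hj => ?_) (fun k hk => ?_))
      · rw [AlgHom.comp_apply, ← genT_succ hj, hT j (by omega), topGen,
          hR'.T_comm j m (by omega) (by omega)]
      · rw [AlgHom.comp_apply, ← genE_succ hk, hE k (by omega), topGen,
          hR'.T_e m k (by omega) (by omega) (by omega)]
  have hfg : Subalgebra.toSubmodule S ≤ Submodule.span Kq (Set.range g) := hS.trans hg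
  have : FiniteDimensional Kq (Submodule.span Kq (Set.range g)) :=
    FiniteDimensional.span_of_finite Kq (Set.finite_range g)
  have hfin : Module.Finite Kq S := Submodule.finiteDimensional_of_le hfg
  have hrank : Module.finrank Kq S ≤ Module.finrank Kq (Blk (n + 1)) := by
    rw [finrank_blk]
    exact ((Submodule.finrank_mono hfg).trans (finrank_range_le_card g)).trans hcard
  set π : S →ₐ[Kq] Blk (n + 1) := (AlgHom.snd Kq W (Blk (n + 1))).comp S.val
  have hsurj : Function.Surjective π := by
    rw [← AlgHom.range_eq_top, AlgHom.range_comp, Subalgebra.range_val, AlgHom.map_adjoin,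
      ← adjoin_genSet (n + 1)]
    congr 1
    ext w
    constructor
    · rintro ⟨_, ⟨j, hj, rfl⟩ | ⟨j, hj, rfl⟩, rfl⟩
      · exact Or.inl ⟨j, hj, rfl⟩
      · exact Or.inr ⟨j, hj, rfl⟩
    · rintro (⟨j, hj, rfl⟩ | ⟨j, hj, rfl⟩)
      · exact ⟨T' j, Or.inl ⟨j, hj, rfl⟩, rfl⟩
      · exact ⟨e' j, Or.inr ⟨j, hj, rfl⟩, rfl⟩
  have hinj : Function.Injective π :=
    (LinearMap.injective_iff_surjective_of_finrank_eq_finrank (f := π.toLinearMap)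
      (le_antisymm hrank (LinearMap.finrank_le_finrank_of_surjective (f := π.toLinearMap) hsurj))).2 hsurj
  set E := AlgEquiv.ofBijective π ⟨hinj, hsurj⟩
  have key : ∀ w (hw : w ∈ S) b, w.2 = b →
      ((AlgHom.fst Kq W (Blk (n + 1))).comp (S.val.comp (E.symm : Blk (n + 1) →ₐ[Kq] S))) b = w.1 := by
    rintro w hw _ rfl
    have : E.symm w.2 = ⟨w, hw⟩ := by
      rw [AlgEquiv.symm_apply_eq]
      rfl
    change (E.symm w.2).1.1 = _
    rw [this]
  refine ⟨_, fun j hj => key (T' j) (Algebra.subset_adjoin (Or.inl ⟨j, hj, rfl⟩)) _ rfl,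
    fun k hk => key (e' k) (Algebra.subset_adjoin (Or.inr ⟨k, hk, rfl⟩)) _ rfl⟩

/-- The algebra of block matrices is presented by the generators and relations of rank `n`. -/
theorem exists_lift : ∀ (n : ℕ) {W : Type} [Ring W] [Algebra Kq W] {T e : ℕ → W},
    Rel qq n T e → ∃ ψ : Blk n →ₐ[Kq] W, (∀ j, j + 1 < n → ψ (genT n j) = T j) ∧
      ∀ k, k ≤ n → ψ (genE n k) = e k
  | 0, _, _, _, _, _, hR => exists_lift_zero hR
  | n + 1, _, _, _, _, _, hR => exists_lift_succ hR (exists_lift n)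

end Presentation

/-! ### Linear independence of orbit functions and the lower bound for the dimension -/

section Independence

open Finset Module

variable {n : ℕ}

/-- After multiplication by a power of the indeterminate, a polynomial with all primes as roots is
left. -/
theorem laurent_eq_zero {c : ℂ[T;T⁻¹]} (h : ∀ x, specialize x c = 0) : c = 0 := by
  obtain ⟨m, p, hp⟩ := LaurentPolynomial.exists_T_pow c
  have h1 : ∀ x : PrimePower, p.eval x.card = 0 := fun x => by
    have h2 := LaurentPolynomial.eval₂_toLaurent (f := RingHom.id ℂ)
      (x := Units.mk0 x.card x.card_ne_zero) p
    rw [hp] at h2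
    change specialize x (c * _) = _ at h2
    rw [map_mul, h, zero_mul] at h2
    rw [Polynomial.eval, ← Units.val_mk0 x.card_ne_zero]
    exact h2.symm
  have h3 : p = 0 := by
    refine Polynomial.eq_zero_of_infinite_isRoot p ?_
    refine Set.infinite_of_injective_forall_mem (f := fun ℓ : Nat.Primes => PrimePower.card (ℓ, 0))
      (fun a b hab => ?_) fun ℓ => h1 (ℓ, 0)
    simp only [PrimePower.card, zero_add, pow_one, Nat.cast_inj] at hab
    exact Subtype.ext hab
  rw [h3, map_zero] at hp
  exact ((LaurentPolynomial.isUnit_T (R := ℂ) m).mul_left_eq_zero).1 hp.symm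

theorem InOrbit.unique {x : PrimePower} {w w' : Equiv.Perm (Fin n)} {β β' : Finset (Fin n)}
    {F F' : FlagVar n x} {v : Vq n x} (h : InOrbit w β F F' v) (h' : InOrbit w' β' F F' v) :
    w = w' ∧ down w β = down w' β' := by
  obtain ⟨b, hb, hv⟩ := inOrbit_iff.1 h
  obtain ⟨b', hb', hv'⟩ := inOrbit_iff.1 h'
  obtain rfl := (hb.unique hb').1
  exact ⟨rfl, by rw [← hv, ← hv', hb.down_support hb' v]⟩

theorem exists_inOrbit (x : PrimePower) (w : Equiv.Perm (Fin n)) (β : Finset (Fin n)) :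
    ∃ (F F' : FlagVar n x) (v : Vq n x), InOrbit w β F F' v :=
  ⟨_, _, _, Pi.basisFun (Fq x) (Fin n), rfl, rfl, rfl⟩

/-- Evaluating a relation at a triple of one orbit, over each finite field, isolates one
coefficient, since labels with different invariants give disjoint orbits. -/
theorem orbitFamily_linearIndependent {Z : Type} (f : Z → Equiv.Perm (Fin n) × Finset (Fin n))
    (hf : Function.Injective fun z => ((f z).1, down (f z).1 (f z).2)) :
    LinearIndependent ℂ[T;T⁻¹] fun z => orbitFamily (f z).1 (f z).2 := by
  classical
  rw [linearIndependent_iff']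
  intro s g hg z hz
  refine laurent_eq_zero fun x => ?_
  obtain ⟨F, F', v, hv⟩ := exists_inOrbit x (f z).1 (f z).2
  let ev : ConvFamily n →+ ℂ :=
    { toFun := fun a => (a x F F').coeff v
      map_zero' := rfl
      map_add' := fun a b => rfl }
  have h1 := congrArg ev hg
  rw [map_sum, map_zero, sum_eq_single z] at h1
  · change ((g z • orbitFamily (f z).1 (f z).2) x F F').coeff v = 0 at h1
    rw [family_smul_apply, Matrix.smul_apply, orbitFamily_apply, AddMonoidAlgebra.coeff_smul,
      Finsupp.smul_apply, coeff_chi, if_pos hv, smul_eq_mul, mul_one] at h1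
    exact h1
  · intro z' _ hz'
    change ((g z' • orbitFamily (f z').1 (f z').2) x F F').coeff v = 0
    rw [family_smul_apply, Matrix.smul_apply, orbitFamily_apply, AddMonoidAlgebra.coeff_smul,
      Finsupp.smul_apply, coeff_chi, if_neg, smul_zero]
    intro hv'
    have := hv'.unique hv
    exact hz' (hf (Prod.ext this.1 this.2))
  · exact fun h => absurd hz h

/-- Partial permutations: a bijection between two sets with `k` elements. -/
abbrev PartialPerm (n : ℕ) : Type :=
  Σ k : Fin (n + 1), {A : Finset (Fin n) // A ∈ univ.powersetCard k.val} ×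
    {B : Finset (Fin n) // B ∈ univ.powersetCard k.val} × Equiv.Perm (Fin k.val)

theorem card_partialPerm (n : ℕ) : Fintype.card (PartialPerm n) = pairCount n n := by
  rw [pairCount_eq, Fintype.card_sigma, sum_range]
  refine sum_congr rfl fun k _ => ?_
  rw [Fintype.card_prod, Fintype.card_prod, Fintype.card_coe, card_powersetCard, card_univ,
    Fintype.card_fin, Fintype.card_perm, Fintype.card_fin, mul_assoc]

/-- Splits `Fin n` into a set with `k` elements and its complement. -/
def splitEquiv {k : ℕ} {A : Finset (Fin n)} (hA : A ∈ univ.powersetCard k) :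
    Fin k ⊕ Fin (n - k) ≃ Fin n :=
  finSumEquivOfFinset (mem_powersetCard.1 hA).2
    (by rw [card_compl, Fintype.card_fin, (mem_powersetCard.1 hA).2])

/-- The inverse of the permutation given by a partial permutation and the order reversing bijection
between the complements. -/
def completePerm (z : PartialPerm n) : Equiv.Perm (Fin n) :=
  (splitEquiv z.2.1.2).symm.trans
    ((Equiv.sumCongr z.2.2.2 Fin.revPerm).trans (splitEquiv z.2.2.1.2))

theorem completePerm_inl (z : PartialPerm n) (a : Fin z.1) :
    completePerm z (splitEquiv z.2.1.2 (Sum.inl a)) = splitEquiv z.2.2.1.2 (Sum.inl (z.2.2.2 a)) := by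
  simp [completePerm]

theorem completePerm_inr (z : PartialPerm n) (a : Fin (n - z.1)) :
    completePerm z (splitEquiv z.2.1.2 (Sum.inr a)) = splitEquiv z.2.2.1.2 (Sum.inr a.rev) := by
  simp [completePerm]

theorem splitEquiv_inl_mem {k : ℕ} {A : Finset (Fin n)} (hA : A ∈ univ.powersetCard k) (a : Fin k) :
    splitEquiv hA (Sum.inl a) ∈ A := by
  rw [splitEquiv, finSumEquivOfFinset_inl]
  exact orderEmbOfFin_mem _ _ _

theorem splitEquiv_inr_notMem {k : ℕ} {A : Finset (Fin n)} (hA : A ∈ univ.powersetCard k)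
    (a : Fin (n - k)) : splitEquiv hA (Sum.inr a) ∉ A := by
  rw [splitEquiv, finSumEquivOfFinset_inr, ← mem_compl]
  exact orderEmbOfFin_mem _ _ _

theorem splitEquiv_inr_le {k : ℕ} {A : Finset (Fin n)} (hA : A ∈ univ.powersetCard k)
    (a b : Fin (n - k)) : splitEquiv hA (Sum.inr a) ≤ splitEquiv hA (Sum.inr b) ↔ a ≤ b := by
  rw [splitEquiv, finSumEquivOfFinset_inr, finSumEquivOfFinset_inr]
  exact OrderEmbedding.le_iff_le _

theorem exists_splitEquiv_of_mem {k : ℕ} {A : Finset (Fin n)} (hA : A ∈ univ.powersetCard k)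
    {i : Fin n} (hi : i ∈ A) : ∃ a, splitEquiv hA (Sum.inl a) = i := by
  obtain ⟨a | a, rfl⟩ := (splitEquiv hA).surjective i
  · exact ⟨a, rfl⟩
  · exact absurd hi (splitEquiv_inr_notMem hA a)

theorem exists_splitEquiv_of_notMem {k : ℕ} {A : Finset (Fin n)} (hA : A ∈ univ.powersetCard k)
    {i : Fin n} (hi : i ∉ A) : ∃ a, splitEquiv hA (Sum.inr a) = i := by
  obtain ⟨a | a, rfl⟩ := (splitEquiv hA).surjective i
  · exact absurd (splitEquiv_inl_mem hA a) hi
  · exact ⟨a, rfl⟩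

/-- An antichain is determined by the set of the elements below it. -/
theorem down_injOn {w : Equiv.Perm (Fin n)} {β β' : Finset (Fin n)}
    (h : ∀ i ∈ β, ∀ j ∈ β, wle w i j → i = j) (h' : ∀ i ∈ β', ∀ j ∈ β', wle w i j → i = j)
    (hd : down w β = down w β') : β = β' := by
  have key : ∀ β β' : Finset (Fin n), (∀ i ∈ β, ∀ j ∈ β, wle w i j → i = j) →
      down w β = down w β' → β ⊆ β' := by
    intro β β' h hd i hi
    have h1 : i ∈ down w β' := hd ▸ mem_down.2 ⟨i, hi, wle_refl w i⟩
    obtain ⟨j, hj, hij⟩ := mem_down.1 h1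
    have h2 : j ∈ down w β := hd ▸ mem_down.2 ⟨j, hj, wle_refl w j⟩
    obtain ⟨l, hl, hjl⟩ := mem_down.1 h2
    obtain rfl := h i hi l hl (wle_trans hij hjl)
    have : i = j := le_antisymm hij.1 hjl.1
    rwa [this]
  exact Subset.antisymm (key β β' h hd) (key β' β h' hd.symm)

/-- On the complement of its domain the completed permutation reverses the order, so two elements
there cannot be comparable in both orders unless they are equal. -/
theorem completePerm_antichain (z : PartialPerm n) : ∀ i ∈ z.2.1.1ᶜ, ∀ j ∈ z.2.1.1ᶜ,
    wle (completePerm z).symm i j → i = j := by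
  intro i hi j hj hij
  obtain ⟨a, rfl⟩ := exists_splitEquiv_of_notMem z.2.1.2 (mem_compl.1 hi)
  obtain ⟨b, rfl⟩ := exists_splitEquiv_of_notMem z.2.1.2 (mem_compl.1 hj)
  have h1 := (splitEquiv_inr_le _ _ _).1 hij.1
  have h2 := hij.2
  rw [Equiv.symm_symm, completePerm_inr, completePerm_inr, splitEquiv_inr_le, Fin.rev_le_rev] at h2
  rw [le_antisymm h1 h2]

/-- The antichain, and with it the domain, is recovered from its downward closure. The codomain and
the bijection are then recovered by restricting the permutation. -/
theorem partialPerm_label_injective : Function.Injective fun z : PartialPerm n =>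
    ((completePerm z).symm, down (completePerm z).symm z.2.1.1ᶜ) := by
  intro z z' h
  have h1 : completePerm z = completePerm z' := Equiv.symm_bijective.1 (Prod.mk.inj h).1
  have h2 := (Prod.mk.inj h).2
  have hA : z.2.1.1 = z'.2.1.1 := by
    have h4 := completePerm_antichain z'
    rw [← h1] at h2 h4
    exact compl_injective (down_injOn (completePerm_antichain z) h4 h2)
  have hB : ∀ z z' : PartialPerm n, completePerm z = completePerm z' → z.2.1.1 = z'.2.1.1 →
      z.2.2.1.1 ⊆ z'.2.2.1.1 := by
    intro z z' h1 hA i hi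
    obtain ⟨a, rfl⟩ := exists_splitEquiv_of_mem z.2.2.1.2 hi
    obtain ⟨a', rfl⟩ := z.2.2.2.surjective a
    rw [← completePerm_inl, h1]
    have h3 : splitEquiv z.2.1.2 (Sum.inl a') ∈ z'.2.1.1 := hA ▸ splitEquiv_inl_mem _ _
    obtain ⟨c, hc⟩ := exists_splitEquiv_of_mem z'.2.1.2 h3
    rw [← hc, completePerm_inl]
    exact splitEquiv_inl_mem _ _
  have hB' := Subset.antisymm (hB z z' h1 hA) (hB z' z h1.symm hA.symm)
  obtain ⟨k, ⟨A, hA1⟩, ⟨B, hB1⟩, σ⟩ := z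
  obtain ⟨k', ⟨A', hA1'⟩, ⟨B', hB1'⟩, σ'⟩ := z'
  obtain rfl : A = A' := hA
  obtain rfl : B = B' := hB'
  obtain rfl : k = k' := Fin.ext
    ((mem_powersetCard.1 hA1).2.symm.trans (mem_powersetCard.1 hA1').2)
  congr 3
  refine Equiv.ext fun a => ?_
  have e := DFunLike.congr_fun h1 (splitEquiv hA1 (Sum.inl a))
  have e1 := completePerm_inl ⟨k, ⟨A, hA1⟩, ⟨B, hB1⟩, σ⟩ a
  have e2 := completePerm_inl ⟨k, ⟨A, hA1⟩, ⟨B, hB1⟩, σ'⟩ a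
  exact Sum.inl_injective ((splitEquiv hB1).injective (e1.symm.trans (e.trans e2)))

/-- The element `1 ⊗ a` of the generic algebra. -/
abbrev toR (n : ℕ) : IntegralMirabolic n →ₐ[ℂ[T;T⁻¹]] R n := Algebra.TensorProduct.includeRight

/-- Linear independence over the Laurent polynomials passes to the fraction field. Only this
inequality is needed; the surjection from `Blk n` gives the other one. -/
theorem pairCount_le_finrank [Module.Finite Kq (R n)] : pairCount n n ≤ Module.finrank Kq (R n) := by
  have h1 := orbitFamily_linearIndependent (fun z : PartialPerm n => ((completePerm z).symm, z.2.1.1ᶜ))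
    partialPerm_label_injective
  have h2 : LinearIndependent ℂ[T;T⁻¹] (fun z : PartialPerm n =>
      (⟨orbitFamily (completePerm z).symm z.2.1.1ᶜ, Algebra.subset_adjoin ⟨_, _, rfl⟩⟩ :
        IntegralMirabolic n)) :=
    LinearIndependent.of_comp (IntegralMirabolic n).val.toLinearMap h1
  have h3 : IsLocalizedModule (nonZeroDivisors ℂ[T;T⁻¹]) (TensorProduct.mk ℂ[T;T⁻¹] Kq (IntegralMirabolic n) 1) :=
    (isLocalizedModule_iff_isBaseChange (nonZeroDivisors ℂ[T;T⁻¹]) Kq _).2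
      (TensorProduct.isBaseChange _ _ _)
  have h4 := LinearIndependent.of_isLocalizedModule Kq (nonZeroDivisors ℂ[T;T⁻¹])
    (TensorProduct.mk ℂ[T;T⁻¹] Kq (IntegralMirabolic n) 1) h2
  rw [← card_partialPerm]
  exact h4.fintype_card_le_finrank

end Independence

/-! ### The isomorphism with the generic algebra, the standard inclusion and the Jucys–Murphy
elements -/

section Iso

open Finset Module

variable {n : ℕ}

theorem Rel.mapRing {K K' W W' : Type*} [CommRing K] [CommRing K'] [Ring W] [Algebra K W] [Ring W']
    [Algebra K' W'] {q : K} {q' : K'} {n : ℕ} {T e : ℕ → W} (h : Rel q n T e) (φ : W →+* W')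
    (hq : ∀ a, φ (q • a) = q' • φ a) : Rel q' n (fun j => φ (T j)) (fun j => φ (e j)) where
  e_zero := by rw [h.e_zero, map_one]
  e_mul i j hij hj := by
    rw [← map_mul, ← map_mul, (h.e_mul i j hij hj).1, (h.e_mul i j hij hj).2]
    exact ⟨rfl, rfl⟩
  T_e j k hj hk hkj := by rw [← map_mul, ← map_mul, h.T_e j k hj hk hkj]
  T_sq j hj := by
    rw [← map_mul, h.T_sq j hj, map_add, sub_smul, one_smul, map_sub, hq, hq, map_one, sub_smul,
      one_smul]
  T_comm i j hij hj := by rw [← map_mul, ← map_mul, h.T_comm i j hij hj]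
  braid j hj := by simp only [← map_mul]; rw [h.braid j hj]
  eTe j hj := by simp only [← map_mul]; rw [h.eTe j hj]
  TeT j hj := by
    have := congrArg φ (h.TeT j hj)
    simpa only [map_mul, map_add, map_one, hq] using this

variable (n) in
open Classical in
/-- The operators `T_{j+1}` as elements of the integral algebra. -/
def intT (j : ℕ) : IntegralMirabolic n := if h : j + 1 < n then ⟨famT n j, famT_mem h⟩ else 0

variable (n) in
open Classical in
/-- The averaging operators as elements of the integral algebra. -/
def intE (k : ℕ) : IntegralMirabolic n := if h : k ≤ n then ⟨famE n k, famE_mem h⟩ else 0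

theorem intT_val {j : ℕ} (h : j + 1 < n) : (intT n j).1 = famT n j := by rw [intT, dif_pos h]

theorem intE_val {k : ℕ} (h : k ≤ n) : (intE n k).1 = famE n k := by rw [intE, dif_pos h]

theorem intRel (n : ℕ) : Rel (LaurentPolynomial.T 1 : ℂ[T;T⁻¹]) n (intT n) (intE n) where
  e_zero := Subtype.ext (by rw [intE_val (Nat.zero_le n)]; exact (famRel n).e_zero)
  e_mul i j hij hj := by
    have h := (famRel n).e_mul i j hij hj
    rw [← intE_val hj, ← intE_val (hij.trans hj)] at h
    exact ⟨Subtype.ext h.1, Subtype.ext h.2⟩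
  T_e j k hj hk hkj := by
    have h := (famRel n).T_e j k hj hk hkj
    rw [← intT_val hj, ← intE_val hk] at h
    exact Subtype.ext h
  T_sq j hj := by
    have h := (famRel n).T_sq j hj
    rw [← intT_val hj] at h
    exact Subtype.ext h
  T_comm i j hij hj := by
    have h := (famRel n).T_comm i j hij hj
    rw [← intT_val hj, ← intT_val (show i + 1 < n by omega)] at h
    exact Subtype.ext h
  braid j hj := by
    have h := (famRel n).braid j hj
    rw [← intT_val (show j + 1 < n by omega), ← intT_val (show j + 1 + 1 < n by omega)] at h
    exact Subtype.ext h
  eTe j hj := by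
    have h := (famRel n).eTe j hj
    rw [← intT_val hj, ← intE_val (show j + 1 ≤ n by omega),
      ← intE_val (show j + 2 ≤ n by omega)] at h
    exact Subtype.ext h
  TeT j hj := by
    have h := (famRel n).TeT j hj
    rw [← intT_val hj, ← intE_val (show j + 1 ≤ n by omega),
      ← intE_val (show j + 2 ≤ n by omega), ← intE_val (show j ≤ n by omega)] at h
    exact Subtype.ext h

theorem toR_smul (c : ℂ[T;T⁻¹]) (a : IntegralMirabolic n) :
    toR n (c • a) = algebraMap ℂ[T;T⁻¹] Kq c • toR n a := by
  rw [map_smul, algebraMap_smul]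

theorem relR (n : ℕ) : Rel qq n (fun j => toR n (intT n j)) (fun k => toR n (intE n k)) :=
  (intRel n).mapRing (toR n).toRingHom fun a => toR_smul _ a

/-- The orbit function as an element of the integral algebra. -/
def intOrbit (w : Equiv.Perm (Fin n)) (β : Finset (Fin n)) : IntegralMirabolic n :=
  ⟨orbitFamily w β, Algebra.subset_adjoin ⟨w, β, rfl⟩⟩

theorem Tw_eq (w : Equiv.Perm (Fin n)) (β : Finset (Fin n)) : Tw w β = toR n (intOrbit w β) := rfl

/-- Transfers `orbit_genPair` to the integral algebras, along the injective inclusions into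
families. -/
theorem intOrbit_mem_adjoin (w : Equiv.Perm (Fin n)) (β : Finset (Fin n)) :
    (intOrbit w β, intOrbit (extp w) (β.map Fin.castSuccEmb)) ∈ Algebra.adjoin ℂ[T;T⁻¹]
      ({p | ∃ j, j + 1 < n ∧ p = (intT n j, intT (n + 1) j)} ∪
        {p | ∃ k, k ≤ n ∧ p = (intE n k, intE (n + 1) k)}) := by
  set D := Algebra.adjoin ℂ[T;T⁻¹]
      ({p : IntegralMirabolic n × IntegralMirabolic (n + 1) |
          ∃ j, j + 1 < n ∧ p = (intT n j, intT (n + 1) j)} ∪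
        {p | ∃ k, k ≤ n ∧ p = (intE n k, intE (n + 1) k)})
  have h1 : genPair n ≤ D.map (AlgHom.prodMap (IntegralMirabolic n).val (IntegralMirabolic (n + 1)).val) := by
    refine Algebra.adjoin_le ?_
    rintro _ (⟨j, hj, rfl⟩ | ⟨k, hk, rfl⟩)
    · exact ⟨(intT n j, intT (n + 1) j), Algebra.subset_adjoin (Or.inl ⟨j, hj, rfl⟩),
        Prod.ext (intT_val hj) (intT_val (show j + 1 < n + 1 by omega))⟩
    · exact ⟨(intE n k, intE (n + 1) k), Algebra.subset_adjoin (Or.inr ⟨k, hk, rfl⟩),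
        Prod.ext (intE_val hk) (intE_val (show k ≤ n + 1 by omega))⟩
  obtain ⟨d, hd, e⟩ := h1 (orbit_genPair w β)
  have h2 : d = (intOrbit w β, intOrbit (extp w) (β.map Fin.castSuccEmb)) :=
    Prod.ext (Subtype.ext (Prod.mk.inj e).1) (Subtype.ext (Prod.mk.inj e).2)
  rw [← h2]
  exact hd

theorem toR_mem {S : Subalgebra Kq (R n)} (hT : ∀ j, j + 1 < n → toR n (intT n j) ∈ S)
    (hE : ∀ k, k ≤ n → toR n (intE n k) ∈ S) (a : IntegralMirabolic n) : toR n a ∈ S := by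
  have h1 : ∀ w β, toR n (intOrbit w β) ∈ S := by
    intro w β
    have h2 := intOrbit_mem_adjoin w β
    have h3 : Algebra.adjoin ℂ[T;T⁻¹]
      ({p : IntegralMirabolic n × IntegralMirabolic (n + 1) |
          ∃ j, j + 1 < n ∧ p = (intT n j, intT (n + 1) j)} ∪
        {p | ∃ k, k ≤ n ∧ p = (intE n k, intE (n + 1) k)}) ≤
        (S.restrictScalars ℂ[T;T⁻¹]).comap ((toR n).comp (AlgHom.fst ℂ[T;T⁻¹] _ _)) := by
      refine Algebra.adjoin_le ?_
      rintro _ (⟨j, hj, rfl⟩ | ⟨k, hk, rfl⟩)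
      · exact hT j hj
      · exact hE k hk
    exact h3 h2
  obtain ⟨a, ha⟩ := a
  have key : ∀ a (ha : a ∈ IntegralMirabolic n), toR n ⟨a, ha⟩ ∈ S := by
    intro a ha
    induction ha using Algebra.adjoin_induction with
    | mem x hx =>
      obtain ⟨w, β, rfl⟩ := hx
      exact h1 w β
    | algebraMap r =>
      have : (⟨algebraMap ℂ[T;T⁻¹] (ConvFamily n) r, Subalgebra.algebraMap_mem _ r⟩ :
        IntegralMirabolic n) = r • 1 := Subtype.ext (Algebra.algebraMap_eq_smul_one r)
      rw [this, toR_smul, map_one]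
      exact S.smul_mem (one_mem _) _
    | add x y hx hy h h' =>
      have := add_mem h h'
      rwa [← map_add] at this
    | mul x y hx hy h h' =>
      have := mul_mem h h'
      rwa [← map_mul] at this
  exact key a ha

theorem eq_top_of_mem {S : Subalgebra Kq (R n)} (hT : ∀ j, j + 1 < n → toR n (intT n j) ∈ S)
    (hE : ∀ k, k ≤ n → toR n (intE n k) ∈ S) : S = ⊤ := by
  rw [eq_top_iff]
  rintro a -
  induction a using TensorProduct.induction_on with
  | zero => exact zero_mem _
  | add x y hx hy => exact add_mem hx hy
  | tmul c a =>
    have : c ⊗ₜ[ℂ[T;T⁻¹]] a = c • toR n a := by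
      rw [Algebra.TensorProduct.includeRight_apply, TensorProduct.smul_tmul', smul_eq_mul, mul_one]
    rw [this]
    exact S.smul_mem (toR_mem hT hE a) c

/-- The presentation gives a homomorphism, which is onto because the orbit functions are generated
by the T and e. It is injective because the independent orbit functions already account for the
dimension of `Blk n`. -/
theorem exists_rEquiv (n : ℕ) : ∃ φ : Blk n ≃ₐ[Kq] R n,
    (∀ j, j + 1 < n → φ (genT n j) = toR n (intT n j)) ∧
      ∀ k, k ≤ n → φ (genE n k) = toR n (intE n k) := by
  obtain ⟨ψ, hT, hE⟩ := exists_lift n (relR n)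
  have hsurj : Function.Surjective ψ := by
    rw [← AlgHom.range_eq_top]
    refine eq_top_of_mem (fun j hj => ?_) fun k hk => ?_
    · rw [← hT j hj]; exact ⟨_, rfl⟩
    · rw [← hE k hk]; exact ⟨_, rfl⟩
  have : Module.Finite Kq (R n) := Module.Finite.of_surjective ψ.toLinearMap hsurj
  have hinj : Function.Injective ψ :=
    (LinearMap.injective_iff_surjective_of_finrank_eq_finrank (f := ψ.toLinearMap)
      (le_antisymm (by rw [finrank_blk, card_IdxP]; exact pairCount_le_finrank)
        (LinearMap.finrank_le_finrank_of_surjective (f := ψ.toLinearMap) hsurj))).2 hsurj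
  exact ⟨AlgEquiv.ofBijective ψ ⟨hinj, hsurj⟩, hT, hE⟩

/-- The generic mirabolic Hecke algebra as an algebra of block matrices. -/
def rEquiv (n : ℕ) : Blk n ≃ₐ[Kq] R n := (exists_rEquiv n).choose

theorem rEquiv_genT {j : ℕ} (hj : j + 1 < n) : rEquiv n (genT n j) = toR n (intT n j) :=
  (exists_rEquiv n).choose_spec.1 j hj

theorem rEquiv_genE {k : ℕ} (hk : k ≤ n) : rEquiv n (genE n k) = toR n (intE n k) :=
  (exists_rEquiv n).choose_spec.2 k hk

/-- The standard inclusion. -/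
def stdIncl (n : ℕ) : R n →ₐ[Kq] R (n + 1) :=
  (rEquiv (n + 1)).toAlgHom.comp ((incl n).comp (rEquiv n).symm.toAlgHom)

theorem stdIncl_rEquiv (a : Blk n) : stdIncl n (rEquiv n a) = rEquiv (n + 1) (incl n a) := by
  change rEquiv (n + 1) (incl n ((rEquiv n).symm (rEquiv n a))) = _
  rw [AlgEquiv.symm_apply_apply]

/-- The pairs of elements matched by the map form an algebra that contains the pairs of
corresponding generators. The pair formed by an orbit function and its extension is generated by
these. -/
theorem isStdInclusion_stdIncl (n : ℕ) : IsStdInclusion n (stdIncl n) := by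
  intro w β
  have h1 := intOrbit_mem_adjoin w β
  have h3 : Algebra.adjoin ℂ[T;T⁻¹]
      ({p : IntegralMirabolic n × IntegralMirabolic (n + 1) |
          ∃ j, j + 1 < n ∧ p = (intT n j, intT (n + 1) j)} ∪
        {p | ∃ k, k ≤ n ∧ p = (intE n k, intE (n + 1) k)}) ≤
      AlgHom.equalizer (((stdIncl n).restrictScalars ℂ[T;T⁻¹]).comp
        ((toR n).comp (AlgHom.fst ℂ[T;T⁻¹] _ _))) ((toR (n + 1)).comp (AlgHom.snd ℂ[T;T⁻¹] _ _)) := by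
    refine Algebra.adjoin_le ?_
    rintro _ (⟨j, hj, rfl⟩ | ⟨k, hk, rfl⟩)
    · change stdIncl n (toR n (intT n j)) = toR (n + 1) (intT (n + 1) j)
      rw [← rEquiv_genT hj, stdIncl_rEquiv, ← genT_succ hj, rEquiv_genT (by omega)]
    · change stdIncl n (toR n (intE n k)) = toR (n + 1) (intE (n + 1) k)
      rw [← rEquiv_genE hk, stdIncl_rEquiv, ← genE_succ hk, rEquiv_genE (by omega)]
  exact h3 h1

theorem Tgen_eq (j : Fin n) : Tgen j = rEquiv (n + 1) (genT (n + 1) j) := by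
  rw [rEquiv_genT (by omega), Tgen, Tw_eq]
  congr 1
  apply Subtype.ext
  rw [intT_val (by omega), famT_eq (by omega)]
  rfl

theorem eGen_eq (n : ℕ) : eGen n = rEquiv (n + 1) (genE (n + 1) 1) := by
  classical
  have h0 : ({a : Fin (n + 1) | a.val < 1} : Set (Fin (n + 1))) = (({0} : Finset (Fin (n + 1))) : Set (Fin (n + 1))) := by
    ext a
    simp only [Set.mem_ofPred_eq, coe_singleton, Set.mem_singleton_iff, Fin.ext_iff, Fin.val_zero,
      Nat.lt_one_iff]
  have hd : IsDown (1 : Equiv.Perm (Fin (n + 1))) (({0} : Finset (Fin (n + 1))) : Set (Fin (n + 1))) := by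
    intro i j hij hj
    simp only [coe_singleton, Set.mem_singleton_iff] at hj ⊢
    exact le_antisymm (hj ▸ hij.1) (Fin.zero_le _)
  have hd0 : IsDown (1 : Equiv.Perm (Fin (n + 1))) ((∅ : Finset (Fin (n + 1))) : Set (Fin (n + 1))) := by
    intro i j hij hj
    simp at hj
  -- A vector of the line F_1 is either non-zero, which gives the orbit of T_0, or zero, which gives
  -- the unit.
  have hX : famX (n := n + 1) 1 {a | a.val < 1} = orbitFamily 1 {0} + 1 := by
    have h1 : (({0} : Finset (Fin (n + 1))).powerset.filter
        (fun J : Finset (Fin (n + 1)) => IsDown (1 : Equiv.Perm (Fin (n + 1))) (J : Set (Fin (n + 1))))) = {{0}, ∅} := by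
      ext J
      rw [mem_filter, mem_powerset, subset_singleton_iff, mem_insert, mem_singleton]
      constructor
      · rintro ⟨rfl | rfl, _⟩
        · exact Or.inr rfl
        · exact Or.inl rfl
      · rintro (rfl | rfl)
        · exact ⟨Or.inr rfl, hd⟩
        · exact ⟨Or.inl rfl, hd0⟩
    rw [h0, famX_eq_sum 1 _ hd, h1, sum_pair (singleton_ne_empty _), orbitFamily_empty, famX_one_empty]
  have hE : intE (n + 1) 1 = (LaurentPolynomial.T (-1) : ℂ[T;T⁻¹]) • (intOrbit 1 {0} + 1) := by
    apply Subtype.ext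
    rw [intE_val (by omega), famE_eq (by omega), hX]
    rfl
  rw [rEquiv_genE (by omega), hE, toR_smul, map_add, map_one, eGen, ← Tw_eq, ← qq_zpow, zpow_neg_one]

/-- The outermost factors of the product are the last generator T, so `genT_lastDiag` contributes
one power of q in each rank; the recursion starts with `lastDiag_zero`. -/
theorem jucysMurphy_eq (n : ℕ) : jucysMurphy n = rEquiv (n + 1) (lastDiag n) := by
  have key : ∀ n, (List.ofFn fun j : Fin n => genT (n + 1) j).reverse.prod * genE (n + 1) 1 *
      (List.ofFn fun j : Fin n => genT (n + 1) j).prod = qq ^ n • lastDiag n := by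
    intro n
    induction n with
    | zero => simp [lastDiag_zero]
    | succ n ih =>
      have h1 : (List.ofFn fun j : Fin (n + 1) => genT (n + 2) j) =
          (List.ofFn fun j : Fin n => genT (n + 1) j).map (incl (n + 1)) ++ [genT (n + 2) n] := by
        rw [List.ofFn_succ', List.concat_eq_append, List.map_ofFn]
        congr 2
        funext j
        exact genT_succ (by simp)
      rw [h1, List.reverse_append, List.prod_append, List.prod_append, List.reverse_singleton,
        List.prod_singleton, ← List.map_reverse, ← map_list_prod, ← map_list_prod,
        genE_succ (by omega), mul_assoc, mul_assoc, ← mul_assoc (incl (n + 1) _), ← map_mul,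
        ← mul_assoc (incl (n + 1) _), ← map_mul, ih, map_smul, smul_mul_assoc, mul_smul_comm, ← mul_assoc,
        genT_lastDiag, smul_smul, pow_succ]
  have h2 : (List.ofFn (Tgen (n := n))) =
      (List.ofFn fun j : Fin n => genT (n + 1) j).map (rEquiv (n + 1)) := by
    rw [List.map_ofFn]
    congr 1
    funext j
    exact Tgen_eq j
  rw [jucysMurphy, h2, ← List.map_reverse, ← map_list_prod, ← map_list_prod, eGen_eq, ← map_mul,
    ← map_mul, key, map_smul, smul_smul, ← mul_pow, inv_mul_cancel₀ qq_ne_zero, one_pow, one_smul]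

end Iso

/-! ### Multiplicities of simple modules -/

section Modules

open Finset Module

variable {n : ℕ}

/-- Matrix units of the generic algebra. -/
def mx (p q : Path n) : R n := rEquiv n (mu p q)

theorem mx_mul_mx {p q r : Path n} (h : tip p = tip q) : mx p q * mx q r = mx p r := by
  rw [mx, mx, ← map_mul, mu_mul_mu h]; rfl

theorem mx_mul_mx_of_ne (p s : Path n) {q r : Path n} (h : q ≠ r) : mx p q * mx r s = 0 := by
  rw [mx, mx, ← map_mul, mu_mul_mu_of_ne p s h, map_zero]

theorem one_eq_sum_mx : (1 : R n) = ∑ p, mx p p := by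
  rw [← map_one (rEquiv n), one_eq_sum_mu, map_sum]; rfl

instance : Module.Finite Kq (R n) := Module.Finite.equiv (rEquiv n).toLinearEquiv

instance (M : FGModuleCat.{0} (R n)) : Module Kq M := Module.compHom M (algebraMap Kq (R n))

instance (M : FGModuleCat.{0} (R n)) : IsScalarTower Kq (R n) M :=
  ⟨fun c r m => by rw [Algebra.smul_def, mul_smul]; rfl⟩

instance (M : FGModuleCat.{0} (R n)) : Module.Finite Kq M := Module.Finite.trans (R n) M

/-- Finitely generated modules from modules of finite dimension. -/
theorem finite_of_finite (N : Type) [AddCommGroup N] [Module Kq N] [Module (R n) N]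
    [IsScalarTower Kq (R n) N] [Module.Finite Kq N] : Module.Finite (R n) N :=
  Module.Finite.of_restrictScalars_finite Kq (R n) N

section Corner

variable {M : Type} [AddCommGroup M] [Module Kq M] [Module (R n) M] [IsScalarTower Kq (R n) M]

variable (M) in
/-- The image of a diagonal matrix unit. -/
def corner (p : Path n) : Submodule Kq M where
  carrier := {m | mx p p • m = m}
  add_mem' := fun {a b} ha hb => by
    rw [Set.mem_ofPred_eq] at ha hb ⊢
    rw [smul_add, ha, hb]
  zero_mem' := smul_zero _
  smul_mem' := fun c m hm => by
    rw [Set.mem_ofPred_eq] at hm ⊢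
    rw [smul_algebra_smul_comm, hm]

theorem mem_corner {p : Path n} {m : M} : m ∈ corner M p ↔ mx p p • m = m := Iff.rfl

theorem mx_smul_mem {p q : Path n} (m : M) : mx p q • m ∈ corner M p := by
  rw [mem_corner, ← mul_smul, mx_mul_mx rfl]

theorem eq_sum_mx_smul (m : M) : m = ∑ p : Path n, mx p p • m := by
  conv_lhs => rw [← one_smul (R n) m, one_eq_sum_mx, sum_smul]

/-- The corners of two paths with the same end point are isomorphic. -/
def cornerEquiv {p q : Path n} (h : tip p = tip q) : corner M p ≃ₗ[Kq] corner M q where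
  toFun m := ⟨mx q p • m.1, mx_smul_mem _⟩
  map_add' _ _ := Subtype.ext (smul_add _ _ _)
  map_smul' _ _ := Subtype.ext (smul_algebra_smul_comm _ _ _)
  invFun m := ⟨mx p q • m.1, mx_smul_mem _⟩
  left_inv m := Subtype.ext (by
    change mx p q • mx q p • m.1 = m.1
    rw [← mul_smul, mx_mul_mx h, mem_corner.1 m.2])
  right_inv m := Subtype.ext (by
    change mx q p • mx p q • m.1 = m.1
    rw [← mul_smul, mx_mul_mx h.symm, mem_corner.1 m.2])

end Corner

open Classical in
/-- The multiplicity of the simple module labelled by a diagram. -/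
def mult (M : FGModuleCat.{0} (R n)) (S : Maya) : ℕ :=
  if ∃ p : Path n, tip p = S then finrank Kq (corner M (rep n S)) else 0

theorem mult_tip (M : FGModuleCat.{0} (R n)) (p : Path n) :
    mult M (tip p) = finrank Kq (corner M p) := by
  rw [mult, if_pos ⟨p, rfl⟩]
  exact (cornerEquiv (tip_rep_tip p)).finrank_eq

theorem mult_of (N : Type) [AddCommGroup N] [Module Kq N] [Module (R n) N] [IsScalarTower Kq (R n) N]
    [Module.Finite (R n) N] (p : Path n) :
    mult (FGModuleCat.of (R n) N) (tip p) = finrank Kq (corner N p) := by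
  rw [mult_tip]
  exact LinearEquiv.finrank_eq
    { toFun := fun m => (⟨m.1, m.2⟩ : corner N p)
      map_add' := fun _ _ => rfl
      map_smul' := fun c m => Subtype.ext (algebraMap_smul (R n) c (m.1 : N))
      invFun := fun m => ⟨m.1, m.2⟩
      left_inv := fun _ => rfl
      right_inv := fun _ => rfl }

theorem mult_eq_zero (M : FGModuleCat.{0} (R n)) {S : Maya} (h : ¬ ∃ p : Path n, tip p = S) :
    mult M S = 0 := if_neg h

/-- Applying an idempotent is exact, so dimensions of corners are additive. -/
theorem mult_exact {M' M M'' : FGModuleCat.{0} (R n)} (f : M' →ₗ[R n] M) (g : M →ₗ[R n] M'')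
    (hf : Function.Injective f) (hfg : Function.Exact f g) (hg : Function.Surjective g) (S : Maya) :
    mult M S = mult M' S + mult M'' S := by
  by_cases h : ∃ p : Path n, tip p = S
  · obtain ⟨p, rfl⟩ := h
    rw [mult_tip, mult_tip, mult_tip]
    have hg' : ∀ (c : Kq) (m : M), g (c • m) = c • g m := fun c m => map_smul g (algebraMap Kq (R n) c) m
    have hf' : ∀ (c : Kq) (m : M'), f (c • m) = c • f m := fun c m => map_smul f (algebraMap Kq (R n) c) m
    let G : corner M p →ₗ[Kq] corner M'' p :=
      { toFun := fun m => ⟨g m.1, by rw [mem_corner, ← map_smul, mem_corner.1 m.2]⟩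
        map_add' := fun a b => Subtype.ext (map_add g _ _)
        map_smul' := fun c a => Subtype.ext (hg' c a.1) }
    let F : corner M' p →ₗ[Kq] corner M p :=
      { toFun := fun m => ⟨f m.1, by rw [mem_corner, ← map_smul, mem_corner.1 m.2]⟩
        map_add' := fun a b => Subtype.ext (map_add f _ _)
        map_smul' := fun c a => Subtype.ext (hf' c a.1) }
    have hG : Function.Surjective G := by
      rintro ⟨m, hm⟩
      obtain ⟨m', rfl⟩ := hg m
      refine ⟨⟨mx p p • m', mx_smul_mem _⟩, Subtype.ext ?_⟩
      change g (mx p p • m') = g m'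
      rw [map_smul, mem_corner.1 hm]
    have hF : Function.Injective F := fun a b hab => Subtype.ext (hf (congrArg Subtype.val hab))
    have hFG : LinearMap.range F = LinearMap.ker G := by
      ext ⟨m, hm⟩
      rw [LinearMap.mem_ker, LinearMap.mem_range]
      constructor
      · rintro ⟨a, ha⟩
        rw [← ha]
        exact Subtype.ext (hfg.apply_apply_eq_zero a.1)
      · intro h
        obtain ⟨a, rfl⟩ := (hfg m).1 (congrArg Subtype.val h)
        refine ⟨⟨a, hf ?_⟩, rfl⟩
        rw [map_smul, mem_corner.1 hm]
    rw [← LinearMap.finrank_range_add_finrank_ker G, LinearMap.range_eq_top.2 hG, finrank_top, ← hFG,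
      LinearMap.finrank_range_of_inj hF, add_comm]
  · rw [mult_eq_zero _ h, mult_eq_zero _ h, mult_eq_zero _ h]

end Modules

/-! ### Modules of functions on paths -/

section Build

open Finset Module

variable {n : ℕ} {U : Type} [AddCommGroup U] [Module Kq U]

variable (n) in
/-- The functions on paths with values in given subspaces, which depend on the end point only. -/
def buildSubmodule (V : Maya → Submodule Kq U) : Submodule Kq (Path n → U) where
  carrier := {f | ∀ x, f x ∈ V (tip x)}
  add_mem' ha hb x := add_mem (ha x) (hb x)
  zero_mem' _ := zero_mem _
  smul_mem' c _ ha x := Submodule.smul_mem _ c (ha x)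

variable {V : Maya → Submodule Kq U}

variable (n V) in
/-- The functions on paths with values in given subspaces, as a type. -/
def Build : Type := buildSubmodule n V

instance : AddCommGroup (Build n V) := inferInstanceAs (AddCommGroup (buildSubmodule n V))

instance : Module Kq (Build n V) := inferInstanceAs (Module Kq (buildSubmodule n V))

instance [Module.Finite Kq U] : Module.Finite Kq (Build n V) :=
  inferInstanceAs (Module.Finite Kq (buildSubmodule n V))

/-- Block matrices only mix paths with the same end point, so values stay in the subspace attached
to it. -/
instance : Module (Blk n) (Build n V) where
  smul a f := ⟨fun x => ∑ y, a.1 x y • f.1 y, fun x => sum_mem fun y _ => by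
    by_cases h : tip x = tip y
    · rw [h]; exact Submodule.smul_mem _ _ (f.2 y)
    · rw [Blk.zero_of_ne a h, zero_smul]; exact zero_mem _⟩
  one_smul f := Subtype.ext (funext fun x => by
    change ∑ y, (1 : Blk n).1 x y • f.1 y = f.1 x
    rw [sum_eq_single x]
    · rw [Blk.one_apply, if_pos rfl, one_smul]
    · intro y _ hy
      rw [Blk.one_apply, if_neg hy.symm, zero_smul]
    · simp)
  mul_smul a b f := Subtype.ext (funext fun x => by
    change ∑ y, (a * b).1 x y • f.1 y = ∑ z, a.1 x z • ∑ y, b.1 z y • f.1 y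
    simp only [Blk.mul_apply, sum_smul, smul_sum, mul_smul]
    exact sum_comm)
  smul_zero a := Subtype.ext (funext fun x => by
    change ∑ y, a.1 x y • (0 : U) = 0
    simp)
  smul_add a f g := Subtype.ext (funext fun x => by
    change ∑ y, a.1 x y • (f.1 y + g.1 y) = ∑ y, a.1 x y • f.1 y + ∑ y, a.1 x y • g.1 y
    rw [← sum_add_distrib]
    exact sum_congr rfl fun y _ => smul_add _ _ _)
  add_smul a b f := Subtype.ext (funext fun x => by
    change ∑ y, (a.1 x y + b.1 x y) • f.1 y = ∑ y, a.1 x y • f.1 y + ∑ y, b.1 x y • f.1 y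
    rw [← sum_add_distrib]
    exact sum_congr rfl fun y _ => add_smul _ _ _)
  zero_smul f := Subtype.ext (funext fun x => by
    change ∑ y, (0 : Kq) • f.1 y = 0
    simp)

theorem build_blk_smul_apply (a : Blk n) (f : Build n V) (x : Path n) :
    (a • f).1 x = ∑ y, a.1 x y • f.1 y := rfl

instance : Module (R n) (Build n V) := Module.compHom _ ((rEquiv n).symm : R n →+* Blk n)

theorem rEquiv_smul_apply (a : Blk n) (f : Build n V) (x : Path n) :
    (rEquiv n a • f).1 x = ∑ y, a.1 x y • f.1 y := by
  change ((rEquiv n).symm (rEquiv n a) • f).1 x = _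
  rw [AlgEquiv.symm_apply_apply, build_blk_smul_apply]

theorem mx_smul_apply {p q : Path n} (h : tip p = tip q) (f : Build n V) (x : Path n) :
    (mx p q • f).1 x = if x = p then f.1 q else 0 := by
  classical
  rw [mx, rEquiv_smul_apply]
  by_cases hx : x = p
  · rw [if_pos hx, sum_eq_single q]
    · rw [mu_apply, if_pos ⟨hx, rfl, h⟩, one_smul]
    · intro y _ hy
      rw [mu_apply, if_neg fun h' => hy h'.2.1, zero_smul]
    · simp
  · rw [if_neg hx]
    refine sum_eq_zero fun y _ => ?_
    rw [mu_apply, if_neg fun h' => hx h'.1, zero_smul]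

instance : IsScalarTower Kq (R n) (Build n V) := ⟨fun c r f => by
  obtain ⟨a, rfl⟩ := (rEquiv n).surjective r
  refine Subtype.ext (funext fun x => ?_)
  change _ = c • (rEquiv n a • f).1 x
  rw [← map_smul, rEquiv_smul_apply, rEquiv_smul_apply, smul_sum]
  exact sum_congr rfl fun y _ => mul_smul _ _ _⟩

instance [Module.Finite Kq U] : Module.Finite (R n) (Build n V) := finite_of_finite _

variable (n V) in
/-- The module of functions on paths. -/
abbrev buildMod [Module.Finite Kq U] : FGModuleCat.{0} (R n) := FGModuleCat.of (R n) (Build n V)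

/-- A function supported at one path. -/
def buildSingle (p : Path n) (v : V (tip p)) : Build n V :=
  ⟨fun x => open Classical in if x = p then v.1 else 0, fun x => by
    change (ite _ _ _) ∈ V (tip x)
    split_ifs with hx
    · rw [hx]; exact v.2
    · exact zero_mem _⟩

open Classical in
theorem buildSingle_apply (p : Path n) (v : V (tip p)) (x : Path n) :
    (buildSingle p v).1 x = if x = p then v.1 else 0 := rfl

theorem build_ext {f g : Build n V} (h : ∀ x, f.1 x = g.1 x) : f = g := Subtype.ext (funext h)

theorem build_congr {f g : Build n V} (h : f = g) (x : Path n) : f.1 x = g.1 x := by rw [h]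

theorem finrank_corner_build (p : Path n) :
    finrank Kq (corner (Build n V) p) = finrank Kq (V (tip p)) := by
  classical
  exact LinearEquiv.finrank_eq
    { toFun := fun f => (⟨f.1.1 p, f.1.2 p⟩ : V (tip p))
      map_add' := fun f g => rfl
      map_smul' := fun c f => rfl
      invFun := fun v => ⟨buildSingle p v, mem_corner.2 (build_ext fun x => by
        rw [mx_smul_apply rfl, buildSingle_apply, buildSingle_apply, if_pos rfl])⟩
      left_inv := fun f => Subtype.ext (build_ext fun x => by
        have h1 := build_congr (mem_corner.1 f.2) x
        rw [mx_smul_apply rfl] at h1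
        rw [← h1, buildSingle_apply])
      right_inv := fun v => Subtype.ext (if_pos rfl) }

theorem mult_build [Module.Finite Kq U] (p : Path n) :
    mult (buildMod n V) (tip p) = finrank Kq (V (tip p)) := by
  rw [mult_of, finrank_corner_build]

open Classical in
variable (n) in
/-- The simple module labelled by a diagram. -/
def simpleMod (S : Maya) : FGModuleCat.{0} (R n) :=
  buildMod n fun T => if T = S then (⊤ : Submodule Kq Kq) else ⊥

open Classical in
theorem mult_simpleMod (S : Maya) (p : Path n) :
    mult (simpleMod n S) (tip p) = if tip p = S then 1 else 0 := by
  rw [simpleMod, mult_build]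
  split_ifs with h
  · rw [if_pos h, finrank_top, finrank_self]
  · rw [if_neg h, finrank_bot]

end Build

/-! ### Simple modules span the Grothendieck groups -/

section Classes

open Finset Module

variable {n : ℕ}

theorem G0_mk_exact {A : Type} [Ring A] {M' M M'' : FGModuleCat.{0} A} (f : M' →ₗ[A] M)
    (g : M →ₗ[A] M'') (hf : Function.Injective f) (hfg : Function.Exact f g)
    (hg : Function.Surjective g) : G0.mk M = G0.mk M' + G0.mk M'' := by
  have h : FreeAbelianGroup.of M - FreeAbelianGroup.of M' - FreeAbelianGroup.of M'' ∈
      AddSubgroup.closure (exactRelations A) :=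
    AddSubgroup.subset_closure ⟨M', M, M'', f, g, hf, hfg, hg, rfl⟩
  rw [← QuotientAddGroup.eq_zero_iff] at h
  rw [← sub_eq_zero, ← sub_sub]
  exact h

theorem cls_exact {M' M M'' : FGModuleCat.{0} (R n)} (f : M' →ₗ[R n] M) (g : M →ₗ[R n] M'')
    (hf : Function.Injective f) (hfg : Function.Exact f g) (hg : Function.Surjective g) :
    cls M = cls M' + cls M'' := by
  rw [cls, cls, cls, G0_mk_exact f g hf hfg hg, TensorProduct.tmul_add, map_add]

theorem mul_mu_eq_sum (a : Blk n) (z w : Path n) : a * mu z w = ∑ x, a.1 x z • mu x w := by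
  conv_lhs => rw [blk_eq_sum a]
  rw [sum_mul]
  refine sum_congr rfl fun x _ => ?_
  rw [sum_mul, sum_eq_single z]
  · by_cases h : tip x = tip z
    · rw [smul_mul_assoc, mu_mul_mu h]
    · rw [Blk.zero_of_ne a h, zero_smul, zero_mul, zero_smul]
  · intro y _ hy
    rw [smul_mul_assoc, mu_mul_mu_of_ne x w hy, smul_zero]
  · simp

section Lift

variable {U M : Type} [AddCommGroup U] [Module Kq U] [AddCommGroup M] [Module Kq M] [Module (R n) M]
  [IsScalarTower Kq (R n) M]

/-- A homomorphism from a module of functions on paths. -/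
def buildLift (V : Maya → Submodule Kq U) (Y : Maya → Path n) (g : U →ₗ[Kq] M) :
    Build n V →ₗ[R n] M where
  toFun f := ∑ x, mx x (Y (tip x)) • g (f.1 x)
  map_add' f f' := by
    rw [← sum_add_distrib]
    refine sum_congr rfl fun x _ => ?_
    rw [← smul_add, ← map_add]
    rfl
  map_smul' r f := by
    obtain ⟨a, rfl⟩ := (rEquiv n).surjective r
    -- Non-zero entries connect paths with the same end point, so the anchor path Y is the same for
    -- both.
    have h1 : ∀ z, rEquiv n a * mx z (Y (tip z)) = ∑ x, a.1 x z • mx x (Y (tip x)) := by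
      intro z
      rw [mx, ← map_mul, mul_mu_eq_sum, map_sum]
      refine sum_congr rfl fun x _ => ?_
      rw [map_smul]
      by_cases h : tip x = tip z
      · rw [h]; rfl
      · rw [Blk.zero_of_ne a h, zero_smul, zero_smul]
    rw [RingHom.id_apply, smul_sum]
    simp only [rEquiv_smul_apply, ← mul_smul, h1, map_sum, sum_smul, smul_sum, map_smul]
    rw [sum_comm]
    refine sum_congr rfl fun z _ => sum_congr rfl fun x _ => ?_
    rw [smul_algebra_smul_comm, smul_assoc]

end Lift

/-- The diagrams that are end points of paths. -/
def reach (n : ℕ) : Finset Maya := open Classical in univ.image (tip : Path n → Maya)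

theorem mem_reach {S : Maya} : S ∈ reach n ↔ ∃ p : Path n, tip p = S := by
  classical
  simp [reach]

-- A non-zero vector in the corner of p generates a copy of the simple module; the matrix units
-- recover each coordinate of a function from its image.
open Classical in
theorem exists_simple_injective (M : FGModuleCat.{0} (R n)) (p : Path n)
    (h : mult M (tip p) ≠ 0) :
    ∃ f : simpleMod n (tip p) →ₗ[R n] M, Function.Injective f := by
  rw [mult_tip] at h
  obtain ⟨⟨v, hv⟩, hv0⟩ : ∃ v : corner M p, v ≠ 0 := by
    by_contra! hcon
    have : Subsingleton (corner M p) := ⟨fun a b => by rw [hcon a, hcon b]⟩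
    exact h finrank_zero_of_subsingleton
  have hv1 : v ≠ 0 := fun e => hv0 (Subtype.ext e)
  let F : Build n (fun T => if T = tip p then (⊤ : Submodule Kq Kq) else ⊥) →ₗ[R n] M :=
    buildLift _ (fun _ => p) (LinearMap.toSpanSingleton Kq M v)
  suffices hF : Function.Injective F from ⟨F, hF⟩
  rw [injective_iff_map_eq_zero]
  intro f hf
  refine build_ext fun x => ?_
  by_cases hx : tip x = tip p
  · have h1 : mx p x • (∑ y, mx y p • ((f.1 y : Kq) • v)) = (f.1 x : Kq) • v := by
      rw [smul_sum, sum_eq_single x]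
      · rw [← mul_smul, mx_mul_mx hx.symm, smul_algebra_smul_comm, mem_corner.1 hv]
      · intro y _ hy
        rw [← mul_smul, mx_mul_mx_of_ne _ _ hy.symm, zero_smul]
      · simp
    have h2 : ∑ y, mx y p • ((f.1 y : Kq) • v) = 0 := hf
    rw [h2, smul_zero] at h1
    exact (smul_eq_zero.1 h1.symm).resolve_right hv1
  · have h1 : (f.1 x : Kq) ∈ if tip x = tip p then (⊤ : Submodule Kq Kq) else ⊥ := f.2 x
    rw [if_neg hx] at h1
    exact (Submodule.mem_bot Kq).1 h1

/-- A module with zero corners is zero. The exact sequence formed by three copies of it gives [M] =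
[M] + [M]. -/
theorem cls_eq_zero (M : FGModuleCat.{0} (R n)) (h : ∀ S, mult M S = 0) : cls M = 0 := by
  have h0 : ∀ m : M, m = 0 := by
    intro m
    rw [eq_sum_mx_smul (n := n) m]
    refine sum_eq_zero fun p _ => ?_
    have h1 := h (tip p)
    rw [mult_tip, Submodule.finrank_eq_zero] at h1
    have h2 : mx p p • m ∈ corner M p := mx_smul_mem m
    rwa [h1, Submodule.mem_bot] at h2
  have h1 := cls_exact (M' := M) (M := M) (M'' := M) LinearMap.id LinearMap.id (fun a b e => e)
    (fun m => by rw [h0 m]; exact ⟨fun _ => ⟨0, rfl⟩, fun _ => rfl⟩) (fun m => ⟨m, rfl⟩)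
  exact left_eq_add.1 h1

/-- Split off simple submodules; each one lowers the total multiplicity by one. Semisimplicity is
not needed for the class. -/
theorem cls_eq_sum (M : FGModuleCat.{0} (R n)) :
    cls M = ∑ S ∈ reach n, (mult M S : ℂ) • cls (simpleMod n S) := by
  classical
  induction hd : ∑ S ∈ reach n, mult M S using Nat.strong_induction_on generalizing M with
  | _ d ih =>
    subst hd
    by_cases h : ∀ S, mult M S = 0
    · rw [cls_eq_zero M h]
      exact (sum_eq_zero fun S _ => by rw [h S, Nat.cast_zero, zero_smul]).symm
    · push Not at h
      obtain ⟨S, hS⟩ := h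
      obtain ⟨p, rfl⟩ : ∃ p : Path n, tip p = S := by
        by_contra hcon
        exact hS (mult_eq_zero M hcon)
      obtain ⟨f, hf⟩ := exists_simple_injective M p hS
      set M'' := FGModuleCat.of (R n) (M ⧸ LinearMap.range f)
      have hex : Function.Exact f (Submodule.mkQ (LinearMap.range f)) := LinearMap.exact_map_mkQ_range f
      have hsurj := Submodule.mkQ_surjective (LinearMap.range f)
      have h1 : ∀ T, mult M T = mult (simpleMod n (tip p)) T + mult M'' T :=
        mult_exact (M'' := M'') f (Submodule.mkQ (LinearMap.range f)) hf hex hsurj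
      have h2 : cls M = cls (simpleMod n (tip p)) + cls M'' :=
        cls_exact (M'' := M'') f (Submodule.mkQ (LinearMap.range f)) hf hex hsurj
      have h3 : ∀ T ∈ reach n, mult (simpleMod n (tip p)) T = if T = tip p then 1 else 0 := by
        intro T hT
        obtain ⟨q, rfl⟩ := mem_reach.1 hT
        exact mult_simpleMod _ _
      have hp : tip p ∈ reach n := mem_reach.2 ⟨p, rfl⟩
      have h4 : ∑ T ∈ reach n, mult (simpleMod n (tip p)) T = 1 := by
        rw [sum_congr rfl h3, sum_ite_eq', if_pos hp]
      rw [h2, ih _ (by simp only [h1, sum_add_distrib]; omega) M'' rfl]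
      simp only [h1, Nat.cast_add, add_smul, sum_add_distrib]
      congr 1
      rw [sum_eq_single (tip p)]
      · rw [h3 _ hp, if_pos rfl, Nat.cast_one, one_smul]
      · intro T hT hne
        rw [h3 T hT, if_neg hne, Nat.cast_zero, zero_smul]
      · exact fun h => absurd hp h

theorem gr_induction {P : GR → Prop} (h0 : P 0) (hadd : ∀ x y, P x → P y → P (x + y))
    (hsmul : ∀ (c : ℂ) x, P x → P (c • x)) (hcls : ∀ (n : ℕ) (M : FGModuleCat.{0} (R n)), P (cls M))
    (x : GR) : P x := by
  induction x using DirectSum.induction_on with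
  | zero => exact h0
  | add x y hx hy => exact hadd x y hx hy
  | of n x =>
    have key : ∀ y : G0 (R n), P (DirectSum.lof ℂ ℕ (fun n => ℂ ⊗[ℤ] G0 (R n)) n ((1 : ℂ) ⊗ₜ[ℤ] y)) := by
      intro y
      induction y using QuotientAddGroup.induction_on with
      | H z =>
        induction z using FreeAbelianGroup.induction_on with
        | zero => rw [QuotientAddGroup.mk_zero, TensorProduct.tmul_zero, map_zero]; exact h0
        | of M => exact hcls n M
        | neg M h =>
          rw [QuotientAddGroup.mk_neg, TensorProduct.tmul_neg, map_neg, ← neg_one_smul ℂ]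
          exact hsmul _ _ h
        | add a b ha hb =>
          rw [QuotientAddGroup.mk_add, TensorProduct.tmul_add, map_add]
          exact hadd _ _ ha hb
    induction x using TensorProduct.induction_on with
    | zero => rw [map_zero]; exact h0
    | add x y hx hy => rw [map_add]; exact hadd _ _ hx hy
    | tmul c y =>
      have : c ⊗ₜ[ℤ] y = c • ((1 : ℂ) ⊗ₜ[ℤ] y) := by
        rw [TensorProduct.smul_tmul', smul_eq_mul, mul_one]
      rw [this]
      change P (DirectSum.lof ℂ ℕ (fun n => ℂ ⊗[ℤ] G0 (R n)) n _)
      rw [map_smul]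
      exact hsmul _ _ (key y)

end Classes

/-! ### The Grothendieck groups of all ranks as a direct sum of Fock spaces -/

section Coordinates

open Finset Module

variable {n : ℕ}

/-- Elements of the charge zero Fock space as combinations of all wedges. -/
def fockVal : Fock →ₗ[ℂ] FullFock := fockSubmodule.subtype

theorem fock_ext {x y : Fock} (h : ∀ S : Maya, S.charge = 0 → fockVal x S = fockVal y S) : x = y := by
  refine Subtype.ext (Finsupp.ext fun S => ?_)
  by_cases hS : S.charge = 0
  · exact h S hS
  · have h1 : ∀ z : Fock, fockVal z S = 0 := fun z => by
      have h2 := (Finsupp.mem_supported' ℂ (fockVal z)).1 z.2 S hS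
      exact h2
    exact (h1 x).trans (h1 y).symm

open Classical in
/-- The wedge of a diagram of charge zero. -/
def fockSingle (S : Maya) : Fock :=
  if h : S.charge = 0 then ⟨Finsupp.single S 1, Finsupp.single_mem_supported ℂ 1 h⟩ else 0

theorem fockVal_fockSingle_eq {S : Maya} (h : S.charge = 0) :
    fockVal (fockSingle S) = Finsupp.single S 1 := by
  have h1 : fockSingle S = ⟨Finsupp.single S 1, Finsupp.single_mem_supported ℂ 1 h⟩ := dif_pos h
  rw [h1]
  rfl

open Classical in
theorem fockVal_fockSingle {S : Maya} (h : S.charge = 0) (T : Maya) :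
    fockVal (fockSingle S) T = if S = T then 1 else 0 := by
  rw [fockVal_fockSingle_eq h]
  exact Finsupp.single_apply

theorem fock_induction {P : Fock → Prop} (h0 : P 0) (hadd : ∀ x y, P x → P y → P (x + y))
    (hsmul : ∀ (c : ℂ) x, P x → P (c • x)) (hs : ∀ S : Maya, S.charge = 0 → P (fockSingle S))
    (x : Fock) : P x := by
  obtain ⟨x, hx⟩ := x
  have hx' := hx
  rw [fockSubmodule, Finsupp.supported_eq_span_single] at hx'
  suffices h : ∃ y : Fock, P y ∧ fockVal y = x by
    obtain ⟨y, hy, e⟩ := h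
    have : y = ⟨x, hx⟩ := Subtype.ext e
    exact this ▸ hy
  clear hx
  induction hx' using Submodule.span_induction with
  | mem z hz =>
    obtain ⟨S, hS, rfl⟩ := hz
    exact ⟨fockSingle S, hs S hS, fockVal_fockSingle_eq hS⟩
  | zero => exact ⟨0, h0, map_zero _⟩
  | add a b _ _ ha hb =>
    obtain ⟨y, hy, rfl⟩ := ha
    obtain ⟨z, hz, rfl⟩ := hb
    exact ⟨y + z, hadd _ _ hy hz, map_add _ _ _⟩
  | smul c a _ ha =>
    obtain ⟨y, hy, rfl⟩ := ha
    exact ⟨c • y, hsmul _ _ hy, map_smul _ _ _⟩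

/-- The coordinates in a direct sum of Fock spaces. -/
def coord (k : ℕ) (S : Maya) : (⨁ _k : ℕ, Fock) →ₗ[ℂ] ℂ :=
  (Finsupp.lapply S).comp (fockVal.comp (DirectSum.component ℂ ℕ (fun _ => Fock) k))

theorem coord_apply (k : ℕ) (S : Maya) (y : ⨁ _k : ℕ, Fock) : coord k S y = fockVal (y k) S := rfl

theorem coord_ext {y z : ⨁ _k : ℕ, Fock}
    (h : ∀ k (S : Maya), S.charge = 0 → coord k S y = coord k S z) : y = z :=
  DFinsupp.ext fun k => fock_ext fun S hS => h k S hS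

open Classical in
theorem coord_lof (k l : ℕ) {S : Maya} (h : S.charge = 0) (T : Maya) :
    coord k T (DirectSum.lof ℂ ℕ (fun _ => Fock) l (fockSingle S)) =
      if l = k ∧ S = T then 1 else 0 := by
  rw [coord_apply]
  by_cases hk : l = k
  · subst hk
    rw [DirectSum.lof_apply, fockVal_fockSingle h]
    simp
  · rw [DirectSum.lof_eq_of, DirectSum.of_eq_of_ne _ _ _ (Ne.symm hk), map_zero,
      if_neg fun h' => hk h'.1]
    rfl

theorem charge_of_mem_reach {S : Maya} (h : S ∈ reach n) : S.charge = 0 := by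
  obtain ⟨p, rfl⟩ := mem_reach.1 h
  exact charge_tip p

theorem size_of_mem_reach {S : Maya} (h : S ∈ reach n) : size S ≤ n := by
  obtain ⟨p, rfl⟩ := mem_reach.1 h
  exact size_tip_le p

/-- The vector of multiplicities of a module. -/
def character (M : FGModuleCat.{0} (R n)) : ⨁ _k : ℕ, Fock :=
  ∑ S ∈ reach n, (mult M S : ℂ) •
    DirectSum.lof ℂ ℕ (fun _ => Fock) ((n : ℤ) - size S).toNat (fockSingle S)

-- In rank n the diagram S contributes to the copy with index k = n - size S, the number of idle
-- steps of any path of length n to S. The truncation in the definition of `character` is harmless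
-- since the size of a reachable diagram is at most n.
open Classical in
theorem coord_character (M : FGModuleCat.{0} (R n)) (k : ℕ) (T : Maya) :
    coord k T (character M) = if (n : ℤ) = k + size T then (mult M T : ℂ) else 0 := by
  rw [character, map_sum]
  have h1 : ∀ S ∈ reach n, coord k T ((mult M S : ℂ) •
      DirectSum.lof ℂ ℕ (fun _ => Fock) ((n : ℤ) - size S).toNat (fockSingle S)) =
      if S = T then (if (n : ℤ) = k + size T then (mult M T : ℂ) else 0) else 0 := by
    intro S hS
    rw [map_smul, coord_lof _ _ (charge_of_mem_reach hS), smul_eq_mul]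
    have h2 := size_of_mem_reach hS
    by_cases hST : S = T
    · subst hST
      have h3 : ((n : ℤ) - size S).toNat = k ↔ (n : ℤ) = k + size S := by omega
      simp [h3]
    · simp [hST]
  rw [sum_congr rfl h1, sum_ite_eq']
  split_ifs with h2 h3
  · rfl
  · rfl
  · rw [mult_eq_zero M fun h' => h2 (mem_reach.2 h'), Nat.cast_zero]
  · rfl

theorem character_exact {M' M M'' : FGModuleCat.{0} (R n)} (f : M' →ₗ[R n] M) (g : M →ₗ[R n] M'')
    (hf : Function.Injective f) (hfg : Function.Exact f g) (hg : Function.Surjective g) :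
    character M = character M' + character M'' := by
  simp only [character, mult_exact f g hf hfg hg, Nat.cast_add, add_smul, sum_add_distrib]

variable (n) in
/-- The character as a map on the Grothendieck group. -/
def characterG0 : G0 (R n) →+ ⨁ _k : ℕ, Fock :=
  QuotientAddGroup.lift _ (FreeAbelianGroup.lift character) <| by
    rw [AddSubgroup.closure_le]
    rintro _ ⟨M', M, M'', f, g, hf, hfg, hg, rfl⟩
    rw [SetLike.mem_coe, AddMonoidHom.mem_ker, map_sub, map_sub, FreeAbelianGroup.lift_apply_of,
      FreeAbelianGroup.lift_apply_of, FreeAbelianGroup.lift_apply_of, character_exact f g hf hfg hg]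
    abel

/-- The characters of all ranks. -/
def characterMap : GR →ₗ[ℂ] ⨁ _k : ℕ, Fock :=
  DirectSum.toModule ℂ ℕ _ fun n => (characterG0 n).toIntLinearMap.liftBaseChange ℂ

theorem characterMap_cls (M : FGModuleCat.{0} (R n)) : characterMap (cls M) = character M := by
  rw [characterMap, cls, DirectSum.toModule_lof, LinearMap.liftBaseChange_tmul, one_smul]
  exact FreeAbelianGroup.lift_apply_of _ _

/-- The linear map that sends wedges to the classes of simple modules. -/
def simpleMap : (⨁ _k : ℕ, Fock) →ₗ[ℂ] GR :=
  DirectSum.toModule ℂ ℕ _ fun k =>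
    (Finsupp.linearCombination ℂ fun S => cls (simpleMod (k + (size S).toNat) S)).comp fockVal

theorem simpleMap_lof (k : ℕ) {S : Maya} (h : S.charge = 0) :
    simpleMap (DirectSum.lof ℂ ℕ (fun _ => Fock) k (fockSingle S)) =
      cls (simpleMod (k + (size S).toNat) S) := by
  rw [simpleMap, DirectSum.toModule_lof, LinearMap.comp_apply, fockVal_fockSingle_eq h,
    Finsupp.linearCombination_single, one_smul]

theorem simpleMap_characterMap (x : GR) : simpleMap (characterMap x) = x := by
  induction x using gr_induction with
  | h0 => rw [map_zero, map_zero]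
  | hadd x y hx hy => rw [map_add, map_add, hx, hy]
  | hsmul c x hx => rw [map_smul, map_smul, hx]
  | hcls n M =>
    rw [characterMap_cls, character, map_sum, cls_eq_sum M]
    refine sum_congr rfl fun S hS => ?_
    rw [map_smul, simpleMap_lof _ (charge_of_mem_reach hS)]
    have h1 := size_of_mem_reach hS
    have h2 := size_nonneg S
    have h3 : ((n : ℤ) - size S).toNat + (size S).toNat = n := by omega
    rw [h3]

/-- For a given pair (k, S) the rank k + size S is the only one in which S has k idle steps, and
there the simple module of S exists with multiplicity one. -/
theorem characterMap_simpleMap (y : ⨁ _k : ℕ, Fock) : characterMap (simpleMap y) = y := by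
  classical
  suffices h : characterMap.comp simpleMap = LinearMap.id from LinearMap.congr_fun h y
  refine DirectSum.linearMap_ext ℂ fun k => LinearMap.ext fun x => ?_
  rw [LinearMap.comp_apply, LinearMap.comp_apply, LinearMap.comp_apply, LinearMap.id_apply]
  induction x using fock_induction with
  | h0 => simp only [map_zero]
  | hadd x y hx hy => simp only [map_add, hx, hy]
  | hsmul c x hx => simp only [map_smul, hx]
  | hs S hS =>
    rw [simpleMap_lof k hS, characterMap_cls]
    refine coord_ext fun l T hT => ?_
    rw [coord_character, coord_lof _ _ hS]
    have h1 := size_nonneg S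
    have h2 := size_nonneg T
    by_cases hl : ((k + (size S).toNat : ℕ) : ℤ) = l + size T
    · obtain ⟨p, rfl⟩ := exists_path (n := k + (size S).toNat) hT (by omega)
      rw [if_pos hl, mult_simpleMod]
      by_cases hp : tip p = S
      · rw [if_pos hp, if_pos ⟨by have := congrArg size hp; push_cast at hl; omega, hp.symm⟩, Nat.cast_one]
      · rw [if_neg hp, if_neg fun h => hp h.2.symm, Nat.cast_zero]
    · rw [if_neg hl, if_neg]
      rintro ⟨rfl, rfl⟩
      push_cast at hl
      omega

/-- The sum of the Grothendieck groups is a direct sum of Fock spaces. -/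
def fockEquiv : GR ≃ₗ[ℂ] ⨁ _k : ℕ, Fock :=
  LinearEquiv.ofLinearMap characterMap simpleMap (LinearMap.ext characterMap_simpleMap)
    (LinearMap.ext simpleMap_characterMap)

theorem fockEquiv_cls (M : FGModuleCat.{0} (R n)) : fockEquiv (cls M) = character M :=
  characterMap_cls M

end Coordinates

/-! ### Refined restriction selects the paths with a given last step -/

section Restriction

open Finset Module

variable {n : ℕ}

theorem dg_pow (f : Path n → Kq) (k : ℕ) : dg f ^ k = dg fun p => f p ^ k := by
  induction k with
  | zero => simp only [pow_zero, dg_one]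
  | succ k ih => rw [pow_succ, ih, dg_mul_dg]; simp only [pow_succ]

theorem lastDiag_sub (n : ℕ) (c : Kq) :
    lastDiag n - algebraMap Kq (Blk (n + 1)) c = dg fun x => eigenvalue (last x) - c := by
  rw [lastDiag, Algebra.algebraMap_eq_smul_one, ← dg_one]
  refine Blk.ext' fun x y => ?_
  change (dg _).1 x y - c * (dg _).1 x y = _
  rw [dg_apply, dg_apply, dg_apply]
  split_ifs <;> ring

/-- The generalized eigenspaces of the last Jucys–Murphy element are the images of idempotents. -/
theorem mem_eigenPart (i : WithTop ℤ) (M : FGModuleCat.{0} (R (n + 1))) (m : M) :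
    m ∈ eigenPart i M ↔ rEquiv (n + 1) (lastProj n i) • m = m := by
  classical
  have h0 : jucysMurphy n - algebraMap Kq (R (n + 1)) (eigenvalue i) =
      rEquiv (n + 1) (dg fun x => eigenvalue (last x) - eigenvalue i) := by
    rw [← lastDiag_sub, map_sub, AlgEquiv.commutes, jucysMurphy_eq]
  change (∃ k : ℕ, (jucysMurphy n - algebraMap Kq (R (n + 1)) (eigenvalue i)) ^ k • m = 0) ↔ _
  rw [h0]
  constructor
  · rintro ⟨k, hk⟩
    -- Away from the eigenvalue the k-th power is inverted entrywise. So a generalized eigenvector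
    -- is annihilated by the complementary idempotent.
    have h1 : dg (fun x : Path (n + 1) =>
        if last x = i then 0 else ((eigenvalue (last x) - eigenvalue i) ^ k)⁻¹) *
        dg (fun x => eigenvalue (last x) - eigenvalue i) ^ k = 1 - lastProj n i := by
      rw [dg_pow, dg_mul_dg, lastProj, ← dg_one]
      refine Blk.ext' fun x y => ?_
      change _ = (dg _).1 x y - (dg _).1 x y
      rw [dg_apply, dg_apply, dg_apply]
      by_cases hxy : x = y
      · by_cases hi : last x = i
        · simp [hxy, ← hi]
        · have : eigenvalue (last x) - eigenvalue i ≠ 0 :=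
            sub_ne_zero.2 fun e => hi (eigenvalue_injective e)
          rw [if_pos hxy, if_pos hxy, if_pos hxy, if_neg hi, if_neg hi,
            inv_mul_cancel₀ (pow_ne_zero k this), sub_zero]
      · simp [hxy]
    have h2 := congrArg (fun z => rEquiv (n + 1) z • m) h1
    simp only [map_mul, map_pow, mul_smul, hk, smul_zero, map_sub, map_one, sub_smul, one_smul] at h2
    exact (sub_eq_zero.1 h2.symm).symm
  · intro h
    refine ⟨1, ?_⟩
    rw [pow_one, ← h, ← mul_smul, ← map_mul, lastProj, dg_mul_dg]
    have : (fun x : Path (n + 1) => (eigenvalue (last x) - eigenvalue i) * if last x = i then 1 else 0) =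
        fun _ => 0 := by
      funext x
      by_cases hi : last x = i <;> simp [hi]
    rw [this]
    have h3 : dg (fun _ : Path (n + 1) => (0 : Kq)) = 0 := Subtype.ext (Matrix.diagonal_zero)
    rw [h3, map_zero, zero_smul]

theorem lastProj_comm (i : WithTop ℤ) (a : Blk n) :
    incl n a * lastProj n i = lastProj n i * incl n a := by
  classical
  refine Blk.ext' fun x y => ?_
  rw [lastProj, mul_dg_apply, dg_mul_apply, incl_apply]
  by_cases h : last x = last y
  · rw [h, mul_comm]
  · rw [if_neg h, zero_mul, mul_zero]

theorem lastProj_idem (n : ℕ) (i : WithTop ℤ) : lastProj n i * lastProj n i = lastProj n i := by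
  classical
  rw [lastProj, dg_mul_dg]
  congr 1
  funext x
  split_ifs <;> simp

/-- The eigenspace of the last Jucys–Murphy element as a subgroup. -/
def eigenSubgroup (i : WithTop ℤ) (M : FGModuleCat.{0} (R (n + 1))) : AddSubgroup M where
  carrier := {m | rEquiv (n + 1) (lastProj n i) • m = m}
  add_mem' := fun {a b} ha hb => by
    rw [Set.mem_ofPred_eq] at ha hb ⊢
    rw [smul_add, ha, hb]
  zero_mem' := smul_zero _
  neg_mem' := fun {a} ha => by
    rw [Set.mem_ofPred_eq] at ha ⊢
    rw [smul_neg, ha]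

/-- The refined restriction of a module, as a type. -/
def Res (i : WithTop ℤ) (M : FGModuleCat.{0} (R (n + 1))) : Type := eigenSubgroup i M

variable {i : WithTop ℤ} {M : FGModuleCat.{0} (R (n + 1))}

instance : AddCommGroup (Res i M) := inferInstanceAs (AddCommGroup (eigenSubgroup i M))

theorem stdIncl_smul_mem (r : R n) (m : Res i M) : stdIncl n r • m.1 ∈ eigenSubgroup i M := by
  obtain ⟨a, rfl⟩ := (rEquiv n).surjective r
  change rEquiv (n + 1) (lastProj n i) • _ = _
  rw [stdIncl_rEquiv, ← mul_smul, ← map_mul, ← lastProj_comm, map_mul, mul_smul]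
  congr 1
  exact m.2

instance : Module (R n) (Res i M) where
  smul r m := ⟨stdIncl n r • m.1, stdIncl_smul_mem r m⟩
  one_smul m := Subtype.ext (by change stdIncl n 1 • m.1 = m.1; rw [map_one, one_smul])
  mul_smul r s m := Subtype.ext (by
    change stdIncl n (r * s) • m.1 = stdIncl n r • stdIncl n s • m.1
    rw [map_mul, mul_smul])
  smul_zero r := Subtype.ext (smul_zero (stdIncl n r))
  smul_add r a b := Subtype.ext (smul_add (stdIncl n r) a.1 b.1)
  add_smul r s m := Subtype.ext (by
    change stdIncl n (r + s) • m.1 = stdIncl n r • m.1 + stdIncl n s • m.1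
    rw [map_add, add_smul])
  zero_smul m := Subtype.ext (by change stdIncl n 0 • m.1 = 0; rw [map_zero, zero_smul])

theorem res_smul_val (r : R n) (m : Res i M) : (r • m).1 = stdIncl n r • m.1 := rfl

instance : Module Kq (Res i M) := Module.compHom _ (algebraMap Kq (R n))

instance : IsScalarTower Kq (R n) (Res i M) :=
  ⟨fun c r m => by rw [Algebra.smul_def, mul_smul]; rfl⟩

theorem res_kq_smul_val (c : Kq) (m : Res i M) : (c • m).1 = c • m.1 := by
  change (algebraMap Kq (R n) c • m).1 = _
  rw [res_smul_val, AlgHom.commutes, algebraMap_smul]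

instance : Module.Finite Kq (Res i M) :=
  Module.Finite.of_injective
    ({ toFun := fun m => m.1
       map_add' := fun _ _ => rfl
       map_smul' := fun c m => res_kq_smul_val c m } : Res i M →ₗ[Kq] M)
    fun _ _ h => Subtype.ext h

instance : Module.Finite (R n) (Res i M) := finite_of_finite _

/-- The refined restriction of a module. -/
abbrev resMod (i : WithTop ℤ) (M : FGModuleCat.{0} (R (n + 1))) : FGModuleCat.{0} (R n) :=
  FGModuleCat.of (R n) (Res i M)

theorem isRefinedRes_resMod (i : WithTop ℤ) (M : FGModuleCat.{0} (R (n + 1))) :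
    IsRefinedRes (stdIncl n) i M (resMod i M) := by
  let j : Res i M →ₛₗ[(stdIncl n : R n →+* R (n + 1))] M :=
    { toFun := fun m => m.1
      map_add' := fun _ _ => rfl
      map_smul' := fun r m => res_smul_val r m }
  refine ⟨j, fun _ _ h => Subtype.ext h, ?_⟩
  ext m
  rw [mem_eigenPart]
  exact ⟨by rintro ⟨m, rfl⟩; exact m.2, fun h => ⟨⟨m, h⟩, rfl⟩⟩

/-- The diagonal matrix unit of p, included in rank n+1 and cut by the projection to the last step
i, is the diagonal matrix unit of p continued by i. So the two corners are the same subspace of M.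
-/
theorem mult_resMod (i : WithTop ℤ) (M : FGModuleCat.{0} (R (n + 1))) (p : Path n)
    (h : CanMove i (tip p)) : mult (resMod i M) (tip p) = mult M (move i (tip p)) := by
  have ht : move i (tip p) = tip (snoc p i h) := rfl
  rw [mult_of, ht, mult_tip]
  have hm : ∀ m : M, mx (snoc p i h) (snoc p i h) • m =
      rEquiv (n + 1) (lastProj n i) • rEquiv (n + 1) (incl n (mu p p)) • m := fun m => by
    rw [mx, ← lastProj_mul_incl_mu h h rfl, map_mul, mul_smul]
  have hm' : ∀ m : Res i M, m ∈ corner (Res i M) p ↔ rEquiv (n + 1) (incl n (mu p p)) • m.1 = m.1 := by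
    intro m
    rw [mem_corner, mx, ← stdIncl_rEquiv]
    exact Subtype.ext_iff
  have h1 : ∀ m : corner M (snoc p i h), rEquiv (n + 1) (lastProj n i) • m.1 = m.1 := fun m => by
    conv_lhs => rw [← mem_corner.1 m.2, hm, ← mul_smul, ← map_mul, lastProj_idem, ← hm,
      mem_corner.1 m.2]
  exact LinearEquiv.finrank_eq
    { toFun := fun m => (⟨m.1.1, by
        rw [mem_corner, hm, (hm' m.1).1 m.2]; exact m.1.2⟩ : corner M (snoc p i h))
      map_add' := fun _ _ => rfl
      map_smul' := fun c m => Subtype.ext (res_kq_smul_val c m.1)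
      invFun := fun m => ⟨⟨m.1, h1 m⟩, (hm' ⟨m.1, h1 m⟩).2 <| by
        change rEquiv (n + 1) (incl n (mu p p)) • m.1 = m.1
        conv_lhs => rw [← mem_corner.1 m.2, hm, ← mul_smul, ← map_mul, lastProj_comm, map_mul,
          mul_smul, ← mul_smul (rEquiv (n + 1) (incl n (mu p p))), ← map_mul, ← map_mul,
          mu_mul_mu rfl, ← hm, mem_corner.1 m.2]⟩
      left_inv := fun _ => rfl
      right_inv := fun _ => rfl }

/-- No path continues p by the step i, so the projection to this last step kills the included matrix
unit of p. -/
theorem mult_resMod_of_not (i : WithTop ℤ) (M : FGModuleCat.{0} (R (n + 1))) (p : Path n)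
    (h : ¬ CanMove i (tip p)) : mult (resMod i M) (tip p) = 0 := by
  classical
  rw [mult_of]
  have h0 : lastProj n i * incl n (mu p p) = 0 := by
    refine Blk.ext' fun x y => ?_
    rw [lastProj, dg_mul_apply, incl_apply, mu_apply]
    by_cases hx : last x = i
    · have : init x ≠ p := fun e => h (by rw [← e, ← hx]; exact canMove_last x)
      rw [if_neg (show ¬ (init x = p ∧ init y = p ∧ tip p = tip p) from fun h' => this h'.1),
        ite_self, mul_zero]
      rfl
    · rw [if_neg hx, zero_mul]; rfl
  have : Subsingleton (corner (Res i M) p) := by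
    suffices h1 : ∀ m : corner (Res i M) p, m = 0 from ⟨fun a b => by rw [h1 a, h1 b]⟩
    rintro ⟨m, hm⟩
    refine Subtype.ext (Subtype.ext ?_)
    have h2 : (mx p p • m).1 = m.1 := by rw [mem_corner.1 hm]
    rw [mx, res_smul_val, stdIncl_rEquiv] at h2
    have h3 : rEquiv (n + 1) (lastProj n i) • m.1 = m.1 := m.2
    rw [← h2, ← mul_smul, ← map_mul, h0, map_zero, zero_smul] at h3
    change m.1 = 0
    rw [← h2, ← h3]
  exact finrank_zero_of_subsingleton

end Restriction

/-! ### Refined induction appends a step -/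

section Induction

open Finset Module

variable {n : ℕ}

open Classical in
variable (n) in
/-- A path that ends with the step `i`, with a chosen beginning, to a given diagram. -/
def repStep (i : WithTop ℤ) (T : Maya) : Path (n + 1) :=
  if h : ∃ S : Maya, CanMove i S ∧ move i S = T ∧ ∃ p : Path n, tip p = S then
    snoc (rep n h.choose) i (by rw [tip_rep h.choose_spec.2.2]; exact h.choose_spec.1)
  else default

/-- The diagram before the step i is determined by the diagram after it, so the choice in the
definition is no choice. -/
theorem repStep_move {i : WithTop ℤ} (p : Path n) (h : CanMove i (tip p)) :
    repStep n i (move i (tip p)) =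
      snoc (rep n (tip p)) i (by rw [tip_rep_tip]; exact h) := by
  have hex : ∃ S : Maya, CanMove i S ∧ move i S = move i (tip p) ∧ ∃ q : Path n, tip q = S :=
    ⟨tip p, h, rfl, p, rfl⟩
  have h1 : hex.choose = tip p := move_injective hex.choose_spec.1 h hex.choose_spec.2.1
  rw [repStep, dif_pos hex]
  refine path_ext ?_ rfl
  rw [init_snoc, init_snoc, h1]

variable {N : Type} [AddCommGroup N] [Module Kq N] [Module (R n) N] [IsScalarTower Kq (R n) N]

open Classical in
variable (N) in
/-- The subspaces of values of the functions in an induced module. -/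
def indSub (i : WithTop ℤ) (T : Maya) : Submodule Kq N :=
  if ∃ S : Maya, CanMove i S ∧ move i S = T ∧ ∃ p : Path n, tip p = S then
    corner N (init (repStep n i T)) else ⊥

theorem indSub_move {i : WithTop ℤ} (p : Path n) (h : CanMove i (tip p)) :
    indSub (n := n) N i (move i (tip p)) = corner N (rep n (tip p)) := by
  rw [indSub, if_pos ⟨tip p, h, rfl, p, rfl⟩, repStep_move p h, init_snoc]

theorem mx_smul_mem_indSub {i : WithTop ℤ} {x : Path (n + 1)} (hx : last x = i) (w : N) :
    mx (rep n (tip (init x))) (init x) • w ∈ indSub (n := n) N i (tip x) := by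
  subst hx
  rw [tip_eq x, indSub_move (init x) (canMove_last x)]
  exact mx_smul_mem w

open Classical in
/-- The universal map to the induced module. -/
def indUnit (i : WithTop ℤ) (w : N) : Build (n + 1) (indSub (n := n) N i) :=
  ⟨fun x => if last x = i then mx (rep n (tip (init x))) (init x) • w else 0, fun x => by
    change (ite _ _ _) ∈ indSub (n := n) N i (tip x)
    split_ifs with hx
    · exact mx_smul_mem_indSub hx w
    · exact zero_mem _⟩

open Classical in
theorem indUnit_apply (i : WithTop ℤ) (w : N) (x : Path (n + 1)) : (indUnit i w).1 x =
    if last x = i then mx (rep n (tip (init x))) (init x) • w else 0 := rfl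

theorem indUnit_add (i : WithTop ℤ) (w w' : N) : indUnit (n := n) i (w + w') = indUnit i w + indUnit i w' := by
  classical
  refine build_ext fun x => ?_
  change _ = (indUnit i w).1 x + (indUnit i w').1 x
  simp only [indUnit_apply]
  split_ifs
  · rw [smul_add]
  · rw [add_zero]

theorem mx_mul_rEquiv (r p : Path n) (h : tip r = tip p) (a : Blk n) :
    mx r p * rEquiv n a = ∑ q, a.1 p q • mx r q := by
  have h1 : mu r p * a = ∑ q, a.1 p q • mu r q := by
    conv_lhs => rw [blk_eq_sum a]
    rw [mul_sum, sum_eq_single p]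
    · rw [mul_sum]
      refine sum_congr rfl fun q _ => ?_
      rw [mul_smul_comm, mu_mul_mu h]
    · intro x _ hx
      rw [mul_sum]
      exact sum_eq_zero fun q _ => by rw [mul_smul_comm, mu_mul_mu_of_ne _ _ hx.symm, smul_zero]
    · simp
  rw [mx, ← map_mul, h1, map_sum]
  exact sum_congr rfl fun q _ => map_smul _ _ _

/-- Linearity comes from the expansion of a row of the matrix units times a, matched with the
entries of `incl n a`, which connect only paths with equal last step. -/
theorem indUnit_smul (i : WithTop ℤ) (a : Blk n) (w : N) :
    indUnit (n := n) i (rEquiv n a • w) = stdIncl n (rEquiv n a) • indUnit (n := n) i w := by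
  classical
  refine build_ext fun x => ?_
  rw [stdIncl_rEquiv, rEquiv_smul_apply, indUnit_apply]
  simp only [incl_apply, indUnit_apply]
  by_cases hx : last x = i
  · subst hx
    have h1 : ∀ y : Path (n + 1), (if last x = last y then a.1 (init x) (init y) else 0) •
        (if last y = last x then mx (rep n (tip (init y))) (init y) • w else 0) =
        if last y = last x then
          a.1 (init x) (init y) • mx (rep n (tip (init y))) (init y) • w else 0 := by
      intro y
      by_cases h : last y = last x
      · rw [if_pos h.symm, if_pos h, if_pos h]
      · rw [if_neg h, if_neg h, smul_zero]
    rw [if_pos rfl, sum_congr rfl fun y _ => h1 y,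
      sum_last_eq (last x) fun y => a.1 (init x) (init y) • mx (rep n (tip (init y))) (init y) • w,
      ← mul_smul, mx_mul_rEquiv _ _ (tip_rep_tip _), sum_smul]
    refine sum_congr rfl fun p _ => ?_
    by_cases ht : tip (init x) = tip p
    · rw [dif_pos (ht ▸ canMove_last x), init_snoc, ht, smul_assoc]
    · rw [Blk.zero_of_ne a ht, zero_smul, zero_smul]
      split_ifs with h
      · rw [init_snoc, Blk.zero_of_ne a ht, zero_smul]
      · rfl
  · rw [if_neg hx]
    refine (sum_eq_zero fun y _ => ?_).symm
    by_cases h : last x = last y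
    · rw [if_neg (show ¬ last y = i from fun e => hx (h.trans e)), smul_zero]
    · rw [if_neg h, zero_smul]

theorem lastProj_indUnit (i : WithTop ℤ) (w : N) :
    rEquiv (n + 1) (lastProj n i) • indUnit (n := n) i w = indUnit (n := n) i w := by
  classical
  refine build_ext fun x => ?_
  rw [rEquiv_smul_apply, sum_eq_single x, lastProj, dg_apply, if_pos rfl, indUnit_apply]
  · by_cases hx : last x = i
    · rw [if_pos hx, if_pos hx, one_smul]
    · rw [if_neg hx, if_neg hx, zero_smul]
  · intro y _ hy
    rw [lastProj, dg_apply, if_neg hy.symm, zero_smul]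
  · simp

/-- The induced module is generated by the image of the universal map. -/
theorem build_eq_sum (i : WithTop ℤ) (f : Build (n + 1) (indSub (n := n) N i)) :
    f = ∑ x, mx x (repStep n i (tip x)) • indUnit i (f.1 x) := by
  classical
  have hval : ∀ (s : Finset (Path (n + 1))) (g : Path (n + 1) → Build (n + 1) (indSub (n := n) N i))
      (z : Path (n + 1)), (∑ x ∈ s, g x).1 z = ∑ x ∈ s, (g x).1 z := fun s g z => by
    induction s using Finset.induction_on with
    | empty => rfl
    | insert a s ha ih =>
      rw [sum_insert ha, sum_insert ha, ← ih]
      rfl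
  refine build_ext fun z => ?_
  rw [hval, sum_eq_single z]
  · by_cases h : ∃ S : Maya, CanMove i S ∧ move i S = tip z ∧ ∃ p : Path n, tip p = S
    · obtain ⟨_, hS, hz, p, rfl⟩ := h
      have hv := f.2 z
      rw [← hz, indSub_move p hS] at hv
      have ht : tip z = tip (repStep n i (tip z)) := by
        rw [← hz, repStep_move p hS, tip_snoc, tip_rep_tip]
      rw [mx_smul_apply ht, if_pos rfl, indUnit_apply, ← hz, repStep_move p hS, if_pos (last_snoc _ _ _),
        init_snoc, tip_rep_tip, mem_corner.1 hv]
    · have hv := f.2 z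
      rw [indSub, if_neg h, Submodule.mem_bot] at hv
      rw [hv]
      have h0 : indUnit (n := n) i (0 : N) = 0 := by
        have := indUnit_add (n := n) i (0 : N) 0
        rw [add_zero] at this
        exact left_eq_add.1 this
      rw [h0, smul_zero]
      rfl
  · intro x _ hx
    by_cases ht : tip x = tip (repStep n i (tip x))
    · rw [mx_smul_apply ht, if_neg hx.symm]
    · rw [mx, mu_of_ne ht, map_zero, zero_smul]
      rfl
  · simp

/-- The triangle identity for the universal map. Each path with last step i contributes its diagonal
matrix unit applied to g w, and these units add up to the projection that fixes g w. -/
theorem sum_mx_indUnit {M : Type} [AddCommGroup M] [Module Kq M] [Module (R (n + 1)) M]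
    [IsScalarTower Kq (R (n + 1)) M] (i : WithTop ℤ) (g : N → M)
    (hg : ∀ (a : Blk n) w, g (rEquiv n a • w) = rEquiv (n + 1) (incl n a) • g w) (hg0 : g 0 = 0)
    (w : N) (hw : rEquiv (n + 1) (lastProj n i) • g w = g w) :
    ∑ x, mx x (repStep n i (tip x)) • g ((indUnit i w).1 x) = g w := by
  classical
  have h1 : ∀ x : Path (n + 1), mx x (repStep n i (tip x)) • g ((indUnit i w).1 x) =
      (if last x = i then mx x x else 0) • g w := by
    intro x
    rw [indUnit_apply]
    by_cases hx : last x = i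
    · subst hx
      have h2 : repStep n (last x) (tip x) = _ := repStep_move (init x) (canMove_last x)
      have h3 : g (mx (rep n (tip (init x))) (init x) • w) =
        rEquiv (n + 1) (incl n (mu (rep n (tip (init x))) (init x))) • g w := hg _ w
      rw [if_pos rfl, if_pos rfl, h3, ← mul_smul, h2, mx, ← map_mul,
        mu_mul_incl_mu x x (tip_rep_tip (init x))]
      rfl
    · rw [if_neg hx, if_neg hx, hg0, smul_zero, zero_smul]
  have h2 : ∑ x : Path (n + 1), (if last x = i then mx x x else 0) = rEquiv (n + 1) (lastProj n i) := by
    rw [blk_eq_sum (lastProj n i), map_sum]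
    refine sum_congr rfl fun x _ => ?_
    rw [sum_eq_single x, lastProj, dg_apply, if_pos rfl, map_smul]
    · split_ifs
      · rw [one_smul]; rfl
      · rw [zero_smul]
    · intro y _ hy
      rw [lastProj, dg_apply, if_neg hy.symm, zero_smul]
    · simp
  rw [sum_congr rfl fun x _ => h1 x, ← sum_smul, h2, hw]

/-- The refined induction of a module. -/
abbrev indMod (i : WithTop ℤ) (N : FGModuleCat.{0} (R n)) : FGModuleCat.{0} (R (n + 1)) :=
  buildMod (n + 1) (indSub (n := n) N i)

/-- Existence of the extension is `buildLift` with `sum_mx_indUnit`; uniqueness holds since the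
values of the universal map generate, by `build_eq_sum`. -/
theorem isRefinedInd_indMod (i : WithTop ℤ) (N : FGModuleCat.{0} (R n)) :
    IsRefinedInd (stdIncl n) i N (indMod i N) := by
  let η : N →ₛₗ[(stdIncl n : R n →+* R (n + 1))] Build (n + 1) (indSub (n := n) N i) :=
    { toFun := indUnit i
      map_add' := indUnit_add i
      map_smul' := fun r w => by
        obtain ⟨a, rfl⟩ := (rEquiv n).surjective r
        exact indUnit_smul i a w }
  refine ⟨η, fun y => (mem_eigenPart i (indMod i N) _).2 (lastProj_indUnit i y), fun M g hg => ?_⟩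
  have hgs : ∀ (a : Blk n) w, g (rEquiv n a • w) = rEquiv (n + 1) (incl n a) • g w := fun a w => by
    rw [← stdIncl_rEquiv]; exact map_smulₛₗ g _ _
  let g' : N →ₗ[Kq] M :=
    { toFun := g
      map_add' := map_add g
      map_smul' := fun c w => by
        have h1 := map_smulₛₗ g (algebraMap Kq (R n) c) w
        have h2 : stdIncl n (algebraMap Kq (R n) c) = algebraMap Kq (R (n + 1)) c := AlgHom.commutes _ _
        have h3 : (stdIncl n : R n →+* R (n + 1)) (algebraMap Kq (R n) c) = algebraMap Kq (R (n + 1)) c := h2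
        rw [h3] at h1
        exact h1 }
  let h : Build (n + 1) (indSub (n := n) N i) →ₗ[R (n + 1)] M := buildLift _ (repStep n i) g'
  refine ⟨h, fun y => sum_mx_indUnit i g hgs (map_zero g) y ((mem_eigenPart i M _).1 (hg y)),
    fun h' hh' => ?_⟩
  let h'' : Build (n + 1) (indSub (n := n) N i) →ₗ[R (n + 1)] M := h'
  suffices e : h'' = h from e
  refine LinearMap.ext fun f => ?_
  have h1 : ∀ y, h'' (indUnit i y) = g y := hh'
  conv_lhs => rw [build_eq_sum i f, map_sum]
  exact sum_congr rfl fun x _ => by rw [map_smul, h1]; rfl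

theorem mult_indMod (i : WithTop ℤ) (N : FGModuleCat.{0} (R n)) (p : Path n) (h : CanMove i (tip p)) :
    mult (indMod i N) (move i (tip p)) = mult N (tip p) := by
  have h1 : move i (tip p) = tip (snoc p i h) := rfl
  rw [h1, mult_build, ← h1, indSub_move p h, ← mult_tip, tip_rep_tip]

theorem mult_indMod_of_not (i : WithTop ℤ) (N : FGModuleCat.{0} (R n)) {T : Maya}
    (h : ¬ ∃ S : Maya, CanMove i S ∧ move i S = T ∧ ∃ p : Path n, tip p = S) :
    mult (indMod i N) T = 0 := by
  by_cases hT : ∃ x : Path (n + 1), tip x = T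
  · obtain ⟨x, rfl⟩ := hT
    rw [mult_build, indSub, if_neg h, finrank_bot]
  · exact mult_eq_zero _ hT

end Induction

/-! ### The operators in the Fock model and the layers of the kernel filtration -/

section Operators

open Finset Module

open Classical in
theorem raise_apply (i : ℤ) (y : FullFock) (S : Maya) :
    fullRepLinear (matE (i + 1) i) y S = if i + 1 ∈ S.1 ∧ i ∉ S.1 then y (unmove i S) else 0 := by
  induction y using Finsupp.induction_linear with
  | zero => simp
  | add y z hy hz => rw [map_add, Finsupp.add_apply, hy, hz]; split_ifs <;> simp
  | single T c =>
    rw [raise_single]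
    by_cases h : i + 1 ∈ S.1 ∧ i ∉ S.1
    · rw [if_pos h]
      by_cases h' : T = unmove i S
      · subst h'
        rw [if_pos (canMove_unmove h.1 h.2), move_unmove h.1 h.2, Finsupp.single_eq_same,
          Finsupp.single_eq_same]
      · rw [Finsupp.single_eq_of_ne' h']
        split_ifs with h2
        · rw [Finsupp.single_eq_of_ne']
          rintro rfl
          exact h' (unmove_move h2).symm
        · rfl
    · rw [if_neg h]
      split_ifs with h2
      · rw [Finsupp.single_eq_of_ne']
        rintro rfl
        exact h (mem_move_of_canMove h2)
      · rfl

/-- The diagonal action on a direct sum of Fock spaces. -/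
def diagRep : glInf →ₗ⁅ℂ⁆ Module.End ℂ (⨁ _k : ℕ, Fock) where
  toFun A := DirectSum.lmap fun _ => fockRep A
  map_add' A B := LinearMap.ext fun y => DFinsupp.ext fun k => by
    change fockRep (A + B) (y k) = fockRep A (y k) + fockRep B (y k)
    rw [map_add, LinearMap.add_apply]
  map_smul' c A := LinearMap.ext fun y => DFinsupp.ext fun k => by
    change fockRep (c • A) (y k) = c • fockRep A (y k)
    rw [map_smul, LinearMap.smul_apply]
  map_lie' := by
    intro A B
    refine LinearMap.ext fun y => DFinsupp.ext fun k => ?_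
    change fockRep ⁅A, B⁆ (y k) = fockRep A (fockRep B (y k)) - fockRep B (fockRep A (y k))
    rw [LieHom.map_lie]
    rfl

theorem diagRep_apply (A : glInf) (y : ⨁ _k : ℕ, Fock) (k : ℕ) :
    diagRep A y k = fockRep A (y k) := rfl

/-- The shift of the summands of a direct sum of Fock spaces to the left. -/
def shiftDown : Module.End ℂ (⨁ _k : ℕ, Fock) :=
  DirectSum.toModule ℂ ℕ _ fun k => match k with
    | 0 => 0
    | k + 1 => DirectSum.lof ℂ ℕ (fun _ => Fock) k

/-- The shift of the summands of a direct sum of Fock spaces to the right. -/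
def shiftUp : Module.End ℂ (⨁ _k : ℕ, Fock) :=
  DirectSum.toModule ℂ ℕ _ fun k => DirectSum.lof ℂ ℕ (fun _ => Fock) (k + 1)

theorem shiftDown_apply (y : ⨁ _k : ℕ, Fock) (k : ℕ) : shiftDown y k = y (k + 1) := by
  induction y using DirectSum.induction_on with
  | zero => rw [map_zero]; rfl
  | add y z hy hz => rw [map_add, DirectSum.add_apply, DirectSum.add_apply, hy, hz]
  | of l x =>
    rw [← DirectSum.lof_eq_of ℂ, shiftDown, DirectSum.toModule_lof]
    cases l with
    | zero =>
      rw [DirectSum.lof_eq_of, DirectSum.of_eq_of_ne _ _ _ (Nat.succ_ne_zero k)]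
      rfl
    | succ l =>
      by_cases h : k = l
      · subst h
        rw [DirectSum.lof_apply, DirectSum.lof_apply]
      · rw [DirectSum.lof_eq_of, DirectSum.lof_eq_of, DirectSum.of_eq_of_ne _ _ _ h,
          DirectSum.of_eq_of_ne _ _ _ (by omega)]

theorem shiftUp_apply_zero (y : ⨁ _k : ℕ, Fock) : shiftUp y 0 = 0 := by
  induction y using DirectSum.induction_on with
  | zero => rw [LinearMap.map_zero shiftUp]; rfl
  | add y z hy hz => rw [LinearMap.map_add shiftUp y z, DirectSum.add_apply, hy, hz, add_zero]
  | of l x =>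
    rw [← DirectSum.lof_eq_of ℂ, shiftUp, DirectSum.toModule_lof, DirectSum.lof_eq_of,
      DirectSum.of_eq_of_ne _ _ _ (by omega)]

theorem shiftUp_apply_succ (y : ⨁ _k : ℕ, Fock) (k : ℕ) : shiftUp y (k + 1) = y k := by
  induction y using DirectSum.induction_on with
  | zero => rw [LinearMap.map_zero shiftUp]; rfl
  | add y z hy hz => rw [LinearMap.map_add shiftUp y z, DirectSum.add_apply, DirectSum.add_apply, hy, hz]
  | of l x =>
    rw [← DirectSum.lof_eq_of ℂ, shiftUp, DirectSum.toModule_lof]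
    by_cases h : k = l
    · subst h
      rw [DirectSum.lof_apply, DirectSum.lof_apply]
    · rw [DirectSum.lof_eq_of, DirectSum.lof_eq_of, DirectSum.of_eq_of_ne _ _ _ h,
        DirectSum.of_eq_of_ne _ _ _ (by omega)]

theorem shiftDown_pow_apply (m : ℕ) (y : ⨁ _k : ℕ, Fock) (k : ℕ) :
    (shiftDown ^ m) y k = y (k + m) := by
  induction m generalizing k with
  | zero => rfl
  | succ m ih => rw [pow_succ', Module.End.mul_apply, shiftDown_apply, ih, add_right_comm, add_assoc]

/-- The operators of refined restriction in the Fock model. -/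
def lowerOp : WithTop ℤ → Module.End ℂ (⨁ _k : ℕ, Fock)
  | (i : ℤ) => diagRep (matE i (i + 1))
  | ⊤ => shiftDown

/-- The operators of refined induction in the Fock model. -/
def raiseOp : WithTop ℤ → Module.End ℂ (⨁ _k : ℕ, Fock)
  | (i : ℤ) => diagRep (matE (i + 1) i)
  | ⊤ => shiftUp

theorem lowerOp_top_apply (y : ⨁ _k : ℕ, Fock) (k : ℕ) : lowerOp ⊤ y k = y (k + 1) :=
  shiftDown_apply y k

theorem raiseOp_top_apply_zero (y : ⨁ _k : ℕ, Fock) : raiseOp ⊤ y 0 = 0 := shiftUp_apply_zero y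

theorem raiseOp_top_apply_succ (y : ⨁ _k : ℕ, Fock) (k : ℕ) : raiseOp ⊤ y (k + 1) = y k :=
  shiftUp_apply_succ y k

open Classical in
theorem coord_lowerOp (i : ℤ) (y : ⨁ _k : ℕ, Fock) (k : ℕ) (S : Maya) :
    coord k S (lowerOp i y) = if CanMove i S then coord k (move i S) y else 0 :=
  lower_apply i (fockVal (y k)) S

open Classical in
theorem coord_raiseOp (i : ℤ) (y : ⨁ _k : ℕ, Fock) (k : ℕ) (S : Maya) :
    coord k S (raiseOp i y) = if i + 1 ∈ S.1 ∧ i ∉ S.1 then coord k (unmove i S) y else 0 :=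
  raise_apply i (fockVal (y k)) S

theorem coord_lowerOp_top (y : ⨁ _k : ℕ, Fock) (k : ℕ) (S : Maya) :
    coord k S (lowerOp ⊤ y) = coord (k + 1) S y := by
  rw [coord_apply, coord_apply, lowerOp_top_apply]

theorem coord_raiseOp_top_zero (y : ⨁ _k : ℕ, Fock) (S : Maya) : coord 0 S (raiseOp ⊤ y) = 0 := by
  rw [coord_apply, raiseOp_top_apply_zero, map_zero]
  rfl

theorem coord_raiseOp_top_succ (y : ⨁ _k : ℕ, Fock) (k : ℕ) (S : Maya) :
    coord (k + 1) S (raiseOp ⊤ y) = coord k S y := by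
  rw [coord_apply, coord_apply, raiseOp_top_apply_succ]

/-- A coordinate of the result would come from a pair with k + size positive, which does not occur
in rank zero. -/
theorem lowerOp_character_zero (i : WithTop ℤ) (M : FGModuleCat.{0} (R 0)) :
    lowerOp i (character M) = 0 := by
  classical
  refine coord_ext fun k S hS => ?_
  rw [map_zero]
  have h0 := size_nonneg S
  induction i using WithTop.recTopCoe with
  | top =>
    rw [coord_lowerOp_top, coord_character, if_neg]
    push_cast
    omega
  | coe i =>
    rw [coord_lowerOp]
    split_ifs with h
    · rw [coord_character, size_move h, if_neg]
      push_cast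
      omega
    · rfl

/-- Compare coordinates. A finite step lowers rank and size by one, so k is kept and the
multiplicity at S is read at the moved diagram, as for E_{i,i+1}; the idle step keeps S and lowers
k. -/
theorem lowerOp_character {n : ℕ} (i : WithTop ℤ) (M : FGModuleCat.{0} (R (n + 1))) :
    lowerOp i (character M) = character (resMod i M) := by
  classical
  refine coord_ext fun k S hS => ?_
  have h0 := size_nonneg S
  rw [coord_character (resMod i M)]
  induction i using WithTop.recTopCoe with
  | top =>
    rw [coord_lowerOp_top, coord_character]
    have h1 : ((n + 1 : ℕ) : ℤ) = (k + 1 : ℕ) + size S ↔ (n : ℤ) = k + size S := by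
      push_cast; omega
    rw [if_congr h1 rfl rfl]
    split_ifs with h
    · obtain ⟨p, rfl⟩ := exists_path (n := n) hS (by omega)
      rw [mult_resMod ⊤ M p trivial, move_top]
    · rfl
  | coe i =>
    rw [coord_lowerOp]
    by_cases h : (n : ℤ) = k + size S
    · obtain ⟨p, rfl⟩ := exists_path (n := n) hS (by omega)
      rw [if_pos h]
      split_ifs with h'
      · rw [coord_character, size_move h', if_pos (by push_cast; omega), mult_resMod _ M p h']
      · rw [mult_resMod_of_not _ M p h', Nat.cast_zero]
    · rw [if_neg h]
      split_ifs with h'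
      · rw [coord_character, size_move h', if_neg (by push_cast; omega)]
      · rfl

/-- The mirror image of restriction. The component k = 0 after an idle step is zero because a
diagram whose size equals the rank cannot end in an idle step. -/
theorem raiseOp_character {n : ℕ} (i : WithTop ℤ) (N : FGModuleCat.{0} (R n)) :
    raiseOp i (character N) = character (indMod i N) := by
  classical
  refine coord_ext fun k S hS => ?_
  have h0 := size_nonneg S
  rw [coord_character (indMod i N)]
  induction i using WithTop.recTopCoe with
  | top =>
    cases k with
    | zero =>
      rw [coord_raiseOp_top_zero]
      split_ifs with h
      · rw [mult_indMod_of_not, Nat.cast_zero]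
        rintro ⟨S', _, h1, p, rfl⟩
        have h2 := size_tip_le p
        rw [← h1, move_top] at h
        push_cast at h
        omega
      · rfl
    | succ k =>
      rw [coord_raiseOp_top_succ, coord_character]
      have h1 : ((n + 1 : ℕ) : ℤ) = (k + 1 : ℕ) + size S ↔ (n : ℤ) = k + size S := by
        push_cast; omega
      rw [if_congr h1 rfl rfl]
      split_ifs with h
      · obtain ⟨p, rfl⟩ := exists_path (n := n) hS (by omega)
        rw [← mult_indMod ⊤ N p trivial, move_top]
      · rfl
  | coe i =>
    rw [coord_raiseOp]
    by_cases hc : i + 1 ∈ S.1 ∧ i ∉ S.1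
    · rw [if_pos hc, coord_character]
      have hm := canMove_unmove hc.1 hc.2
      have he := move_unmove hc.1 hc.2
      have h1 := size_move hm
      have h2 := charge_move hm
      rw [he] at h1 h2
      have h3 : ((n + 1 : ℕ) : ℤ) = k + size S ↔ (n : ℤ) = k + size (unmove i S) := by
        rw [h1]; push_cast; omega
      rw [if_congr h3 rfl rfl]
      split_ifs with h
      · obtain ⟨p, hp⟩ := exists_path (n := n) (h2.symm.trans hS) (by omega)
        have h4 := mult_indMod i N p (hp ▸ hm)
        rw [hp, he] at h4
        rw [h4]
      · rfl
    · rw [if_neg hc]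
      split_ifs
      · rw [mult_indMod_of_not, Nat.cast_zero]
        rintro ⟨S', hS', rfl, _⟩
        exact hc (mem_move_of_canMove hS')
      · rfl

/-- An operator on the sum of the Grothendieck groups from an operator in the Fock model. -/
def transport (φ : Module.End ℂ (⨁ _k : ℕ, Fock)) : Module.End ℂ GR :=
  fockEquiv.symm.toLinearMap.comp (φ.comp fockEquiv.toLinearMap)

theorem fockEquiv_transport (φ : Module.End ℂ (⨁ _k : ℕ, Fock)) (x : GR) :
    fockEquiv (transport φ x) = φ (fockEquiv x) := fockEquiv.apply_symm_apply _

theorem isResOperator_transport (i : WithTop ℤ) :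
    IsResOperator stdIncl i (transport (lowerOp i)) := by
  refine ⟨fun M => fockEquiv.injective ?_, fun n M => ⟨resMod i M, isRefinedRes_resMod i M,
    fockEquiv.injective ?_⟩⟩
  · rw [fockEquiv_transport, fockEquiv_cls, lowerOp_character_zero, map_zero]
  · rw [fockEquiv_transport, fockEquiv_cls, fockEquiv_cls, lowerOp_character]

theorem isIndOperator_transport (i : WithTop ℤ) :
    IsIndOperator stdIncl i (transport (raiseOp i)) := by
  refine fun n N => ⟨indMod i N, isRefinedInd_indMod i N, fockEquiv.injective ?_⟩
  rw [fockEquiv_transport, fockEquiv_cls, fockEquiv_cls, raiseOp_character]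

/-- The representation on the sum of the Grothendieck groups. -/
def grRep : glInf →ₗ⁅ℂ⁆ Module.End ℂ GR where
  toFun A := transport (diagRep A)
  map_add' A B := LinearMap.ext fun x => fockEquiv.injective <| by
    rw [fockEquiv_transport, map_add diagRep, LinearMap.add_apply, LinearMap.add_apply,
      fockEquiv.map_add, fockEquiv_transport, fockEquiv_transport]
  map_smul' c A := LinearMap.ext fun x => fockEquiv.injective <| by
    rw [RingHom.id_apply, fockEquiv_transport, map_smul diagRep, LinearMap.smul_apply,
      LinearMap.smul_apply, fockEquiv.map_smul, fockEquiv_transport]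
  map_lie' := by
    intro A B
    refine LinearMap.ext fun x => fockEquiv.injective ?_
    rw [Ring.lie_def, LinearMap.sub_apply, Module.End.mul_apply, Module.End.mul_apply, map_sub]
    simp only [fockEquiv_transport]
    rw [LieHom.map_lie, Ring.lie_def, LinearMap.sub_apply, Module.End.mul_apply,
      Module.End.mul_apply]

theorem fockEquiv_grRep (A : glInf) (x : GR) (k : ℕ) :
    fockEquiv (grRep A x) k = fockRep A (fockEquiv x k) := by
  change fockEquiv (transport (diagRep A) x) k = _
  rw [fockEquiv_transport, diagRep_apply]

/-- In the Fock model the operator is the left shift, so the kernel of its k-th power is the sum of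
the first k copies of the Fock space. -/
theorem mem_ker_pow (k : ℕ) (x : GR) : x ∈ LinearMap.ker (transport (lowerOp ⊤) ^ k) ↔
    ∀ j, fockEquiv x (j + k) = 0 := by
  have h1 : ∀ (k : ℕ) (x : GR), fockEquiv ((transport (lowerOp ⊤) ^ k) x) =
      (shiftDown ^ k) (fockEquiv x) := by
    intro k
    induction k with
    | zero => intro x; rfl
    | succ k ih =>
      intro x
      rw [pow_succ', pow_succ', Module.End.mul_apply, Module.End.mul_apply, fockEquiv_transport, ih]
      rfl
  rw [LinearMap.mem_ker, ← fockEquiv.map_eq_zero_iff, h1]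
  constructor
  · intro h j
    rw [← shiftDown_pow_apply, h]
    rfl
  · intro h
    refine DFinsupp.ext fun j => ?_
    rw [shiftDown_pow_apply, h]
    rfl

theorem ker_le_comap_grRep (A : glInf) (k : ℕ) : LinearMap.ker (transport (lowerOp ⊤) ^ k) ≤
    (LinearMap.ker (transport (lowerOp ⊤) ^ k)).comap (grRep A) := by
  intro x hx
  rw [Submodule.mem_comap, mem_ker_pow]
  rw [mem_ker_pow] at hx
  intro j
  rw [fockEquiv_grRep, hx, map_zero]

theorem ker_le_comap_raise (k : ℕ) : LinearMap.ker (transport (lowerOp ⊤) ^ k) ≤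
    (LinearMap.ker (transport (lowerOp ⊤) ^ (k + 1))).comap (transport (raiseOp ⊤)) := by
  intro x hx
  rw [Submodule.mem_comap, mem_ker_pow]
  rw [mem_ker_pow] at hx
  intro j
  rw [fockEquiv_transport, ← add_assoc, raiseOp_top_apply_succ, hx]

theorem ker_le_comap_lower (k : ℕ) : LinearMap.ker (transport (lowerOp ⊤) ^ (k + 1)) ≤
    (LinearMap.ker (transport (lowerOp ⊤) ^ k)).comap (transport (lowerOp ⊤)) := by
  intro x hx
  rw [Submodule.mem_comap, mem_ker_pow]
  rw [mem_ker_pow] at hx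
  intro j
  rw [fockEquiv_transport, lowerOp_top_apply, add_assoc, hx]

theorem layer_lower_raise (k : ℕ) (x : Layer (transport (lowerOp ⊤)) k) :
    layerMap (transport (lowerOp ⊤)) (transport (lowerOp ⊤)) (k + 1) k (ker_le_comap_lower (k + 1))
      (ker_le_comap_lower k) (layerMap (transport (lowerOp ⊤)) (transport (raiseOp ⊤)) k (k + 1)
        (ker_le_comap_raise (k + 1)) (ker_le_comap_raise k) x) = x := by
  obtain ⟨x, rfl⟩ := Submodule.mkQ_surjective _ x
  change Submodule.Quotient.mk _ = Submodule.Quotient.mk _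
  congr 1
  refine Subtype.ext (fockEquiv.injective ?_)
  change fockEquiv (transport (lowerOp ⊤) (transport (raiseOp ⊤) x.1)) = fockEquiv x.1
  refine DFinsupp.ext fun j => ?_
  rw [fockEquiv_transport, fockEquiv_transport, lowerOp_top_apply,
    raiseOp_top_apply_succ]

theorem layer_raise_lower (k : ℕ) (y : Layer (transport (lowerOp ⊤)) (k + 1)) :
    layerMap (transport (lowerOp ⊤)) (transport (raiseOp ⊤)) k (k + 1) (ker_le_comap_raise (k + 1))
      (ker_le_comap_raise k) (layerMap (transport (lowerOp ⊤)) (transport (lowerOp ⊤)) (k + 1) k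
        (ker_le_comap_lower (k + 1)) (ker_le_comap_lower k) y) = y := by
  obtain ⟨y, rfl⟩ := Submodule.mkQ_surjective _ y
  change Submodule.Quotient.mk _ = Submodule.Quotient.mk _
  rw [Submodule.Quotient.eq]
  change transport (raiseOp ⊤) (transport (lowerOp ⊤) y.1) - y.1 ∈
    LinearMap.ker (transport (lowerOp ⊤) ^ (k + 1))
  rw [mem_ker_pow]
  intro j
  -- Shifting down and up again loses only the component with index 0, which the quotient ignores.
  rw [map_sub, fockEquiv_transport, fockEquiv_transport, DirectSum.sub_apply, ← add_assoc,
    raiseOp_top_apply_succ, lowerOp_top_apply, sub_self]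

/-- The component that describes a layer. -/
def layerVal (k : ℕ) : LinearMap.ker (transport (lowerOp ⊤) ^ (k + 1)) →ₗ[ℂ] Fock :=
  (DirectSum.component ℂ ℕ (fun _ => Fock) k).comp
    (fockEquiv.toLinearMap.comp (Submodule.subtype _))

theorem layerVal_apply (k : ℕ) (x : LinearMap.ker (transport (lowerOp ⊤) ^ (k + 1))) :
    layerVal k x = fockEquiv x.1 k := rfl

theorem layerVal_surjective (k : ℕ) : Function.Surjective (layerVal k) := by
  intro z
  have h : fockEquiv.symm (DirectSum.lof ℂ ℕ (fun _ => Fock) k z) ∈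
      LinearMap.ker (transport (lowerOp ⊤) ^ (k + 1)) := by
    rw [mem_ker_pow]
    intro j
    rw [LinearEquiv.apply_symm_apply, DirectSum.lof_eq_of, DirectSum.of_eq_of_ne _ _ _ (by omega)]
  refine ⟨⟨_, h⟩, ?_⟩
  rw [layerVal_apply, LinearEquiv.apply_symm_apply, DirectSum.lof_apply]

/-- An element of the larger kernel has no components beyond k, so it lies in the smaller kernel as
soon as its component k vanishes. -/
theorem ker_layerVal (k : ℕ) : (LinearMap.ker (transport (lowerOp ⊤) ^ k)).submoduleOf
    (LinearMap.ker (transport (lowerOp ⊤) ^ (k + 1))) = LinearMap.ker (layerVal k) := by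
  ext x
  change x.1 ∈ LinearMap.ker (transport (lowerOp ⊤) ^ k) ↔ layerVal k x = 0
  rw [mem_ker_pow, layerVal_apply]
  have hx := (mem_ker_pow (k + 1) x.1).1 x.2
  constructor
  · intro h
    simpa using h 0
  · intro h j
    cases j with
    | zero => rw [zero_add, h]
    | succ j => rw [add_assoc, add_comm 1 k, hx]

/-- Each layer is a Fock space. -/
def layerEquiv (k : ℕ) : Layer (transport (lowerOp ⊤)) k ≃ₗ[ℂ] Fock :=
  (Submodule.quotEquivOfEq _ _ (ker_layerVal k)).trans
    ((layerVal k).quotKerEquivOfSurjective (layerVal_surjective k))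

theorem layerEquiv_grRep (A : glInf) (k : ℕ) (x : Layer (transport (lowerOp ⊤)) k) :
    layerEquiv k (layerMap (transport (lowerOp ⊤)) (grRep A) k k (ker_le_comap_grRep A (k + 1))
      (ker_le_comap_grRep A k) x) = fockRep A (layerEquiv k x) := by
  obtain ⟨x, rfl⟩ := Submodule.mkQ_surjective _ x
  change fockEquiv (grRep A x.1) k = fockRep A (fockEquiv x.1 k)
  exact fockEquiv_grRep A x.1 k

end Operators

end

end Mirabolic

theorem mainTheorem4 :
    -- the standard inclusions `R_n → R_{n+1}`
    ∃ ι : ∀ n, R n →ₐ[Kq] R (n + 1), (∀ n, IsStdInclusion n (ι n)) ∧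
    -- the operators induced by the refined restriction and induction functors
    ∃ e f : WithTop ℤ → Module.End ℂ GR,
      (∀ i, IsResOperator ι i (e i)) ∧ (∀ i, IsIndOperator ι i (f i)) ∧
      -- `e_i` and `f_i`, `i ∈ ℤ`, preserve the filtration by the kernels of powers of `e_∞`, and
      -- therefore each layer
      (∀ (i : ℤ) (k : ℕ),
        LinearMap.ker (e ⊤ ^ k) ≤ (LinearMap.ker (e ⊤ ^ k)).comap (e i) ∧
        LinearMap.ker (e ⊤ ^ k) ≤ (LinearMap.ker (e ⊤ ^ k)).comap (f i)) ∧
      -- `f_∞` and `e_∞` induce mutually inverse maps between consecutive layers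
      (∃ (hf : ∀ k : ℕ,
            LinearMap.ker (e ⊤ ^ k) ≤ (LinearMap.ker (e ⊤ ^ (k + 1))).comap (f ⊤))
          (he : ∀ k : ℕ,
            LinearMap.ker (e ⊤ ^ (k + 1)) ≤ (LinearMap.ker (e ⊤ ^ k)).comap (e ⊤)),
        ∀ k : ℕ,
          Function.Bijective (layerMap (e ⊤) (f ⊤) k (k + 1) (hf (k + 1)) (hf k)) ∧
          (∀ x, layerMap (e ⊤) (e ⊤) (k + 1) k (he (k + 1)) (he k)
            (layerMap (e ⊤) (f ⊤) k (k + 1) (hf (k + 1)) (hf k) x) = x) ∧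
          (∀ y, layerMap (e ⊤) (f ⊤) k (k + 1) (hf (k + 1)) (hf k)
            (layerMap (e ⊤) (e ⊤) (k + 1) k (he (k + 1)) (he k) y) = y)) ∧
      -- the action of `gl_∞` on `G(R)` through the `e_i` and `f_i`, `i ∈ ℤ`
      ∃ ρ : glInf →ₗ⁅ℂ⁆ Module.End ℂ GR,
        (∀ i : ℤ, ρ (matE i (i + 1)) = e i ∧ ρ (matE (i + 1) i) = f i) ∧
        -- it induces an action on each layer, which is isomorphic to the charge zero Fock space
        (∃ hρ : ∀ (A : glInf) (k : ℕ),
            LinearMap.ker (e ⊤ ^ k) ≤ (LinearMap.ker (e ⊤ ^ k)).comap (ρ A),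
          ∀ k : ℕ, ∃ Φ : Layer (e ⊤) k ≃ₗ[ℂ] Fock, ∀ (A : glInf) (x : Layer (e ⊤) k),
            Φ (layerMap (e ⊤) (ρ A) k k (hρ A (k + 1)) (hρ A k) x) = fockRep A (Φ x)) ∧
        -- `G(R)` is a direct sum of countably many copies of the Fock space
        ∃ Ψ : GR ≃ₗ[ℂ] (⨁ _k : ℕ, Fock), ∀ (A : glInf) (x : GR) (k : ℕ),
          Ψ (ρ A x) k = fockRep A (Ψ x k) := by
  refine ⟨stdIncl, isStdInclusion_stdIncl, fun i => transport (lowerOp i),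
    fun i => transport (raiseOp i), isResOperator_transport, isIndOperator_transport,
    fun i k => ⟨ker_le_comap_grRep (matE i (i + 1)) k, ker_le_comap_grRep (matE (i + 1) i) k⟩,
    ⟨ker_le_comap_raise, ker_le_comap_lower, fun k => ⟨?_, layer_lower_raise k,
      layer_raise_lower k⟩⟩,
    grRep, fun i => ⟨rfl, rfl⟩, ⟨ker_le_comap_grRep, fun k => ⟨layerEquiv k, fun A x =>
      layerEquiv_grRep A k x⟩⟩, fockEquiv, fockEquiv_grRep⟩
  exact Function.bijective_iff_has_inverse.2 ⟨_, layer_lower_raise k, layer_raise_lower k⟩
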